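/- Let $\mathbf H$ be the Hilbert transform on $L^2(\mathbb R)$ (the Fourier multiplier with symbol $-i\,\mathrm{sgn}\,\xi$) and let $H^s=H^s(\mathbb R)$ be the $L^2$-based Sobolev space of real-valued functions, with norm $\|f\|_{H^s}=\|(1-\partial_x^2)^{s/2}f\|_{L^2}$. There are universal constants $\epsilon_0>0$ and $\alpha>0$, and for every integer $k\ge 2$ a constant $C_k\ge 0$ depending only on $k$, such that the following holds for every $0<\epsilon\le\epsilon_0$, with $I^\epsilon=[-\alpha/\epsilon^2,\alpha/\epsilon^2]$. (a) If $u_0\in H^k$ satisfies $\|u_0\|_{H^2}\le\epsilon$, then there is a solution $u\in C(I^\epsilon;H^k)\cap C^1(I^\epsilon;H^{k-1})$ of the Burgers--Hilbert equation $$u_t+u\,u_x=\mathbf H[u]\ \text{ on } I^\epsilon,\qquad u(0)=u_0,$$ such that for all real $s$ with $0\le s\le k$ $$\|u\|_{L^\infty(I^\epsilon;H^s)}\le C_k\,\|u(0)\|_{H^s}.$$ (b) If $u_1,u_2\in C(I^\epsilon;H^k)\cap C^1(I^\epsilon;H^{k-1})$ are two solutions of $u_t+u\,u_x=\mathbf H[u]$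 on $I^\epsilon$ with $\|u_1(0)\|_{H^2}\le\epsilon$ and $\|u_2(0)\|_{H^2}\le\epsilon$, then $$\|u_1-u_2\|_{L^\infty(I^\epsilon;L^2)}\le C_k\,\|u_1(0)-u_2(0)\|_{L^2}.$$ -/

import Mathlib

open MeasureTheory Set Filter
open scoped Topology ENNReal NNReal ContDiff FourierTransform

namespace BurgersHilbert

/-- The real Hilbert space `L²(ℝ; ℝ)`. -/
abbrev L2 : Type := Lp ℝ 2 (volume : Measure ℝ)

/-- The complex Hilbert space `L²(ℝ; ℂ)`, on which the Fourier transform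
`𝓕 f (ξ) = ∫ exp (-2πi x ξ) f x dx` acts as a unitary operator. -/
abbrev L2C : Type := Lp ℂ 2 (volume : Measure ℝ)

/-- A real-valued `L²` function, regarded as complex-valued. -/
noncomputable def toComplex (f : L2) : L2C := Complex.ofRealCLM.compLp f

/-- The norm of `f` in the Sobolev space `H^s(ℝ)`: the `L²` norm of
`(1 + |2πξ|²)^(s/2) 𝓕 f (ξ)`, i.e. of `(1 - ∂ₓ²)^(s/2) f`.
It is `∞` exactly when `f` does not belong to `H^s(ℝ)`. -/
noncomputable def sobolevNorm (s : ℝ) (f : L2) : ℝ≥0∞ :=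
  eLpNorm (fun ξ : ℝ => (1 + (2 * Real.pi * ξ) ^ 2) ^ (s / 2) * ‖(𝓕 (toComplex f) : L2C) ξ‖)
    2 volume

/-- `f ∈ H^s(ℝ)` (for `s ≥ 0`). -/
def MemH (s : ℝ) (f : L2) : Prop := sobolevNorm s f < ⊤

/-- The symbol `-i sgn ξ` of the Hilbert transform. -/
noncomputable def hilbertSymbol (ξ : ℝ) : ℂ := -Complex.I * (Real.sign ξ : ℝ)

theorem norm_hilbertSymbol_le (ξ : ℝ) : ‖hilbertSymbol ξ‖ ≤ 1 := by
  rcases Real.sign_apply_eq ξ with h | h | h <;> simp [hilbertSymbol, h]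

theorem measurable_hilbertSymbol : Measurable hilbertSymbol := by
  have h : Measurable Real.sign :=
    Measurable.ite measurableSet_Iio measurable_const
      (Measurable.ite measurableSet_Ioi measurable_const measurable_const)
  exact measurable_const.mul (Complex.measurable_ofReal.comp h)

theorem memLp_hilbertSymbol_mul (g : L2C) :
    MemLp (fun ξ => hilbertSymbol ξ * g ξ) 2 (volume : Measure ℝ) := by
  refine (Lp.memLp g).of_le
    (measurable_hilbertSymbol.aestronglyMeasurable.mul (Lp.aestronglyMeasurable g))
    (Eventually.of_forall fun ξ => ?_)
  rw [norm_mul]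
  exact mul_le_of_le_one_left (norm_nonneg _) (norm_hilbertSymbol_le ξ)

/-- The Hilbert transform on `L²`: the Fourier multiplier with symbol `-i sgn ξ`. -/
noncomputable def hilbertTransform (f : L2C) : L2C :=
  𝓕⁻ ((memLp_hilbertSymbol_mul (𝓕 f : L2C)).toLp _ : L2C)

/-- `g` is the weak derivative of `f` on `ℝ`. -/
def HasWeakDeriv (f g : L2) : Prop :=
  ∀ φ : ℝ → ℝ, ContDiff ℝ ∞ φ → HasCompactSupport φ →
    ∫ x, f x * deriv φ x = -∫ x, g x * φ x

/-- `u ∈ C(I; H^s(ℝ))`. -/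
def ContinuousInH (s : ℝ) (I : Set ℝ) (u : ℝ → L2) : Prop :=
  (∀ t ∈ I, MemH s (u t)) ∧
    ∀ t₀ ∈ I, Tendsto (fun t => sobolevNorm s (u t - u t₀)) (𝓝[I] t₀) (𝓝 0)

/-- `u` is differentiable on `I` as a function with values in `H^s(ℝ)` (one-sidedly at endpoints
of `I`), with derivative `u'`. -/
def HasDerivInH (s : ℝ) (I : Set ℝ) (u u' : ℝ → L2) : Prop :=
  (∀ t ∈ I, MemH s (u t) ∧ MemH s (u' t)) ∧
    ∀ t₀ ∈ I, Tendsto (fun t => sobolevNorm s ((t - t₀)⁻¹ • (u t - u t₀) - u' t₀))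
      (𝓝[I \ {t₀}] t₀) (𝓝 0)

/-- `u ∈ C(I; H^k(ℝ)) ∩ C¹(I; H^(k-1)(ℝ))` solves `u_t + u u_x = H[u]` on `I`. -/
def IsSolution (k : ℕ) (I : Set ℝ) (u : ℝ → L2) : Prop :=
  ContinuousInH k I u ∧
    ∃ u_t : ℝ → L2, HasDerivInH ((k : ℝ) - 1) I u u_t ∧ ContinuousInH ((k : ℝ) - 1) I u_t ∧
      ∀ t ∈ I, ∃ u_x : L2, HasWeakDeriv (u t) u_x ∧
        ∀ᵐ x : ℝ, ((u_t t x + u t x * u_x x : ℝ) : ℂ) = hilbertTransform (toComplex (u t)) x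

/-- The time interval `I^ε = [-α/ε², α/ε²]`. -/
noncomputable def timeInterval (α ε : ℝ) : Set ℝ := Icc (-(α / ε ^ 2)) (α / ε ^ 2)

end BurgersHilbert

namespace BurgersHilbert

/-- The sign of `x`, with the convention that the sign of `0` is `1`. -/
noncomputable def sg (x : ℝ) : ℝ := if 0 ≤ x then 1 else -1

theorem sg_of_nonneg {x : ℝ} (h : 0 ≤ x) : sg x = 1 := by simp [sg, h]

theorem sg_of_neg {x : ℝ} (h : x < 0) : sg x = -1 := by simp [sg, not_le.2 h]

theorem sg_eq (x : ℝ) : sg x = 1 ∨ sg x = -1 := by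
  unfold sg; split_ifs <;> simp

theorem sg_mul_self (x : ℝ) : sg x * x = |x| := by
  rcases le_or_gt 0 x with h | h
  · rw [sg_of_nonneg h, abs_of_nonneg h, one_mul]
  · rw [sg_of_neg h, abs_of_neg h]; ring

theorem sg_mul_sg (x : ℝ) : sg x * sg x = 1 := by
  rcases sg_eq x with h | h <;> rw [h] <;> norm_num

theorem abs_sg (x : ℝ) : |sg x| = 1 := by
  rcases sg_eq x with h | h <;> rw [h] <;> norm_num

theorem measurable_sg : Measurable sg :=
  Measurable.ite measurableSet_Ici measurable_const measurable_const

theorem sg_neg {x : ℝ} (h : x ≠ 0) : sg (-x) = -sg x := by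
  rcases lt_or_gt_of_ne h with h | h
  · rw [sg_of_neg h, sg_of_nonneg (by linarith)]; norm_num
  · rw [sg_of_nonneg h.le, sg_of_neg (by linarith)]

/-- On `x + y + z = 0` the three signs do not all agree. -/
theorem sg_prod_mul_sum {x y z : ℝ} (h : x + y + z = 0) (h0 : ¬(x = 0 ∧ y = 0 ∧ z = 0)) :
    sg x * sg y * sg z * (sg x + sg y + sg z) = -1 := by
  rcases le_or_gt 0 x with hx | hx <;> rcases le_or_gt 0 y with hy | hy <;>
    rcases le_or_gt 0 z with hz | hz
  · exact absurd ⟨by linarith, by linarith, by linarith⟩ h0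
  all_goals first
    | (exfalso; linarith)
    | (simp only [sg_of_nonneg, sg_of_neg, *]; norm_num)

theorem pow_add_sub_bounds (p : ℕ) {x y : ℝ} (hx : 0 ≤ x) (hy : 0 ≤ y) :
    0 ≤ (x + y) ^ (p + 2) - x ^ (p + 2) - y ^ (p + 2) ∧
      (x + y) ^ (p + 2) - x ^ (p + 2) - y ^ (p + 2) ≤ 2 * (p + 1) * (x * y) * (x + y) ^ p := by
  induction p with
  | zero =>
    have := mul_nonneg hx hy
    simp only [Nat.cast_zero, zero_add, pow_zero, mul_one]
    constructor <;> nlinarith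
  | succ p ih =>
    obtain ⟨h1, h2⟩ := ih
    have e : (x + y) ^ (p + 1 + 2) - x ^ (p + 1 + 2) - y ^ (p + 1 + 2) =
        (x + y) * ((x + y) ^ (p + 2) - x ^ (p + 2) - y ^ (p + 2)) +
          x * y * (x ^ (p + 1) + y ^ (p + 1)) := by ring
    have hs : 0 ≤ x + y := by positivity
    have hx' : x ^ (p + 1) ≤ (x + y) ^ (p + 1) := by gcongr; linarith
    have hy' : y ^ (p + 1) ≤ (x + y) ^ (p + 1) := by gcongr; linarith
    rw [e]
    constructor
    · positivity
    · have h3 := mul_le_mul_of_nonneg_left h2 hs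
      have h4 := mul_le_mul_of_nonneg_left (add_le_add hx' hy') (mul_nonneg hx hy)
      have e2 : (x + y) * (2 * (p + 1) * (x * y) * (x + y) ^ p) =
        2 * (p + 1) * (x * y) * (x + y) ^ (p + 1) := by ring
      push_cast
      nlinarith

/-- The third order difference of `t ^ (p + 3)` at `0`. -/
theorem exists_third_difference_bound (p : ℕ) : ∃ C : ℝ, 0 ≤ C ∧ ∀ x y z : ℝ, 0 ≤ x → 0 ≤ y → 0 ≤ z →
    |(x + y + z) ^ (p + 3) - (x + y) ^ (p + 3) - (y + z) ^ (p + 3) - (x + z) ^ (p + 3)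
      + x ^ (p + 3) + y ^ (p + 3) + z ^ (p + 3)| ≤ C * (x * y * z) * (x + y + z) ^ p := by
  induction p with
  | zero =>
    refine ⟨6, by norm_num, fun x y z hx hy hz => le_of_eq ?_⟩
    have : (x + y + z) ^ (0 + 3) - (x + y) ^ (0 + 3) - (y + z) ^ (0 + 3) - (x + z) ^ (0 + 3)
      + x ^ (0 + 3) + y ^ (0 + 3) + z ^ (0 + 3) = 6 * (x * y * z) := by ring
    rw [this, abs_of_nonneg (by positivity), pow_zero, mul_one]
  | succ p ih =>
    obtain ⟨C, hC, ih⟩ := ih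
    refine ⟨C + 6 * (p + 2), by positivity, fun x y z hx hy hz => ?_⟩
    have hs : 0 ≤ x + y + z := by positivity
    have key : ∀ a b c : ℝ, 0 ≤ a → 0 ≤ b → 0 ≤ c →
        |c * ((a + b) ^ (p + 1 + 2) - a ^ (p + 1 + 2) - b ^ (p + 1 + 2))| ≤
          2 * (p + 2) * (a * b * c) * (a + b + c) ^ (p + 1) := by
      intro a b c ha hb hc
      obtain ⟨h1, h2⟩ := pow_add_sub_bounds (p + 1) ha hb
      rw [abs_of_nonneg (by positivity)]
      have h3 : (a + b) ^ (p + 1) ≤ (a + b + c) ^ (p + 1) :=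
        pow_le_pow_left₀ (add_nonneg ha hb) (by linarith) _
      push_cast at h2
      calc _ ≤ c * (2 * (p + 1 + 1) * (a * b) * (a + b) ^ (p + 1)) := by gcongr
        _ ≤ c * (2 * (p + 1 + 1) * (a * b) * (a + b + c) ^ (p + 1)) := by gcongr
        _ = _ := by ring
    have e : (x + y + z) ^ (p + 1 + 3) - (x + y) ^ (p + 1 + 3) - (y + z) ^ (p + 1 + 3)
        - (x + z) ^ (p + 1 + 3) + x ^ (p + 1 + 3) + y ^ (p + 1 + 3) + z ^ (p + 1 + 3) =
        (x + y + z) * ((x + y + z) ^ (p + 3) - (x + y) ^ (p + 3) - (y + z) ^ (p + 3)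
          - (x + z) ^ (p + 3) + x ^ (p + 3) + y ^ (p + 3) + z ^ (p + 3)) +
        z * ((x + y) ^ (p + 1 + 2) - x ^ (p + 1 + 2) - y ^ (p + 1 + 2)) +
        x * ((y + z) ^ (p + 1 + 2) - y ^ (p + 1 + 2) - z ^ (p + 1 + 2)) +
        y * ((x + z) ^ (p + 1 + 2) - x ^ (p + 1 + 2) - z ^ (p + 1 + 2)) := by ring
    have h1 := ih x y z hx hy hz
    have k1 := key x y z hx hy hz
    have k2 := key y z x hy hz hx
    have k3 := key x z y hx hz hy
    have h1' : |(x + y + z) * ((x + y + z) ^ (p + 3) - (x + y) ^ (p + 3) - (y + z) ^ (p + 3)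
          - (x + z) ^ (p + 3) + x ^ (p + 3) + y ^ (p + 3) + z ^ (p + 3))| ≤
        (x + y + z) * (C * (x * y * z) * (x + y + z) ^ p) := by
      rw [abs_mul, abs_of_nonneg hs]; gcongr
    rw [e]
    refine (abs_add_le _ _).trans ((add_le_add ((abs_add_le _ _).trans
      (add_le_add ((abs_add_le _ _).trans (add_le_add h1' k1)) k2)) k3).trans (le_of_eq ?_))
    rw [show y + z + x = x + y + z by ring, show x + z + y = x + y + z by ring]
    ring

theorem exists_cubic_symbol_bound (m : ℕ) : ∃ C : ℝ, 0 ≤ C ∧ ∀ x y z : ℝ, x + y + z = 0 →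
    |x ^ (2 * m + 3) + y ^ (2 * m + 3) + z ^ (2 * m + 3)| ≤
      C * (|x| * |y| * |z|) * (|x| + |y| + |z|) ^ (2 * m) := by
  have hodd : Odd (2 * m + 3) := ⟨m + 1, by ring⟩
  refine ⟨2 * (((2 * m + 1 : ℕ) : ℝ) + 1), by positivity, ?_⟩
  have pos : ∀ x y : ℝ, 0 ≤ x → 0 ≤ y →
      |x ^ (2 * m + 3) + y ^ (2 * m + 3) + (-(x + y)) ^ (2 * m + 3)| ≤
      2 * (((2 * m + 1 : ℕ) : ℝ) + 1) * (|x| * |y| * |-(x + y)|) *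
        (|x| + |y| + |-(x + y)|) ^ (2 * m) := by
    intro x y hx hy
    obtain ⟨h1, h2⟩ := pow_add_sub_bounds (2 * m + 1) hx hy
    rw [hodd.neg_pow, abs_neg, abs_of_nonneg hx, abs_of_nonneg hy,
      abs_of_nonneg (add_nonneg hx hy),
      show x ^ (2 * m + 3) + y ^ (2 * m + 3) + -(x + y) ^ (2 * m + 3) =
        -((x + y) ^ (2 * m + 1 + 2) - x ^ (2 * m + 1 + 2) - y ^ (2 * m + 1 + 2)) by ring,
      abs_neg, abs_of_nonneg h1]
    refine h2.trans ?_
    have h3 : (x + y) ^ (2 * m) ≤ (x + y + (x + y)) ^ (2 * m) :=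
      pow_le_pow_left₀ (add_nonneg hx hy) (by linarith) _
    calc _ = 2 * (((2 * m + 1 : ℕ) : ℝ) + 1) * (x * y * (x + y)) * (x + y) ^ (2 * m) := by ring
      _ ≤ _ := by gcongr
  have same : ∀ x y z : ℝ, x + y + z = 0 → 0 ≤ x * y →
      |x ^ (2 * m + 3) + y ^ (2 * m + 3) + z ^ (2 * m + 3)| ≤
      2 * (((2 * m + 1 : ℕ) : ℝ) + 1) * (|x| * |y| * |z|) * (|x| + |y| + |z|) ^ (2 * m) := by
    intro x y z h hxy
    obtain rfl : z = -(x + y) := by linarith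
    rcases mul_nonneg_iff.1 hxy with ⟨hx, hy⟩ | ⟨hx, hy⟩
    · exact pos x y hx hy
    · have := pos (-x) (-y) (by linarith) (by linarith)
      rw [show -(-x + -y) = -(-(x + y)) by ring] at this
      rw [hodd.neg_pow x, hodd.neg_pow y, hodd.neg_pow (-(x + y)), ← neg_add, ← neg_add,
        abs_neg, abs_neg, abs_neg, abs_neg (-(x + y))] at this
      exact this
  intro x y z h
  by_cases h1 : 0 ≤ x * y
  · exact same x y z h h1
  by_cases h2 : 0 ≤ x * z
  · have := same x z y (by linarith) h2
    calc _ = |x ^ (2 * m + 3) + z ^ (2 * m + 3) + y ^ (2 * m + 3)| := by congr 1; ring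
      _ ≤ _ := this
      _ = _ := by rw [show |x| + |z| + |y| = |x| + |y| + |z| by ring]; ring
  · have h3 : 0 ≤ y * z := by
      push Not at h1 h2
      rcases lt_trichotomy x 0 with hx | hx | hx
      · exact mul_nonneg (by nlinarith) (by nlinarith)
      · simp [hx] at h1
      · exact mul_nonneg_of_nonpos_of_nonpos (by nlinarith) (by nlinarith)
    have := same y z x (by linarith) h3
    calc _ = |y ^ (2 * m + 3) + z ^ (2 * m + 3) + x ^ (2 * m + 3)| := by congr 1; ring
      _ ≤ _ := this
      _ = _ := by rw [show |y| + |z| + |x| = |x| + |y| + |z| by ring]; ring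

/-- The weights on the three frequencies of a cubic term: one factor carries one derivative,
the two others carry `n`. -/
def cubicWeight (n : ℕ) (x y z : ℝ) : ℝ :=
  |x| * |y| ^ n * |z| ^ n + |x| ^ n * |y| * |z| ^ n + |x| ^ n * |y| ^ n * |z|

theorem cubicWeight_ge (m : ℕ) {x y z : ℝ} (h : x + y + z = 0) :
    (|x| * |y| * |z|) * (|x| + |y| + |z|) ^ (2 * m) ≤ 9 ^ m * cubicWeight (m + 1) x y z := by
  have hx : |x| ≤ |y| + |z| := by
    rw [show x = -(y + z) by linarith, abs_neg]; exact abs_add_le _ _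
  have hy : |y| ≤ |x| + |z| := by
    rw [show y = -(x + z) by linarith, abs_neg]; exact abs_add_le _ _
  have hz : |z| ≤ |x| + |y| := by
    rw [show z = -(x + y) by linarith, abs_neg]; exact abs_add_le _ _
  have key : ∀ a b c : ℝ, 0 ≤ a → 0 ≤ b → 0 ≤ c → a ≤ b + c → b ≤ a + c → c ≤ a → c ≤ b →
      (a * b * c) * (a + b + c) ^ (2 * m) ≤ 9 ^ m * (a ^ (m + 1) * b ^ (m + 1) * c) := by
    intro a b c ha hb hc h1 h2 h3 h4
    have : (a + b + c) ^ 2 ≤ 9 * (a * b) := by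
      rcases le_total a b with hab | hab
      · nlinarith [mul_nonneg (sub_nonneg.2 hab) (by linarith : 0 ≤ 4 * a - b)]
      · nlinarith [mul_nonneg (sub_nonneg.2 hab) (by linarith : 0 ≤ 4 * b - a)]
    calc (a * b * c) * (a + b + c) ^ (2 * m) = (a * b * c) * ((a + b + c) ^ 2) ^ m := by
          rw [pow_mul]
      _ ≤ (a * b * c) * (9 * (a * b)) ^ m := by gcongr
      _ = _ := by rw [mul_pow, mul_pow]; ring
  unfold cubicWeight
  have ax := abs_nonneg x
  have ay := abs_nonneg y
  have az := abs_nonneg z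
  have p1 : 0 ≤ 9 ^ m * (|x| * |y| ^ (m + 1) * |z| ^ (m + 1)) := by positivity
  have p2 : 0 ≤ 9 ^ m * (|x| ^ (m + 1) * |y| * |z| ^ (m + 1)) := by positivity
  have p3 : 0 ≤ 9 ^ m * (|x| ^ (m + 1) * |y| ^ (m + 1) * |z|) := by positivity
  by_cases c1 : |x| ≤ |y| ∧ |x| ≤ |z|
  · have := key |y| |z| |x| ay az ax (by linarith) (by linarith) c1.1 c1.2
    rw [show |y| + |z| + |x| = |x| + |y| + |z| by ring] at this
    nlinarith
  by_cases c2 : |y| ≤ |x| ∧ |y| ≤ |z|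
  · have := key |x| |z| |y| ax az ay (by linarith) (by linarith) c2.1 c2.2
    rw [show |x| + |z| + |y| = |x| + |y| + |z| by ring] at this
    nlinarith
  · have h1 : |z| ≤ |x| := by
      by_contra hc
      rcases le_total |x| |y| with h' | h'
      · exact c1 ⟨h', (not_le.1 hc).le⟩
      · exact c2 ⟨h', h'.trans (not_le.1 hc).le⟩
    have h2 : |z| ≤ |y| := by
      by_contra hc
      rcases le_total |x| |y| with h' | h'
      · exact c1 ⟨h', h'.trans (not_le.1 hc).le⟩
      · exact c2 ⟨h', (not_le.1 hc).le⟩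
    have := key |x| |y| |z| ax ay az (by linarith) (by linarith) h1 h2
    nlinarith

theorem exists_cubic_symbol_le_weight (m : ℕ) : ∃ C : ℝ, 0 ≤ C ∧ ∀ x y z : ℝ, x + y + z = 0 →
    |x ^ (2 * m + 3) + y ^ (2 * m + 3) + z ^ (2 * m + 3)| ≤ C * cubicWeight (m + 1) x y z := by
  obtain ⟨C, hC, h⟩ := exists_cubic_symbol_bound m
  refine ⟨C * 9 ^ m, by positivity, fun x y z hs => (h x y z hs).trans ?_⟩
  calc _ = C * ((|x| * |y| * |z|) * (|x| + |y| + |z|) ^ (2 * m)) := by ring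
    _ ≤ C * (9 ^ m * cubicWeight (m + 1) x y z) := by exact mul_le_mul_of_nonneg_left (cubicWeight_ge m hs) hC
    _ = _ := by ring

/-- The quartic symbol produced by the cubic correction of the energy. -/
noncomputable def quarticSymbol (m : ℕ) (x y : ℝ) : ℝ :=
  sg x * sg y * |x + y| * (x ^ (2 * m + 3) + y ^ (2 * m + 3) - (x + y) ^ (2 * m + 3))

theorem quarticSymbol_comm (m : ℕ) (x y : ℝ) : quarticSymbol m x y = quarticSymbol m y x := by
  unfold quarticSymbol; rw [add_comm y x]; ring

/-- The sum of the quartic symbol over all pairs of frequencies. -/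
noncomputable def quarticSum (m : ℕ) (x y z w : ℝ) : ℝ :=
  quarticSymbol m x y + quarticSymbol m x z + quarticSymbol m x w +
    quarticSymbol m y z + quarticSymbol m y w + quarticSymbol m z w

theorem quarticSum_swap12 (m : ℕ) (x y z w : ℝ) : quarticSum m y x z w = quarticSum m x y z w := by
  unfold quarticSum; rw [quarticSymbol_comm m y x]; ring

theorem quarticSum_swap23 (m : ℕ) (x y z w : ℝ) : quarticSum m x z y w = quarticSum m x y z w := by
  unfold quarticSum; rw [quarticSymbol_comm m z y]; ring

theorem quarticSum_swap34 (m : ℕ) (x y z w : ℝ) : quarticSum m x y w z = quarticSum m x y z w := by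
  unfold quarticSum; rw [quarticSymbol_comm m w z]; ring

theorem exists_quarticSum_bound (m : ℕ) : ∃ C : ℝ, 0 ≤ C ∧ ∀ x y z w : ℝ, x + y + z + w = 0 →
    |quarticSum m x y z w| ≤
      C * (|x| * |y| * |z| * |w|) * (|x| + |y| + |z| + |w|) ^ (2 * m) := by
  have hodd : Odd (2 * m + 3) := ⟨m + 1, by ring⟩
  obtain ⟨C₁, hC₁, h₁⟩ := exists_third_difference_bound (2 * m + 1)
  set C₂ : ℝ := 2 * (((2 * m + 1 : ℕ) : ℝ) + 1) with hC₂
  have hC₂0 : 0 ≤ C₂ := by positivity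
  refine ⟨2 * C₁ + 8 * C₂, by positivity, ?_⟩
  -- the case of three frequencies of one sign
  have A : ∀ x y z : ℝ, 0 ≤ x → 0 ≤ y → 0 ≤ z →
      |(x + y) * (x ^ (2 * m + 3) + y ^ (2 * m + 3) - (x + y) ^ (2 * m + 3)) +
        (x + z) * (x ^ (2 * m + 3) + z ^ (2 * m + 3) - (x + z) ^ (2 * m + 3)) +
        (y + z) * (y ^ (2 * m + 3) + z ^ (2 * m + 3) - (y + z) ^ (2 * m + 3)) -
        (x + y) * (z ^ (2 * m + 3) - (x + y + z) ^ (2 * m + 3) + (x + y) ^ (2 * m + 3)) -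
        (x + z) * (y ^ (2 * m + 3) - (x + y + z) ^ (2 * m + 3) + (x + z) ^ (2 * m + 3)) -
        (y + z) * (x ^ (2 * m + 3) - (x + y + z) ^ (2 * m + 3) + (y + z) ^ (2 * m + 3))| ≤
      (2 * C₁ + 8 * C₂) * (x * y * z * (x + y + z)) * (x + y + z + (x + y + z)) ^ (2 * m) := by
    intro x y z hx hy hz
    have h := h₁ x y z hx hy hz
    have hs : (x + y + z) ^ (2 * m) ≤ (x + y + z + (x + y + z)) ^ (2 * m) :=
      pow_le_pow_left₀ (by positivity) (by linarith [add_nonneg (add_nonneg hx hy) hz]) _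
    calc _ = |2 * ((x + y + z) ^ (2 * m + 1 + 3) - (x + y) ^ (2 * m + 1 + 3)
          - (y + z) ^ (2 * m + 1 + 3) - (x + z) ^ (2 * m + 1 + 3)
          + x ^ (2 * m + 1 + 3) + y ^ (2 * m + 1 + 3) + z ^ (2 * m + 1 + 3))| := by
          congr 1; ring
      _ ≤ 2 * (C₁ * (x * y * z) * (x + y + z) ^ (2 * m + 1)) := by
          rw [abs_mul, abs_two]; gcongr
      _ = (2 * C₁) * (x * y * z * (x + y + z)) * (x + y + z) ^ (2 * m) := by ring
      _ ≤ _ := by gcongr; linarith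
  -- the case of two frequencies of each sign
  have B : ∀ x y z w : ℝ, 0 ≤ x → 0 ≤ y → 0 ≤ z → 0 ≤ w → x + y = z + w → z ≤ x → w ≤ x →
      |(x ^ (2 * m + 3) + y ^ (2 * m + 3) - z ^ (2 * m + 3) - w ^ (2 * m + 3)) * (2 * y)| ≤
      (2 * C₁ + 8 * C₂) * (x * y * z * w) * (x + y + z + w) ^ (2 * m) := by
    intro x y z w hx hy hz hw h hzx hwx
    obtain ⟨a1, a2⟩ := pow_add_sub_bounds (2 * m + 1) hx hy
    obtain ⟨b1, b2⟩ := pow_add_sub_bounds (2 * m + 1) hz hw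
    have hxy : x * y ≤ z * w := by nlinarith
    have hd : |x ^ (2 * m + 3) + y ^ (2 * m + 3) - z ^ (2 * m + 3) - w ^ (2 * m + 3)| ≤
        C₂ * (z * w) * (x + y) ^ (2 * m + 1) := by
      have a3 : C₂ * (x * y) * (x + y) ^ (2 * m + 1) ≤ C₂ * (z * w) * (x + y) ^ (2 * m + 1) := by
        gcongr
      rw [← h] at b1 b2
      rw [abs_le]
      constructor <;> linarith
    have hs : (x + y) ^ (2 * m) ≤ (x + y + z + w) ^ (2 * m) :=
      pow_le_pow_left₀ (by positivity) (by linarith) _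
    calc _ = 2 * y * |x ^ (2 * m + 3) + y ^ (2 * m + 3) - z ^ (2 * m + 3) - w ^ (2 * m + 3)| := by
          rw [abs_mul, abs_of_nonneg (by positivity : 0 ≤ 2 * y)]; ring
      _ ≤ 2 * y * (C₂ * (z * w) * (x + y) ^ (2 * m + 1)) := by gcongr
      _ = 2 * C₂ * (y * z * w) * (x + y) * (x + y) ^ (2 * m) := by ring
      _ ≤ 2 * C₂ * (y * z * w) * (2 * x) * (x + y + z + w) ^ (2 * m) := by
          gcongr; linarith
      _ = (4 * C₂) * (x * y * z * w) * (x + y + z + w) ^ (2 * m) := by ring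
      _ ≤ _ := by gcongr; linarith
  have A' : ∀ x y z w : ℝ, x + y + z + w = 0 → 0 ≤ x → 0 ≤ y → 0 ≤ z → w < 0 →
      |quarticSum m x y z w| ≤ (2 * C₁ + 8 * C₂) * (|x| * |y| * |z| * |w|) *
        (|x| + |y| + |z| + |w|) ^ (2 * m) := by
    intro x y z w h hx hy hz hw
    obtain rfl : w = -(x + y + z) := by linarith
    have := A x y z hx hy hz
    unfold quarticSum quarticSymbol
    rw [sg_of_nonneg hx, sg_of_nonneg hy, sg_of_nonneg hz, sg_of_neg hw,
      show x + -(x + y + z) = -(y + z) by ring, show y + -(x + y + z) = -(x + z) by ring,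
      show z + -(x + y + z) = -(x + y) by ring]
    simp only [abs_neg, hodd.neg_pow]
    rw [abs_of_nonneg hx, abs_of_nonneg hy, abs_of_nonneg hz, abs_of_nonneg (add_nonneg hx hy),
      abs_of_nonneg (add_nonneg hx hz), abs_of_nonneg (add_nonneg hy hz),
      abs_of_nonneg (add_nonneg (add_nonneg hx hy) hz)]
    refine le_trans (le_of_eq ?_) this
    congr 1; ring
  have A'' : ∀ x y z w : ℝ, x + y + z + w = 0 → x < 0 → y < 0 → z < 0 → 0 ≤ w →
      |quarticSum m x y z w| ≤ (2 * C₁ + 8 * C₂) * (|x| * |y| * |z| * |w|) *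
        (|x| + |y| + |z| + |w|) ^ (2 * m) := by
    intro x y z w h hx hy hz hw
    have := A' (-x) (-y) (-z) (-w) (by linarith) (by linarith) (by linarith) (by linarith)
      (by linarith)
    simp only [abs_neg] at this
    have hq : ∀ a b : ℝ, a ≠ 0 → b ≠ 0 → quarticSymbol m (-a) (-b) = - quarticSymbol m a b := by
      intro a b ha hb
      unfold quarticSymbol
      rw [sg_neg ha, sg_neg hb, ← neg_add, abs_neg]
      simp only [hodd.neg_pow]; ring
    unfold quarticSum at this ⊢
    have hw' : w ≠ 0 := by intro h0; linarith
    rw [hq x y hx.ne hy.ne, hq x z hx.ne hz.ne, hq x w hx.ne hw', hq y z hy.ne hz.ne,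
      hq y w hy.ne hw', hq z w hz.ne hw'] at this
    rwa [← abs_neg, show ∀ a b c d e f : ℝ, -(a + b + c + d + e + f) =
      -a + -b + -c + -d + -e + -f by intros; ring]
  have B' : ∀ x y z w : ℝ, x + y + z + w = 0 → 0 ≤ x → 0 ≤ y → z < 0 → w < 0 →
      |quarticSum m x y z w| ≤ (2 * C₁ + 8 * C₂) * (|x| * |y| * |z| * |w|) *
        (|x| + |y| + |z| + |w|) ^ (2 * m) := by
    intro x y z w h hx hy hz hw
    obtain ⟨u, rfl⟩ : ∃ u, z = -u := ⟨-z, by ring⟩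
    obtain ⟨v, rfl⟩ : ∃ v, w = -v := ⟨-w, by ring⟩
    have hu : 0 ≤ u := by linarith
    have hv : 0 ≤ v := by linarith
    have huv : u + v = x + y := by linarith
    have e : quarticSum m x y (-u) (-v) =
        (x ^ (2 * m + 3) + y ^ (2 * m + 3) - u ^ (2 * m + 3) - v ^ (2 * m + 3)) *
          ((x + y) - |x - u| - |x - v|) := by
      unfold quarticSum quarticSymbol
      rw [sg_of_nonneg hx, sg_of_nonneg hy, sg_of_neg hz, sg_of_neg hw,
        show -u + -v = -(x + y) by linarith, show y + -u = -(x - v) by linarith,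
        show y + -v = -(x - u) by linarith, ← sub_eq_add_neg, ← sub_eq_add_neg]
      simp only [abs_neg, hodd.neg_pow]
      rw [abs_of_nonneg (add_nonneg hx hy)]
      ring
    rw [e]
    simp only [abs_neg, abs_of_nonneg, hx, hy, hu, hv]
    rcases le_total u x with h1 | h1
    · rcases le_total v x with h2 | h2
      · rw [abs_of_nonneg (by linarith : 0 ≤ x - u), abs_of_nonneg (by linarith : 0 ≤ x - v)]
        refine le_trans (le_of_eq ?_) (B x y u v hx hy hu hv (by linarith) h1 h2)
        congr 2; linarith
      · rw [abs_of_nonneg (by linarith : 0 ≤ x - u), abs_of_nonpos (by linarith : x - v ≤ 0)]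
        refine le_trans (le_of_eq ?_) ((B v u y x hv hu hy hx (by linarith) (by linarith)
          (by linarith)).trans (le_of_eq ?_))
        · rw [← abs_neg]; congr 1
          rw [show x + y - (x - u) - -(x - v) = 2 * u by linarith]; ring
        · rw [show v + u + y + x = x + y + u + v by ring]; ring
    · rcases le_total v x with h2 | h2
      · rw [abs_of_nonpos (by linarith : x - u ≤ 0), abs_of_nonneg (by linarith : 0 ≤ x - v)]
        refine le_trans (le_of_eq ?_) ((B u v y x hu hv hy hx (by linarith) (by linarith)
          (by linarith)).trans (le_of_eq ?_))
        · rw [← abs_neg]; congr 1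
          rw [show x + y - -(x - u) - (x - v) = 2 * v by linarith]; ring
        · rw [show u + v + y + x = x + y + u + v by ring]; ring
      · rw [abs_of_nonpos (by linarith : x - u ≤ 0), abs_of_nonpos (by linarith : x - v ≤ 0)]
        refine le_trans (le_of_eq ?_) ((B y x u v hy hx hu hv (by linarith) (by linarith)
          (by linarith)).trans (le_of_eq ?_))
        · congr 1
          rw [show x + y - -(x - u) - -(x - v) = 2 * x by linarith]; ring
        · rw [show y + x + u + v = x + y + u + v by ring]; ring
  intro x y z w h
  rcases le_or_gt 0 x with hx | hx <;> rcases le_or_gt 0 y with hy | hy <;>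
    rcases le_or_gt 0 z with hz | hz <;> rcases le_or_gt 0 w with hw | hw
  · obtain ⟨rfl, rfl, rfl, rfl⟩ : x = 0 ∧ y = 0 ∧ z = 0 ∧ w = 0 :=
      ⟨by linarith, by linarith, by linarith, by linarith⟩
    simp [quarticSum, quarticSymbol]
  · exact A' x y z w h hx hy hz hw
  · rw [← quarticSum_swap34]
    refine (A' x y w z (by linarith) hx hy hw hz).trans (le_of_eq ?_)
    rw [show |x| + |y| + |w| + |z| = |x| + |y| + |z| + |w| by ring]; ring
  · exact B' x y z w h hx hy hz hw
  · rw [← quarticSum_swap23, ← quarticSum_swap34]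
    refine (A' x z w y (by linarith) hx hz hw hy).trans (le_of_eq ?_)
    rw [show |x| + |z| + |w| + |y| = |x| + |y| + |z| + |w| by ring]; ring
  · rw [← quarticSum_swap23]
    refine (B' x z y w (by linarith) hx hz hy hw).trans (le_of_eq ?_)
    rw [show |x| + |z| + |y| + |w| = |x| + |y| + |z| + |w| by ring]; ring
  · rw [← quarticSum_swap34, ← quarticSum_swap23]
    refine (B' x w y z (by linarith) hx hw hy hz).trans (le_of_eq ?_)
    rw [show |x| + |w| + |y| + |z| = |x| + |y| + |z| + |w| by ring]; ring
  · rw [← quarticSum_swap12, ← quarticSum_swap23, ← quarticSum_swap34]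
    refine (A'' y z w x (by linarith) hy hz hw hx).trans (le_of_eq ?_)
    rw [show |y| + |z| + |w| + |x| = |x| + |y| + |z| + |w| by ring]; ring
  · rw [← quarticSum_swap12, ← quarticSum_swap23, ← quarticSum_swap34]
    refine (A' y z w x (by linarith) hy hz hw hx).trans (le_of_eq ?_)
    rw [show |y| + |z| + |w| + |x| = |x| + |y| + |z| + |w| by ring]; ring
  · rw [← quarticSum_swap12, ← quarticSum_swap23]
    refine (B' y z x w (by linarith) hy hz hx hw).trans (le_of_eq ?_)
    rw [show |y| + |z| + |x| + |w| = |x| + |y| + |z| + |w| by ring]; ring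
  · rw [← quarticSum_swap12, ← quarticSum_swap34, ← quarticSum_swap23]
    refine (B' y w x z (by linarith) hy hw hx hz).trans (le_of_eq ?_)
    rw [show |y| + |w| + |x| + |z| = |x| + |y| + |z| + |w| by ring]; ring
  · rw [← quarticSum_swap23, ← quarticSum_swap34]
    refine (A'' x z w y (by linarith) hx hz hw hy).trans (le_of_eq ?_)
    rw [show |x| + |z| + |w| + |y| = |x| + |y| + |z| + |w| by ring]; ring
  · have e : quarticSum m z w x y = quarticSum m x y z w := by
      rw [← quarticSum_swap23 m z w x y, ← quarticSum_swap12 m z x w y,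
        ← quarticSum_swap34 m x z w y, ← quarticSum_swap23 m x z y w]
    rw [← e]
    refine (B' z w x y (by linarith) hz hw hx hy).trans (le_of_eq ?_)
    rw [show |z| + |w| + |x| + |y| = |x| + |y| + |z| + |w| by ring]; ring
  · rw [← quarticSum_swap34]
    refine (A'' x y w z (by linarith) hx hy hw hz).trans (le_of_eq ?_)
    rw [show |x| + |y| + |w| + |z| = |x| + |y| + |z| + |w| by ring]; ring
  · exact A'' x y z w h hx hy hz hw
  · exfalso; linarith

/-- The weights on the four frequencies of a quartic term: two factors carry one derivative,
the two others carry `n`. -/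
def quarticWeight (n : ℕ) (x y z w : ℝ) : ℝ :=
  |x| ^ n * |y| ^ n * |z| * |w| + |x| ^ n * |y| * |z| ^ n * |w| + |x| ^ n * |y| * |z| * |w| ^ n +
    |x| * |y| ^ n * |z| ^ n * |w| + |x| * |y| ^ n * |z| * |w| ^ n + |x| * |y| * |z| ^ n * |w| ^ n

theorem sq_sum_le_of_sum_eq_zero {x y z w : ℝ} (h : x + y + z + w = 0) :
    (|x| + |y| + |z| + |w|) ^ 2 ≤ 16 * (|x| * |y|) ∨ (|x| + |y| + |z| + |w|) ^ 2 ≤ 16 * (|x| * |z|) ∨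
    (|x| + |y| + |z| + |w|) ^ 2 ≤ 16 * (|x| * |w|) ∨ (|x| + |y| + |z| + |w|) ^ 2 ≤ 16 * (|y| * |z|) ∨
    (|x| + |y| + |z| + |w|) ^ 2 ≤ 16 * (|y| * |w|) ∨
    (|x| + |y| + |z| + |w|) ^ 2 ≤ 16 * (|z| * |w|) := by
  have tri : ∀ a b c d : ℝ, a + b + c + d = 0 → |a| ≤ |b| + |c| + |d| := by
    intro a b c d h
    rw [show a = -(b + c + d) by linarith, abs_neg]
    exact (abs_add_le _ _).trans (by gcongr; exact abs_add_le _ _)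
  have key : ∀ a b c d : ℝ, 0 ≤ a → 0 ≤ b → 0 ≤ c → 0 ≤ d → a ≤ b + c + d → c ≤ b → d ≤ b → b ≤ a →
      (a + b + c + d) ^ 2 ≤ 16 * (a * b) := by
    intro a b c d ha hb hc hd h1 h2 h3 h4
    have k2 : 0 ≤ 9 * b - a := by linarith
    calc (a + b + c + d) ^ 2 ≤ (a + 3 * b) ^ 2 :=
          pow_le_pow_left₀ (by positivity) (by linarith) _
      _ ≤ 16 * (a * b) := by nlinarith [mul_nonneg (sub_nonneg.2 h4) k2]
  have key2 : ∀ a b c d : ℝ, 0 ≤ a → 0 ≤ b → 0 ≤ c → 0 ≤ d → a ≤ b + c + d → b ≤ a → c ≤ a → d ≤ a →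
      (a + b + c + d) ^ 2 ≤ 16 * (a * b) ∨ (a + b + c + d) ^ 2 ≤ 16 * (a * c) ∨
      (a + b + c + d) ^ 2 ≤ 16 * (a * d) := by
    intro a b c d ha hb hc hd h1 h2 h3 h4
    by_cases c1 : c ≤ b ∧ d ≤ b
    · exact Or.inl (key a b c d ha hb hc hd h1 c1.1 c1.2 h2)
    by_cases c2 : b ≤ c ∧ d ≤ c
    · refine Or.inr (Or.inl ?_)
      have := key a c b d ha hc hb hd (by linarith) c2.1 c2.2 h3
      rwa [show a + c + b + d = a + b + c + d by ring] at this
    · refine Or.inr (Or.inr ?_)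
      have k1 : b ≤ d := by
        by_contra hh
        rcases le_total b c with h' | h'
        · exact c2 ⟨h', (not_le.1 hh).le.trans h'⟩
        · exact c1 ⟨h', (not_le.1 hh).le⟩
      have k2 : c ≤ d := by
        by_contra hh
        rcases le_total b c with h' | h'
        · exact c2 ⟨h', (not_le.1 hh).le⟩
        · exact c1 ⟨h', (not_le.1 hh).le.trans h'⟩
      have := key a d b c ha hd hb hc (by linarith) k1 k2 h4
      rwa [show a + d + b + c = a + b + c + d by ring] at this
  have ax := abs_nonneg x
  have ay := abs_nonneg y
  have az := abs_nonneg z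
  have aw := abs_nonneg w
  have hx := tri x y z w h
  have hy := tri y x z w (by linarith)
  have hz := tri z x y w (by linarith)
  have hw := tri w x y z (by linarith)
  generalize |x| = a at *
  generalize |y| = b at *
  generalize |z| = c at *
  generalize |w| = d at *
  by_cases c1 : b ≤ a ∧ c ≤ a ∧ d ≤ a
  · rcases key2 a b c d ax ay az aw hx c1.1 c1.2.1 c1.2.2 with h | h | h <;> simp only [h, true_or, or_true]
  by_cases c2 : a ≤ b ∧ c ≤ b ∧ d ≤ b
  · have := key2 b a c d ay ax az aw hy c2.1 c2.2.1 c2.2.2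
    rw [show b + a + c + d = a + b + c + d by ring, mul_comm b a] at this
    tauto
  by_cases c3 : a ≤ c ∧ b ≤ c ∧ d ≤ c
  · have := key2 c a b d az ax ay aw hz c3.1 c3.2.1 c3.2.2
    rw [show c + a + b + d = a + b + c + d by ring, mul_comm c a, mul_comm c b] at this
    tauto
  · have hd : a ≤ d ∧ b ≤ d ∧ c ≤ d := by
      rcases le_total (max a b) (max c d) with h1 | h1
      · rcases le_total c d with h2 | h2
        · rw [max_eq_right h2, max_le_iff] at h1
          exact ⟨h1.1, h1.2, h2⟩
        · rw [max_eq_left h2, max_le_iff] at h1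
          exact absurd ⟨h1.1, h1.2, h2⟩ c3
      · rcases le_total a b with h2 | h2
        · rw [max_eq_right h2, max_le_iff] at h1
          exact absurd ⟨h2, h1.1, h1.2⟩ c2
        · rw [max_eq_left h2, max_le_iff] at h1
          exact absurd ⟨h2, h1.1, h1.2⟩ c1
    have := key2 d a b c aw ax ay az hw hd.1 hd.2.1 hd.2.2
    rw [show d + a + b + c = a + b + c + d by ring, mul_comm d a, mul_comm d b, mul_comm d c] at this
    tauto

theorem quarticWeight_ge (m : ℕ) {x y z w : ℝ} (h : x + y + z + w = 0) :
    (|x| * |y| * |z| * |w|) * (|x| + |y| + |z| + |w|) ^ (2 * m) ≤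
      16 ^ m * quarticWeight (m + 1) x y z w := by
  have h2 := sq_sum_le_of_sum_eq_zero h
  have ax := abs_nonneg x
  have ay := abs_nonneg y
  have az := abs_nonneg z
  have aw := abs_nonneg w
  unfold quarticWeight
  generalize |x| = a at *
  generalize |y| = b at *
  generalize |z| = c at *
  generalize |w| = d at *
  have p1 : 0 ≤ a ^ (m + 1) * b ^ (m + 1) * c * d := by positivity
  have p2 : 0 ≤ a ^ (m + 1) * b * c ^ (m + 1) * d := by positivity
  have p3 : 0 ≤ a ^ (m + 1) * b * c * d ^ (m + 1) := by positivity
  have p4 : 0 ≤ a * b ^ (m + 1) * c ^ (m + 1) * d := by positivity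
  have p5 : 0 ≤ a * b ^ (m + 1) * c * d ^ (m + 1) := by positivity
  have p6 : 0 ≤ a * b * c ^ (m + 1) * d ^ (m + 1) := by positivity
  have key : ∀ e : ℝ, (a + b + c + d) ^ 2 ≤ 16 * e →
      (a * b * c * d) * (a + b + c + d) ^ (2 * m) ≤ 16 ^ m * ((a * b * c * d) * e ^ m) := by
    intro e he
    calc _ = (a * b * c * d) * ((a + b + c + d) ^ 2) ^ m := by rw [pow_mul]
      _ ≤ (a * b * c * d) * (16 * e) ^ m := by gcongr
      _ = _ := by rw [mul_pow]; ring
  have t1 : (a * b * c * d) * (a * b) ^ m = a ^ (m + 1) * b ^ (m + 1) * c * d := by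
    rw [mul_pow]; ring
  have t2 : (a * b * c * d) * (a * c) ^ m = a ^ (m + 1) * b * c ^ (m + 1) * d := by
    rw [mul_pow]; ring
  have t3 : (a * b * c * d) * (a * d) ^ m = a ^ (m + 1) * b * c * d ^ (m + 1) := by
    rw [mul_pow]; ring
  have t4 : (a * b * c * d) * (b * c) ^ m = a * b ^ (m + 1) * c ^ (m + 1) * d := by
    rw [mul_pow]; ring
  have t5 : (a * b * c * d) * (b * d) ^ m = a * b ^ (m + 1) * c * d ^ (m + 1) := by
    rw [mul_pow]; ring
  have t6 : (a * b * c * d) * (c * d) ^ m = a * b * c ^ (m + 1) * d ^ (m + 1) := by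
    rw [mul_pow]; ring
  rcases h2 with h | h | h | h | h | h <;>
    refine (key _ h).trans (mul_le_mul_of_nonneg_left ?_ (by positivity)) <;> linarith

theorem exists_quarticSum_le_weight (m : ℕ) : ∃ C : ℝ, 0 ≤ C ∧ ∀ x y z w : ℝ, x + y + z + w = 0 →
    |quarticSum m x y z w| ≤ C * quarticWeight (m + 1) x y z w := by
  obtain ⟨C, hC, h⟩ := exists_quarticSum_bound m
  refine ⟨C * 16 ^ m, by positivity, fun x y z w hs => (h x y z w hs).trans ?_⟩
  calc _ = C * ((|x| * |y| * |z| * |w|) * (|x| + |y| + |z| + |w|) ^ (2 * m)) := by ring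
    _ ≤ C * (16 ^ m * quarticWeight (m + 1) x y z w) := by exact mul_le_mul_of_nonneg_left (quarticWeight_ge m hs) hC
    _ = _ := by ring

/-- The symmetrized quartic symbol in the energy of a difference of two solutions. -/
noncomputable def differenceSymbol (x y z w : ℝ) : ℝ :=
  |x + y| * (x + y) * (sg z * sg w) + |x| * (sg z * |y + w| + sg w * |y + z|) +
    |y| * (sg z * |x + w| + sg w * |x + z|)

theorem abs_differenceSymbol_le {x y z w : ℝ} (h : x + y + z + w = 0) :
    |differenceSymbol x y z w| ≤ 8 * (|x| * |y|) := by
  have main : ∀ x y z w : ℝ, x + y + z + w = 0 → |x| ≤ |y| →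
      |differenceSymbol x y z w| ≤ 8 * (|x| * |y|) := by
    intro x y z w h hxy
    set E₁ := |y + w| - |z| with hE₁
    set E₂ := |y + z| - |w| with hE₂
    set E₃ := |x + w| - |w| with hE₃
    set E₄ := |x + z| - |z| with hE₄
    have e1 : |E₁| ≤ |x| := by
      rw [hE₁, show y + w = -(x + z) by linarith, abs_neg]
      exact (abs_abs_sub_abs_le _ _).trans (by simp)
    have e2 : |E₂| ≤ |x| := by
      rw [hE₂, show y + z = -(x + w) by linarith, abs_neg]
      exact (abs_abs_sub_abs_le _ _).trans (by simp)
    have e3 : |E₃| ≤ |x| := (abs_abs_sub_abs_le _ _).trans (by simp)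
    have e4 : |E₄| ≤ |x| := (abs_abs_sub_abs_le _ _).trans (by simp)
    have e5 : |(|x + y| - |y|)| ≤ |x| := (abs_abs_sub_abs_le _ _).trans (by simp)
    have e6 : |x + y| ≤ 2 * |y| := (abs_add_le _ _).trans (by linarith)
    have id1 : differenceSymbol x y z w =
        sg z * sg w * (x + y) * (|x + y| - |y|) - |x| * (x + y) +
          |x| * (sg z * E₁ + sg w * E₂) + |y| * (sg z * E₃ + sg w * E₄) := by
      have hzw : |z| = sg z * z := (sg_mul_self z).symm
      have hww : |w| = sg w * w := (sg_mul_self w).symm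
      have hz2 := sg_mul_sg z
      have hw2 := sg_mul_sg w
      have hxyzw : x + y = -(z + w) := by linarith
      unfold differenceSymbol
      rw [show |y + w| = E₁ + sg z * z by rw [hE₁, hzw]; ring,
        show |y + z| = E₂ + sg w * w by rw [hE₂, hww]; ring,
        show |x + w| = E₃ + sg w * w by rw [hE₃, hww]; ring,
        show |x + z| = E₄ + sg z * z by rw [hE₄, hzw]; ring]
      have t1 : sg z * (E₁ + sg z * z) = sg z * E₁ + z := by linear_combination z * hz2
      have t2 : sg w * (E₂ + sg w * w) = sg w * E₂ + w := by linear_combination w * hw2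
      rw [t1, t2]
      linear_combination (|x| + |y| * sg z * sg w) * hxyzw
    have b1 : |sg z * sg w * (x + y) * (|x + y| - |y|)| ≤ 2 * |y| * |x| := by
      rw [abs_mul, abs_mul, abs_mul, abs_sg, abs_sg, one_mul, one_mul]; gcongr
    have b2 : |(|x| * (x + y))| ≤ |x| * (2 * |y|) := by
      rw [abs_mul, abs_abs]; gcongr
    have b3 : |(|x| * (sg z * E₁ + sg w * E₂))| ≤ |x| * (2 * |y|) := by
      rw [abs_mul, abs_abs]; gcongr
      refine (abs_add_le _ _).trans ?_
      rw [abs_mul, abs_mul, abs_sg, abs_sg]; linarith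
    have b4 : |(|y| * (sg z * E₃ + sg w * E₄))| ≤ |y| * (2 * |x|) := by
      rw [abs_mul, abs_abs]; gcongr
      refine (abs_add_le _ _).trans ?_
      rw [abs_mul, abs_mul, abs_sg, abs_sg]; linarith
    rw [id1]
    refine (abs_add_le _ _).trans ((add_le_add ((abs_add_le _ _).trans
      (add_le_add ((abs_sub _ _).trans (add_le_add b1 b2)) b3)) b4).trans (le_of_eq ?_))
    ring
  rcases le_total |x| |y| with hxy | hxy
  · exact main x y z w h hxy
  · have := main y x z w (by linarith) hxy
    have e : differenceSymbol y x z w = differenceSymbol x y z w := by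
      unfold differenceSymbol; rw [add_comm y x]; ring
    rw [e] at this
    linarith [mul_comm |x| |y|]

/-- A quartic weight with a single derivative on each of two factors. -/
def pairWeight (x y z w : ℝ) : ℝ :=
  |x| * |y| + |x| * |z| + |x| * |w| + |y| * |z| + |y| * |w| + |z| * |w|

theorem sq_add_le_pairWeight {x y z w : ℝ} (h : x + y + z + w = 0) :
    |(|x + y| * (x + y))| ≤ 16 * pairWeight x y z w := by
  have h1 : |(|x + y| * (x + y))| ≤ (|x| + |y| + |z| + |w|) ^ 2 := by
    rw [abs_mul, abs_abs, ← sq]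
    have := abs_add_le x y
    have := abs_nonneg z
    have := abs_nonneg w
    gcongr
    linarith
  refine h1.trans ?_
  unfold pairWeight
  have ax := abs_nonneg x
  have ay := abs_nonneg y
  have az := abs_nonneg z
  have aw := abs_nonneg w
  have := mul_nonneg ax ay
  have := mul_nonneg ax az
  have := mul_nonneg ax aw
  have := mul_nonneg ay az
  have := mul_nonneg ay aw
  have := mul_nonneg az aw
  rcases sq_sum_le_of_sum_eq_zero h with h | h | h | h | h | h <;> linarith

/-- The involution `(x, y) ↦ (x, -x - y)`. -/
def reflectThird : (ℝ × ℝ) ≃ᵐ (ℝ × ℝ) where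
  toFun p := (p.1, -p.1 - p.2)
  invFun p := (p.1, -p.1 - p.2)
  left_inv p := by ext <;> simp
  right_inv p := by ext <;> simp
  measurable_toFun := by
    show Measurable fun p : ℝ × ℝ => (p.1, -p.1 - p.2)
    fun_prop
  measurable_invFun := by
    show Measurable fun p : ℝ × ℝ => (p.1, -p.1 - p.2)
    fun_prop

theorem measurePreserving_reflectThird : MeasurePreserving reflectThird := by
  have h := (MeasurePreserving.id (volume : Measure ℝ)).skew_product (μb := volume) (μd := volume)
    (g := fun a b : ℝ => -a - b) (by fun_prop)
    (Eventually.of_forall fun a => (Measure.measurePreserving_sub_left volume (-a)).map_eq)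
  exact h

/-- The involution `((x, y), z) ↦ ((x, y), -x - y - z)`. -/
def reflectFourth : ((ℝ × ℝ) × ℝ) ≃ᵐ ((ℝ × ℝ) × ℝ) where
  toFun p := (p.1, -p.1.1 - p.1.2 - p.2)
  invFun p := (p.1, -p.1.1 - p.1.2 - p.2)
  left_inv p := by ext <;> simp
  right_inv p := by ext <;> simp
  measurable_toFun := by
    show Measurable fun p : (ℝ × ℝ) × ℝ => (p.1, -p.1.1 - p.1.2 - p.2)
    fun_prop
  measurable_invFun := by
    show Measurable fun p : (ℝ × ℝ) × ℝ => (p.1, -p.1.1 - p.1.2 - p.2)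
    fun_prop

theorem measurePreserving_reflectFourth : MeasurePreserving reflectFourth := by
  have h := (MeasurePreserving.id (volume : Measure (ℝ × ℝ))).skew_product (μb := volume)
    (μd := volume) (g := fun (a : ℝ × ℝ) (b : ℝ) => -a.1 - a.2 - b) (by fun_prop)
    (Eventually.of_forall fun a => (Measure.measurePreserving_sub_left volume (-a.1 - a.2)).map_eq)
  exact h

/-- The involution `((x, y), z) ↦ ((x, z), y)`. -/
def swapLast : ((ℝ × ℝ) × ℝ) ≃ᵐ ((ℝ × ℝ) × ℝ) :=
  (MeasurableEquiv.prodAssoc.trans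
    (MeasurableEquiv.prodCongr (MeasurableEquiv.refl ℝ) MeasurableEquiv.prodComm)).trans
    MeasurableEquiv.prodAssoc.symm

theorem measurePreserving_swapLast : MeasurePreserving swapLast := by
  have h1 : MeasurePreserving (MeasurableEquiv.prodAssoc : (ℝ × ℝ) × ℝ ≃ᵐ ℝ × ℝ × ℝ) :=
    measurePreserving_prodAssoc volume volume volume
  have h2 : MeasurePreserving (MeasurableEquiv.prodCongr (MeasurableEquiv.refl ℝ)
      (MeasurableEquiv.prodComm : ℝ × ℝ ≃ᵐ ℝ × ℝ)) :=
    (MeasurePreserving.id volume).prod Measure.measurePreserving_swap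
  exact (h2.comp h1).trans (h1.symm _)

/-- The involution `((x, y), z) ↦ ((y, x), z)`. -/
def swapFirst : ((ℝ × ℝ) × ℝ) ≃ᵐ ((ℝ × ℝ) × ℝ) :=
  MeasurableEquiv.prodCongr MeasurableEquiv.prodComm (MeasurableEquiv.refl ℝ)

theorem measurePreserving_swapFirst : MeasurePreserving swapFirst :=
  (Measure.measurePreserving_swap (μ := (volume : Measure ℝ)) (ν := (volume : Measure ℝ))).prod
    (MeasurePreserving.id volume)

theorem measurePreserving_prodComm :
    MeasurePreserving (MeasurableEquiv.prodComm : ℝ × ℝ ≃ᵐ ℝ × ℝ) :=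
  Measure.measurePreserving_swap

/-! ### Convolution inequalities -/

theorem lintegral_mul_reflect_le {G H : ℝ → ℂ} (hG : Measurable G) (hH : Measurable H) (c : ℝ) :
    ∫⁻ y, ‖G y‖ₑ * ‖H (c - y)‖ₑ ≤ eLpNorm G 2 volume * eLpNorm H 2 volume := by
  have h := ENNReal.lintegral_mul_le_Lp_mul_Lq volume Real.HolderConjugate.two_two
    (hG.enorm.aemeasurable) ((hH.comp (measurable_const.sub measurable_id)).enorm.aemeasurable)
    (f := fun y => ‖G y‖ₑ) (g := fun y => ‖H (c - y)‖ₑ)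
  refine h.trans (le_of_eq ?_)
  have e : ∫⁻ y, ‖H (c - y)‖ₑ ^ (2 : ℝ) = ∫⁻ y, ‖H y‖ₑ ^ (2 : ℝ) :=
    lintegral_sub_left_eq_self (fun y => ‖H y‖ₑ ^ (2 : ℝ)) c
  rw [e, eLpNorm_eq_lintegral_rpow_enorm_toReal (by norm_num) (by norm_num),
    eLpNorm_eq_lintegral_rpow_enorm_toReal (by norm_num) (by norm_num)]
  simp

/-- The integral of a product of three factors over frequencies of zero sum. -/
noncomputable def triAbs (F G H : ℝ → ℂ) : ℝ≥0∞ :=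
  ∫⁻ p : ℝ × ℝ, ‖F p.1‖ₑ * ‖G p.2‖ₑ * ‖H (-p.1 - p.2)‖ₑ

/-- The integral of a product of four factors over frequencies of zero sum. -/
noncomputable def quadAbs (F G H J : ℝ → ℂ) : ℝ≥0∞ :=
  ∫⁻ p : (ℝ × ℝ) × ℝ, ‖F p.1.1‖ₑ * ‖G p.1.2‖ₑ * ‖H p.2‖ₑ * ‖J (-p.1.1 - p.1.2 - p.2)‖ₑ

theorem triAbs_swap12 (F G H : ℝ → ℂ) : triAbs F G H = triAbs G F H := by
  unfold triAbs
  rw [← measurePreserving_prodComm.lintegral_comp_emb MeasurableEquiv.prodComm.measurableEmbedding]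
  refine lintegral_congr fun p => ?_
  simp only [MeasurableEquiv.prodComm, MeasurableEquiv.coe_mk, Equiv.prodComm_apply, Prod.fst_swap,
    Prod.snd_swap]
  rw [mul_comm ‖F p.2‖ₑ, show -p.2 - p.1 = -p.1 - p.2 by ring]

theorem triAbs_swap23 (F G H : ℝ → ℂ) : triAbs F G H = triAbs F H G := by
  unfold triAbs
  rw [← measurePreserving_reflectThird.lintegral_comp_emb reflectThird.measurableEmbedding]
  refine lintegral_congr fun p => ?_
  simp only [reflectThird, MeasurableEquiv.coe_mk, Equiv.coe_fn_mk]
  rw [mul_assoc, mul_comm ‖G _‖ₑ, ← mul_assoc, show -p.1 - (-p.1 - p.2) = p.2 by ring]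

theorem quadAbs_swap12 (F G H J : ℝ → ℂ) : quadAbs F G H J = quadAbs G F H J := by
  unfold quadAbs
  rw [← measurePreserving_swapFirst.lintegral_comp_emb swapFirst.measurableEmbedding]
  refine lintegral_congr fun p => ?_
  show ‖F p.1.2‖ₑ * ‖G p.1.1‖ₑ * ‖H p.2‖ₑ * ‖J (-p.1.2 - p.1.1 - p.2)‖ₑ = _
  rw [mul_comm ‖F p.1.2‖ₑ, show -p.1.2 - p.1.1 - p.2 = -p.1.1 - p.1.2 - p.2 by ring]

theorem quadAbs_swap23 (F G H J : ℝ → ℂ) : quadAbs F G H J = quadAbs F H G J := by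
  unfold quadAbs
  rw [← measurePreserving_swapLast.lintegral_comp_emb swapLast.measurableEmbedding]
  refine lintegral_congr fun p => ?_
  show ‖F p.1.1‖ₑ * ‖G p.2‖ₑ * ‖H p.1.2‖ₑ * ‖J (-p.1.1 - p.2 - p.1.2)‖ₑ = _
  rw [mul_assoc ‖F p.1.1‖ₑ, mul_comm ‖G p.2‖ₑ, ← mul_assoc,
    show -p.1.1 - p.2 - p.1.2 = -p.1.1 - p.1.2 - p.2 by ring]

theorem quadAbs_swap34 (F G H J : ℝ → ℂ) : quadAbs F G H J = quadAbs F G J H := by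
  unfold quadAbs
  rw [← measurePreserving_reflectFourth.lintegral_comp_emb reflectFourth.measurableEmbedding]
  refine lintegral_congr fun p => ?_
  show ‖F p.1.1‖ₑ * ‖G p.1.2‖ₑ * ‖H (-p.1.1 - p.1.2 - p.2)‖ₑ *
    ‖J (-p.1.1 - p.1.2 - (-p.1.1 - p.1.2 - p.2))‖ₑ = _
  rw [mul_assoc, mul_comm ‖H _‖ₑ, ← mul_assoc,
    show -p.1.1 - p.1.2 - (-p.1.1 - p.1.2 - p.2) = p.2 by ring]

theorem triAbs_le {F G H : ℝ → ℂ} (hF : Measurable F) (hG : Measurable G) (hH : Measurable H) :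
    triAbs F G H ≤ eLpNorm F 1 volume * eLpNorm G 2 volume * eLpNorm H 2 volume := by
  unfold triAbs
  rw [Measure.volume_eq_prod, lintegral_prod _ (by fun_prop)]
  calc ∫⁻ x, ∫⁻ y, ‖F x‖ₑ * ‖G y‖ₑ * ‖H (-x - y)‖ₑ
      = ∫⁻ x, ‖F x‖ₑ * ∫⁻ y, ‖G y‖ₑ * ‖H (-x - y)‖ₑ := by
        refine lintegral_congr fun x => ?_
        rw [← lintegral_const_mul _ (by fun_prop)]
        simp_rw [mul_assoc]
    _ ≤ ∫⁻ x, ‖F x‖ₑ * (eLpNorm G 2 volume * eLpNorm H 2 volume) := by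
        gcongr with x; exact lintegral_mul_reflect_le hG hH _
    _ = _ := by
        rw [lintegral_mul_const _ hF.enorm, eLpNorm_one_eq_lintegral_enorm, mul_assoc]

theorem quadAbs_le {F G H J : ℝ → ℂ} (hF : Measurable F) (hG : Measurable G) (hH : Measurable H)
    (hJ : Measurable J) : quadAbs F G H J ≤ eLpNorm F 1 volume * eLpNorm G 1 volume *
      eLpNorm H 2 volume * eLpNorm J 2 volume := by
  unfold quadAbs
  rw [Measure.volume_eq_prod, lintegral_prod _ (by fun_prop)]
  calc ∫⁻ x : ℝ × ℝ, ∫⁻ z, ‖F x.1‖ₑ * ‖G x.2‖ₑ * ‖H z‖ₑ * ‖J (-x.1 - x.2 - z)‖ₑ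
      = ∫⁻ x : ℝ × ℝ, (‖F x.1‖ₑ * ‖G x.2‖ₑ) * ∫⁻ z, ‖H z‖ₑ * ‖J (-x.1 - x.2 - z)‖ₑ := by
        refine lintegral_congr fun x => ?_
        rw [← lintegral_const_mul _ (by fun_prop)]
        simp_rw [mul_assoc]
    _ ≤ ∫⁻ x : ℝ × ℝ, (‖F x.1‖ₑ * ‖G x.2‖ₑ) * (eLpNorm H 2 volume * eLpNorm J 2 volume) := by
        gcongr with x; exact lintegral_mul_reflect_le hH hJ _
    _ = _ := by
        rw [lintegral_mul_const _ (by fun_prop), Measure.volume_eq_prod,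
          lintegral_prod_mul hF.enorm.aemeasurable hG.enorm.aemeasurable,
          eLpNorm_one_eq_lintegral_enorm, eLpNorm_one_eq_lintegral_enorm]
        ring

/-! ### Multilinear forms -/

/-- The trilinear form with symbol `q` over frequencies of zero sum. -/
noncomputable def tri (q : ℝ → ℝ → ℝ → ℝ) (F G H : ℝ → ℂ) : ℂ :=
  ∫ p : ℝ × ℝ, (q p.1 p.2 (-p.1 - p.2) : ℂ) * (F p.1 * G p.2 * H (-p.1 - p.2))

/-- Absolute convergence of the trilinear form `tri`. -/
def TriIntegrable (q : ℝ → ℝ → ℝ → ℝ) (F G H : ℝ → ℂ) : Prop :=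
  Integrable fun p : ℝ × ℝ => (q p.1 p.2 (-p.1 - p.2) : ℂ) * (F p.1 * G p.2 * H (-p.1 - p.2))

/-- The quadrilinear form with symbol `q` over frequencies of zero sum. -/
noncomputable def quad (q : ℝ → ℝ → ℝ → ℝ → ℝ) (F G H J : ℝ → ℂ) : ℂ :=
  ∫ p : (ℝ × ℝ) × ℝ, (q p.1.1 p.1.2 p.2 (-p.1.1 - p.1.2 - p.2) : ℂ) *
    (F p.1.1 * G p.1.2 * H p.2 * J (-p.1.1 - p.1.2 - p.2))

/-- Absolute convergence of the quadrilinear form `quad`. -/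
def QuadIntegrable (q : ℝ → ℝ → ℝ → ℝ → ℝ) (F G H J : ℝ → ℂ) : Prop :=
  Integrable fun p : (ℝ × ℝ) × ℝ => (q p.1.1 p.1.2 p.2 (-p.1.1 - p.1.2 - p.2) : ℂ) *
    (F p.1.1 * G p.1.2 * H p.2 * J (-p.1.1 - p.1.2 - p.2))

theorem tri_swap12 (q : ℝ → ℝ → ℝ → ℝ) (F G H : ℝ → ℂ) :
    tri q F G H = tri (fun x y z => q y x z) G F H := by
  unfold tri
  rw [← measurePreserving_prodComm.integral_comp MeasurableEquiv.prodComm.measurableEmbedding]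
  refine integral_congr_ae (Eventually.of_forall fun p => ?_)
  simp only [MeasurableEquiv.prodComm, MeasurableEquiv.coe_mk, Equiv.prodComm_apply, Prod.fst_swap,
    Prod.snd_swap]
  rw [mul_comm (F p.2), show -p.2 - p.1 = -p.1 - p.2 by ring]

theorem tri_swap23 (q : ℝ → ℝ → ℝ → ℝ) (F G H : ℝ → ℂ) :
    tri q F G H = tri (fun x y z => q x z y) F H G := by
  unfold tri
  rw [← measurePreserving_reflectThird.integral_comp reflectThird.measurableEmbedding]
  refine integral_congr_ae (Eventually.of_forall fun p => ?_)
  simp only [reflectThird, MeasurableEquiv.coe_mk, Equiv.coe_fn_mk]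
  rw [mul_assoc (F _), mul_comm (G _), ← mul_assoc (F _), show -p.1 - (-p.1 - p.2) = p.2 by ring]

theorem quad_swap12 (q : ℝ → ℝ → ℝ → ℝ → ℝ) (F G H J : ℝ → ℂ) :
    quad q F G H J = quad (fun x y z w => q y x z w) G F H J := by
  unfold quad
  rw [← measurePreserving_swapFirst.integral_comp swapFirst.measurableEmbedding]
  refine integral_congr_ae (Eventually.of_forall fun p => ?_)
  show (q p.1.2 p.1.1 p.2 (-p.1.2 - p.1.1 - p.2) : ℂ) *
    (F p.1.2 * G p.1.1 * H p.2 * J (-p.1.2 - p.1.1 - p.2)) = _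
  rw [mul_comm (F p.1.2), show -p.1.2 - p.1.1 - p.2 = -p.1.1 - p.1.2 - p.2 by ring]

theorem quad_swap23 (q : ℝ → ℝ → ℝ → ℝ → ℝ) (F G H J : ℝ → ℂ) :
    quad q F G H J = quad (fun x y z w => q x z y w) F H G J := by
  unfold quad
  rw [← measurePreserving_swapLast.integral_comp swapLast.measurableEmbedding]
  refine integral_congr_ae (Eventually.of_forall fun p => ?_)
  show (q p.1.1 p.2 p.1.2 (-p.1.1 - p.2 - p.1.2) : ℂ) *
    (F p.1.1 * G p.2 * H p.1.2 * J (-p.1.1 - p.2 - p.1.2)) = _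
  rw [mul_assoc (F p.1.1), mul_comm (G p.2), ← mul_assoc (F p.1.1),
    show -p.1.1 - p.2 - p.1.2 = -p.1.1 - p.1.2 - p.2 by ring]

theorem quad_swap34 (q : ℝ → ℝ → ℝ → ℝ → ℝ) (F G H J : ℝ → ℂ) :
    quad q F G H J = quad (fun x y z w => q x y w z) F G J H := by
  unfold quad
  rw [← measurePreserving_reflectFourth.integral_comp reflectFourth.measurableEmbedding]
  refine integral_congr_ae (Eventually.of_forall fun p => ?_)
  show (q p.1.1 p.1.2 (-p.1.1 - p.1.2 - p.2) (-p.1.1 - p.1.2 - (-p.1.1 - p.1.2 - p.2)) : ℂ) *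
    (F p.1.1 * G p.1.2 * H (-p.1.1 - p.1.2 - p.2) *
      J (-p.1.1 - p.1.2 - (-p.1.1 - p.1.2 - p.2))) = _
  rw [mul_assoc (F _ * G _), mul_comm (H _), ← mul_assoc (F _ * G _),
    show -p.1.1 - p.1.2 - (-p.1.1 - p.1.2 - p.2) = p.2 by ring]

theorem tri_congr {q q' : ℝ → ℝ → ℝ → ℝ} (h : ∀ x y z, x + y + z = 0 → q x y z = q' x y z)
    (F G H : ℝ → ℂ) : tri q F G H = tri q' F G H := by
  unfold tri
  refine integral_congr_ae (Eventually.of_forall fun p => ?_)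
  simp only
  rw [h _ _ _ (by ring)]

theorem quad_congr {q q' : ℝ → ℝ → ℝ → ℝ → ℝ}
    (h : ∀ x y z w, x + y + z + w = 0 → q x y z w = q' x y z w)
    (F G H J : ℝ → ℂ) : quad q F G H J = quad q' F G H J := by
  unfold quad
  refine integral_congr_ae (Eventually.of_forall fun p => ?_)
  simp only
  rw [h _ _ _ _ (by ring)]

theorem tri_add {q q' : ℝ → ℝ → ℝ → ℝ} {F G H : ℝ → ℂ} (h : TriIntegrable q F G H)
    (h' : TriIntegrable q' F G H) :
    tri (fun x y z => q x y z + q' x y z) F G H = tri q F G H + tri q' F G H := by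
  unfold tri
  rw [← integral_add h h']
  refine integral_congr_ae (Eventually.of_forall fun p => ?_)
  simp only [Complex.ofReal_add]
  ring

theorem tri_const_mul (c : ℝ) (q : ℝ → ℝ → ℝ → ℝ) (F G H : ℝ → ℂ) :
    tri (fun x y z => c * q x y z) F G H = c * tri q F G H := by
  unfold tri
  rw [← integral_const_mul]
  refine integral_congr_ae (Eventually.of_forall fun p => ?_)
  simp only [Complex.ofReal_mul]
  ring

theorem tri_add_right {q : ℝ → ℝ → ℝ → ℝ} {F G H H' : ℝ → ℂ} (h : TriIntegrable q F G H)
    (h' : TriIntegrable q F G H') :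
    tri q F G (fun x => H x + H' x) = tri q F G H + tri q F G H' := by
  unfold tri
  rw [← integral_add h h']
  refine integral_congr_ae (Eventually.of_forall fun p => ?_)
  simp only
  ring

theorem tri_const_mul_right (c : ℂ) (q : ℝ → ℝ → ℝ → ℝ) (F G H : ℝ → ℂ) :
    tri q F G (fun x => c * H x) = c * tri q F G H := by
  unfold tri
  rw [← integral_const_mul]
  refine integral_congr_ae (Eventually.of_forall fun p => ?_)
  simp only
  ring

theorem quad_add {q q' : ℝ → ℝ → ℝ → ℝ → ℝ} {F G H J : ℝ → ℂ} (h : QuadIntegrable q F G H J)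
    (h' : QuadIntegrable q' F G H J) :
    quad (fun x y z w => q x y z w + q' x y z w) F G H J = quad q F G H J + quad q' F G H J := by
  unfold quad
  rw [← integral_add h h']
  refine integral_congr_ae (Eventually.of_forall fun p => ?_)
  simp only [Complex.ofReal_add]
  ring

/-! ### Bounds for the multilinear forms -/

/-- The function `|x| ^ n F x`. -/
noncomputable def wt (n : ℕ) (F : ℝ → ℂ) (x : ℝ) : ℂ := ((|x| ^ n : ℝ) : ℂ) * F x

@[fun_prop]
theorem measurable_wt (n : ℕ) {F : ℝ → ℂ} (hF : Measurable F) : Measurable (wt n F) := by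
  unfold wt; fun_prop

theorem enorm_wt (n : ℕ) (F : ℝ → ℂ) (x : ℝ) :
    ‖wt n F x‖ₑ = ENNReal.ofReal (|x| ^ n) * ‖F x‖ₑ := by
  rw [wt, enorm_mul, ← ofReal_norm, Complex.norm_real, Real.norm_of_nonneg (by positivity)]

theorem wt_zero (F : ℝ → ℂ) : wt 0 F = F := by ext x; simp [wt]

theorem enorm_tri_le_lintegral (q : ℝ → ℝ → ℝ → ℝ) (F G H : ℝ → ℂ) :
    ‖tri q F G H‖ₑ ≤ ∫⁻ p : ℝ × ℝ, ENNReal.ofReal |q p.1 p.2 (-p.1 - p.2)| *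
      (‖F p.1‖ₑ * ‖G p.2‖ₑ * ‖H (-p.1 - p.2)‖ₑ) := by
  refine (enorm_integral_le_lintegral_enorm _).trans (le_of_eq (lintegral_congr fun p => ?_))
  rw [enorm_mul, enorm_mul, enorm_mul, ← ofReal_norm (_ : ℂ), Complex.norm_real, Real.norm_eq_abs]

theorem enorm_quad_le_lintegral (q : ℝ → ℝ → ℝ → ℝ → ℝ) (F G H J : ℝ → ℂ) :
    ‖quad q F G H J‖ₑ ≤ ∫⁻ p : (ℝ × ℝ) × ℝ,
      ENNReal.ofReal |q p.1.1 p.1.2 p.2 (-p.1.1 - p.1.2 - p.2)| *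
      (‖F p.1.1‖ₑ * ‖G p.1.2‖ₑ * ‖H p.2‖ₑ * ‖J (-p.1.1 - p.1.2 - p.2)‖ₑ) := by
  refine (enorm_integral_le_lintegral_enorm _).trans (le_of_eq (lintegral_congr fun p => ?_))
  rw [enorm_mul, enorm_mul, enorm_mul, enorm_mul, ← ofReal_norm (_ : ℂ), Complex.norm_real,
    Real.norm_eq_abs]

/-- The `L¹` norm of `|x| F`. -/
noncomputable def An (F : ℝ → ℂ) : ℝ≥0∞ := eLpNorm (wt 1 F) 1 volume

/-- The `L²` norm of `|x| ^ n F`. -/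
noncomputable def Yn (n : ℕ) (F : ℝ → ℂ) : ℝ≥0∞ := eLpNorm (wt n F) 2 volume

theorem lintegral_cubicWeight_le {n : ℕ} {F G H : ℝ → ℂ} (hF : Measurable F) (hG : Measurable G)
    (hH : Measurable H) :
    ∫⁻ p : ℝ × ℝ, ENNReal.ofReal (cubicWeight n p.1 p.2 (-p.1 - p.2)) *
      (‖F p.1‖ₑ * ‖G p.2‖ₑ * ‖H (-p.1 - p.2)‖ₑ) ≤
      An F * Yn n G * Yn n H + Yn n F * An G * Yn n H + Yn n F * Yn n G * An H := by
  calc _ = ∫⁻ p : ℝ × ℝ, (‖wt 1 F p.1‖ₑ * ‖wt n G p.2‖ₑ * ‖wt n H (-p.1 - p.2)‖ₑ +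
        ‖wt n F p.1‖ₑ * ‖wt 1 G p.2‖ₑ * ‖wt n H (-p.1 - p.2)‖ₑ) +
        ‖wt n F p.1‖ₑ * ‖wt n G p.2‖ₑ * ‖wt 1 H (-p.1 - p.2)‖ₑ := by
        refine lintegral_congr fun p => ?_
        simp only [enorm_wt, cubicWeight, pow_one]
        rw [ENNReal.ofReal_add (by positivity) (by positivity),
          ENNReal.ofReal_add (by positivity) (by positivity)]
        rw [ENNReal.ofReal_mul (by positivity), ENNReal.ofReal_mul (by positivity),
          ENNReal.ofReal_mul (by positivity), ENNReal.ofReal_mul (by positivity),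
          ENNReal.ofReal_mul (by positivity), ENNReal.ofReal_mul (by positivity)]
        ring
    _ = triAbs (wt 1 F) (wt n G) (wt n H) + triAbs (wt n F) (wt 1 G) (wt n H) +
        triAbs (wt n F) (wt n G) (wt 1 H) := by
        rw [lintegral_add_left (by fun_prop), lintegral_add_left (by fun_prop)]; rfl
    _ ≤ _ := by
        gcongr
        · exact triAbs_le (by fun_prop) (by fun_prop) (by fun_prop)
        · rw [triAbs_swap12]
          refine (triAbs_le (by fun_prop) (by fun_prop) (by fun_prop)).trans (le_of_eq ?_)
          unfold An Yn; ring
        · rw [triAbs_swap23, triAbs_swap12]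
          refine (triAbs_le (by fun_prop) (by fun_prop) (by fun_prop)).trans (le_of_eq ?_)
          unfold An Yn; ring

theorem lintegral_quarticWeight_le {n : ℕ} {F : ℝ → ℂ} (hF : Measurable F) :
    ∫⁻ p : (ℝ × ℝ) × ℝ, ENNReal.ofReal (quarticWeight n p.1.1 p.1.2 p.2 (-p.1.1 - p.1.2 - p.2)) *
      (‖F p.1.1‖ₑ * ‖F p.1.2‖ₑ * ‖F p.2‖ₑ * ‖F (-p.1.1 - p.1.2 - p.2)‖ₑ) ≤
      6 * (An F ^ 2 * Yn n F ^ 2) := by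
  have base := quadAbs_le (measurable_wt 1 hF) (measurable_wt 1 hF) (measurable_wt n hF)
    (measurable_wt n hF)
  calc _ = ∫⁻ p : (ℝ × ℝ) × ℝ,
        (((((‖wt n F p.1.1‖ₑ * ‖wt n F p.1.2‖ₑ * ‖wt 1 F p.2‖ₑ * ‖wt 1 F (-p.1.1 - p.1.2 - p.2)‖ₑ +
        ‖wt n F p.1.1‖ₑ * ‖wt 1 F p.1.2‖ₑ * ‖wt n F p.2‖ₑ * ‖wt 1 F (-p.1.1 - p.1.2 - p.2)‖ₑ) +
        ‖wt n F p.1.1‖ₑ * ‖wt 1 F p.1.2‖ₑ * ‖wt 1 F p.2‖ₑ * ‖wt n F (-p.1.1 - p.1.2 - p.2)‖ₑ) +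
        ‖wt 1 F p.1.1‖ₑ * ‖wt n F p.1.2‖ₑ * ‖wt n F p.2‖ₑ * ‖wt 1 F (-p.1.1 - p.1.2 - p.2)‖ₑ) +
        ‖wt 1 F p.1.1‖ₑ * ‖wt n F p.1.2‖ₑ * ‖wt 1 F p.2‖ₑ * ‖wt n F (-p.1.1 - p.1.2 - p.2)‖ₑ) +
        ‖wt 1 F p.1.1‖ₑ * ‖wt 1 F p.1.2‖ₑ * ‖wt n F p.2‖ₑ * ‖wt n F (-p.1.1 - p.1.2 - p.2)‖ₑ) := by
        refine lintegral_congr fun p => ?_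
        simp only [enorm_wt, quarticWeight, pow_one]
        generalize -p.1.1 - p.1.2 - p.2 = w
        rw [ENNReal.ofReal_add (by positivity) (by positivity),
          ENNReal.ofReal_add (by positivity) (by positivity),
          ENNReal.ofReal_add (by positivity) (by positivity),
          ENNReal.ofReal_add (by positivity) (by positivity),
          ENNReal.ofReal_add (by positivity) (by positivity)]
        have e : ∀ a b c d : ℝ, 0 ≤ a → 0 ≤ b → 0 ≤ c → ENNReal.ofReal (a * b * c * d) =
            ENNReal.ofReal a * ENNReal.ofReal b * ENNReal.ofReal c * ENNReal.ofReal d := by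
          intro a b c d ha hb hc
          rw [ENNReal.ofReal_mul (by positivity), ENNReal.ofReal_mul (by positivity),
            ENNReal.ofReal_mul (by positivity)]
        rw [e _ _ _ _ (by positivity) (by positivity) (by positivity),
          e _ _ _ _ (by positivity) (by positivity) (by positivity),
          e _ _ _ _ (by positivity) (by positivity) (by positivity),
          e _ _ _ _ (by positivity) (by positivity) (by positivity),
          e _ _ _ _ (by positivity) (by positivity) (by positivity),
          e _ _ _ _ (by positivity) (by positivity) (by positivity)]
        ring
    _ = quadAbs (wt n F) (wt n F) (wt 1 F) (wt 1 F) + quadAbs (wt n F) (wt 1 F) (wt n F) (wt 1 F) +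
        quadAbs (wt n F) (wt 1 F) (wt 1 F) (wt n F) + quadAbs (wt 1 F) (wt n F) (wt n F) (wt 1 F) +
        quadAbs (wt 1 F) (wt n F) (wt 1 F) (wt n F) +
        quadAbs (wt 1 F) (wt 1 F) (wt n F) (wt n F) := by
        rw [lintegral_add_left (by fun_prop), lintegral_add_left (by fun_prop),
          lintegral_add_left (by fun_prop), lintegral_add_left (by fun_prop),
          lintegral_add_left (by fun_prop)]; rfl
    _ = 6 * quadAbs (wt 1 F) (wt 1 F) (wt n F) (wt n F) := by
        have e5 : quadAbs (wt 1 F) (wt n F) (wt 1 F) (wt n F) =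
          quadAbs (wt 1 F) (wt 1 F) (wt n F) (wt n F) := quadAbs_swap23 _ _ _ _
        have e4 : quadAbs (wt 1 F) (wt n F) (wt n F) (wt 1 F) =
          quadAbs (wt 1 F) (wt 1 F) (wt n F) (wt n F) := by rw [quadAbs_swap34, e5]
        have e3 : quadAbs (wt n F) (wt 1 F) (wt 1 F) (wt n F) =
          quadAbs (wt 1 F) (wt 1 F) (wt n F) (wt n F) := by rw [quadAbs_swap12, e5]
        have e2 : quadAbs (wt n F) (wt 1 F) (wt n F) (wt 1 F) =
          quadAbs (wt 1 F) (wt 1 F) (wt n F) (wt n F) := by rw [quadAbs_swap34, e3]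
        have e1 : quadAbs (wt n F) (wt n F) (wt 1 F) (wt 1 F) =
          quadAbs (wt 1 F) (wt 1 F) (wt n F) (wt n F) := by rw [quadAbs_swap23, e2]
        rw [e1, e2, e3, e4, e5]; ring
    _ ≤ _ := by
        gcongr
        refine base.trans (le_of_eq ?_)
        unfold An Yn; ring

theorem lintegral_firstTwo_le {F G : ℝ → ℂ} (hF : Measurable F) (hG : Measurable G) :
    ∫⁻ p : (ℝ × ℝ) × ℝ, ENNReal.ofReal (|p.1.1| * |p.1.2|) *
      (‖F p.1.1‖ₑ * ‖F p.1.2‖ₑ * ‖G p.2‖ₑ * ‖G (-p.1.1 - p.1.2 - p.2)‖ₑ) ≤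
      An F ^ 2 * Yn 0 G ^ 2 := by
  have base := quadAbs_le (measurable_wt 1 hF) (measurable_wt 1 hF) (measurable_wt 0 hG)
    (measurable_wt 0 hG)
  calc _ = quadAbs (wt 1 F) (wt 1 F) (wt 0 G) (wt 0 G) := by
        refine lintegral_congr fun p => ?_
        simp only [enorm_wt, pow_one, pow_zero, ENNReal.ofReal_one, one_mul]
        rw [ENNReal.ofReal_mul (by positivity)]
        ring
    _ ≤ _ := base
    _ = _ := by unfold An Yn; ring

theorem measurable_coe (f : L2C) : Measurable f := (Lp.stronglyMeasurable f).measurable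

/-! ### Multiplication operators -/

/-- A bounded measurable symbol. -/
def IsMult (p : ℝ → ℂ) : Prop := Measurable p ∧ ∃ C : ℝ, ∀ x, ‖p x‖ ≤ C

theorem IsMult.memLp {p : ℝ → ℂ} (hp : IsMult p) (f : L2C) :
    MemLp (fun x => p x * f x) 2 (volume : Measure ℝ) := by
  obtain ⟨hm, C, hC⟩ := hp
  refine (Lp.memLp f).of_le_mul (c := C) (hm.mul (measurable_coe f)).aestronglyMeasurable
    (Eventually.of_forall fun x => ?_)
  rw [norm_mul]
  exact mul_le_mul_of_nonneg_right (hC x) (norm_nonneg _)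

/-- Multiplication by a bounded measurable symbol, as an operator on `L²`. -/
noncomputable def mulOp (p : ℝ → ℂ) (hp : IsMult p) : L2C →L[ℝ] L2C :=
  LinearMap.mkContinuous
    { toFun := fun f => (hp.memLp f).toLp _
      map_add' := fun f g => by
        rw [← MemLp.toLp_add]
        refine (MemLp.toLp_eq_toLp_iff _ _).2 ?_
        filter_upwards [Lp.coeFn_add f g] with x hx
        simp only [hx, Pi.add_apply, mul_add]
      map_smul' := fun c f => by
        rw [RingHom.id_apply, ← MemLp.toLp_const_smul]
        refine (MemLp.toLp_eq_toLp_iff _ _).2 ?_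
        filter_upwards [Lp.coeFn_smul c f] with x hx
        simp only [hx, Pi.smul_apply, Complex.real_smul]
        ring }
    hp.2.choose (fun f => by
      refine Lp.norm_le_mul_norm_of_ae_le_mul ?_
      filter_upwards [(hp.memLp f).coeFn_toLp] with x hx
      simp only [LinearMap.coe_mk, AddHom.coe_mk]
      rw [hx, norm_mul]
      exact mul_le_mul_of_nonneg_right (hp.2.choose_spec x) (norm_nonneg _))

theorem mulOp_coe (p : ℝ → ℂ) (hp : IsMult p) (f : L2C) :
    mulOp p hp f =ᵐ[volume] fun x => p x * f x := (hp.memLp f).coeFn_toLp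

/-! ### Convolution -/

/-- The convolution of two functions. -/
noncomputable def conv (F G : ℝ → ℂ) (ξ : ℝ) : ℂ := ∫ η, F η * G (ξ - η)

theorem measurable_conv {F G : ℝ → ℂ} (hF : Measurable F) (hG : Measurable G) :
    Measurable (conv F G) := by
  have h : StronglyMeasurable (Function.uncurry fun ξ η : ℝ => F η * G (ξ - η)) := by
    apply Measurable.stronglyMeasurable
    show Measurable fun p : ℝ × ℝ => F p.2 * G (p.1 - p.2)
    fun_prop
  exact (StronglyMeasurable.integral_prod_right h).measurable

theorem conv_congr {F F' G G' : ℝ → ℂ} (hF : F =ᵐ[volume] F') (hG : G =ᵐ[volume] G') :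
    conv F G = conv F' G' := by
  ext ξ
  refine integral_congr_ae ?_
  filter_upwards [hF, (quasiMeasurePreserving_sub_left volume ξ).ae_eq_comp hG] with η h1 h2
  simp only [Function.comp_apply] at h2
  rw [h1, h2]

theorem enorm_conv_le {F G : ℝ → ℂ} (hF : Measurable F) (hG : Measurable G) (ξ : ℝ) :
    ‖conv F G ξ‖ₑ ≤ eLpNorm F 2 volume * eLpNorm G 2 volume := by
  refine (enorm_integral_le_lintegral_enorm _).trans ?_
  simp_rw [enorm_mul]
  exact lintegral_mul_reflect_le hF hG ξ

theorem integrable_conv_integrand {F G : ℝ → ℂ} (hF : MemLp F 2 volume) (hG : MemLp G 2 volume)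
    (ξ : ℝ) : Integrable fun η => F η * G (ξ - η) := by
  have h : MemLp (fun η => G (ξ - η)) 2 volume :=
    hG.comp_measurePreserving (Measure.measurePreserving_sub_left volume ξ)
  exact hF.integrable_mul h

theorem conv_comm (F G : ℝ → ℂ) : conv F G = conv G F := by
  ext ξ
  unfold conv
  rw [← integral_sub_left_eq_self _ _ ξ]
  refine integral_congr_ae (Eventually.of_forall fun η => ?_)
  simp only [sub_sub_cancel]
  ring

theorem conv_add_left {F F' G : ℝ → ℂ} (hF : MemLp F 2 volume) (hF' : MemLp F' 2 volume)
    (hG : MemLp G 2 volume) (ξ : ℝ) :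
    conv (fun x => F x + F' x) G ξ = conv F G ξ + conv F' G ξ := by
  unfold conv
  rw [← integral_add (integrable_conv_integrand hF hG ξ) (integrable_conv_integrand hF' hG ξ)]
  simp_rw [add_mul]

theorem conv_const_mul_left (c : ℂ) (F G : ℝ → ℂ) (ξ : ℝ) :
    conv (fun x => c * F x) G ξ = c * conv F G ξ := by
  unfold conv
  rw [← integral_const_mul]
  simp_rw [mul_assoc]

theorem conv_add_right {F G G' : ℝ → ℂ} (hF : MemLp F 2 volume) (hG : MemLp G 2 volume)
    (hG' : MemLp G' 2 volume) (ξ : ℝ) :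
    conv F (fun x => G x + G' x) ξ = conv F G ξ + conv F G' ξ := by
  rw [conv_comm, conv_add_left hG hG' hF, conv_comm G, conv_comm G']

theorem conv_const_mul_right (c : ℂ) (F G : ℝ → ℂ) (ξ : ℝ) :
    conv F (fun x => c * G x) ξ = c * conv F G ξ := by
  rw [conv_comm, conv_const_mul_left, conv_comm G]

/-- The restriction of a function to the frequency band `[-R, R]`. -/
noncomputable def cut (R : ℝ) (F : ℝ → ℂ) : ℝ → ℂ := (Icc (-R) R).indicator F

theorem measurable_cut (R : ℝ) {F : ℝ → ℂ} (hF : Measurable F) : Measurable (cut R F) :=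
  hF.indicator measurableSet_Icc

theorem cut_of_le {R x : ℝ} (h : |x| ≤ R) (F : ℝ → ℂ) : cut R F x = F x :=
  indicator_of_mem (s := Icc (-R) R) (abs_le.1 h) F

theorem cut_of_lt {R x : ℝ} (h : R < |x|) (F : ℝ → ℂ) : cut R F x = 0 :=
  indicator_of_notMem (s := Icc (-R) R) (fun hx => not_le.2 h (abs_le.2 hx)) F

theorem eLpNorm_cut_conv_le (R : ℝ) (f g : L2C) :
    eLpNorm (cut R (conv f g)) 2 volume ≤
      ENNReal.ofReal (volume.real (Icc (-R) R) ^ (2 : ℝ)⁻¹ * ‖f‖ * ‖g‖) := by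
  unfold cut
  rw [eLpNorm_indicator_eq_eLpNorm_restrict measurableSet_Icc]
  refine (eLpNorm_le_of_ae_bound (C := ‖f‖ * ‖g‖) (Eventually.of_forall fun ξ => ?_)).trans ?_
  · have h := enorm_conv_le (measurable_coe f) (measurable_coe g) ξ
    rw [← Lp.enorm_def, ← Lp.enorm_def, ← ofReal_norm, ← ofReal_norm f, ← ofReal_norm g,
      ← ENNReal.ofReal_mul (norm_nonneg _)] at h
    exact (ENNReal.ofReal_le_ofReal_iff (by positivity)).1 h
  · rw [Measure.restrict_apply_univ, mul_assoc,
      ENNReal.ofReal_mul (Real.rpow_nonneg measureReal_nonneg _), ENNReal.ofReal_mul (norm_nonneg f),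
      ← ENNReal.ofReal_rpow_of_nonneg measureReal_nonneg (by norm_num), Measure.real,
      ENNReal.ofReal_toReal (by simp), ENNReal.toReal_ofNat]

theorem memLp_cut_conv (R : ℝ) (f g : L2C) : MemLp (cut R (conv f g)) 2 volume :=
  ⟨(measurable_cut R (measurable_conv (measurable_coe f) (measurable_coe g))).aestronglyMeasurable,
    (eLpNorm_cut_conv_le R f g).trans_lt ENNReal.ofReal_lt_top⟩

/-- The convolution of two `L²` functions, cut off to the frequency band `[-R, R]`. -/
noncomputable def cutConv (R : ℝ) : L2C →L[ℝ] L2C →L[ℝ] L2C :=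
  LinearMap.mkContinuous₂
    (LinearMap.mk₂ ℝ (fun f g => (memLp_cut_conv R f g).toLp _)
      (fun f f' g => by
        rw [← MemLp.toLp_add]
        refine (MemLp.toLp_eq_toLp_iff _ _).2 (Eventually.of_forall fun ξ => ?_)
        have : conv (f + f' : L2C) g ξ = conv f g ξ + conv f' g ξ := by
          rw [← conv_add_left (Lp.memLp f) (Lp.memLp f') (Lp.memLp g),
            conv_congr (Lp.coeFn_add f f') EventuallyEq.rfl]
          rfl
        simp only [cut, Pi.add_apply, indicator, this]
        split_ifs <;> simp)
      (fun c f g => by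
        rw [← MemLp.toLp_const_smul]
        refine (MemLp.toLp_eq_toLp_iff _ _).2 (Eventually.of_forall fun ξ => ?_)
        have : conv (c • f : L2C) g ξ = c * conv f g ξ := by
          rw [← conv_const_mul_left, conv_congr (Lp.coeFn_smul c f) EventuallyEq.rfl]
          rfl
        simp only [cut, Pi.smul_apply, indicator, this]
        split_ifs <;> simp)
      (fun f g g' => by
        rw [← MemLp.toLp_add]
        refine (MemLp.toLp_eq_toLp_iff _ _).2 (Eventually.of_forall fun ξ => ?_)
        have : conv f (g + g' : L2C) ξ = conv f g ξ + conv f g' ξ := by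
          rw [← conv_add_right (Lp.memLp f) (Lp.memLp g) (Lp.memLp g'),
            conv_congr EventuallyEq.rfl (Lp.coeFn_add g g')]
          rfl
        simp only [cut, Pi.add_apply, indicator, this]
        split_ifs <;> simp)
      (fun c f g => by
        rw [← MemLp.toLp_const_smul]
        refine (MemLp.toLp_eq_toLp_iff _ _).2 (Eventually.of_forall fun ξ => ?_)
        have : conv f (c • g : L2C) ξ = c * conv f g ξ := by
          rw [← conv_const_mul_right, conv_congr EventuallyEq.rfl (Lp.coeFn_smul c g)]
          rfl
        simp only [cut, Pi.smul_apply, indicator, this]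
        split_ifs <;> simp))
    (volume.real (Icc (-R) R) ^ (2 : ℝ)⁻¹) (fun f g => by
      simp only [LinearMap.mk₂_apply]
      rw [Lp.norm_toLp]
      exact ENNReal.toReal_le_of_le_ofReal (by positivity) (eLpNorm_cut_conv_le R f g))

theorem cutConv_coe (R : ℝ) (f g : L2C) : cutConv R f g =ᵐ[volume] cut R (conv f g) :=
  (memLp_cut_conv R f g).coeFn_toLp

/-! ### Band limited and Hermitian functions -/

/-- `f` vanishes outside of the frequency band `[-R, R]`. -/
def Band (R : ℝ) (F : ℝ → ℂ) : Prop := ∀ᵐ x, R < |x| → F x = 0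

/-- `f (-x)` is the complex conjugate of `f x`. -/
def Herm (F : ℝ → ℂ) : Prop := ∀ᵐ x, F (-x) = starRingEnd ℂ (F x)

theorem Band.mono {R R' : ℝ} {F : ℝ → ℂ} (h : Band R F) (hR : R ≤ R') : Band R' F :=
  Eventually.mono h fun _ hx hx' => hx (hR.trans_lt hx')

theorem Band.mul_left {R : ℝ} {F : ℝ → ℂ} (h : Band R F) (p : ℝ → ℂ) :
    Band R (fun x => p x * F x) :=
  Eventually.mono h fun x hx hx' => by simp only [hx hx', mul_zero]

theorem Band.wt {R : ℝ} {F : ℝ → ℂ} (h : Band R F) (n : ℕ) : Band R (wt n F) := h.mul_left _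

theorem Band.congr {R : ℝ} {F G : ℝ → ℂ} (h : Band R F) (hFG : F =ᵐ[volume] G) : Band R G := by
  filter_upwards [h, hFG] with x h1 h2 h3
  rw [← h2, h1 h3]

theorem band_cut (R : ℝ) (F : ℝ → ℂ) : Band R (cut R F) :=
  Eventually.of_forall fun _ hx => cut_of_lt hx F

theorem Band.cut_eq {R : ℝ} {F : ℝ → ℂ} (h : Band R F) : cut R F =ᵐ[volume] F := by
  filter_upwards [h] with x hx
  rcases le_or_gt |x| R with h' | h'
  · exact cut_of_le h' F
  · rw [cut_of_lt h', hx h']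

theorem Band.conv {N : ℝ} {F G : ℝ → ℂ} (hF : Band N F) (hG : Band N G) {ξ : ℝ} (hξ : 2 * N < |ξ|) :
    conv F G ξ = 0 := by
  unfold BurgersHilbert.conv
  rw [← integral_zero ℝ ℂ]
  refine integral_congr_ae ?_
  filter_upwards [hF, (quasiMeasurePreserving_sub_left volume ξ).ae hG] with η h1 h2
  by_cases h : N < |η|
  · rw [h1 h, zero_mul]
  · have : N < |ξ - η| := by
      have := abs_sub_abs_le_abs_sub ξ η
      push Not at h
      linarith
    rw [h2 this, mul_zero]

theorem Band.eLpNorm_one_le {R : ℝ} {F : ℝ → ℂ} (h : Band R F) (hF : Measurable F) :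
    eLpNorm F 1 volume ≤ eLpNorm F 2 volume * volume (Icc (-R) R) ^ (1 / (2 : ℝ)) := by
  have e1 := eLpNorm_congr_ae (p := 1) h.cut_eq
  have e2 := eLpNorm_congr_ae (p := 2) h.cut_eq
  unfold cut at e1 e2
  rw [eLpNorm_indicator_eq_eLpNorm_restrict measurableSet_Icc] at e1 e2
  rw [← e1, ← e2]
  refine (eLpNorm_le_eLpNorm_mul_rpow_measure_univ (by norm_num : (1 : ℝ≥0∞) ≤ 2)
    hF.aestronglyMeasurable).trans (le_of_eq ?_)
  rw [Measure.restrict_apply_univ]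
  norm_num

theorem Band.eLpNorm_wt_lt_top {R : ℝ} {F : ℝ → ℂ} (h : Band R F) (hF : MemLp F 2 volume) (n : ℕ) :
    eLpNorm (BurgersHilbert.wt n F) 2 volume < ⊤ := by
  refine (MemLp.of_le_mul (c := |R| ^ n) hF ?_ ?_).2
  · have : AEStronglyMeasurable (fun x : ℝ => ((|x| ^ n : ℝ) : ℂ)) volume := by
      apply Continuous.aestronglyMeasurable; fun_prop
    exact this.mul hF.1
  · filter_upwards [h] with x hx
    rcases le_or_gt |x| R with h' | h'
    · rw [BurgersHilbert.wt, norm_mul, Complex.norm_real, Real.norm_of_nonneg (by positivity)]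
      exact mul_le_mul_of_nonneg_right
        (pow_le_pow_left₀ (abs_nonneg x) (h'.trans (le_abs_self R)) n) (norm_nonneg _)
    · rw [BurgersHilbert.wt, hx h']; simp

theorem Band.Yn_lt_top {R : ℝ} {F : ℝ → ℂ} (h : Band R F) (hF : MemLp F 2 volume) (n : ℕ) :
    Yn n F < ⊤ := h.eLpNorm_wt_lt_top hF n

theorem Band.An_lt_top {R : ℝ} {F : ℝ → ℂ} (h : Band R F) (hF : MemLp F 2 volume)
    (hFm : Measurable F) : An F < ⊤ := by
  refine ((h.wt 1).eLpNorm_one_le (measurable_wt 1 hFm)).trans_lt ?_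
  exact ENNReal.mul_lt_top (h.eLpNorm_wt_lt_top hF 1)
    (ENNReal.rpow_lt_top_of_nonneg (by norm_num) (by simp))

/-- A symbol for a trilinear form that is measurable and locally bounded. -/
def Sym3 (q : ℝ → ℝ → ℝ → ℝ) : Prop :=
  Measurable (fun p : ℝ × ℝ × ℝ => q p.1 p.2.1 p.2.2) ∧
    ∀ R : ℝ, ∃ C : ℝ, 0 ≤ C ∧ ∀ x y z, |x| ≤ R → |y| ≤ R → |z| ≤ R → |q x y z| ≤ C

/-- A symbol for a quadrilinear form that is measurable and locally bounded. -/
def Sym4 (q : ℝ → ℝ → ℝ → ℝ → ℝ) : Prop :=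
  Measurable (fun p : ℝ × ℝ × ℝ × ℝ => q p.1 p.2.1 p.2.2.1 p.2.2.2) ∧
    ∀ R : ℝ, ∃ C : ℝ, 0 ≤ C ∧ ∀ x y z w, |x| ≤ R → |y| ≤ R → |z| ≤ R → |w| ≤ R → |q x y z w| ≤ C

/-- A measurable and locally bounded function of one variable. -/
def Sym1 (p : ℝ → ℝ) : Prop :=
  Measurable p ∧ ∀ R : ℝ, ∃ C : ℝ, 0 ≤ C ∧ ∀ x, |x| ≤ R → |p x| ≤ C

theorem sym1_sg : Sym1 sg :=
  ⟨measurable_sg, fun _ => ⟨1, zero_le_one, fun x _ => (abs_sg x).le⟩⟩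

theorem Continuous.sym1 {p : ℝ → ℝ} (h : Continuous p) : Sym1 p := by
  refine ⟨h.measurable, fun R => ?_⟩
  obtain ⟨C, hC⟩ := (isCompact_Icc (a := -R) (b := R)).exists_bound_of_continuousOn h.continuousOn
  exact ⟨|C|, abs_nonneg C, fun x hx => (hC x (abs_le.1 hx)).trans (le_abs_self C)⟩

theorem Sym3.mul {p q : ℝ → ℝ → ℝ → ℝ} (hp : Sym3 p) (hq : Sym3 q) :
    Sym3 (fun x y z => p x y z * q x y z) := by
  refine ⟨hp.1.mul hq.1, fun R => ?_⟩
  obtain ⟨C, hC, h⟩ := hp.2 R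
  obtain ⟨D, hD, h'⟩ := hq.2 R
  refine ⟨C * D, by positivity, fun x y z hx hy hz => ?_⟩
  rw [abs_mul]
  exact mul_le_mul (h x y z hx hy hz) (h' x y z hx hy hz) (abs_nonneg _) hC

theorem Sym3.add {p q : ℝ → ℝ → ℝ → ℝ} (hp : Sym3 p) (hq : Sym3 q) :
    Sym3 (fun x y z => p x y z + q x y z) := by
  refine ⟨hp.1.add hq.1, fun R => ?_⟩
  obtain ⟨C, hC, h⟩ := hp.2 R
  obtain ⟨D, hD, h'⟩ := hq.2 R
  refine ⟨C + D, by positivity, fun x y z hx hy hz => ?_⟩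
  exact (abs_add_le _ _).trans (add_le_add (h x y z hx hy hz) (h' x y z hx hy hz))

theorem Sym1.sym3_fst {p : ℝ → ℝ} (hp : Sym1 p) : Sym3 (fun x _ _ => p x) := by
  refine ⟨hp.1.comp measurable_fst, fun R => ?_⟩
  obtain ⟨C, hC, h⟩ := hp.2 R
  exact ⟨C, hC, fun x y z hx _ _ => h x hx⟩

theorem Sym1.sym3_snd {p : ℝ → ℝ} (hp : Sym1 p) : Sym3 (fun _ y _ => p y) := by
  refine ⟨hp.1.comp (measurable_fst.comp measurable_snd), fun R => ?_⟩
  obtain ⟨C, hC, h⟩ := hp.2 R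
  exact ⟨C, hC, fun x y z _ hy _ => h y hy⟩

theorem Sym1.sym3_thd {p : ℝ → ℝ} (hp : Sym1 p) : Sym3 (fun _ _ z => p z) := by
  refine ⟨hp.1.comp (measurable_snd.comp measurable_snd), fun R => ?_⟩
  obtain ⟨C, hC, h⟩ := hp.2 R
  exact ⟨C, hC, fun x y z _ _ hz => h z hz⟩

theorem Sym4.swap12 {q : ℝ → ℝ → ℝ → ℝ → ℝ} (h : Sym4 q) : Sym4 (fun x y z w => q y x z w) := by
  refine ⟨h.1.comp (g := fun p : ℝ × ℝ × ℝ × ℝ => q p.1 p.2.1 p.2.2.1 p.2.2.2)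
    (f := fun p : ℝ × ℝ × ℝ × ℝ => (p.2.1, p.1, p.2.2.1, p.2.2.2)) (by fun_prop), fun R => ?_⟩
  obtain ⟨C, hC, h⟩ := h.2 R
  exact ⟨C, hC, fun x y z w hx hy hz hw => h y x z w hy hx hz hw⟩

theorem Sym4.swap23 {q : ℝ → ℝ → ℝ → ℝ → ℝ} (h : Sym4 q) : Sym4 (fun x y z w => q x z y w) := by
  refine ⟨h.1.comp (g := fun p : ℝ × ℝ × ℝ × ℝ => q p.1 p.2.1 p.2.2.1 p.2.2.2)
    (f := fun p : ℝ × ℝ × ℝ × ℝ => (p.1, p.2.2.1, p.2.1, p.2.2.2)) (by fun_prop), fun R => ?_⟩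
  obtain ⟨C, hC, h⟩ := h.2 R
  exact ⟨C, hC, fun x y z w hx hy hz hw => h x z y w hx hz hy hw⟩

theorem Sym4.swap34 {q : ℝ → ℝ → ℝ → ℝ → ℝ} (h : Sym4 q) : Sym4 (fun x y z w => q x y w z) := by
  refine ⟨h.1.comp (g := fun p : ℝ × ℝ × ℝ × ℝ => q p.1 p.2.1 p.2.2.1 p.2.2.2)
    (f := fun p : ℝ × ℝ × ℝ × ℝ => (p.1, p.2.1, p.2.2.2, p.2.2.1)) (by fun_prop), fun R => ?_⟩
  obtain ⟨C, hC, h⟩ := h.2 R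
  exact ⟨C, hC, fun x y z w hx hy hz hw => h x y w z hx hy hw hz⟩

theorem Sym3.sym4 {q : ℝ → ℝ → ℝ → ℝ} (h : Sym3 q) : Sym4 (fun x y z w => q x y (z + w)) := by
  refine ⟨h.1.comp (g := fun p : ℝ × ℝ × ℝ => q p.1 p.2.1 p.2.2)
    (f := fun p : ℝ × ℝ × ℝ × ℝ => (p.1, p.2.1, p.2.2.1 + p.2.2.2)) (by fun_prop), fun R => ?_⟩
  obtain ⟨C, hC, h⟩ := h.2 (2 * |R|)
  have hR := le_abs_self R
  have hR' := abs_nonneg R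
  exact ⟨C, hC, fun x y z w hx hy hz hw => h x y (z + w) (by linarith) (by linarith)
    ((abs_add_le _ _).trans (by linarith))⟩

/-- Absolutely convergent data for the multilinear forms: measurable, square integrable and
band limited functions. -/
structure BL (R : ℝ) (F : ℝ → ℂ) : Prop where
  meas : Measurable F
  memLp : MemLp F 2 volume
  band : Band R F

theorem BL.eLpNorm_one_lt_top {R : ℝ} {F : ℝ → ℂ} (h : BL R F) : eLpNorm F 1 volume < ⊤ :=
  (h.band.eLpNorm_one_le h.meas).trans_lt
    (ENNReal.mul_lt_top h.memLp.2 (ENNReal.rpow_lt_top_of_nonneg (by norm_num) (by simp)))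

theorem BL.mul_left {R : ℝ} {F : ℝ → ℂ} (h : BL R F) {p : ℝ → ℂ} (hp : Measurable p)
    (hb : ∃ C : ℝ, ∀ x, |x| ≤ R → ‖p x‖ ≤ C) : BL R (fun x => p x * F x) := by
  refine ⟨hp.mul h.meas, ?_, h.band.mul_left p⟩
  obtain ⟨C, hC⟩ := hb
  refine h.memLp.of_le_mul (c := C) (hp.mul h.meas).aestronglyMeasurable ?_
  filter_upwards [h.band] with x hx
  rcases le_or_gt |x| R with h' | h'
  · rw [norm_mul]; exact mul_le_mul_of_nonneg_right (hC x h') (norm_nonneg _)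
  · rw [hx h']; simp

theorem BL.of_coe {R : ℝ} {f : L2C} (h : Band R f) : BL R f :=
  ⟨measurable_coe f, Lp.memLp f, h⟩

theorem quasiMeasurePreserving_third :
    Measure.QuasiMeasurePreserving (fun p : ℝ × ℝ => -p.1 - p.2) volume volume := by
  have h := (Measure.quasiMeasurePreserving_snd (μ := (volume : Measure ℝ))
    (ν := (volume : Measure ℝ))).comp measurePreserving_reflectThird.quasiMeasurePreserving
  exact h

theorem BL.triIntegrable {R : ℝ} {F G H : ℝ → ℂ} (hF : BL R F) (hG : BL R G) (hH : BL R H)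
    {q : ℝ → ℝ → ℝ → ℝ} (hq : Sym3 q) : TriIntegrable q F G H := by
  have mF := hF.meas
  have mG := hG.meas
  have mH := hH.meas
  have mq : Measurable (fun p : ℝ × ℝ => q p.1 p.2 (-p.1 - p.2)) :=
    hq.1.comp (f := fun p : ℝ × ℝ => (p.1, p.2, -p.1 - p.2)) (by fun_prop)
  refine ⟨((Complex.measurable_ofReal.comp mq).mul (by fun_prop)).aestronglyMeasurable, ?_⟩
  obtain ⟨C, hC, hb⟩ := hq.2 R
  have key : ∀ᵐ p : ℝ × ℝ, ‖(q p.1 p.2 (-p.1 - p.2) : ℂ) * (F p.1 * G p.2 * H (-p.1 - p.2))‖ₑ ≤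
      ENNReal.ofReal C * (‖F p.1‖ₑ * ‖G p.2‖ₑ * ‖H (-p.1 - p.2)‖ₑ) := by
    have a1 := (Measure.quasiMeasurePreserving_fst (μ := (volume : Measure ℝ))
      (ν := (volume : Measure ℝ))).ae hF.band
    have a2 := (Measure.quasiMeasurePreserving_snd (μ := (volume : Measure ℝ))
      (ν := (volume : Measure ℝ))).ae hG.band
    have a3 := quasiMeasurePreserving_third.ae hH.band
    rw [← Measure.volume_eq_prod] at a1 a2
    filter_upwards [a1, a2, a3] with p h1 h2 h3
    rcases le_or_gt |p.1| R with b1 | b1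
    swap; · rw [h1 b1]; simp
    rcases le_or_gt |p.2| R with b2 | b2
    swap; · rw [h2 b2]; simp
    rcases le_or_gt |-p.1 - p.2| R with b3 | b3
    swap; · rw [h3 b3]; simp
    rw [enorm_mul, enorm_mul, enorm_mul]
    gcongr
    rw [← ofReal_norm, Complex.norm_real]
    exact ENNReal.ofReal_le_ofReal (hb _ _ _ b1 b2 b3)
  refine (lintegral_mono_ae key).trans_lt ?_
  rw [lintegral_const_mul _ (by fun_prop)]
  refine ENNReal.mul_lt_top ENNReal.ofReal_lt_top ((triAbs_le mF mG mH).trans_lt ?_)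
  exact ENNReal.mul_lt_top (ENNReal.mul_lt_top hF.eLpNorm_one_lt_top hG.memLp.2) hH.memLp.2

theorem quasiMeasurePreserving_fourth : Measure.QuasiMeasurePreserving
    (fun p : (ℝ × ℝ) × ℝ => -p.1.1 - p.1.2 - p.2) volume volume := by
  have h := (Measure.quasiMeasurePreserving_snd (μ := (volume : Measure (ℝ × ℝ)))
    (ν := (volume : Measure ℝ))).comp measurePreserving_reflectFourth.quasiMeasurePreserving
  exact h

theorem BL.quadIntegrable {R : ℝ} {F G H J : ℝ → ℂ} (hF : BL R F) (hG : BL R G) (hH : BL R H)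
    (hJ : BL R J) {q : ℝ → ℝ → ℝ → ℝ → ℝ} (hq : Sym4 q) : QuadIntegrable q F G H J := by
  have mF := hF.meas
  have mG := hG.meas
  have mH := hH.meas
  have mJ := hJ.meas
  have mq : Measurable (fun p : (ℝ × ℝ) × ℝ => q p.1.1 p.1.2 p.2 (-p.1.1 - p.1.2 - p.2)) :=
    hq.1.comp (f := fun p : (ℝ × ℝ) × ℝ => (p.1.1, p.1.2, p.2, -p.1.1 - p.1.2 - p.2)) (by fun_prop)
  refine ⟨((Complex.measurable_ofReal.comp mq).mul (by fun_prop)).aestronglyMeasurable, ?_⟩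
  obtain ⟨C, hC, hb⟩ := hq.2 R
  have key : ∀ᵐ p : (ℝ × ℝ) × ℝ, ‖(q p.1.1 p.1.2 p.2 (-p.1.1 - p.1.2 - p.2) : ℂ) *
      (F p.1.1 * G p.1.2 * H p.2 * J (-p.1.1 - p.1.2 - p.2))‖ₑ ≤
      ENNReal.ofReal C * (‖F p.1.1‖ₑ * ‖G p.1.2‖ₑ * ‖H p.2‖ₑ * ‖J (-p.1.1 - p.1.2 - p.2)‖ₑ) := by
    have q1 := Measure.quasiMeasurePreserving_fst (μ := (volume : Measure (ℝ × ℝ)))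
      (ν := (volume : Measure ℝ))
    have q2 := Measure.quasiMeasurePreserving_fst (μ := (volume : Measure ℝ))
      (ν := (volume : Measure ℝ))
    have q3 := Measure.quasiMeasurePreserving_snd (μ := (volume : Measure ℝ))
      (ν := (volume : Measure ℝ))
    have a1 := (q2.comp q1).ae hF.band
    have a2 := (q3.comp q1).ae hG.band
    have a3 := (Measure.quasiMeasurePreserving_snd (μ := (volume : Measure (ℝ × ℝ)))
      (ν := (volume : Measure ℝ))).ae hH.band
    have a4 := quasiMeasurePreserving_fourth.ae hJ.band
    rw [← Measure.volume_eq_prod] at a1 a2 a3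
    filter_upwards [a1, a2, a3, a4] with p h1 h2 h3 h4
    simp only [Function.comp_apply] at h1 h2
    rcases le_or_gt |p.1.1| R with b1 | b1
    swap; · rw [h1 b1]; simp
    rcases le_or_gt |p.1.2| R with b2 | b2
    swap; · rw [h2 b2]; simp
    rcases le_or_gt |p.2| R with b3 | b3
    swap; · rw [h3 b3]; simp
    rcases le_or_gt |-p.1.1 - p.1.2 - p.2| R with b4 | b4
    swap; · rw [h4 b4]; simp
    rw [enorm_mul, enorm_mul, enorm_mul, enorm_mul]
    gcongr
    rw [← ofReal_norm, Complex.norm_real]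
    exact ENNReal.ofReal_le_ofReal (hb _ _ _ _ b1 b2 b3 b4)
  refine (lintegral_mono_ae key).trans_lt ?_
  rw [lintegral_const_mul _ (by fun_prop)]
  refine ENNReal.mul_lt_top ENNReal.ofReal_lt_top ((quadAbs_le mF mG mH mJ).trans_lt ?_)
  exact ENNReal.mul_lt_top (ENNReal.mul_lt_top (ENNReal.mul_lt_top hF.eLpNorm_one_lt_top
    hG.eLpNorm_one_lt_top) hH.memLp.2) hJ.memLp.2

theorem tri_congr_ae (q : ℝ → ℝ → ℝ → ℝ) {F F' G G' H H' : ℝ → ℂ} (hF : F =ᵐ[volume] F')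
    (hG : G =ᵐ[volume] G') (hH : H =ᵐ[volume] H') : tri q F G H = tri q F' G' H' := by
  unfold tri
  have a1 := (Measure.quasiMeasurePreserving_fst (μ := (volume : Measure ℝ))
    (ν := (volume : Measure ℝ))).ae hF
  have a2 := (Measure.quasiMeasurePreserving_snd (μ := (volume : Measure ℝ))
    (ν := (volume : Measure ℝ))).ae hG
  have a3 := quasiMeasurePreserving_third.ae hH
  rw [← Measure.volume_eq_prod] at a1 a2
  refine integral_congr_ae ?_
  filter_upwards [a1, a2, a3] with p h1 h2 h3
  rw [h1, h2, h3]

/-- The pairing of a Hermitian function with a convolution. -/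
theorem integral_conj_mul_conv {p : ℝ → ℝ} {F G H : ℝ → ℂ} (hF : Herm F)
    (hI : TriIntegrable (fun x _ _ => p (-x)) F G H) :
    ∫ ξ, (p ξ : ℂ) * (starRingEnd ℂ (F ξ) * conv G H ξ) = tri (fun x _ _ => p (-x)) F G H := by
  unfold TriIntegrable at hI
  unfold tri
  rw [Measure.volume_eq_prod] at hI ⊢
  rw [integral_prod _ hI, ← integral_neg_eq_self]
  refine integral_congr_ae ?_
  filter_upwards [hF] with x hx
  rw [conv, show F (-x) = starRingEnd ℂ (F x) from hx, Complex.conj_conj, ← integral_const_mul,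
    ← integral_const_mul]
  refine integral_congr_ae (Eventually.of_forall fun y => ?_)
  simp only
  ring

theorem tri_conv_eq_quad {q : ℝ → ℝ → ℝ → ℝ} {F G H J : ℝ → ℂ}
    (hI : QuadIntegrable (fun x y z w => q x y (z + w) * (z + w)) F G H J) :
    tri q F G (fun z => (z : ℂ) * conv H J z) =
      quad (fun x y z w => q x y (z + w) * (z + w)) F G H J := by
  unfold QuadIntegrable at hI
  unfold tri quad
  rw [Measure.volume_eq_prod (α := ℝ × ℝ)] at hI ⊢
  rw [integral_prod _ hI]
  refine integral_congr_ae (Eventually.of_forall fun p => ?_)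
  simp only
  rw [conv, ← integral_const_mul, ← integral_const_mul, ← integral_const_mul]
  refine integral_congr_ae (Eventually.of_forall fun y => ?_)
  beta_reduce
  rw [show y + (-p.1 - p.2 - y) = -p.1 - p.2 by ring]
  push_cast
  ring

theorem enorm_sg (x : ℝ) : ‖(sg x : ℂ)‖ = 1 := by
  rw [Complex.norm_real, Real.norm_eq_abs, abs_sg]

theorem isMult_sg : IsMult (fun x => (sg x : ℂ)) :=
  ⟨Complex.measurable_ofReal.comp measurable_sg, 1, fun x => (enorm_sg x).le⟩

theorem isMult_cut {p : ℝ → ℝ} (hp : Sym1 p) (R : ℝ) : IsMult (cut R fun x => (p x : ℂ)) := by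
  refine ⟨measurable_cut R (Complex.measurable_ofReal.comp hp.1), ?_⟩
  obtain ⟨C, hC, h⟩ := hp.2 R
  refine ⟨C, fun x => ?_⟩
  rcases le_or_gt |x| R with h' | h'
  · rw [cut_of_le h', Complex.norm_real]; exact h x h'
  · rw [cut_of_lt h', norm_zero]; exact hC

theorem BL.sg_mul {R : ℝ} {F : ℝ → ℂ} (h : BL R F) : BL R (fun x => (sg x : ℂ) * F x) :=
  h.mul_left isMult_sg.1 ⟨1, fun x _ => (enorm_sg x).le⟩

theorem BL.const_mul {R : ℝ} {F : ℝ → ℂ} (h : BL R F) (c : ℂ) : BL R (fun x => c * F x) :=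
  h.mul_left measurable_const ⟨‖c‖, fun _ _ => le_rfl⟩

theorem BL.id_mul {R : ℝ} {F : ℝ → ℂ} (h : BL R F) : BL R (fun x => (x : ℂ) * F x) :=
  h.mul_left Complex.measurable_ofReal ⟨R, fun x hx => by rwa [Complex.norm_real]⟩

theorem BL.add {R : ℝ} {F G : ℝ → ℂ} (hF : BL R F) (hG : BL R G) : BL R (fun x => F x + G x) :=
  ⟨hF.meas.add hG.meas, hF.memLp.add hG.memLp, by
    filter_upwards [hF.band, hG.band] with x h1 h2 h3
    rw [h1 h3, h2 h3, add_zero]⟩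

theorem BL.conv {N : ℝ} {F G : ℝ → ℂ} (hF : BL N F) (hG : BL N G) :
    BL (2 * N) (conv F G) := by
  have hb : Band (2 * N) (BurgersHilbert.conv F G) :=
    Eventually.of_forall fun ξ hξ => hF.band.conv hG.band hξ
  refine ⟨measurable_conv hF.meas hG.meas, ?_, hb⟩
  have e1 : BurgersHilbert.conv F G = BurgersHilbert.conv (hF.memLp.toLp F) (hG.memLp.toLp G) :=
    conv_congr hF.memLp.coeFn_toLp.symm hG.memLp.coeFn_toLp.symm
  rw [e1] at hb ⊢
  exact (memLp_cut_conv (2 * N) _ _).ae_eq hb.cut_eq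

/-- The trilinear form expressed through bounded operators. -/
theorem inner_mulOp_cutConv {R : ℝ} {p : ℝ → ℝ} (hp : Sym1 p) (hpe : ∀ x, p (-x) = p x)
    {F G H : L2C} (hF : Band R F) (hFh : Herm F) (hG : Band R G) (hH : Band R H) :
    inner ℂ F (mulOp _ (isMult_cut hp R)
      (cutConv R (mulOp _ isMult_sg G) (mulOp _ isMult_sg H))) =
      tri (fun x y z => p x * (sg y * sg z)) F G H := by
  have bF := BL.of_coe hF
  have bG := (BL.of_coe hG).sg_mul
  have bH := (BL.of_coe hH).sg_mul
  have hI : TriIntegrable (fun x _ _ => p (-x)) F (fun x => (sg x : ℂ) * G x)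
      (fun x => (sg x : ℂ) * H x) := by
    simp only [hpe]
    exact bF.triIntegrable bG bH hp.sym3_fst
  have e := integral_conj_mul_conv hFh hI
  rw [L2.inner_def]
  trans ∫ ξ, (p ξ : ℂ) * (starRingEnd ℂ (F ξ) *
    conv (fun x => (sg x : ℂ) * G x) (fun x => (sg x : ℂ) * H x) ξ)
  · refine integral_congr_ae ?_
    have c : conv (mulOp _ isMult_sg G) (mulOp _ isMult_sg H) =
      conv (fun x => (sg x : ℂ) * G x) (fun x => (sg x : ℂ) * H x) :=
      conv_congr (mulOp_coe _ _ _) (mulOp_coe _ _ _)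
    filter_upwards [hF, mulOp_coe _ (isMult_cut hp R)
      (cutConv R (mulOp _ isMult_sg G) (mulOp _ isMult_sg H)),
      cutConv_coe R (mulOp _ isMult_sg G) (mulOp _ isMult_sg H)] with ξ h1 h2 h3
    rw [RCLike.inner_apply, h2, h3, c]
    rcases le_or_gt |ξ| R with h | h
    · rw [cut_of_le h, cut_of_le h]; ring
    · rw [h1 h]; simp
  · rw [e]
    unfold tri
    refine integral_congr_ae (Eventually.of_forall fun x => ?_)
    simp only [hpe]
    push_cast
    ring

theorem hasDerivAt_tri {R : ℝ} {p : ℝ → ℝ} (hp : Sym1 p) (hpe : ∀ x, p (-x) = p x)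
    {s v : ℝ → L2C} {s' v' : L2C} {t : ℝ} (hs : HasDerivAt s s' t) (hv : HasDerivAt v v' t)
    (hsb : ∀ᶠ τ in 𝓝 t, Band R (s τ) ∧ Herm (s τ)) (hvb : ∀ᶠ τ in 𝓝 t, Band R (v τ))
    (hsb' : Band R s') (hsh' : Herm s') (hvb' : Band R v') :
    HasDerivAt (fun τ => tri (fun x y z => p x * (sg y * sg z)) (s τ) (v τ) (v τ))
      (tri (fun x y z => p x * (sg y * sg z)) s' (v t) (v t) +
        tri (fun x y z => p x * (sg y * sg z)) (s t) v' (v t) +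
        tri (fun x y z => p x * (sg y * sg z)) (s t) (v t) v') t := by
  set M := mulOp _ (isMult_cut hp R)
  set S := mulOp _ isMult_sg
  have hSv : HasDerivAt (fun τ => S (v τ)) (S v') t := S.hasFDerivAt.comp_hasDerivAt t hv
  have hB : HasDerivAt (fun τ => cutConv R (S (v τ))) (cutConv R (S v')) t :=
    (cutConv R).hasFDerivAt.comp_hasDerivAt t hSv
  have hC := hB.clm_apply hSv
  have hD : HasDerivAt (fun τ => M (cutConv R (S (v τ)) (S (v τ))))
    (M (cutConv R (S v') (S (v t)) + cutConv R (S (v t)) (S v'))) t :=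
    M.hasFDerivAt.comp_hasDerivAt t hC
  have hE := HasDerivAt.inner ℂ hs hD
  have e1 : (fun τ => tri (fun x y z => p x * (sg y * sg z)) (s τ) (v τ) (v τ)) =ᶠ[𝓝 t]
      fun τ => inner ℂ (s τ) (M (cutConv R (S (v τ)) (S (v τ)))) := by
    filter_upwards [hsb, hvb] with τ h1 h2
    exact (inner_mulOp_cutConv hp hpe h1.1 h1.2 h2 h2).symm
  refine HasDerivAt.congr_of_eventuallyEq ?_ e1
  obtain ⟨hst, hsht⟩ := hsb.self_of_nhds
  have hvt := hvb.self_of_nhds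
  refine hE.congr_deriv ?_
  rw [map_add, inner_add_right, inner_mulOp_cutConv hp hpe hst hsht hvb' hvt,
    inner_mulOp_cutConv hp hpe hst hsht hvt hvb', inner_mulOp_cutConv hp hpe hsb' hsh' hvt hvt]
  ring

/-! ### Quadratic energies -/

/-- The norm `‖|ξ|ⁿ F‖` as a real number. -/
noncomputable def yn (n : ℕ) (F : ℝ → ℂ) : ℝ := (Yn n F).toReal

/-- The norm `‖|ξ| F‖₁` as a real number. -/
noncomputable def an (F : ℝ → ℂ) : ℝ := (An F).toReal

theorem yn_nonneg (n : ℕ) (F : ℝ → ℂ) : 0 ≤ yn n F := ENNReal.toReal_nonneg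

theorem an_nonneg (F : ℝ → ℂ) : 0 ≤ an F := ENNReal.toReal_nonneg

theorem BL.ofReal_yn {R : ℝ} {F : ℝ → ℂ} (h : BL R F) (n : ℕ) :
    ENNReal.ofReal (yn n F) = Yn n F := ENNReal.ofReal_toReal (h.band.Yn_lt_top h.memLp n).ne

theorem BL.ofReal_an {R : ℝ} {F : ℝ → ℂ} (h : BL R F) : ENNReal.ofReal (an F) = An F :=
  ENNReal.ofReal_toReal (h.band.An_lt_top h.memLp h.meas).ne

/-- The pairing of `F` and `G` with weight `|ξ|^(2n)`. -/
noncomputable def ip (n : ℕ) (F G : ℝ → ℂ) : ℂ :=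
  ∫ ξ, ((|ξ| ^ (2 * n) : ℝ) : ℂ) * (starRingEnd ℂ (F ξ) * G ξ)

theorem sym1_abs_pow (n : ℕ) : Sym1 (fun x => |x| ^ n) := Continuous.sym1 (by fun_prop)

theorem sym1_pow (n : ℕ) : Sym1 (fun x => x ^ n) := Continuous.sym1 (by fun_prop)

theorem mulOp_abs_pow {R : ℝ} {f : L2C} (hf : Band R f) (n : ℕ) :
    mulOp _ (isMult_cut (sym1_abs_pow n) R) f =ᵐ[volume] wt n f := by
  filter_upwards [mulOp_coe _ (isMult_cut (sym1_abs_pow n) R) f, hf] with x h1 h2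
  rw [h1, wt]
  rcases le_or_gt |x| R with h | h
  · rw [cut_of_le h]
  · rw [h2 h]; simp

theorem norm_mulOp_abs_pow {R : ℝ} {f : L2C} (hf : Band R f) (n : ℕ) :
    ‖mulOp _ (isMult_cut (sym1_abs_pow n) R) f‖ = yn n f := by
  rw [Lp.norm_def, yn, Yn, eLpNorm_congr_ae (mulOp_abs_pow hf n)]

theorem inner_mulOp_abs_pow {R : ℝ} {f g : L2C} (hf : Band R f) (hg : Band R g) (n : ℕ) :
    inner ℂ (mulOp _ (isMult_cut (sym1_abs_pow n) R) f)
      (mulOp _ (isMult_cut (sym1_abs_pow n) R) g) = ip n f g := by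
  rw [L2.inner_def, ip]
  refine integral_congr_ae ?_
  filter_upwards [mulOp_abs_pow hf n, mulOp_abs_pow hg n] with x h1 h2
  rw [RCLike.inner_apply, h1, h2, wt, wt, map_mul, Complex.conj_ofReal, two_mul n, pow_add]
  push_cast
  ring

theorem norm_ip_le {R : ℝ} {f g : L2C} (hf : Band R f) (hg : Band R g) (n : ℕ) :
    ‖ip n f g‖ ≤ yn n f * yn n g := by
  rw [← inner_mulOp_abs_pow hf hg, ← norm_mulOp_abs_pow hf, ← norm_mulOp_abs_pow hg]
  exact norm_inner_le_norm _ _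

theorem inner_real_eq_re (f g : L2C) : inner ℝ f g = (inner ℂ f g).re := by
  have h := (L2.integrable_inner (𝕜 := ℂ) f g)
  rw [L2.inner_def, L2.inner_def]
  exact integral_re h

theorem hasDerivAt_yn_sq {R : ℝ} {f : ℝ → L2C} {f' : L2C} {t : ℝ} (hf : HasDerivAt f f' t)
    (hb : ∀ᶠ τ in 𝓝 t, Band R (f τ)) (hb' : Band R f') (n : ℕ) :
    HasDerivAt (fun τ => yn n (f τ) ^ 2) (2 * (ip n (f t) f').re) t := by
  set M := mulOp _ (isMult_cut (sym1_abs_pow n) R)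
  have hM : HasDerivAt (fun τ => M (f τ)) (M f') t := M.hasFDerivAt.comp_hasDerivAt t hf
  have h := hM.norm_sq
  refine (h.congr_deriv ?_).congr_of_eventuallyEq (hb.mono fun τ hτ => by
    show yn n (f τ) ^ 2 = ‖M (f τ)‖ ^ 2
    rw [norm_mulOp_abs_pow hτ])
  rw [← inner_mulOp_abs_pow hb.self_of_nhds hb', ← inner_real_eq_re]

theorem BL.integrable_ip {R : ℝ} {F G : ℝ → ℂ} (hF : BL R F) (hG : MemLp G 2 volume) (n : ℕ) :
    Integrable fun ξ => ((|ξ| ^ (2 * n) : ℝ) : ℂ) * (starRingEnd ℂ (F ξ) * G ξ) := by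
  have h1 : MemLp (wt (2 * n) F) 2 volume :=
    ⟨(measurable_wt _ hF.meas).aestronglyMeasurable, hF.band.Yn_lt_top hF.memLp _⟩
  have h2 : MemLp (fun ξ => starRingEnd ℂ (wt (2 * n) F ξ)) 2 volume := h1.star
  refine (h2.integrable_mul hG).congr (Eventually.of_forall fun ξ => ?_)
  simp only [wt, Pi.mul_apply, map_mul, Complex.conj_ofReal]
  ring

theorem ip_add_right {R : ℝ} {F G H : ℝ → ℂ} (hF : BL R F) (hG : MemLp G 2 volume)
    (hH : MemLp H 2 volume) (n : ℕ) :
    ip n F (fun x => G x + H x) = ip n F G + ip n F H := by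
  unfold ip
  rw [← integral_add (hF.integrable_ip hG n) (hF.integrable_ip hH n)]
  refine integral_congr_ae (Eventually.of_forall fun ξ => ?_)
  simp only
  ring

theorem ip_const_mul_right (n : ℕ) (c : ℂ) (F G : ℝ → ℂ) :
    ip n F (fun x => c * G x) = c * ip n F G := by
  unfold ip
  rw [← integral_const_mul]
  refine integral_congr_ae (Eventually.of_forall fun ξ => ?_)
  simp only
  ring

theorem ip_congr (n : ℕ) (F : ℝ → ℂ) {G G' : ℝ → ℂ} (h : G =ᵐ[volume] G') :
    ip n F G = ip n F G' := by
  unfold ip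
  refine integral_congr_ae ?_
  filter_upwards [h] with ξ h
  rw [h]

theorem im_ip_sg (n : ℕ) (F : ℝ → ℂ) : (ip n F fun ξ => (sg ξ : ℂ) * F ξ).im = 0 := by
  have : ip n F (fun ξ => (sg ξ : ℂ) * F ξ) =
      ((∫ ξ, |ξ| ^ (2 * n) * (sg ξ * Complex.normSq (F ξ)) : ℝ) : ℂ) := by
    unfold ip
    rw [← integral_complex_ofReal]
    refine integral_congr_ae (Eventually.of_forall fun ξ => ?_)
    simp only
    push_cast
    rw [Complex.normSq_eq_conj_mul_self]
    ring
  rw [this, Complex.ofReal_im]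

theorem ip_id_mul_conv {R : ℝ} {F G H : ℝ → ℂ} (hF : BL R F) (hh : Herm F) (hG : BL R G)
    (hH : BL R H) (n : ℕ) :
    ip n F (fun ξ => (ξ : ℂ) * conv G H ξ) = -tri (fun x _ _ => x ^ (2 * n + 1)) F G H := by
  have hodd : Odd (2 * n + 1) := ⟨n, rfl⟩
  have hs : Sym1 fun x : ℝ => (-x) ^ (2 * n + 1) := Continuous.sym1 (by fun_prop)
  have e := integral_conj_mul_conv (p := fun x => x ^ (2 * n + 1)) hh
    (hF.triIntegrable hG hH hs.sym3_fst)
  have e2 : tri (fun x _ _ => (-x) ^ (2 * n + 1)) F G H =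
      -tri (fun x _ _ => x ^ (2 * n + 1)) F G H := by
    rw [tri_congr (q' := fun x _ _ => (-1) * x ^ (2 * n + 1)) (fun x y z _ => by
      rw [hodd.neg_pow]; ring), tri_const_mul]
    simp
  rw [← e2, ← e]
  unfold ip
  refine integral_congr_ae (Eventually.of_forall fun ξ => ?_)
  simp only
  rw [show |ξ| ^ (2 * n) = ξ ^ (2 * n) by rw [pow_mul, sq_abs, ← pow_mul]]
  push_cast
  ring

/-! ### Approximate solutions -/

/-- `f'` is the right-hand side of the Burgers-Hilbert equation at `f`, up to the error `r`. -/
structure ApproxAt (R : ℝ) (f f' r : L2C) : Prop where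
  band : Band (R / 2) f
  band' : Band R f'
  band_r : Band R r
  herm : Herm f
  herm' : Herm f'
  herm_r : Herm r
  nonneg : 0 ≤ R
  eq : f' =ᵐ[volume] fun ξ => -Complex.I * ((sg ξ : ℂ) * f ξ) +
    (-(Complex.I * Real.pi)) * ((ξ : ℂ) * conv f f ξ) + r ξ

namespace ApproxAt

variable {R : ℝ} {f f' r : L2C}

theorem bandR (h : ApproxAt R f f' r) : Band R f := h.band.mono (by linarith [h.nonneg])

theorem bl (h : ApproxAt R f f' r) : BL R f := BL.of_coe h.bandR

theorem bl' (h : ApproxAt R f f' r) : BL R f' := BL.of_coe h.band'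

theorem bl_r (h : ApproxAt R f f' r) : BL R r := BL.of_coe h.band_r

theorem bl_conv (h : ApproxAt R f f' r) : BL R (fun ξ => (ξ : ℂ) * conv f f ξ) := by
  have := ((BL.of_coe h.band).conv (BL.of_coe h.band)).id_mul
  rwa [mul_div_cancel₀ R two_ne_zero] at this

theorem mono (h : ApproxAt R f f' r) {R' : ℝ} (hR : R ≤ R') : ApproxAt R' f f' r :=
  ⟨h.band.mono (by linarith), h.band'.mono hR, h.band_r.mono hR, h.herm, h.herm', h.herm_r,
    h.nonneg.trans hR, h.eq⟩

end ApproxAt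

theorem tri_pow_symm {R : ℝ} {F : ℝ → ℂ} (hF : BL R F) (k : ℕ) :
    3 * tri (fun x _ _ => x ^ k) F F F = tri (fun x y z => x ^ k + y ^ k + z ^ k) F F F := by
  have h := sym1_pow k
  have h1 := hF.triIntegrable hF hF h.sym3_fst
  have h2 := hF.triIntegrable hF hF h.sym3_snd
  have h3 := hF.triIntegrable hF hF h.sym3_thd
  have h12 := hF.triIntegrable hF hF (h.sym3_fst.add h.sym3_snd)
  rw [tri_add h12 h3, tri_add h1 h2]
  have e1 : tri (fun x _ _ => x ^ k) F F F = tri (fun _ y _ => y ^ k) F F F := tri_swap12 _ _ _ _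
  have e2 : tri (fun _ y _ => y ^ k) F F F = tri (fun _ _ z => z ^ k) F F F := tri_swap23 _ _ _ _
  rw [← e2, ← e1]
  ring

theorem re_ip_deriv {R : ℝ} {f f' r : L2C} (h : ApproxAt R f f' r) (n : ℕ) :
    2 * (ip n f f').re = 2 * Real.pi / 3 * (Complex.I *
      tri (fun x y z => x ^ (2 * n + 1) + y ^ (2 * n + 1) + z ^ (2 * n + 1)) f f f).re +
      2 * (ip n f r).re := by
  rw [ip_congr n f h.eq, ip_add_right h.bl ((h.bl.sg_mul.const_mul _).add
      (h.bl_conv.const_mul _)).memLp h.bl_r.memLp, ip_add_right h.bl (h.bl.sg_mul.const_mul _).memLp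
      (h.bl_conv.const_mul _).memLp, ip_const_mul_right, ip_const_mul_right,
      ip_id_mul_conv h.bl h.herm h.bl h.bl, ← tri_pow_symm h.bl]
  have := im_ip_sg n f
  simp only [Complex.add_re, Complex.mul_re, Complex.neg_re, Complex.neg_im, Complex.I_re,
    Complex.I_im, Complex.mul_im, Complex.ofReal_re, Complex.ofReal_im, this, Complex.re_ofNat,
    Complex.im_ofNat]
  ring

theorem toReal_le_of_enorm_le {z : ℂ} {B : ℝ≥0∞} {b : ℝ} (h : ‖z‖ₑ ≤ B)
    (hB : B ≤ ENNReal.ofReal b) (hb : 0 ≤ b) : ‖z‖ ≤ b := by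
  rw [← ofReal_norm] at h
  exact (ENNReal.ofReal_le_ofReal_iff hb).1 (h.trans hB)

theorem norm_tri_le_cubicWeight {n : ℕ} {R : ℝ} {F G H : ℝ → ℂ} (hF : BL R F) (hG : BL R G)
    (hH : BL R H) {q : ℝ → ℝ → ℝ → ℝ} {C : ℝ} (hC : 0 ≤ C)
    (hq : ∀ x y z, x + y + z = 0 → |q x y z| ≤ C * cubicWeight n x y z) :
    ‖tri q F G H‖ ≤ C * (an F * yn n G * yn n H + yn n F * an G * yn n H +
      yn n F * yn n G * an H) := by
  have nn := an_nonneg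
  have nn' := yn_nonneg
  refine toReal_le_of_enorm_le (enorm_tri_le_lintegral q F G H)
    (B := ∫⁻ p : ℝ × ℝ, ENNReal.ofReal |q p.1 p.2 (-p.1 - p.2)| *
      (‖F p.1‖ₑ * ‖G p.2‖ₑ * ‖H (-p.1 - p.2)‖ₑ)) ?_ (by
        have := nn F; have := nn G; have := nn H; have := nn' n F; have := nn' n G
        have := nn' n H
        positivity)
  calc _ ≤ ∫⁻ p : ℝ × ℝ, ENNReal.ofReal C * (ENNReal.ofReal (cubicWeight n p.1 p.2 (-p.1 - p.2)) *
        (‖F p.1‖ₑ * ‖G p.2‖ₑ * ‖H (-p.1 - p.2)‖ₑ)) := by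
        refine lintegral_mono fun p => ?_
        rw [← mul_assoc (ENNReal.ofReal C), ← ENNReal.ofReal_mul hC]
        gcongr
        exact hq _ _ _ (by ring)
    _ = ENNReal.ofReal C * ∫⁻ p : ℝ × ℝ, (ENNReal.ofReal (cubicWeight n p.1 p.2 (-p.1 - p.2)) *
        (‖F p.1‖ₑ * ‖G p.2‖ₑ * ‖H (-p.1 - p.2)‖ₑ)) :=
        lintegral_const_mul' _ _ ENNReal.ofReal_ne_top
    _ ≤ ENNReal.ofReal C * (An F * Yn n G * Yn n H + Yn n F * An G * Yn n H +
        Yn n F * Yn n G * An H) := by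
        gcongr
        exact lintegral_cubicWeight_le hF.meas hG.meas hH.meas
    _ = _ := by
        rw [← hF.ofReal_an, ← hG.ofReal_an, ← hH.ofReal_an, ← hF.ofReal_yn, ← hG.ofReal_yn,
          ← hH.ofReal_yn]
        have := nn F; have := nn G; have := nn H
        have := nn' n F; have := nn' n G; have := nn' n H
        rw [ENNReal.ofReal_mul hC, ENNReal.ofReal_add (by positivity) (by positivity),
          ENNReal.ofReal_add (by positivity) (by positivity), ENNReal.ofReal_mul (by positivity),
          ENNReal.ofReal_mul (by positivity), ENNReal.ofReal_mul (by positivity),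
          ENNReal.ofReal_mul (by positivity), ENNReal.ofReal_mul (by positivity),
          ENNReal.ofReal_mul (by positivity)]

theorem norm_quad_le_quarticWeight {n : ℕ} {R : ℝ} {F : ℝ → ℂ} (hF : BL R F)
    {q : ℝ → ℝ → ℝ → ℝ → ℝ} {C : ℝ} (hC : 0 ≤ C)
    (hq : ∀ x y z w, x + y + z + w = 0 → |q x y z w| ≤ C * quarticWeight n x y z w) :
    ‖quad q F F F F‖ ≤ C * (6 * (an F ^ 2 * yn n F ^ 2)) := by
  have nn := an_nonneg F
  have nn' := yn_nonneg n F
  refine toReal_le_of_enorm_le (enorm_quad_le_lintegral q F F F F) ?_ (by positivity)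
  calc _ ≤ ∫⁻ p : (ℝ × ℝ) × ℝ, ENNReal.ofReal C *
        (ENNReal.ofReal (quarticWeight n p.1.1 p.1.2 p.2 (-p.1.1 - p.1.2 - p.2)) *
        (‖F p.1.1‖ₑ * ‖F p.1.2‖ₑ * ‖F p.2‖ₑ * ‖F (-p.1.1 - p.1.2 - p.2)‖ₑ)) := by
        refine lintegral_mono fun p => ?_
        rw [← mul_assoc (ENNReal.ofReal C), ← ENNReal.ofReal_mul hC]
        gcongr
        exact hq _ _ _ _ (by ring)
    _ = ENNReal.ofReal C * ∫⁻ p : (ℝ × ℝ) × ℝ,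
        (ENNReal.ofReal (quarticWeight n p.1.1 p.1.2 p.2 (-p.1.1 - p.1.2 - p.2)) *
        (‖F p.1.1‖ₑ * ‖F p.1.2‖ₑ * ‖F p.2‖ₑ * ‖F (-p.1.1 - p.1.2 - p.2)‖ₑ)) :=
        lintegral_const_mul' _ _ ENNReal.ofReal_ne_top
    _ ≤ ENNReal.ofReal C * (6 * (An F ^ 2 * Yn n F ^ 2)) := by
        gcongr
        exact lintegral_quarticWeight_le hF.meas
    _ = _ := by
        rw [← hF.ofReal_an, ← hF.ofReal_yn, ENNReal.ofReal_mul hC,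
          ENNReal.ofReal_mul (by norm_num), ENNReal.ofReal_mul (by positivity),
          ENNReal.ofReal_pow nn, ENNReal.ofReal_pow nn']
        simp

/-- The modified energy of order `m + 1`. -/
noncomputable def modEnergy (m : ℕ) (F : ℝ → ℂ) : ℝ :=
  yn (m + 1) F ^ 2 -
    2 * Real.pi * (tri (fun x y z => |x| ^ (2 * m + 3) * (sg y * sg z)) F F F).re

theorem sg_mul_pow_odd (x : ℝ) (m : ℕ) : sg x * x ^ (2 * m + 3) = |x| ^ (2 * m + 3) := by
  rw [show 2 * m + 3 = 2 * (m + 1) + 1 by ring, pow_succ, pow_succ |x|, pow_mul, pow_mul, sq_abs,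
    ← sg_mul_self x]
  ring

/-- The symmetric symbol of the cubic correction. -/
noncomputable def cubicSymbol (m : ℕ) (x y z : ℝ) : ℝ :=
  sg x * sg y * sg z * (x ^ (2 * m + 3) + y ^ (2 * m + 3) + z ^ (2 * m + 3))

theorem abs_cubicSymbol (m : ℕ) (x y z : ℝ) :
    |cubicSymbol m x y z| = |x ^ (2 * m + 3) + y ^ (2 * m + 3) + z ^ (2 * m + 3)| := by
  rw [cubicSymbol, abs_mul, abs_mul, abs_mul, abs_sg, abs_sg, abs_sg]; ring

theorem sym3_sg (m : ℕ) :
    Sym3 (fun x y z => |x| ^ (2 * m + 3) * (sg y * sg z)) :=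
  (sym1_abs_pow _).sym3_fst.mul (sym1_sg.sym3_snd.mul sym1_sg.sym3_thd)

theorem sym3_sum_pow (k : ℕ) : Sym3 (fun x y z : ℝ => x ^ k + y ^ k + z ^ k) :=
  (((sym1_pow k).sym3_fst.add (sym1_pow k).sym3_snd).add (sym1_pow k).sym3_thd)

theorem sym3_cubicSymbol (m : ℕ) : Sym3 (cubicSymbol m) :=
  ((sym1_sg.sym3_fst.mul sym1_sg.sym3_snd).mul sym1_sg.sym3_thd).mul (sym3_sum_pow _)

theorem tri_cubicSymbol {R : ℝ} {F H : ℝ → ℂ} (hF : BL R F) (hH : BL R H) (m : ℕ) :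
    tri (fun x y z => |x| ^ (2 * m + 3) * (sg y * sg z)) H F F +
      tri (fun x y z => |x| ^ (2 * m + 3) * (sg y * sg z)) F H F +
      tri (fun x y z => |x| ^ (2 * m + 3) * (sg y * sg z)) F F H =
    tri (cubicSymbol m) F F H := by
  have s1 : Sym3 (fun x y z => |z| ^ (2 * m + 3) * (sg x * sg y)) :=
    (sym1_abs_pow _).sym3_thd.mul (sym1_sg.sym3_fst.mul sym1_sg.sym3_snd)
  have s2 : Sym3 (fun x y z => |y| ^ (2 * m + 3) * (sg z * sg x)) :=
    (sym1_abs_pow _).sym3_snd.mul (sym1_sg.sym3_thd.mul sym1_sg.sym3_fst)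
  have e1 : tri (fun x y z => |x| ^ (2 * m + 3) * (sg y * sg z)) H F F =
      tri (fun x y z => |z| ^ (2 * m + 3) * (sg x * sg y)) F F H := by
    rw [tri_swap12, tri_swap23]
  have e2 : tri (fun x y z => |x| ^ (2 * m + 3) * (sg y * sg z)) F H F =
      tri (fun x y z => |y| ^ (2 * m + 3) * (sg z * sg x)) F F H := by
    rw [tri_swap23, tri_swap12]
  rw [e1, e2, ← tri_add (hF.triIntegrable hF hH s1) (hF.triIntegrable hF hH s2),
    ← tri_add (hF.triIntegrable hF hH (s1.add s2)) (hF.triIntegrable hF hH (sym3_sg m))]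
  refine tri_congr (fun x y z _ => ?_) _ _ _
  rw [cubicSymbol, ← sg_mul_pow_odd x, ← sg_mul_pow_odd y, ← sg_mul_pow_odd z]
  ring

theorem tri_cubicSymbol_sg {R : ℝ} {F : ℝ → ℂ} (hF : BL R F) (m : ℕ) :
    3 * tri (cubicSymbol m) F F (fun x => (sg x : ℂ) * F x) =
      -tri (fun x y z => x ^ (2 * m + 3) + y ^ (2 * m + 3) + z ^ (2 * m + 3)) F F F := by
  have hc := sym3_cubicSymbol m
  have s1 := hc.mul sym1_sg.sym3_fst
  have s2 := hc.mul sym1_sg.sym3_snd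
  have s3 := hc.mul sym1_sg.sym3_thd
  have e0 : tri (cubicSymbol m) F F (fun x => (sg x : ℂ) * F x) =
      tri (fun x y z => cubicSymbol m x y z * sg z) F F F := by
    unfold tri
    refine integral_congr_ae (Eventually.of_forall fun p => ?_)
    simp only
    push_cast
    ring
  have e1 : tri (fun x y z => cubicSymbol m x y z * sg z) F F F =
      tri (fun x y z => cubicSymbol m x y z * sg y) F F F := by
    rw [tri_swap23]
    exact tri_congr (fun x y z _ => by unfold cubicSymbol; ring) _ _ _
  have e2 : tri (fun x y z => cubicSymbol m x y z * sg y) F F F =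
      tri (fun x y z => cubicSymbol m x y z * sg x) F F F := by
    rw [tri_swap12]
    exact tri_congr (fun x y z _ => by unfold cubicSymbol; ring) _ _ _
  have e3 : tri (fun x y z => cubicSymbol m x y z * sg x + cubicSymbol m x y z * sg y +
      cubicSymbol m x y z * sg z) F F F = 3 * tri (fun x y z => cubicSymbol m x y z * sg z) F F F := by
    rw [tri_add (hF.triIntegrable hF hF (s1.add s2)) (hF.triIntegrable hF hF s3),
      tri_add (hF.triIntegrable hF hF s1) (hF.triIntegrable hF hF s2), e1, e2]
    ring
  have e4 : -tri (fun x y z => x ^ (2 * m + 3) + y ^ (2 * m + 3) + z ^ (2 * m + 3)) F F F =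
      tri (fun x y z => (-1) * (x ^ (2 * m + 3) + y ^ (2 * m + 3) + z ^ (2 * m + 3))) F F F := by
    rw [tri_const_mul]; simp
  rw [e0, ← e3, e4]
  refine tri_congr (fun x y z h => ?_) _ _ _
  by_cases h0 : x = 0 ∧ y = 0 ∧ z = 0
  · obtain ⟨rfl, rfl, rfl⟩ := h0
    simp [cubicSymbol]
  · have := sg_prod_mul_sum h h0
    unfold cubicSymbol
    linear_combination (x ^ (2 * m + 3) + y ^ (2 * m + 3) + z ^ (2 * m + 3)) * this

theorem sym4_quarticSymbol (m : ℕ) : Sym4 (fun x y _ _ => quarticSymbol m x y) := by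
  have s : Sym3 (fun x y _ => quarticSymbol m x y) := by
    have h1 : Sym3 (fun x y _ : ℝ => |x + y|) := by
      refine ⟨by fun_prop, fun R => ⟨2 * |R|, by positivity, fun x y z hx hy _ => ?_⟩⟩
      rw [abs_abs]
      have := le_abs_self R
      exact (abs_add_le _ _).trans (by linarith)
    have h2 : Sym3 (fun x y _ : ℝ => -(x + y) ^ (2 * m + 3)) := by
      refine ⟨by fun_prop, fun R => ⟨(2 * |R|) ^ (2 * m + 3), by positivity,
        fun x y z hx hy _ => ?_⟩⟩
      rw [abs_neg, abs_pow]
      have := le_abs_self R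
      exact pow_le_pow_left₀ (abs_nonneg _) ((abs_add_le _ _).trans (by linarith)) _
    have := ((sym1_sg.sym3_fst.mul sym1_sg.sym3_snd).mul h1).mul
      (((sym1_pow (2 * m + 3)).sym3_fst.add (sym1_pow (2 * m + 3)).sym3_snd).add h2)
    simpa only [quarticSymbol, sub_eq_add_neg] using this
  exact s.sym4

theorem tri_cubicSymbol_conv {R : ℝ} {F : ℝ → ℂ} (hF : BL R F) (m : ℕ) :
    6 * tri (cubicSymbol m) F F (fun z => (z : ℂ) * conv F F z) =
      quad (quarticSum m) F F F F := by
  have hs : Sym4 (fun x y z w => cubicSymbol m x y (z + w) * (z + w)) :=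
    ((sym3_cubicSymbol m).mul (Continuous.sym1 continuous_id).sym3_thd).sym4
  rw [tri_conv_eq_quad (hF.quadIntegrable hF hF hF hs)]
  have e0 : quad (fun x y z w => cubicSymbol m x y (z + w) * (z + w)) F F F F =
      quad (fun x y _ _ => quarticSymbol m x y) F F F F := by
    refine quad_congr (fun x y z w h => ?_) _ _ _ _
    have hodd : Odd (2 * m + 3) := ⟨m + 1, by ring⟩
    obtain hzw : z + w = -(x + y) := by linarith
    have := sg_mul_self (z + w)
    rw [cubicSymbol, quarticSymbol, ← abs_neg (x + y), ← hzw, ← this, hzw, hodd.neg_pow]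
    ring
  have i0 := sym4_quarticSymbol m
  have e1 : quad (fun x y _ _ => quarticSymbol m x y) F F F F =
      quad (fun x _ z _ => quarticSymbol m x z) F F F F := quad_swap23 _ _ _ _ _
  have e2 : quad (fun x _ z _ => quarticSymbol m x z) F F F F =
      quad (fun x _ _ w => quarticSymbol m x w) F F F F := quad_swap34 _ _ _ _ _
  have e3 : quad (fun x _ z _ => quarticSymbol m x z) F F F F =
      quad (fun _ y z _ => quarticSymbol m y z) F F F F := quad_swap12 _ _ _ _ _
  have e4 : quad (fun x _ _ w => quarticSymbol m x w) F F F F =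
      quad (fun _ y _ w => quarticSymbol m y w) F F F F := quad_swap12 _ _ _ _ _
  have e5 : quad (fun _ y _ w => quarticSymbol m y w) F F F F =
      quad (fun _ _ z w => quarticSymbol m z w) F F F F := quad_swap23 _ _ _ _ _
  have j0 := hF.quadIntegrable hF hF hF i0
  have j1 := hF.quadIntegrable hF hF hF i0.swap23
  have j2 := hF.quadIntegrable hF hF hF i0.swap23.swap34
  have j3 := hF.quadIntegrable hF hF hF i0.swap23.swap12
  have j4 := hF.quadIntegrable hF hF hF i0.swap23.swap34.swap12
  have j5 := hF.quadIntegrable hF hF hF i0.swap23.swap34.swap12.swap23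
  have e6 : quad (quarticSum m) F F F F = quad (fun x y _ _ => quarticSymbol m x y) F F F F +
      quad (fun x _ z _ => quarticSymbol m x z) F F F F +
      quad (fun x _ _ w => quarticSymbol m x w) F F F F +
      quad (fun _ y z _ => quarticSymbol m y z) F F F F +
      quad (fun _ y _ w => quarticSymbol m y w) F F F F +
      quad (fun _ _ z w => quarticSymbol m z w) F F F F := by
    have k1 : QuadIntegrable (fun x y z w => quarticSymbol m x y + quarticSymbol m x z) F F F F := by
      refine (j0.add j1).congr (Eventually.of_forall fun p => ?_)
      simp only [Pi.add_apply]; push_cast; ring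
    have k2 : QuadIntegrable (fun x y z w => quarticSymbol m x y + quarticSymbol m x z +
        quarticSymbol m x w) F F F F := by
      refine (k1.add j2).congr (Eventually.of_forall fun p => ?_)
      simp only [Pi.add_apply]; push_cast; ring
    have k3 : QuadIntegrable (fun x y z w => quarticSymbol m x y + quarticSymbol m x z +
        quarticSymbol m x w + quarticSymbol m y z) F F F F := by
      refine (k2.add j3).congr (Eventually.of_forall fun p => ?_)
      simp only [Pi.add_apply]; push_cast; ring
    have k4 : QuadIntegrable (fun x y z w => quarticSymbol m x y + quarticSymbol m x z +
        quarticSymbol m x w + quarticSymbol m y z + quarticSymbol m y w) F F F F := by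
      refine (k3.add j4).congr (Eventually.of_forall fun p => ?_)
      simp only [Pi.add_apply]; push_cast; ring
    rw [← quad_add j0 j1, ← quad_add k1 j2, ← quad_add k2 j3, ← quad_add k3 j4, ← quad_add k4 j5]
    rfl
  rw [e6, e0, ← e5, ← e4, ← e3, ← e2, ← e1]
  ring

theorem exists_modEnergy_estimates (m : ℕ) : ∃ C : ℝ, 0 ≤ C ∧
    (∀ (R : ℝ) (F : ℝ → ℂ), BL R F →
      |modEnergy m F - yn (m + 1) F ^ 2| ≤ C * (an F * yn (m + 1) F ^ 2)) ∧
    (∀ (R : ℝ) (F : ℝ → ℂ), BL R F →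
      ‖tri (fun x y z => x ^ (2 * (m + 1) + 1) + y ^ (2 * (m + 1) + 1) + z ^ (2 * (m + 1) + 1))
        F F F‖ ≤ C * (an F * yn (m + 1) F ^ 2)) ∧
    ∀ (R : ℝ) (f : ℝ → L2C) (f' r : L2C) (t : ℝ), ApproxAt R (f t) f' r → HasDerivAt f f' t →
      (∀ᶠ τ in 𝓝 t, Band R (f τ) ∧ Herm (f τ)) → ∃ D, HasDerivAt (fun τ => modEnergy m (f τ)) D t ∧
        |D| ≤ C * (an (f t) ^ 2 * yn (m + 1) (f t) ^ 2) +
          2 * (yn (m + 1) (f t) * yn (m + 1) r) +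
          C * (an (f t) * yn (m + 1) (f t) * yn (m + 1) r + yn (m + 1) (f t) ^ 2 * an r) := by
  obtain ⟨C₁, hC₁, h₁⟩ := exists_cubic_symbol_le_weight m
  obtain ⟨C₂, hC₂, h₂⟩ := exists_quarticSum_le_weight m
  have hpi := Real.pi_pos
  have hcub : ∀ (R : ℝ) (F H : ℝ → ℂ), BL R F → BL R H → ‖tri (cubicSymbol m) F F H‖ ≤
      C₁ * (2 * (an F * yn (m + 1) F * yn (m + 1) H) + yn (m + 1) F ^ 2 * an H) := by
    intro R F H hF hH
    refine (norm_tri_le_cubicWeight (n := m + 1) hF hF hH hC₁ (fun x y z h => ?_)).trans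
      (le_of_eq (by ring))
    rw [abs_cubicSymbol]
    exact h₁ x y z h
  refine ⟨2 * Real.pi * (2 * C₁) + 3 * C₁ + 2 * Real.pi ^ 2 * C₂, by positivity, ?_, ?_, ?_⟩
  · intro R F hF
    have e := tri_cubicSymbol hF hF m
    have e' : tri (fun x y z => |x| ^ (2 * m + 3) * (sg y * sg z)) F F F =
        (1 / 3 : ℝ) * tri (cubicSymbol m) F F F := by rw [← e]; push_cast; ring
    have hb := hcub R F F hF hF
    have nn := an_nonneg F
    have nn' := yn_nonneg (m + 1) F
    rw [modEnergy, sub_sub_cancel_left, abs_neg, e', Complex.re_ofReal_mul, abs_mul,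
      abs_of_nonneg (by positivity : (0 : ℝ) ≤ 2 * Real.pi), abs_mul,
      abs_of_nonneg (by norm_num : (0 : ℝ) ≤ 1 / 3)]
    have h3 := (Complex.abs_re_le_norm _).trans hb
    calc _ ≤ 2 * Real.pi * (1 / 3 * (C₁ * (2 * (an F * yn (m + 1) F * yn (m + 1) F) +
          yn (m + 1) F ^ 2 * an F))) := by gcongr
      _ = 2 * Real.pi * C₁ * (an F * yn (m + 1) F ^ 2) := by ring
      _ ≤ _ := by
        gcongr
        nlinarith [mul_nonneg hpi.le hC₁, mul_nonneg (sq_nonneg Real.pi) hC₂]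
  · intro R F hF
    have nn := an_nonneg F
    have nn' := yn_nonneg (m + 1) F
    refine (norm_tri_le_cubicWeight (n := m + 1) hF hF hF hC₁ (fun x y z h => ?_)).trans ?_
    · exact h₁ x y z h
    · calc _ = 3 * C₁ * (an F * yn (m + 1) F ^ 2) := by ring
        _ ≤ _ := by
          gcongr
          nlinarith [mul_nonneg hpi.le hC₁, mul_nonneg (sq_nonneg Real.pi) hC₂]
  · intro R f f' r t hA hf hb
    have hy := hasDerivAt_yn_sq hf (hb.mono fun _ h => h.1) hA.band' (m + 1)
    have ht := hasDerivAt_tri (p := fun x => |x| ^ (2 * m + 3)) (sym1_abs_pow _)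
      (fun x => by rw [abs_neg]) hf hf hb (hb.mono fun _ h => h.1) hA.band' hA.herm' hA.band'
    rw [tri_cubicSymbol hA.bl hA.bl' m] at ht
    have htre : HasDerivAt (fun τ => (tri (fun x y z => |x| ^ (2 * m + 3) * (sg y * sg z))
        (f τ) (f τ) (f τ)).re) (tri (cubicSymbol m) (f t) (f t) f').re t :=
      (Complex.reCLM.hasFDerivAt.comp_hasDerivAt t ht)
    have hD := hy.sub (htre.const_mul (2 * Real.pi))
    refine ⟨_, hD, ?_⟩
    have hl := hA.bl
    have hc := sym3_cubicSymbol m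
    have e1 : tri (cubicSymbol m) (f t) (f t) f' =
        -Complex.I * tri (cubicSymbol m) (f t) (f t) (fun x => (sg x : ℂ) * f t x) +
        (-(Complex.I * Real.pi)) *
          tri (cubicSymbol m) (f t) (f t) (fun ξ => (ξ : ℂ) * conv (f t) (f t) ξ) +
        tri (cubicSymbol m) (f t) (f t) r := by
      rw [tri_congr_ae _ EventuallyEq.rfl EventuallyEq.rfl hA.eq,
        tri_add_right (hl.triIntegrable hl ((hl.sg_mul.const_mul _).add
          (hA.bl_conv.const_mul _)) hc) (hl.triIntegrable hl hA.bl_r hc),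
        tri_add_right (hl.triIntegrable hl (hl.sg_mul.const_mul _) hc)
          (hl.triIntegrable hl (hA.bl_conv.const_mul _) hc), tri_const_mul_right,
        tri_const_mul_right]
    have e2 := tri_cubicSymbol_sg hl m
    have e3 := tri_cubicSymbol_conv hl m
    have e4 := re_ip_deriv hA (m + 1)
    rw [show 2 * (m + 1) + 1 = 2 * m + 3 by ring] at e4
    set X := tri (fun x y z => x ^ (2 * m + 3) + y ^ (2 * m + 3) + z ^ (2 * m + 3)) (f t) (f t) (f t)
    set Q := quad (quarticSum m) (f t) (f t) (f t) (f t)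
    have e5 : tri (cubicSymbol m) (f t) (f t) f' = (1 / 3 : ℝ) * (Complex.I * X) -
        (Real.pi / 6 : ℝ) * (Complex.I * Q) + tri (cubicSymbol m) (f t) (f t) r := by
      rw [e1, ← e3]
      rw [show X = -(3 * tri (cubicSymbol m) (f t) (f t) fun x => (sg x : ℂ) * f t x) by
        rw [e2, neg_neg]]
      push_cast
      ring
    have e6 : 2 * (ip (m + 1) (f t) f').re - 2 * Real.pi * (tri (cubicSymbol m) (f t) (f t) f').re =
        2 * (ip (m + 1) (f t) r).re - 2 * Real.pi * (tri (cubicSymbol m) (f t) (f t) r).re +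
          Real.pi ^ 2 / 3 * (Complex.I * Q).re := by
      rw [e4, e5, Complex.add_re, Complex.sub_re, Complex.re_ofReal_mul, Complex.re_ofReal_mul]
      ring
    rw [e6]
    have b1 : |(ip (m + 1) (f t) r).re| ≤ yn (m + 1) (f t) * yn (m + 1) r :=
      (Complex.abs_re_le_norm _).trans (norm_ip_le hA.bandR hA.band_r _)
    have b2 : |(tri (cubicSymbol m) (f t) (f t) r).re| ≤
        C₁ * (2 * (an (f t) * yn (m + 1) (f t) * yn (m + 1) r) + yn (m + 1) (f t) ^ 2 * an r) :=
      (Complex.abs_re_le_norm _).trans (hcub R _ _ hl hA.bl_r)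
    have b3 : |(Complex.I * Q).re| ≤ C₂ * (6 * (an (f t) ^ 2 * yn (m + 1) (f t) ^ 2)) := by
      refine (Complex.abs_re_le_norm _).trans ?_
      rw [norm_mul, Complex.norm_I, one_mul]
      exact norm_quad_le_quarticWeight hl hC₂ h₂
    have n1 := an_nonneg (f t)
    have n2 := yn_nonneg (m + 1) (f t)
    have n3 := an_nonneg r
    have n4 := yn_nonneg (m + 1) r
    refine (abs_add_le _ _).trans ((add_le_add ((abs_sub _ _).trans (add_le_add
      (le_of_eq (abs_mul _ _)) (le_of_eq (abs_mul _ _)))) (le_of_eq (abs_mul _ _))).trans ?_)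
    rw [abs_two, abs_of_nonneg (by positivity : (0 : ℝ) ≤ 2 * Real.pi),
      abs_of_nonneg (by positivity : 0 ≤ Real.pi ^ 2 / 3)]
    calc _ ≤ 2 * (yn (m + 1) (f t) * yn (m + 1) r) +
        2 * Real.pi * (C₁ * (2 * (an (f t) * yn (m + 1) (f t) * yn (m + 1) r) +
          yn (m + 1) (f t) ^ 2 * an r)) +
        Real.pi ^ 2 / 3 * (C₂ * (6 * (an (f t) ^ 2 * yn (m + 1) (f t) ^ 2))) := by gcongr
      _ = 2 * Real.pi ^ 2 * C₂ * (an (f t) ^ 2 * yn (m + 1) (f t) ^ 2) +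
          2 * (yn (m + 1) (f t) * yn (m + 1) r) +
          (2 * Real.pi * (2 * C₁) * (an (f t) * yn (m + 1) (f t) * yn (m + 1) r) +
           2 * Real.pi * C₁ * (yn (m + 1) (f t) ^ 2 * an r)) := by ring
      _ ≤ _ := by
        have hp : 0 ≤ Real.pi * C₁ := by positivity
        have hq : 0 ≤ Real.pi ^ 2 * C₂ := by positivity
        rw [mul_add (2 * Real.pi * (2 * C₁) + 3 * C₁ + 2 * Real.pi ^ 2 * C₂)]
        gcongr <;> nlinarith

theorem norm_tri_le_first {R : ℝ} {F G H : ℝ → ℂ} (hF : BL R F) (hG : BL R G)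
    (hH : BL R H) {q : ℝ → ℝ → ℝ → ℝ} (hq : ∀ x y z, x + y + z = 0 → |q x y z| ≤ |x|) :
    ‖tri q F G H‖ ≤ an F * yn 0 G * yn 0 H := by
  have nn := an_nonneg F
  have nn' := yn_nonneg 0 G
  have nn'' := yn_nonneg 0 H
  refine toReal_le_of_enorm_le (enorm_tri_le_lintegral q F G H) ?_ (by positivity)
  calc _ ≤ triAbs (wt 1 F) (wt 0 G) (wt 0 H) := by
        refine lintegral_mono fun p => ?_
        simp only [enorm_wt, pow_one, pow_zero, ENNReal.ofReal_one, one_mul]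
        refine (mul_le_mul_left (ENNReal.ofReal_le_ofReal (hq p.1 p.2 (-p.1 - p.2) (by ring)))
          _).trans (le_of_eq (by ring))
    _ ≤ An F * Yn 0 G * Yn 0 H :=
        triAbs_le (measurable_wt _ hF.meas) (measurable_wt _ hG.meas) (measurable_wt _ hH.meas)
    _ = _ := by
        rw [← hF.ofReal_an, ← hG.ofReal_yn, ← hH.ofReal_yn, ENNReal.ofReal_mul (by positivity),
          ENNReal.ofReal_mul (by positivity)]

theorem norm_quad_le_firstTwo {R : ℝ} {F G : ℝ → ℂ} (hF : BL R F) (hG : BL R G)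
    {q : ℝ → ℝ → ℝ → ℝ → ℝ} {C : ℝ} (hC : 0 ≤ C)
    (hq : ∀ x y z w, x + y + z + w = 0 → |q x y z w| ≤ C * (|x| * |y|)) :
    ‖quad q F F G G‖ ≤ C * (an F ^ 2 * yn 0 G ^ 2) := by
  have nn := an_nonneg F
  have nn' := yn_nonneg 0 G
  refine toReal_le_of_enorm_le (enorm_quad_le_lintegral q F F G G) ?_ (by positivity)
  calc _ ≤ ∫⁻ p : (ℝ × ℝ) × ℝ, ENNReal.ofReal C * (ENNReal.ofReal (|p.1.1| * |p.1.2|) *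
        (‖F p.1.1‖ₑ * ‖F p.1.2‖ₑ * ‖G p.2‖ₑ * ‖G (-p.1.1 - p.1.2 - p.2)‖ₑ)) := by
        refine lintegral_mono fun p => ?_
        rw [← mul_assoc (ENNReal.ofReal C), ← ENNReal.ofReal_mul hC]
        gcongr
        exact hq _ _ _ _ (by ring)
    _ = ENNReal.ofReal C * ∫⁻ p : (ℝ × ℝ) × ℝ, (ENNReal.ofReal (|p.1.1| * |p.1.2|) *
        (‖F p.1.1‖ₑ * ‖F p.1.2‖ₑ * ‖G p.2‖ₑ * ‖G (-p.1.1 - p.1.2 - p.2)‖ₑ)) :=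
        lintegral_const_mul' _ _ ENNReal.ofReal_ne_top
    _ ≤ ENNReal.ofReal C * (An F ^ 2 * Yn 0 G ^ 2) := by
        gcongr
        exact lintegral_firstTwo_le hF.meas hG.meas
    _ = _ := by
        rw [← hF.ofReal_an, ← hG.ofReal_yn, ENNReal.ofReal_mul hC,
          ENNReal.ofReal_mul (by positivity), ENNReal.ofReal_pow nn, ENNReal.ofReal_pow nn']

/-- The symbol of the cubic correction of the `L²` energy of a difference. -/
noncomputable def diffSymbol (x y z : ℝ) : ℝ := |x| * (sg y * sg z)

theorem sym3_diffSymbol : Sym3 diffSymbol :=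
  (Continuous.sym1 continuous_abs).sym3_fst.mul (sym1_sg.sym3_snd.mul sym1_sg.sym3_thd)

theorem abs_diffSymbol (x y z : ℝ) : |diffSymbol x y z| = |x| := by
  rw [diffSymbol, abs_mul, abs_mul, abs_sg, abs_sg, abs_abs]; ring

theorem tri_diffSymbol_swap (F G H : ℝ → ℂ) : tri diffSymbol F G H = tri diffSymbol F H G := by
  rw [tri_swap23]
  exact tri_congr (fun x y z _ => by unfold diffSymbol; ring) _ _ _

/-- The modified energy of the difference `V` of two solutions with mean `S`. -/
noncomputable def diffEnergy (S V : ℝ → ℂ) : ℝ :=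
  yn 0 V ^ 2 + 2 * Real.pi * (tri diffSymbol S V V).re

theorem abs_diffEnergy_sub_le {R : ℝ} {S V : ℝ → ℂ} (hS : BL R S) (hV : BL R V) :
    |diffEnergy S V - yn 0 V ^ 2| ≤ 2 * Real.pi * (an S * yn 0 V ^ 2) := by
  have hpi := Real.pi_pos
  rw [diffEnergy, add_sub_cancel_left, abs_mul, abs_of_pos (by positivity : 0 < 2 * Real.pi)]
  gcongr
  refine ((Complex.abs_re_le_norm _).trans (norm_tri_le_first hS hV hV fun x y z _ =>
    (abs_diffSymbol x y z).le)).trans (le_of_eq (by ring))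

theorem tri_diffSymbol_sg {R : ℝ} {S V : ℝ → ℂ} (hS : BL R S) (hV : BL R V) :
    tri diffSymbol (fun x => (sg x : ℂ) * S x) V V + tri diffSymbol S (fun x => (sg x : ℂ) * V x) V +
      tri diffSymbol S V (fun x => (sg x : ℂ) * V x) = -tri (fun x _ _ => x) S V V := by
  have hc := sym3_diffSymbol
  have s1 := hc.mul sym1_sg.sym3_fst
  have s2 := hc.mul sym1_sg.sym3_snd
  have s3 := hc.mul sym1_sg.sym3_thd
  have e1 : tri diffSymbol (fun x => (sg x : ℂ) * S x) V V =
      tri (fun x y z => diffSymbol x y z * sg x) S V V := by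
    unfold tri
    refine integral_congr_ae (Eventually.of_forall fun p => ?_)
    simp only
    push_cast
    ring
  have e2 : tri diffSymbol S (fun x => (sg x : ℂ) * V x) V =
      tri (fun x y z => diffSymbol x y z * sg y) S V V := by
    unfold tri
    refine integral_congr_ae (Eventually.of_forall fun p => ?_)
    simp only
    push_cast
    ring
  have e3 : tri diffSymbol S V (fun x => (sg x : ℂ) * V x) =
      tri (fun x y z => diffSymbol x y z * sg z) S V V := by
    unfold tri
    refine integral_congr_ae (Eventually.of_forall fun p => ?_)
    simp only
    push_cast
    ring
  have e4 : -tri (fun x _ _ => x) S V V = tri (fun x _ _ => (-1) * x) S V V := by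
    rw [tri_const_mul]; simp
  rw [e1, e2, e3, e4, ← tri_add (hS.triIntegrable hV hV s1) (hS.triIntegrable hV hV s2),
    ← tri_add (hS.triIntegrable hV hV (s1.add s2)) (hS.triIntegrable hV hV s3)]
  refine tri_congr (fun x y z h => ?_) _ _ _
  by_cases h0 : x = 0 ∧ y = 0 ∧ z = 0
  · obtain ⟨rfl, rfl, rfl⟩ := h0
    simp [diffSymbol]
  · have := sg_prod_mul_sum h h0
    unfold diffSymbol
    rw [← sg_mul_self x]
    linear_combination x * this

theorem tri_fst_symm {R : ℝ} {S V : ℝ → ℂ} (hS : BL R S) (hV : BL R V) :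
    2 * tri (fun x _ _ => x) V S V = -tri (fun x _ _ => x) S V V := by
  have h := Continuous.sym1 (p := fun x : ℝ => x) continuous_id
  have e1 : tri (fun x _ _ => x) V S V = tri (fun _ y _ => y) S V V := tri_swap12 _ _ _ _
  have e2 : tri (fun _ y _ => y) S V V = tri (fun _ _ z => z) S V V := tri_swap23 _ _ _ _
  have e4 : -tri (fun x _ _ => x) S V V = tri (fun x _ _ => (-1) * x) S V V := by
    rw [tri_const_mul]; simp
  rw [two_mul, e1, e4]
  nth_rewrite 2 [e2]
  rw [← tri_add (hS.triIntegrable hV hV h.sym3_snd) (hS.triIntegrable hV hV h.sym3_thd)]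
  exact tri_congr (fun x y z h => by linarith) _ _ _

theorem tri_diffSymbol_conv_first {R : ℝ} {F V : ℝ → ℂ} (hF : BL R F) (hV : BL R V) :
    tri diffSymbol (fun ξ => (ξ : ℂ) * conv F F ξ) V V =
      quad (fun x y z w => |x + y| * (x + y) * (sg z * sg w)) F F V V := by
  have s0 : Sym3 (fun x y z => |z| * (sg x * sg y)) :=
    (Continuous.sym1 continuous_abs).sym3_thd.mul (sym1_sg.sym3_fst.mul sym1_sg.sym3_snd)
  have s1 : Sym4 (fun x y z w => |z + w| * (sg x * sg y) * (z + w)) :=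
    (s0.mul (Continuous.sym1 continuous_id).sym3_thd).sym4
  have e1 : tri diffSymbol (fun ξ => (ξ : ℂ) * conv F F ξ) V V =
      tri (fun x y z => |z| * (sg x * sg y)) V V (fun ξ => (ξ : ℂ) * conv F F ξ) := by
    rw [tri_swap12, tri_swap23]; rfl
  rw [e1, tri_conv_eq_quad (hV.quadIntegrable hV hF hF s1), quad_swap23, quad_swap12, quad_swap34,
    quad_swap23]
  exact quad_congr (fun x y z w _ => by ring) _ _ _ _

theorem tri_diffSymbol_conv_thd {R : ℝ} {S V : ℝ → ℂ} (hS : BL R S) (hV : BL R V) :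
    4 * tri diffSymbol S V (fun ξ => (ξ : ℂ) * conv S V ξ) +
      quad (fun x y z w => |x + y| * (x + y) * (sg z * sg w)) S S V V =
      quad differenceSymbol S S V V := by
  have s1 : Sym4 (fun x y z w => diffSymbol x y (z + w) * (z + w)) :=
    (sym3_diffSymbol.mul (Continuous.sym1 continuous_id).sym3_thd).sym4
  have j1 := hS.quadIntegrable hS hV hV s1.swap23
  have j2 := hS.quadIntegrable hS hV hV s1.swap23.swap34
  have j3 := hS.quadIntegrable hS hV hV s1.swap23.swap12
  have j4 := hS.quadIntegrable hS hV hV s1.swap23.swap34.swap12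
  have s5 : Sym4 (fun x y z w => |x + y| * (x + y) * (sg z * sg w)) := by
    have s0 : Sym3 (fun x y z => |z| * (sg x * sg y)) :=
      (Continuous.sym1 continuous_abs).sym3_thd.mul (sym1_sg.sym3_fst.mul sym1_sg.sym3_snd)
    have : Sym4 (fun x y z w => |z + w| * (sg x * sg y) * (z + w)) :=
      (s0.mul (Continuous.sym1 continuous_id).sym3_thd).sym4
    have := this.swap23.swap12.swap34.swap23
    refine ⟨?_, ?_⟩
    · convert this.1 using 2; ring
    · intro R
      obtain ⟨C, hC, h⟩ := this.2 R
      refine ⟨C, hC, fun x y z w a b c d => ?_⟩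
      convert h x y z w a b c d using 2; ring
  have j5 := hS.quadIntegrable hS hV hV s5
  have e1 : tri diffSymbol S V (fun ξ => (ξ : ℂ) * conv S V ξ) =
      quad (fun x y z w => diffSymbol x z (y + w) * (y + w)) S S V V := by
    rw [tri_conv_eq_quad (hS.quadIntegrable hV hS hV s1), quad_swap23]
  have e2 : quad (fun x y z w => diffSymbol x z (y + w) * (y + w)) S S V V =
      quad (fun x y z w => diffSymbol x w (y + z) * (y + z)) S S V V := quad_swap34 _ _ _ _ _
  have e3 : quad (fun x y z w => diffSymbol x z (y + w) * (y + w)) S S V V =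
      quad (fun x y z w => diffSymbol y z (x + w) * (x + w)) S S V V := quad_swap12 _ _ _ _ _
  have e4 : quad (fun x y z w => diffSymbol x w (y + z) * (y + z)) S S V V =
      quad (fun x y z w => diffSymbol y w (x + z) * (x + z)) S S V V := quad_swap12 _ _ _ _ _
  have e6 : quad differenceSymbol S S V V =
      quad (fun x y z w => diffSymbol x z (y + w) * (y + w)) S S V V +
      quad (fun x y z w => diffSymbol x w (y + z) * (y + z)) S S V V +
      quad (fun x y z w => diffSymbol y z (x + w) * (x + w)) S S V V +
      quad (fun x y z w => diffSymbol y w (x + z) * (x + z)) S S V V +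
      quad (fun x y z w => |x + y| * (x + y) * (sg z * sg w)) S S V V := by
    have k1 : QuadIntegrable (fun x y z w => diffSymbol x z (y + w) * (y + w) +
        diffSymbol x w (y + z) * (y + z)) S S V V := by
      refine (j1.add j2).congr (Eventually.of_forall fun p => ?_)
      simp only [Pi.add_apply]; push_cast; ring
    have k2 : QuadIntegrable (fun x y z w => diffSymbol x z (y + w) * (y + w) +
        diffSymbol x w (y + z) * (y + z) + diffSymbol y z (x + w) * (x + w)) S S V V := by
      refine (k1.add j3).congr (Eventually.of_forall fun p => ?_)
      simp only [Pi.add_apply]; push_cast; ring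
    have k3 : QuadIntegrable (fun x y z w => diffSymbol x z (y + w) * (y + w) +
        diffSymbol x w (y + z) * (y + z) + diffSymbol y z (x + w) * (x + w) +
        diffSymbol y w (x + z) * (x + z)) S S V V := by
      refine (k2.add j4).congr (Eventually.of_forall fun p => ?_)
      simp only [Pi.add_apply]; push_cast; ring
    rw [← quad_add j1 j2, ← quad_add k1 j3, ← quad_add k2 j4, ← quad_add k3 j5]
    refine quad_congr (fun x y z w _ => ?_) _ _ _ _
    simp only [differenceSymbol, diffSymbol, ← sg_mul_self (x + w), ← sg_mul_self (y + w),
      ← sg_mul_self (x + z), ← sg_mul_self (y + z)]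
    ring
  rw [e6, ← e4, ← e3, ← e2, e1]
  ring

theorem conv_self_of_add {S V : ℝ → ℂ} (hS : MemLp S 2 volume) (hV : MemLp V 2 volume) (c : ℂ)
    (ξ : ℝ) : conv (fun x => S x + c * V x) (fun x => S x + c * V x) ξ =
      conv S S ξ + 2 * c * conv S V ξ + c ^ 2 * conv V V ξ := by
  have hV' : MemLp (fun x => c * V x) 2 volume := hV.const_mul c
  rw [conv_add_left hS hV' (show MemLp (fun x => S x + c * V x) 2 volume from hS.add hV'), conv_add_right hS hS hV', conv_add_right hV' hS hV',
    conv_const_mul_left, conv_const_mul_left, conv_const_mul_right, conv_const_mul_right,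
    conv_comm V S]
  ring

/-- The mean `S` and difference `V` of two approximate solutions. -/
structure ApproxPairAt (R : ℝ) (S V S' V' r ρ : L2C) : Prop where
  bandS : Band (R / 2) S
  bandV : Band (R / 2) V
  hermS : Herm S
  hermV : Herm V
  bandS' : Band R S'
  hermS' : Herm S'
  bandV' : Band R V'
  band_r : Band R r
  band_ρ : Band R ρ
  nonneg : 0 ≤ R
  eqS : S' =ᵐ[volume] fun ξ => -Complex.I * ((sg ξ : ℂ) * S ξ) +
    (-(Complex.I * Real.pi)) * ((ξ : ℂ) * conv S S ξ) +
    (-(Complex.I * Real.pi) / 4) * ((ξ : ℂ) * conv V V ξ) + r ξ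
  eqV : V' =ᵐ[volume] fun ξ => -Complex.I * ((sg ξ : ℂ) * V ξ) +
    (-(2 * Complex.I * Real.pi)) * ((ξ : ℂ) * conv S V ξ) + ρ ξ

namespace ApproxPairAt

variable {R : ℝ} {S V S' V' r ρ : L2C}

theorem blS (h : ApproxPairAt R S V S' V' r ρ) : BL R S :=
  BL.of_coe (h.bandS.mono (by linarith [h.nonneg]))

theorem blV (h : ApproxPairAt R S V S' V' r ρ) : BL R V :=
  BL.of_coe (h.bandV.mono (by linarith [h.nonneg]))

theorem bl_conv {F G : L2C} (hF : Band (R / 2) F) (hG : Band (R / 2) G) :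
    BL R (fun ξ => (ξ : ℂ) * conv F G ξ) := by
  have := ((BL.of_coe hF).conv (BL.of_coe hG)).id_mul
  rwa [mul_div_cancel₀ R two_ne_zero] at this

theorem re_ip (h : ApproxPairAt R S V S' V' r ρ) :
    2 * (ip 0 V V').re = -2 * Real.pi * (Complex.I * tri (fun x _ _ => x) S V V).re +
      2 * (ip 0 V ρ).re := by
  have hc := bl_conv h.bandS h.bandV
  have hρ := BL.of_coe h.band_ρ
  have e := ip_id_mul_conv h.blV h.hermV h.blS h.blV 0
  have e' : tri (fun x _ _ => x ^ (2 * 0 + 1)) V S V = tri (fun x _ _ => x) V S V :=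
    tri_congr (fun x y z _ => by ring) _ _ _
  rw [ip_congr 0 V h.eqV, ip_add_right h.blV ((h.blV.sg_mul.const_mul _).add
      (hc.const_mul _)).memLp hρ.memLp, ip_add_right h.blV (h.blV.sg_mul.const_mul _).memLp
      (hc.const_mul _).memLp, ip_const_mul_right, ip_const_mul_right, e, e']
  have h1 := im_ip_sg 0 V
  have h2 := tri_fst_symm h.blS h.blV
  rw [show tri (fun x _ _ => x) S V V = -(2 * tri (fun x _ _ => x) V S V) by rw [h2, neg_neg]]
  simp only [Complex.add_re, Complex.mul_re, Complex.neg_re, Complex.neg_im, Complex.I_re,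
    Complex.I_im, Complex.mul_im, Complex.ofReal_re, Complex.ofReal_im, h1, Complex.re_ofNat,
    Complex.im_ofNat]
  ring

theorem tri_deriv (h : ApproxPairAt R S V S' V' r ρ) :
    tri diffSymbol S' V V + tri diffSymbol S V' V + tri diffSymbol S V V' =
      Complex.I * tri (fun x _ _ => x) S V V -
      Complex.I * Real.pi * quad differenceSymbol S S V V -
      Complex.I * Real.pi / 4 *
        quad (fun x y z w => |x + y| * (x + y) * (sg z * sg w)) V V V V +
      tri diffSymbol r V V + 2 * tri diffSymbol S V ρ := by
  have hs := h.blS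
  have hv := h.blV
  have hr := BL.of_coe h.band_r
  have hρ := BL.of_coe h.band_ρ
  have cSS := bl_conv h.bandS h.bandS
  have cVV := bl_conv h.bandV h.bandV
  have cSV := bl_conv h.bandS h.bandV
  have hd := sym3_diffSymbol
  have rot : ∀ F : ℝ → ℂ, tri diffSymbol F V V = tri (fun x y z => |z| * (sg x * sg y)) V V F := by
    intro F
    rw [tri_swap12, tri_swap23]; rfl
  have hd' : Sym3 (fun x y z => |z| * (sg x * sg y)) :=
    (Continuous.sym1 continuous_abs).sym3_thd.mul (sym1_sg.sym3_fst.mul sym1_sg.sym3_snd)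
  have eS : tri diffSymbol S' V V = -Complex.I * tri diffSymbol (fun x => (sg x : ℂ) * S x) V V +
      (-(Complex.I * Real.pi)) * tri diffSymbol (fun ξ => (ξ : ℂ) * conv S S ξ) V V +
      (-(Complex.I * Real.pi) / 4) * tri diffSymbol (fun ξ => (ξ : ℂ) * conv V V ξ) V V +
      tri diffSymbol r V V := by
    simp only [rot]
    have l1 := hs.sg_mul.const_mul (-Complex.I)
    have l2 := cSS.const_mul (-(Complex.I * Real.pi))
    have l3 := cVV.const_mul (-(Complex.I * Real.pi) / 4)
    rw [tri_congr_ae _ EventuallyEq.rfl EventuallyEq.rfl h.eqS,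
      tri_add_right (hv.triIntegrable hv ((l1.add l2).add l3) hd') (hv.triIntegrable hv hr hd'),
      tri_add_right (hv.triIntegrable hv (l1.add l2) hd') (hv.triIntegrable hv l3 hd'),
      tri_add_right (hv.triIntegrable hv l1 hd') (hv.triIntegrable hv l2 hd'),
      tri_const_mul_right, tri_const_mul_right, tri_const_mul_right]
  have eV : tri diffSymbol S V V' = -Complex.I * tri diffSymbol S V (fun x => (sg x : ℂ) * V x) +
      (-(2 * Complex.I * Real.pi)) * tri diffSymbol S V (fun ξ => (ξ : ℂ) * conv S V ξ) +
      tri diffSymbol S V ρ := by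
    have l1 := hv.sg_mul.const_mul (-Complex.I)
    have l2 := cSV.const_mul (-(2 * Complex.I * Real.pi))
    rw [tri_congr_ae _ EventuallyEq.rfl EventuallyEq.rfl h.eqV,
      tri_add_right (hs.triIntegrable hv (l1.add l2) hd) (hs.triIntegrable hv hρ hd),
      tri_add_right (hs.triIntegrable hv l1 hd) (hs.triIntegrable hv l2 hd),
      tri_const_mul_right, tri_const_mul_right]
  have e1 := tri_diffSymbol_sg hs hv
  rw [tri_diffSymbol_swap S (fun x => (sg x : ℂ) * V x) V] at e1
  have e2 := tri_diffSymbol_conv_thd hs hv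
  rw [tri_diffSymbol_swap S V' V, eS, eV, tri_diffSymbol_conv_first hs hv,
    tri_diffSymbol_conv_first hv hv, ← e2]
  linear_combination -Complex.I * e1

end ApproxPairAt

theorem exists_diffEnergy_estimate : ∃ C : ℝ, 0 ≤ C ∧
    ∀ (R : ℝ) (S V : ℝ → L2C) (S' V' r ρ : L2C) (t : ℝ),
      ApproxPairAt R (S t) (V t) S' V' r ρ → HasDerivAt S S' t → HasDerivAt V V' t →
      (∀ᶠ τ in 𝓝 t, Band R (S τ) ∧ Herm (S τ)) → (∀ᶠ τ in 𝓝 t, Band R (V τ)) →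
      ∃ D, HasDerivAt (fun τ => diffEnergy (S τ) (V τ)) D t ∧
        |D| ≤ C * ((an (S t) ^ 2 + an (V t) ^ 2) * yn 0 (V t) ^ 2) +
          2 * (yn 0 (V t) * yn 0 ρ) +
          C * (an r * yn 0 (V t) ^ 2 + an (S t) * yn 0 (V t) * yn 0 ρ) := by
  have hpi := Real.pi_pos
  refine ⟨48 * Real.pi ^ 2 + 4 * Real.pi, by positivity, ?_⟩
  intro R S V S' V' r ρ t h hS hV hSb hVb
  have hy := hasDerivAt_yn_sq hV hVb h.bandV' 0
  have ht := hasDerivAt_tri (p := fun x => |x|) (Continuous.sym1 continuous_abs)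
    (fun x => abs_neg x) hS hV hSb hVb h.bandS' h.hermS' h.bandV'
  change HasDerivAt (fun τ => tri diffSymbol (S τ) (V τ) (V τ)) (tri diffSymbol S' (V t) (V t) +
    tri diffSymbol (S t) V' (V t) + tri diffSymbol (S t) (V t) V') t at ht
  rw [h.tri_deriv] at ht
  have htre := Complex.reCLM.hasFDerivAt.comp_hasDerivAt t ht
  have hD := hy.add (htre.const_mul (2 * Real.pi))
  refine ⟨_, hD, ?_⟩
  rw [h.re_ip]
  have hs := h.blS
  have hv := h.blV
  have hr := BL.of_coe h.band_r
  have hρ := BL.of_coe h.band_ρ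
  have b1 : |(ip 0 (V t) ρ).re| ≤ yn 0 (V t) * yn 0 ρ :=
    (Complex.abs_re_le_norm _).trans (norm_ip_le hv.band hρ.band 0)
  have b2 : |(Complex.I * quad differenceSymbol (S t) (S t) (V t) (V t)).re| ≤
      8 * (an (S t) ^ 2 * yn 0 (V t) ^ 2) := by
    refine (Complex.abs_re_le_norm _).trans ?_
    rw [norm_mul, Complex.norm_I, one_mul]
    exact norm_quad_le_firstTwo hs hv (by norm_num) fun x y z w h => abs_differenceSymbol_le h
  have b3 : |(Complex.I * quad (fun x y z w => |x + y| * (x + y) * (sg z * sg w))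
      (V t) (V t) (V t) (V t)).re| ≤ 16 * (6 * (an (V t) ^ 2 * yn 0 (V t) ^ 2)) := by
    refine (Complex.abs_re_le_norm _).trans ?_
    rw [norm_mul, Complex.norm_I, one_mul]
    refine norm_quad_le_quarticWeight (n := 0) hv (by norm_num) fun x y z w h => ?_
    rw [abs_mul, abs_mul (sg z), abs_sg, abs_sg, mul_one, mul_one]
    refine (sq_add_le_pairWeight h).trans (le_of_eq ?_)
    simp only [pairWeight, quarticWeight, pow_zero]
    ring
  have b4 : |(tri diffSymbol r (V t) (V t)).re| ≤ an r * yn 0 (V t) * yn 0 (V t) :=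
    (Complex.abs_re_le_norm _).trans (norm_tri_le_first hr hv hv fun x y z _ =>
      (abs_diffSymbol x y z).le)
  have b5 : |(tri diffSymbol (S t) (V t) ρ).re| ≤ an (S t) * yn 0 (V t) * yn 0 ρ :=
    (Complex.abs_re_le_norm _).trans (norm_tri_le_first hs hv hρ fun x y z _ =>
      (abs_diffSymbol x y z).le)
  have n1 := an_nonneg (S t)
  have n2 := an_nonneg (V t)
  have n3 := an_nonneg r
  have n4 := yn_nonneg 0 (V t)
  have n5 := yn_nonneg 0 ρ
  set X := tri (fun x _ _ => x) (S t) (V t) (V t)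
  set Q₁ := quad differenceSymbol (S t) (S t) (V t) (V t)
  set Q₂ := quad (fun x y z w => |x + y| * (x + y) * (sg z * sg w)) (V t) (V t) (V t) (V t)
  set T₁ := tri diffSymbol r (V t) (V t)
  set T₂ := tri diffSymbol (S t) (V t) ρ
  have e : -2 * Real.pi * (Complex.I * X).re + 2 * (ip 0 (V t) ρ).re + 2 * Real.pi *
      Complex.reCLM (Complex.I * X - Complex.I * Real.pi * Q₁ - Complex.I * Real.pi / 4 * Q₂ +
        T₁ + 2 * T₂) = 2 * (ip 0 (V t) ρ).re + 2 * Real.pi * (-(Real.pi * (Complex.I * Q₁).re) -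
        Real.pi / 4 * (Complex.I * Q₂).re + T₁.re + 2 * T₂.re) := by
    rw [show Complex.I * X - Complex.I * Real.pi * Q₁ - Complex.I * Real.pi / 4 * Q₂ +
        T₁ + 2 * T₂ = Complex.I * X - (Real.pi : ℝ) * (Complex.I * Q₁) -
        (Real.pi / 4 : ℝ) * (Complex.I * Q₂) + T₁ + (2 : ℝ) * T₂ by push_cast; ring]
    simp only [Complex.reCLM_apply, Complex.add_re, Complex.sub_re, Complex.re_ofReal_mul]
    ring
  rw [e]
  have c1 : |-(Real.pi * (Complex.I * Q₁).re) - Real.pi / 4 * (Complex.I * Q₂).re + T₁.re +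
      2 * T₂.re| ≤ Real.pi * (8 * (an (S t) ^ 2 * yn 0 (V t) ^ 2)) +
      Real.pi / 4 * (16 * (6 * (an (V t) ^ 2 * yn 0 (V t) ^ 2))) +
      an r * yn 0 (V t) * yn 0 (V t) + 2 * (an (S t) * yn 0 (V t) * yn 0 ρ) := by
    rw [abs_le] at *
    have := mul_le_mul_of_nonneg_left b2.1 hpi.le
    have := mul_le_mul_of_nonneg_left b2.2 hpi.le
    have := mul_le_mul_of_nonneg_left b3.1 (by positivity : 0 ≤ Real.pi / 4)
    have := mul_le_mul_of_nonneg_left b3.2 (by positivity : 0 ≤ Real.pi / 4)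
    constructor <;> linarith [b4.1, b4.2, b5.1, b5.2]
  refine (abs_add_le _ _).trans ?_
  rw [abs_mul, abs_mul, abs_two, abs_of_pos (by positivity : 0 < 2 * Real.pi)]
  calc _ ≤ 2 * (yn 0 (V t) * yn 0 ρ) + 2 * Real.pi *
      (Real.pi * (8 * (an (S t) ^ 2 * yn 0 (V t) ^ 2)) +
      Real.pi / 4 * (16 * (6 * (an (V t) ^ 2 * yn 0 (V t) ^ 2))) +
      an r * yn 0 (V t) * yn 0 (V t) + 2 * (an (S t) * yn 0 (V t) * yn 0 ρ)) := by gcongr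
    _ = 16 * Real.pi ^ 2 * (an (S t) ^ 2 * yn 0 (V t) ^ 2) +
        48 * Real.pi ^ 2 * (an (V t) ^ 2 * yn 0 (V t) ^ 2) + 2 * (yn 0 (V t) * yn 0 ρ) +
        (2 * Real.pi * (an r * yn 0 (V t) ^ 2) +
          4 * Real.pi * (an (S t) * yn 0 (V t) * yn 0 ρ)) := by ring
    _ ≤ (48 * Real.pi ^ 2 + 4 * Real.pi) * (an (S t) ^ 2 * yn 0 (V t) ^ 2) +
        (48 * Real.pi ^ 2 + 4 * Real.pi) * (an (V t) ^ 2 * yn 0 (V t) ^ 2) +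
        2 * (yn 0 (V t) * yn 0 ρ) +
        ((48 * Real.pi ^ 2 + 4 * Real.pi) * (an r * yn 0 (V t) ^ 2) +
          (48 * Real.pi ^ 2 + 4 * Real.pi) * (an (S t) * yn 0 (V t) * yn 0 ρ)) := by
        have := sq_nonneg Real.pi
        gcongr <;> linarith
    _ = _ := by ring

/-- A vector field of quadratic growth which is orthogonal to the position has integral curves on
all time intervals, of constant norm. -/
theorem exists_curve_of_orthogonal {E : Type*} [NormedAddCommGroup E] [InnerProductSpace ℝ E]
    [CompleteSpace E] (G : E → E) {c : ℝ} (hc : 0 ≤ c) (h0 : ∀ x, ‖G x‖ ≤ c * (‖x‖ + ‖x‖ ^ 2))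
    (h1 : ∀ x y b, ‖x‖ ≤ b → ‖y‖ ≤ b → ‖G x - G y‖ ≤ c * (1 + b) * ‖x - y‖)
    (h2 : ∀ x, inner ℝ x (G x) = 0) (x₀ : E) {T : ℝ} (hT : 0 < T) :
    ∃ f : ℝ → E, f 0 = x₀ ∧ ∀ t ∈ Ioo (-T) T, HasDerivAt f (G (f t)) t ∧ ‖f t‖ = ‖x₀‖ := by
  set R : ℝ := ‖x₀‖ + 1 with hR
  have hx₀ := norm_nonneg x₀
  have hR1 : 1 ≤ R := by linarith
  have hR2 : 1 ≤ R ^ 2 := one_le_pow₀ hR1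
  set m : E → ℝ := fun x => max (R ^ 2) (‖x‖ ^ 2)
  have hm1 : ∀ x, R ^ 2 ≤ m x := fun x => le_max_left _ _
  have hm0 : ∀ x, 0 < m x := fun x => by linarith [hm1 x]
  set l : E → ℝ := fun x => R ^ 2 / m x
  have hl0 : ∀ x, 0 ≤ l x := fun x => div_nonneg (sq_nonneg R) (hm0 x).le
  have hl1 : ∀ x, l x ≤ 1 := fun x => div_le_one_of_le₀ (hm1 x) (hm0 x).le
  have hl2 : ∀ x, l x * ‖x‖ ^ 2 ≤ R ^ 2 := fun x => by
    rw [div_mul_eq_mul_div, div_le_iff₀ (hm0 x)]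
    exact mul_le_mul_of_nonneg_left (le_max_right _ _) (sq_nonneg R)
  have hll : ∀ x y b, ‖x‖ ≤ b → ‖y‖ ≤ b → |l x - l y| ≤ 2 * b * ‖x - y‖ := by
    intro x y b hx hy
    have e : l x - l y = R ^ 2 * (m y - m x) / (m x * m y) := by
      have := (hm0 x).ne'; have := (hm0 y).ne'
      simp only [l]; field_simp
    have e1 : |m y - m x| ≤ 2 * b * ‖x - y‖ := by
      refine (abs_max_sub_max_le_max _ _ _ _).trans ?_
      rw [sub_self, abs_zero]
      refine max_le (mul_nonneg (mul_nonneg two_pos.le ((norm_nonneg x).trans hx))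
        (norm_nonneg _)) ?_
      rw [show ‖y‖ ^ 2 - ‖x‖ ^ 2 = (‖y‖ + ‖x‖) * (‖y‖ - ‖x‖) by ring, abs_mul,
        abs_of_nonneg (by positivity : 0 ≤ ‖y‖ + ‖x‖)]
      refine mul_le_mul (by linarith) ?_ (abs_nonneg _) (by linarith [norm_nonneg x])
      rw [norm_sub_rev]
      exact abs_norm_sub_norm_le y x
    rw [e, abs_div, abs_mul, abs_of_nonneg (sq_nonneg R), abs_of_pos (mul_pos (hm0 x) (hm0 y)),
      div_le_iff₀ (mul_pos (hm0 x) (hm0 y)), mul_comm]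
    refine mul_le_mul e1 ?_ (sq_nonneg R) ((abs_nonneg _).trans e1)
    nlinarith [hm1 x, hm1 y, hm0 x]
  set L : ℝ := c * (1 + 2 * R ^ 2)
  have hL0 : 0 ≤ L := by positivity
  set a : ℝ := L * T
  have ha : 0 ≤ a := by positivity
  set b : ℝ := ‖x₀‖ + a
  have hb : 0 ≤ b := by positivity
  set K : ℝ := c * (1 + b) + 2 * b * (c * (b + b ^ 2))
  have hK : 0 ≤ K := by positivity
  have hball : ∀ x ∈ Metric.closedBall x₀ a, ‖x‖ ≤ b := fun x hx => by
    rw [mem_closedBall_iff_norm] at hx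
    calc ‖x‖ = ‖x₀ + (x - x₀)‖ := by rw [add_sub_cancel]
      _ ≤ ‖x₀‖ + ‖x - x₀‖ := norm_add_le _ _
      _ ≤ b := add_le_add le_rfl hx
  have h0T : (0 : ℝ) ∈ Icc (-T) T := ⟨by linarith, hT.le⟩
  have hPL : IsPicardLindelof (fun (_ : ℝ) x => l x • G x) (tmin := -T) (tmax := T) ⟨0, h0T⟩ x₀
      ⟨a, ha⟩ 0 ⟨L, hL0⟩ ⟨K, hK⟩ := by
    refine ⟨fun t _ => LipschitzOnWith.of_dist_le_mul fun x hx y hy => ?_,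
      fun x _ => continuousOn_const, fun t _ x _ => ?_, ?_⟩
    · rw [dist_eq_norm, dist_eq_norm]
      have hx' := hball x hx
      have hy' := hball y hy
      calc ‖l x • G x - l y • G y‖ = ‖l x • (G x - G y) + (l x - l y) • G y‖ := by
            congr 1; module
        _ ≤ ‖l x • (G x - G y)‖ + ‖(l x - l y) • G y‖ := norm_add_le _ _
        _ = l x * ‖G x - G y‖ + |l x - l y| * ‖G y‖ := by
            rw [norm_smul, norm_smul, Real.norm_of_nonneg (hl0 x), Real.norm_eq_abs]
        _ ≤ 1 * (c * (1 + b) * ‖x - y‖) + 2 * b * ‖x - y‖ * (c * (b + b ^ 2)) := by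
            gcongr
            · exact hl1 x
            · exact h1 x y b hx' hy'
            · exact hll x y b hx' hy'
            · exact (h0 y).trans (by gcongr)
        _ = K * ‖x - y‖ := by ring
    · rw [norm_smul, Real.norm_of_nonneg (hl0 x)]
      calc l x * ‖G x‖ ≤ l x * (c * (1 + 2 * ‖x‖ ^ 2)) := by
            gcongr
            exact (h0 x).trans (mul_le_mul_of_nonneg_left
              (by nlinarith [sq_nonneg (‖x‖ - 1)]) hc)
        _ = c * (l x + 2 * (l x * ‖x‖ ^ 2)) := by ring
        _ ≤ c * (1 + 2 * R ^ 2) := by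
            gcongr
            · exact hl1 x
            · exact hl2 x
    · simp only [sub_zero, zero_sub, neg_neg, max_self, NNReal.coe_zero]
      exact le_rfl
  obtain ⟨f, hf0, hf⟩ := hPL.exists_eq_forall_mem_Icc_hasDerivWithinAt₀
  have hnorm : ∀ t ∈ Icc (-T) T, ‖f t‖ ^ 2 = ‖x₀‖ ^ 2 := by
    intro t ht
    have := Convex.norm_image_sub_le_of_norm_hasDerivWithin_le (C := 0)
      (fun s hs => (hf s hs).norm_sq) (fun s _ => by rw [inner_smul_right, h2]; simp)
      (convex_Icc (-T) T) h0T ht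
    rw [zero_mul, norm_le_zero_iff, sub_eq_zero] at this
    rw [this]
    exact congrArg (fun z => ‖z‖ ^ 2) hf0
  refine ⟨f, hf0, fun t ht => ?_⟩
  have ht' := Ioo_subset_Icc_self ht
  have hn := hnorm t ht'
  refine ⟨?_, (sq_eq_sq₀ (norm_nonneg _) (norm_nonneg _)).1 hn⟩
  have hd := (hf t ht').hasDerivAt (Icc_mem_nhds ht.1 ht.2)
  have : l (f t) = 1 := by
    simp only [l, m]
    rw [hn, max_eq_left (by gcongr; linarith), div_self (by positivity)]
  rwa [this, one_smul] at hd

/-! ### The truncated equation -/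

theorem Herm.congr {F G : ℝ → ℂ} (h : Herm F) (hFG : F =ᵐ[volume] G) : Herm G := by
  filter_upwards [h, hFG, (Measure.measurePreserving_neg volume).quasiMeasurePreserving.ae_eq_comp hFG]
    with x h1 h2 h3
  have h3' : F (-x) = G (-x) := h3
  rw [← h2, ← h3', h1]

theorem Herm.add {F G : ℝ → ℂ} (h : Herm F) (h' : Herm G) : Herm (fun x => F x + G x) := by
  filter_upwards [h, h'] with x h1 h2
  rw [h1, h2, map_add]

theorem Herm.neg_I_sg_mul {F : ℝ → ℂ} (h : Herm F) :
    Herm (fun x => -Complex.I * ((sg x : ℂ) * F x)) := by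
  filter_upwards [h, Measure.ae_ne volume 0] with x h1 h2
  rw [h1, sg_neg h2, map_mul, map_mul, map_neg, Complex.conj_I, Complex.conj_ofReal]
  push_cast
  ring

theorem Herm.conv_neg {F G : ℝ → ℂ} (hF : Herm F) (hG : Herm G) (ξ : ℝ) :
    conv F G (-ξ) = starRingEnd ℂ (conv F G ξ) := by
  unfold conv
  rw [← integral_conj, ← integral_neg_eq_self]
  refine integral_congr_ae ?_
  filter_upwards [hF, (quasiMeasurePreserving_sub_left volume ξ).ae hG] with η h1 h2
  rw [h1, map_mul, ← h2]
  congr 2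
  ring

/-- The closed real subspace of Hermitian functions with frequencies in `[-N, N]`. -/
noncomputable def bandSpace (N : ℝ) : Submodule ℝ L2C where
  carrier := {f | Band N f ∧ Herm f}
  zero_mem' := by
    have h := Lp.coeFn_zero ℂ 2 (volume : Measure ℝ)
    refine ⟨?_, ?_⟩
    · filter_upwards [h] with x hx _
      rw [hx]; rfl
    · refine Herm.congr (F := fun _ => 0) (Eventually.of_forall fun x => by simp) h.symm
  add_mem' := fun {f g} hf hg => by
    have h := (Lp.coeFn_add f g).symm
    have hb : Band N (fun x => f x + g x) := by
      filter_upwards [hf.1, hg.1] with x h1 h2 hx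
      rw [h1 hx, h2 hx, add_zero]
    exact ⟨hb.congr h, (hf.2.add hg.2).congr h⟩
  smul_mem' := fun c f hf => by
    have h := (Lp.coeFn_smul c f).symm
    refine ⟨(hf.1.mul_left fun _ => (c : ℂ)).congr h, Herm.congr ?_ h⟩
    filter_upwards [hf.2] with x hx
    simp only [Pi.smul_apply, hx, Complex.real_smul, map_mul, Complex.conj_ofReal]

theorem exists_subseq_ae_tendsto {u : ℕ → L2C} {f : L2C} (h : Tendsto u atTop (𝓝 f)) :
    ∃ ns : ℕ → ℕ, StrictMono ns ∧ ∀ᵐ x, Tendsto (fun i => u (ns i) x) atTop (𝓝 (f x)) :=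
  (tendstoInMeasure_of_tendsto_Lp h).exists_seq_tendsto_ae

theorem isClosed_bandSpace (N : ℝ) : IsClosed (bandSpace N : Set L2C) := by
  refine isSeqClosed_iff_isClosed.1 fun u f hu h => ?_
  obtain ⟨ns, -, hns⟩ := exists_subseq_ae_tendsto h
  have h1 : ∀ᵐ x, ∀ i, N < |x| → u (ns i) x = 0 := ae_all_iff.2 fun i => (hu (ns i)).1
  have h2 : ∀ᵐ x, ∀ i, u (ns i) (-x) = starRingEnd ℂ (u (ns i) x) :=
    ae_all_iff.2 fun i => (hu (ns i)).2
  refine ⟨?_, ?_⟩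
  · filter_upwards [hns, h1] with x hx hx1 hxN
    refine tendsto_nhds_unique hx ?_
    simp only [hx1 _ hxN]
    exact tendsto_const_nhds
  · filter_upwards [hns, (Measure.measurePreserving_neg volume).quasiMeasurePreserving.ae hns, h2] with x hx hx1 hx2
    refine tendsto_nhds_unique hx1 ?_
    simp only [hx2]
    exact (Complex.continuous_conj.tendsto _).comp hx

instance (N : ℝ) : CompleteSpace (bandSpace N) :=
  (isClosed_bandSpace N).completeSpace_coe

theorem isMult_neg_I_sg : IsMult (fun x => -Complex.I * (sg x : ℂ)) :=
  ⟨measurable_const.mul isMult_sg.1, 1, fun x => by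
    rw [norm_mul, norm_neg, Complex.norm_I, one_mul, enorm_sg]⟩

theorem isMult_cut_id (R : ℝ) : IsMult (cut R fun x => -(Complex.I * Real.pi) * (x : ℂ)) := by
  refine ⟨measurable_cut R (by fun_prop), Real.pi * |R|, fun x => ?_⟩
  rcases le_or_gt |x| R with h' | h'
  · rw [cut_of_le h', norm_mul, norm_neg, norm_mul, Complex.norm_I, one_mul, Complex.norm_real,
      Complex.norm_real, Real.norm_of_nonneg Real.pi_pos.le, Real.norm_eq_abs]
    exact mul_le_mul_of_nonneg_left (h'.trans (le_abs_self R)) Real.pi_pos.le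
  · rw [cut_of_lt h', norm_zero]; positivity

/-- The nonlinearity `-iπ ξ (f * g)` cut off to the frequency band `[-R, R]`. -/
noncomputable def quadTerm (R : ℝ) : L2C →L[ℝ] L2C →L[ℝ] L2C :=
  (ContinuousLinearMap.compL ℝ L2C L2C L2C (mulOp _ (isMult_cut_id R))).comp (cutConv R)

theorem quadTerm_coe (R : ℝ) (f g : L2C) : quadTerm R f g =ᵐ[volume]
    cut R fun ξ => -(Complex.I * Real.pi) * ((ξ : ℂ) * conv f g ξ) := by
  filter_upwards [mulOp_coe _ (isMult_cut_id R) (cutConv R f g), cutConv_coe R f g] with x h1 h2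
  change quadTerm R f g x = _ at h1
  rw [h1, h2]
  rcases le_or_gt |x| R with h' | h'
  · rw [cut_of_le h', cut_of_le h', cut_of_le h']; ring
  · rw [cut_of_lt h', cut_of_lt h', zero_mul, cut_of_lt h']

theorem quadTerm_mem (R : ℝ) {f g : L2C} (hf : Herm f) (hg : Herm g) :
    quadTerm R f g ∈ bandSpace R := by
  refine ⟨(band_cut R _).congr (quadTerm_coe R f g).symm, Herm.congr ?_ (quadTerm_coe R f g).symm⟩
  refine Eventually.of_forall fun ξ => ?_
  rcases le_or_gt |ξ| R with h' | h'
  · rw [cut_of_le h', cut_of_le (by rwa [abs_neg]), hf.conv_neg hg]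
    simp only [map_mul, map_neg, Complex.conj_I, Complex.conj_ofReal]
    push_cast
    ring
  · rw [cut_of_lt h', cut_of_lt (by rwa [abs_neg]), map_zero]

/-- The right-hand side of the truncated equation. -/
noncomputable def galerkinField (N : ℝ) (f : L2C) : L2C :=
  mulOp _ isMult_neg_I_sg f + quadTerm N f f

/-- The truncation error. -/
noncomputable def galerkinError (N : ℝ) (f : L2C) : L2C :=
  quadTerm N f f - quadTerm (2 * N) f f

theorem galerkinField_mem {N : ℝ} {f : L2C} (hf : f ∈ bandSpace N) :
    galerkinField N f ∈ bandSpace N := by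
  refine (bandSpace N).add_mem ⟨?_, ?_⟩ (quadTerm_mem N hf.2 hf.2)
  · exact (hf.1.mul_left _).congr (mulOp_coe _ isMult_neg_I_sg f).symm
  · refine hf.2.neg_I_sg_mul.congr ?_
    filter_upwards [mulOp_coe _ isMult_neg_I_sg f] with x hx
    rw [hx]; ring

theorem galerkinError_coe (N : ℝ) {f : L2C} (hf : Band N f) :
    galerkinError N f =ᵐ[volume] fun ξ => cut N (fun ξ => -(Complex.I * Real.pi) *
      ((ξ : ℂ) * conv f f ξ)) ξ - -(Complex.I * Real.pi) * ((ξ : ℂ) * conv f f ξ) := by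
  filter_upwards [Lp.coeFn_sub (quadTerm N f f) (quadTerm (2 * N) f f), quadTerm_coe N f f,
    quadTerm_coe (2 * N) f f] with ξ h1 h2 h3
  rw [galerkinError, h1, Pi.sub_apply, h2, h3]
  rcases le_or_gt |ξ| (2 * N) with h' | h'
  · rw [cut_of_le h']
  · rw [cut_of_lt h', hf.conv hf h']; simp

theorem approxAt_galerkin {N : ℝ} (hN : 0 ≤ N) {f : L2C} (hf : f ∈ bandSpace N) :
    ApproxAt (2 * N) f (galerkinField N f) (galerkinError N f) := by
  have hm : ∀ {g : L2C}, g ∈ bandSpace N → g ∈ bandSpace (2 * N) := fun h =>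
    ⟨h.1.mono (by linarith), h.2⟩
  have hG := hm (galerkinField_mem hf)
  have hE : galerkinError N f ∈ bandSpace (2 * N) :=
    (bandSpace (2 * N)).sub_mem (hm (quadTerm_mem N hf.2 hf.2)) (quadTerm_mem _ hf.2 hf.2)
  refine ⟨by rw [mul_div_cancel_left₀ N two_ne_zero]; exact hf.1, hG.1, hE.1, hf.2, hG.2, hE.2,
    by positivity, ?_⟩
  filter_upwards [Lp.coeFn_add (mulOp _ isMult_neg_I_sg f) (quadTerm N f f),
    mulOp_coe _ isMult_neg_I_sg f, quadTerm_coe N f f, galerkinError_coe N hf.1]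
    with ξ h1 h2 h3 h4
  rw [galerkinField, h1, Pi.add_apply, h2, h3, h4]
  ring

theorem ip_galerkinError {N : ℝ} {f : L2C} (hf : Band N f) (n : ℕ) :
    ip n f (galerkinError N f) = 0 := by
  unfold ip
  rw [← integral_zero ℝ ℂ]
  refine integral_congr_ae ?_
  filter_upwards [hf, galerkinError_coe N hf] with ξ h1 h2
  rcases le_or_gt |ξ| N with h' | h'
  · rw [h2, cut_of_le h']; simp
  · rw [h1 h']; simp

theorem yn_zero_coe (f : L2C) : yn 0 f = ‖f‖ := by
  rw [yn, Yn, wt_zero, Lp.norm_def]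

theorem ip_zero_eq_inner (f g : L2C) : ip 0 f g = inner ℂ f g := by
  rw [L2.inner_def, ip]
  refine integral_congr_ae (Eventually.of_forall fun x => ?_)
  simp only [RCLike.inner_apply]
  simp
  ring

theorem inner_galerkinField {N : ℝ} (hN : 0 ≤ N) {f : L2C} (hf : f ∈ bandSpace N) :
    inner ℝ f (galerkinField N f) = 0 := by
  have h := re_ip_deriv (approxAt_galerkin hN hf) 0
  rw [ip_galerkinError hf.1, ip_zero_eq_inner, ← inner_real_eq_re] at h
  have e : tri (fun x y z => x ^ (2 * 0 + 1) + y ^ (2 * 0 + 1) + z ^ (2 * 0 + 1)) f f f = 0 := by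
    rw [tri_congr (q' := fun _ _ _ => (0 : ℝ) * 0) (fun x y z h => by
      rw [zero_mul]; simpa using h), tri_const_mul]
    simp
  rw [e] at h
  simpa using h

/-- Solutions of the truncated equation exist for all times. -/
theorem exists_galerkin {N : ℝ} (hN : 0 ≤ N) {f₀ : L2C} (h₀ : f₀ ∈ bandSpace N) {T : ℝ}
    (hT : 0 < T) : ∃ f : ℝ → L2C, f 0 = f₀ ∧ (∀ t, f t ∈ bandSpace N) ∧
      ∀ t ∈ Ioo (-T) T, HasDerivAt f (galerkinField N (f t)) t ∧ ‖f t‖ = ‖f₀‖ := by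
  set A := mulOp _ isMult_neg_I_sg
  set c : ℝ := max ‖A‖ (2 * ‖quadTerm N‖)
  have hc1 : ‖A‖ ≤ c := le_max_left _ _
  have hc2 : 2 * ‖quadTerm N‖ ≤ c := le_max_right _ _
  have hc : 0 ≤ c := (norm_nonneg A).trans hc1
  have hQ := norm_nonneg (quadTerm N)
  have hc3 : ‖quadTerm N‖ ≤ c := by linarith
  obtain ⟨f, hf0, hf⟩ := exists_curve_of_orthogonal
    (E := bandSpace N) (fun x => ⟨galerkinField N x, galerkinField_mem x.2⟩) hc
    (fun x => by
      rw [Submodule.coe_norm, Submodule.coe_norm]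
      calc ‖galerkinField N x‖ ≤ ‖A x‖ + ‖quadTerm N x x‖ := norm_add_le _ _
        _ ≤ ‖A‖ * ‖(x : L2C)‖ + ‖quadTerm N‖ * ‖(x : L2C)‖ * ‖(x : L2C)‖ :=
          add_le_add (A.le_opNorm _) ((quadTerm N).le_opNorm₂ _ _)
        _ ≤ c * ‖(x : L2C)‖ + c * ‖(x : L2C)‖ * ‖(x : L2C)‖ := by gcongr
        _ = _ := by ring)
    (fun x y b hx hy => by
      rw [Submodule.coe_norm] at hx hy
      rw [Submodule.coe_norm, Submodule.coe_norm, Submodule.coe_sub, Submodule.coe_sub]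
      have hb : 0 ≤ b := (norm_nonneg _).trans hx
      have e : galerkinField N x - galerkinField N y = A (x - y) +
          (quadTerm N x (x - y) + quadTerm N (x - y) y) := by
        simp only [galerkinField, map_sub, sub_apply]
        abel
      calc ‖galerkinField N x - galerkinField N y‖ ≤ ‖A (x - y)‖ +
            (‖quadTerm N x (x - y)‖ + ‖quadTerm N (x - y) y‖) := by
            rw [e]
            exact (norm_add_le _ _).trans (by gcongr; exact norm_add_le _ _)
        _ ≤ ‖A‖ * ‖(x - y : L2C)‖ + (‖quadTerm N‖ * ‖(x : L2C)‖ * ‖(x - y : L2C)‖ +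
            ‖quadTerm N‖ * ‖(x - y : L2C)‖ * ‖(y : L2C)‖) := by
            gcongr
            · exact A.le_opNorm _
            · exact (quadTerm N).le_opNorm₂ _ _
            · exact (quadTerm N).le_opNorm₂ _ _
        _ ≤ ‖A‖ * ‖(x - y : L2C)‖ + (‖quadTerm N‖ * b * ‖(x - y : L2C)‖ +
            ‖quadTerm N‖ * ‖(x - y : L2C)‖ * b) := by gcongr
        _ = (‖A‖ + 2 * ‖quadTerm N‖ * b) * ‖(x - y : L2C)‖ := by ring
        _ ≤ (c + c * b) * ‖(x - y : L2C)‖ := by gcongr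
        _ = c * (1 + b) * ‖(x - y : L2C)‖ := by ring)
    (fun x => by
      rw [Submodule.coe_inner]
      exact inner_galerkinField hN x.2) ⟨f₀, h₀⟩ hT
  refine ⟨fun t => f t, congrArg Subtype.val hf0, fun t => (f t).2, fun t ht => ?_⟩
  exact ⟨(bandSpace N).subtypeL.hasFDerivAt.comp_hasDerivAt t (hf t ht).1, (hf t ht).2⟩

/-! ### Norm inequalities -/

theorem sq_lintegral_mul_le {f g : ℝ → ℝ≥0∞} (hf : Measurable f) (hg : Measurable g) :
    (∫⁻ x, f x * g x) ^ 2 ≤ (∫⁻ x, f x) * ∫⁻ x, f x * g x ^ 2 := by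
  have h := ENNReal.lintegral_mul_le_Lp_mul_Lq (volume.withDensity f)
    Real.HolderConjugate.two_two (f := fun _ => 1) (g := g) aemeasurable_const hg.aemeasurable
  simp only [Pi.mul_apply, one_mul, ENNReal.one_rpow] at h
  rw [lintegral_withDensity_eq_lintegral_mul _ hf hg,
    lintegral_withDensity_eq_lintegral_mul _ hf measurable_const,
    lintegral_withDensity_eq_lintegral_mul _ hf (hg.pow_const _)] at h
  simp only [Pi.mul_apply, mul_one, ENNReal.rpow_two] at h
  calc _ ≤ ((∫⁻ x, f x) ^ (1 / 2 : ℝ) * (∫⁻ x, f x * g x ^ 2) ^ (1 / 2 : ℝ)) ^ 2 := by gcongr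
    _ = _ := by
      rw [mul_pow, ← ENNReal.rpow_two, ← ENNReal.rpow_two, ← ENNReal.rpow_mul, ← ENNReal.rpow_mul]
      simp

/-- The convolution of the absolute values. -/
noncomputable def absConv (F G : ℝ → ℂ) (ξ : ℝ) : ℝ≥0∞ := ∫⁻ η, ‖F η‖ₑ * ‖G (ξ - η)‖ₑ

theorem measurable_absConv {F G : ℝ → ℂ} (hF : Measurable F) (hG : Measurable G) :
    Measurable (absConv F G) :=
  Measurable.lintegral_prod_right' (f := fun p : ℝ × ℝ => ‖F p.2‖ₑ * ‖G (p.1 - p.2)‖ₑ)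
    (by fun_prop)

theorem absConv_comm (F G : ℝ → ℂ) : absConv F G = absConv G F := by
  ext ξ
  unfold absConv
  rw [← lintegral_sub_left_eq_self _ ξ]
  refine lintegral_congr fun η => ?_
  rw [sub_sub_cancel, mul_comm]

theorem eLpNorm_two_sq {E : Type*} [ENorm E] (f : ℝ → E) :
    eLpNorm f 2 volume ^ 2 = ∫⁻ x, ‖f x‖ₑ ^ 2 := by
  rw [eLpNorm_eq_lintegral_rpow_enorm_toReal (by norm_num) (by norm_num), ← ENNReal.rpow_two,
    ← ENNReal.rpow_mul]
  simp

/-- Young's inequality. -/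
theorem eLpNorm_absConv_le {F G : ℝ → ℂ} (hF : Measurable F) (hG : Measurable G) :
    eLpNorm (absConv F G) 2 volume ≤ eLpNorm F 1 volume * eLpNorm G 2 volume := by
  refine (ENNReal.pow_le_pow_left_iff two_ne_zero).1 ?_
  rw [mul_pow, eLpNorm_two_sq, eLpNorm_two_sq, eLpNorm_one_eq_lintegral_enorm]
  calc ∫⁻ ξ, ‖absConv F G ξ‖ₑ ^ 2
      ≤ ∫⁻ ξ, (∫⁻ η, ‖F η‖ₑ) * ∫⁻ η, ‖F η‖ₑ * ‖G (ξ - η)‖ₑ ^ 2 := by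
        refine lintegral_mono fun ξ => ?_
        rw [enorm_eq_self]
        exact sq_lintegral_mul_le hF.enorm (hG.comp (measurable_const.sub measurable_id)).enorm
    _ = (∫⁻ η, ‖F η‖ₑ) * ∫⁻ ξ, ∫⁻ η, ‖F η‖ₑ * ‖G (ξ - η)‖ₑ ^ 2 :=
        lintegral_const_mul _ (Measurable.lintegral_prod_right'
          (f := fun p : ℝ × ℝ => ‖F p.2‖ₑ * ‖G (p.1 - p.2)‖ₑ ^ 2) (by fun_prop))
    _ = (∫⁻ η, ‖F η‖ₑ) * ∫⁻ η, ‖F η‖ₑ * ∫⁻ ξ, ‖G ξ‖ₑ ^ 2 := by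
        rw [lintegral_lintegral_swap (by fun_prop)]
        congr 1
        refine lintegral_congr fun η => ?_
        rw [lintegral_const_mul _ (by fun_prop),
          lintegral_sub_right_eq_self (fun ξ => ‖G ξ‖ₑ ^ 2) η]
    _ = _ := by
        rw [lintegral_mul_const _ hF.enorm, sq, mul_assoc]

theorem enorm_wt_conv_le {F G : ℝ → ℂ} (hF : Measurable F) (hG : Measurable G) (n : ℕ) (ξ : ℝ) :
    ‖wt n (conv F G) ξ‖ₑ ≤ 2 ^ n * (absConv (wt n F) G ξ + absConv F (wt n G) ξ) := by
  have h : ∀ η : ℝ, ENNReal.ofReal (|ξ| ^ n) ≤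
      2 ^ n * (ENNReal.ofReal (|η| ^ n) + ENNReal.ofReal (|ξ - η| ^ n)) := by
    intro η
    rw [← ENNReal.ofReal_add (by positivity) (by positivity),
      show (2 : ℝ≥0∞) ^ n = ENNReal.ofReal (2 ^ n) by
        rw [ENNReal.ofReal_pow (by norm_num), ENNReal.ofReal_ofNat],
      ← ENNReal.ofReal_mul (by positivity)]
    refine ENNReal.ofReal_le_ofReal ?_
    have h1 : |ξ| ≤ 2 * max |η| |ξ - η| := by
      calc |ξ| = |η + (ξ - η)| := by rw [add_sub_cancel]
        _ ≤ |η| + |ξ - η| := abs_add_le _ _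
        _ ≤ _ := by linarith [le_max_left |η| |ξ - η|, le_max_right |η| |ξ - η|]
    calc |ξ| ^ n ≤ (2 * max |η| |ξ - η|) ^ n := by gcongr
      _ = 2 ^ n * max |η| |ξ - η| ^ n := mul_pow _ _ _
      _ ≤ _ := by
        gcongr
        rcases max_choice |η| |ξ - η| with e | e <;> rw [e]
        · exact le_add_of_nonneg_right (by positivity)
        · exact le_add_of_nonneg_left (by positivity)
  rw [enorm_wt, absConv, absConv, ← lintegral_add_left (by fun_prop),
    ← lintegral_const_mul _ (by fun_prop)]
  calc _ ≤ ENNReal.ofReal (|ξ| ^ n) * ∫⁻ η, ‖F η‖ₑ * ‖G (ξ - η)‖ₑ := by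
        gcongr
        refine (enorm_integral_le_lintegral_enorm _).trans (le_of_eq ?_)
        simp_rw [enorm_mul]
    _ = ∫⁻ η, ENNReal.ofReal (|ξ| ^ n) * (‖F η‖ₑ * ‖G (ξ - η)‖ₑ) :=
        (lintegral_const_mul _ (by fun_prop)).symm
    _ ≤ _ := by
        refine lintegral_mono fun η => ?_
        rw [enorm_wt, enorm_wt]
        refine (mul_le_mul_left (h η) _).trans (le_of_eq (by ring))

theorem Yn_conv_le {F G : ℝ → ℂ} (hF : Measurable F) (hG : Measurable G) (n : ℕ) :
    Yn n (conv F G) ≤ 2 ^ n * (Yn n F * eLpNorm G 1 volume + eLpNorm F 1 volume * Yn n G) := by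
  have m1 := measurable_absConv (measurable_wt n hF) hG
  have m2 := measurable_absConv hF (measurable_wt n hG)
  calc Yn n (conv F G)
      ≤ eLpNorm (fun ξ => (2 ^ n : ℝ≥0∞) * (absConv (wt n F) G ξ + absConv F (wt n G) ξ)) 2 volume :=
        eLpNorm_mono_enorm fun ξ => by
          rw [enorm_eq_self]; exact enorm_wt_conv_le hF hG n ξ
    _ ≤ 2 ^ n * eLpNorm (absConv (wt n F) G + absConv F (wt n G)) 2 volume := by
        refine (ENNReal.pow_le_pow_left_iff two_ne_zero).1 ?_
        rw [mul_pow, eLpNorm_two_sq, eLpNorm_two_sq, ← lintegral_const_mul _ (by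
          simp only [Pi.add_apply, enorm_eq_self]; fun_prop)]
        refine le_of_eq (lintegral_congr fun ξ => ?_)
        rw [enorm_eq_self, enorm_eq_self, mul_pow]; rfl
    _ ≤ 2 ^ n * (eLpNorm (absConv (wt n F) G) 2 volume + eLpNorm (absConv F (wt n G)) 2 volume) := by
        gcongr
        exact eLpNorm_add_le m1.aestronglyMeasurable m2.aestronglyMeasurable (by norm_num)
    _ ≤ _ := by
        gcongr
        · rw [absConv_comm, mul_comm]
          exact eLpNorm_absConv_le hG (measurable_wt n hF)
        · exact eLpNorm_absConv_le hF (measurable_wt n hG)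

theorem memLp_one_add_abs_inv : MemLp (fun x : ℝ => (1 + |x|)⁻¹) 2 volume := by
  rw [memLp_two_iff_integrable_sq (by
    apply Continuous.aestronglyMeasurable
    exact Continuous.inv₀ (by fun_prop) fun x => by positivity)]
  have h := integrable_one_add_norm (E := ℝ) (μ := volume) (r := 2) (by simp)
  refine h.congr (Eventually.of_forall fun x => ?_)
  simp only [Real.norm_eq_abs]
  rw [Real.rpow_neg (by positivity), inv_pow, Real.rpow_two]

/-- The `L²` norm of `1 / (1 + |x|)`. -/
noncomputable def sobConst : ℝ := (eLpNorm (fun x : ℝ => (1 + |x|)⁻¹) 2 volume).toReal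

theorem sobConst_nonneg : 0 ≤ sobConst := ENNReal.toReal_nonneg

theorem eLpNorm_one_le {F : ℝ → ℂ} (hF : Measurable F) :
    eLpNorm F 1 volume ≤ ENNReal.ofReal sobConst * (Yn 0 F + Yn 1 F) := by
  rw [sobConst, ENNReal.ofReal_toReal memLp_one_add_abs_inv.2.ne]
  have e : F = (fun x : ℝ => (1 + |x|)⁻¹) • (wt 0 F + wt 1 F) := by
    ext x
    have : (1 + |x| : ℝ) ≠ 0 := by positivity
    simp only [Pi.smul_apply', Pi.add_apply, wt, pow_zero, pow_one, Complex.real_smul]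
    have h2 : (1 + ((|x| : ℝ) : ℂ)) ≠ 0 := by exact_mod_cast this
    push_cast
    field_simp
  have h1 := eLpNorm_smul_le_mul_eLpNorm (p := 2) (q := 2) (r := 1) (μ := volume)
    (f := wt 0 F + wt 1 F) (φ := fun x : ℝ => (1 + |x|)⁻¹)
    ((measurable_wt 0 hF).add (measurable_wt 1 hF)).aestronglyMeasurable
    memLp_one_add_abs_inv.1
  rw [← e] at h1
  refine h1.trans ?_
  gcongr
  exact eLpNorm_add_le (measurable_wt 0 hF).aestronglyMeasurable
    (measurable_wt 1 hF).aestronglyMeasurable (by norm_num)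

theorem Yn_wt (m n : ℕ) (F : ℝ → ℂ) : Yn m (wt n F) = Yn (m + n) F := by
  unfold Yn
  congr 1
  ext x
  simp only [wt, pow_add]
  push_cast
  ring

theorem An_le {F : ℝ → ℂ} (hF : Measurable F) :
    An F ≤ ENNReal.ofReal sobConst * (Yn 1 F + Yn 2 F) := by
  have := eLpNorm_one_le (measurable_wt 1 hF)
  rwa [Yn_wt, Yn_wt] at this

theorem Yn_one_le {F : ℝ → ℂ} (hF : Measurable F) : Yn 1 F ≤ Yn 0 F + Yn 2 F := by
  refine le_trans (eLpNorm_mono_enorm (g := fun x => ‖wt 0 F x‖ₑ + ‖wt 2 F x‖ₑ) fun x => ?_) ?_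
  · simp only [enorm_wt, enorm_eq_self]
    rw [← add_mul, ← ENNReal.ofReal_add (by positivity) (by positivity)]
    gcongr
    nlinarith [abs_nonneg x]
  · refine (eLpNorm_add_le (measurable_wt 0 hF).enorm.aestronglyMeasurable
      (measurable_wt 2 hF).enorm.aestronglyMeasurable (by norm_num)).trans ?_
    rw [eLpNorm_enorm, eLpNorm_enorm]
    rfl

/-! ### Real-valued versions for band limited functions -/

/-- The `L¹` norm as a real number. -/
noncomputable def l1 (F : ℝ → ℂ) : ℝ := (eLpNorm F 1 volume).toReal

theorem l1_nonneg (F : ℝ → ℂ) : 0 ≤ l1 F := ENNReal.toReal_nonneg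

namespace BL

variable {R : ℝ} {F : ℝ → ℂ}

theorem ofReal_l1 (h : BL R F) : ENNReal.ofReal (l1 F) = eLpNorm F 1 volume :=
  ENNReal.ofReal_toReal h.eLpNorm_one_lt_top.ne

theorem yn_one_le (h : BL R F) : yn 1 F ≤ yn 0 F + yn 2 F := by
  have := Yn_one_le h.meas
  rw [← h.ofReal_yn, ← h.ofReal_yn, ← h.ofReal_yn,
    ← ENNReal.ofReal_add (yn_nonneg _ _) (yn_nonneg _ _)] at this
  exact (ENNReal.ofReal_le_ofReal_iff (add_nonneg (yn_nonneg _ _) (yn_nonneg _ _))).1 this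

theorem l1_le (h : BL R F) : l1 F ≤ sobConst * (yn 0 F + yn 1 F) := by
  have := eLpNorm_one_le h.meas
  rw [← h.ofReal_yn, ← h.ofReal_yn, ← h.ofReal_l1,
    ← ENNReal.ofReal_add (yn_nonneg _ _) (yn_nonneg _ _),
    ← ENNReal.ofReal_mul sobConst_nonneg] at this
  exact (ENNReal.ofReal_le_ofReal_iff (mul_nonneg sobConst_nonneg
    (add_nonneg (yn_nonneg _ _) (yn_nonneg _ _)))).1 this

theorem an_le (h : BL R F) : an F ≤ sobConst * (yn 1 F + yn 2 F) := by
  have := An_le h.meas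
  rw [← h.ofReal_yn, ← h.ofReal_yn, ← h.ofReal_an,
    ← ENNReal.ofReal_add (yn_nonneg _ _) (yn_nonneg _ _),
    ← ENNReal.ofReal_mul sobConst_nonneg] at this
  exact (ENNReal.ofReal_le_ofReal_iff (mul_nonneg sobConst_nonneg
    (add_nonneg (yn_nonneg _ _) (yn_nonneg _ _)))).1 this

theorem an_le' (h : BL R F) : an F ≤ 2 * sobConst * (yn 0 F + yn 2 F) := by
  have h1 := h.an_le
  have h2 := h.yn_one_le
  have := sobConst_nonneg
  have := yn_nonneg 0 F
  nlinarith

theorem l1_le' (h : BL R F) : l1 F ≤ 2 * sobConst * (yn 0 F + yn 2 F) := by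
  have h1 := h.l1_le
  have h2 := h.yn_one_le
  have := sobConst_nonneg
  have := yn_nonneg 2 F
  nlinarith

theorem yn_conv_le (h : BL R F) (n : ℕ) :
    yn n (BurgersHilbert.conv F F) ≤ 2 ^ (n + 1) * (l1 F * yn n F) := by
  have := Yn_conv_le h.meas h.meas n
  rw [← (h.conv h).ofReal_yn, ← h.ofReal_yn, ← h.ofReal_l1, ← ENNReal.ofReal_mul (yn_nonneg _ _),
    ← ENNReal.ofReal_mul (l1_nonneg _), ← ENNReal.ofReal_add
    (mul_nonneg (yn_nonneg _ _) (l1_nonneg _)) (mul_nonneg (l1_nonneg _) (yn_nonneg _ _)),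
    show (2 : ℝ≥0∞) ^ n = ENNReal.ofReal (2 ^ n) by
        rw [ENNReal.ofReal_pow (by norm_num), ENNReal.ofReal_ofNat],
    ← ENNReal.ofReal_mul (by positivity)] at this
  have hp := mul_nonneg (l1_nonneg F) (yn_nonneg n F)
  have := (ENNReal.ofReal_le_ofReal_iff (by
    rw [mul_comm (yn n F)]; positivity)).1 this
  exact this.trans (le_of_eq (by ring))

end BL

theorem yn_galerkinError_le {N : ℝ} (hN : 0 < N) {f : L2C} (hf : f ∈ bandSpace N) (n : ℕ) :
    yn n (galerkinError N f) ≤ Real.pi * 2 ^ (n + 3) * (l1 f * yn (n + 2) f) / N := by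
  have hb := BL.of_coe hf.1
  have hE := (approxAt_galerkin hN.le hf).bl_r
  have hpi := Real.pi_pos
  have h1 : Yn n (galerkinError N f) ≤ ENNReal.ofReal (Real.pi / N) * Yn (n + 2) (conv f f) := by
    have e : ENNReal.ofReal (Real.pi / N) * Yn (n + 2) (conv f f) =
        eLpNorm ((Real.pi / N) • wt (n + 2) (conv f f)) 2 volume := by
      rw [eLpNorm_const_smul, ← ofReal_norm, Real.norm_of_nonneg (by positivity)]
      rfl
    rw [e]
    refine eLpNorm_mono_ae ?_
    filter_upwards [galerkinError_coe N hf.1] with ξ hξ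
    rw [wt, hξ, Pi.smul_apply, wt, norm_smul, norm_mul, norm_mul, Complex.norm_real,
      Complex.norm_real, Real.norm_of_nonneg (by positivity), Real.norm_of_nonneg (by positivity),
      Real.norm_of_nonneg (by positivity)]
    rcases le_or_gt |ξ| N with h' | h'
    · rw [cut_of_le h', sub_self, norm_zero, mul_zero]; positivity
    · rw [cut_of_lt h', zero_sub, norm_neg, norm_mul, norm_mul, norm_neg, norm_mul,
        Complex.norm_I, Complex.norm_real, Complex.norm_real, Real.norm_of_nonneg hpi.le,
        Real.norm_eq_abs]
      have : 1 ≤ |ξ| / N := (one_le_div hN).2 h'.le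
      calc |ξ| ^ n * (1 * Real.pi * (|ξ| * ‖conv f f ξ‖))
          = Real.pi * |ξ| ^ (n + 1) * ‖conv f f ξ‖ * 1 := by ring
        _ ≤ Real.pi * |ξ| ^ (n + 1) * ‖conv f f ξ‖ * (|ξ| / N) := by gcongr
        _ = Real.pi / N * (|ξ| ^ (n + 2) * ‖conv f f ξ‖) := by ring
  rw [← hE.ofReal_yn, ← (hb.conv hb).ofReal_yn, ← ENNReal.ofReal_mul (by positivity)] at h1
  have h2 := (ENNReal.ofReal_le_ofReal_iff (mul_nonneg (by positivity) (yn_nonneg _ _))).1 h1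
  calc _ ≤ Real.pi / N * yn (n + 2) (conv f f) := h2
    _ ≤ Real.pi / N * (2 ^ (n + 2 + 1) * (l1 f * yn (n + 2) f)) := by
      gcongr; exact hb.yn_conv_le _
    _ = _ := by ring

/-! ### Continuity arguments on symmetric time intervals -/

theorem abs_le_of_abs_deriv_le {E E' : ℝ → ℝ} {κ δ t : ℝ} (hκ : 0 < κ) (hδ : 0 ≤ δ)
    (h : ∀ s ∈ uIcc 0 t, HasDerivAt E (E' s) s) (hb : ∀ s ∈ uIcc 0 t, |E' s| ≤ κ * |E s| + δ) :
    |E t| ≤ (|E 0| + δ / κ) * Real.exp (κ * |t|) := by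
  have main : ∀ (F F' : ℝ → ℝ) (b : ℝ), 0 ≤ b → (∀ s ∈ Icc 0 b, HasDerivAt F (F' s) s) →
      (∀ s ∈ Icc 0 b, |F' s| ≤ κ * |F s| + δ) →
      |F b| ≤ (|F 0| + δ / κ) * Real.exp (κ * b) := by
    intro F F' b hb0 hF hbd
    have := norm_le_gronwallBound_of_norm_deriv_right_le (f := F) (f' := F') (δ := |F 0|) (K := κ)
      (ε := δ) (a := 0) (b := b) (fun s hs => (hF s hs).continuousAt.continuousWithinAt)
      (fun s hs => (hF s (Ico_subset_Icc_self hs)).hasDerivWithinAt) le_rfl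
      (fun s hs => hbd s (Ico_subset_Icc_self hs)) b ⟨hb0, le_rfl⟩
    rw [gronwallBound_of_K_ne_0 hκ.ne', sub_zero, Real.norm_eq_abs] at this
    have h0 : 0 ≤ δ / κ := by positivity
    linarith
  rcases le_total 0 t with ht | ht
  · rw [uIcc_of_le ht] at h hb
    rw [abs_of_nonneg ht]
    exact main E E' t ht h hb
  · rw [uIcc_of_ge ht] at h hb
    rw [abs_of_nonpos ht]
    have := main (fun s => E (-s)) (fun s => -E' (-s)) (-t) (by linarith)
      (fun s hs => by
        have := (h (-s) ⟨by linarith [hs.2], by linarith [hs.1]⟩).comp s (hasDerivAt_neg s)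
        exact this.congr_deriv (by ring))
      (fun s hs => by
        rw [abs_neg]
        exact hb (-s) ⟨by linarith [hs.2], by linarith [hs.1]⟩)
    simpa using this

theorem lt_of_continuity_argument {X : ℝ → ℝ} {T B : ℝ} (hX : ContinuousOn X (Icc (-T) T))
    (h0 : X 0 < B) (h : ∀ t ∈ Icc (-T) T, (∀ s ∈ uIcc 0 t, X s ≤ B) → X t < B) :
    ∀ t ∈ Icc (-T) T, X t < B := by
  have main : ∀ Y : ℝ → ℝ, ContinuousOn Y (Icc 0 T) → Y 0 < B →
      (∀ t ∈ Icc 0 T, (∀ s ∈ Icc 0 t, Y s ≤ B) → Y t < B) → ∀ t ∈ Icc 0 T, Y t < B := by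
    intro Y hY hY0 hYb t ht
    by_contra! hc
    have hYt := hY.mono (Icc_subset_Icc_right ht.2)
    obtain ⟨u, hu, hmin⟩ : ∃ u, IsLeast {s ∈ Icc 0 t | B ≤ Y s} u := by
      refine IsCompact.exists_isLeast ?_ ⟨t, ⟨ht.1, le_rfl⟩, hc⟩
      exact isCompact_Icc.of_isClosed_subset
        (hYt.preimage_isClosed_of_isClosed isClosed_Icc isClosed_Ici) fun s hs => hs.1
    obtain ⟨v, hv, hvB⟩ := intermediate_value_Icc hu.1.1
      (hYt.mono (Icc_subset_Icc_right hu.1.2)) ⟨hY0.le, hu.2⟩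
    have hvu : v = u := le_antisymm hv.2 (hmin ⟨⟨hv.1, hv.2.trans hu.1.2⟩, hvB.ge⟩)
    subst hvu
    refine absurd (hYb v ⟨hv.1, hu.1.2.trans ht.2⟩ fun s hs => ?_) (not_lt.2 hvB.ge)
    rcases eq_or_lt_of_le hs.2 with e | e
    · rw [e, hvB]
    · by_contra! hlt
      exact absurd (hmin ⟨⟨hs.1, hs.2.trans hu.1.2⟩, hlt.le⟩) (not_le.2 e)
  intro t ht
  rcases le_total 0 t with h1 | h1
  · refine main X (hX.mono fun s hs => ⟨?_, hs.2⟩) h0 (fun s hs hs' => ?_) t ⟨h1, ht.2⟩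
    · linarith [hs.1, hs.2]
    · exact h s ⟨by linarith [hs.1, hs.2], hs.2⟩ (by rwa [uIcc_of_le hs.1])
  · have := main (fun s => X (-s)) (hX.comp (by fun_prop) fun s hs => ⟨?_, ?_⟩) (by simpa using h0)
      (fun s hs hs' => ?_) (-t) ⟨by linarith, by linarith [ht.1]⟩
    · simpa using this
    · linarith [hs.2]
    · linarith [hs.1, hs.2]
    · refine h (-s) ⟨by linarith [hs.2], by linarith [hs.1, hs.2]⟩ fun u hu => ?_
      rw [uIcc_of_ge (by linarith [hs.1])] at hu
      simpa using hs' (-u) ⟨by linarith [hu.2], by linarith [hu.1]⟩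

/-- The estimates of `exists_modEnergy_estimates` with the constant `C`. -/
structure EnergyConst (m : ℕ) (C : ℝ) : Prop where
  one_le : 1 ≤ C
  equiv : ∀ (R : ℝ) (F : ℝ → ℂ), BL R F →
    |modEnergy m F - yn (m + 1) F ^ 2| ≤ C * (an F * yn (m + 1) F ^ 2)
  cubic : ∀ (R : ℝ) (F : ℝ → ℂ), BL R F →
    ‖tri (fun x y z => x ^ (2 * (m + 1) + 1) + y ^ (2 * (m + 1) + 1) + z ^ (2 * (m + 1) + 1))
      F F F‖ ≤ C * (an F * yn (m + 1) F ^ 2)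
  deriv : ∀ (R : ℝ) (f : ℝ → L2C) (f' r : L2C) (t : ℝ), ApproxAt R (f t) f' r →
    HasDerivAt f f' t → (∀ᶠ τ in 𝓝 t, Band R (f τ) ∧ Herm (f τ)) →
    ∃ D, HasDerivAt (fun τ => modEnergy m (f τ)) D t ∧
      |D| ≤ C * (an (f t) ^ 2 * yn (m + 1) (f t) ^ 2) +
        2 * (yn (m + 1) (f t) * yn (m + 1) r) +
        C * (an (f t) * yn (m + 1) (f t) * yn (m + 1) r + yn (m + 1) (f t) ^ 2 * an r)

theorem exists_energyConst (m : ℕ) : ∃ C, EnergyConst m C := by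
  obtain ⟨C, hC, h1, h2, h3⟩ := exists_modEnergy_estimates m
  have hle : C ≤ C + 1 := by linarith
  refine ⟨C + 1, by linarith, fun R F hF => (h1 R F hF).trans ?_,
    fun R F hF => (h2 R F hF).trans ?_, fun R f f' r t hA hd hb => ?_⟩
  · have := an_nonneg F
    gcongr
  · have := an_nonneg F
    gcongr
  · obtain ⟨D, hD, hb⟩ := h3 R f f' r t hA hd hb
    have := an_nonneg (f t)
    have := an_nonneg r
    have := yn_nonneg (m + 1) (f t)
    have := yn_nonneg (m + 1) r
    exact ⟨D, hD, hb.trans (by gcongr)⟩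

/-- Growth of the norms of solutions of the truncated equation. -/
theorem yn_sq_le_crude {m : ℕ} {C : ℝ} (hC : EnergyConst m C) {N : ℝ} (hN : 0 ≤ N) {f : ℝ → L2C}
    (hf : ∀ t, f t ∈ bandSpace N) {t a : ℝ} (ha : 0 < a)
    (hd : ∀ s ∈ uIcc 0 t, HasDerivAt f (galerkinField N (f s)) s)
    (han : ∀ s ∈ uIcc 0 t, an (f s) ≤ a) :
    yn (m + 1) (f t) ^ 2 ≤ yn (m + 1) (f 0) ^ 2 * Real.exp (3 * C * a * |t|) := by
  have hC1 := hC.one_le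
  have h := abs_le_of_abs_deriv_le (E := fun τ => yn (m + 1) (f τ) ^ 2)
    (E' := fun s => 2 * (ip (m + 1) (f s) (galerkinField N (f s))).re) (κ := 3 * C * a) (δ := 0)
    (t := t) (by positivity) le_rfl (fun s hs => hasDerivAt_yn_sq (hd s hs)
      (Eventually.of_forall fun τ => (hf τ).1) (galerkinField_mem (hf s)).1 (m + 1))
    (fun s hs => by
      have hA := approxAt_galerkin hN (hf s)
      rw [re_ip_deriv hA, ip_galerkinError (hf s).1]
      have h1 := hC.cubic _ _ hA.bl
      have hy := yn_nonneg (m + 1) (f s)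
      simp only [Complex.zero_re, mul_zero, add_zero]
      rw [abs_mul, abs_of_pos (by have := Real.pi_pos; positivity), abs_of_nonneg (sq_nonneg (yn (m + 1) (f s)))]
      have h2 := Complex.abs_re_le_norm (Complex.I * tri (fun x y z => x ^ (2 * (m + 1) + 1) +
        y ^ (2 * (m + 1) + 1) + z ^ (2 * (m + 1) + 1)) (f s) (f s) (f s))
      rw [norm_mul, Complex.norm_I, one_mul] at h2
      calc _ ≤ 2 * Real.pi / 3 * (C * (a * yn (m + 1) (f s) ^ 2)) := by
            have := Real.pi_pos
            gcongr
            refine h2.trans (h1.trans ?_)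
            gcongr
            exact han s hs
        _ ≤ 3 * (C * (a * yn (m + 1) (f s) ^ 2)) := by
            gcongr
            linarith [Real.pi_lt_four]
        _ = _ := by ring)
  simpa only [zero_div, add_zero, abs_sq] using h

/-- Growth of the norms of small solutions of the truncated equation. -/
theorem yn_sq_le_refined {m : ℕ} {C : ℝ} (hC : EnergyConst m C) {N : ℝ} (hN : 0 ≤ N)
    {f : ℝ → L2C} (hf : ∀ t, f t ∈ bandSpace N) {t a δ : ℝ} (ha : 0 < a) (hCa : C * a ≤ 1 / 2)
    (hδ : 0 ≤ δ) (hd : ∀ s ∈ uIcc 0 t, HasDerivAt f (galerkinField N (f s)) s)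
    (han : ∀ s ∈ uIcc 0 t, an (f s) ≤ a)
    (hr : ∀ s ∈ uIcc 0 t, 2 * (yn (m + 1) (f s) * yn (m + 1) (galerkinError N (f s))) +
        C * (an (f s) * yn (m + 1) (f s) * yn (m + 1) (galerkinError N (f s)) +
          yn (m + 1) (f s) ^ 2 * an (galerkinError N (f s))) ≤ δ) :
    yn (m + 1) (f t) ^ 2 ≤
      (3 * yn (m + 1) (f 0) ^ 2 + δ / (C * a ^ 2)) * Real.exp (2 * C * a ^ 2 * |t|) := by
  have hC1 := hC.one_le
  have heq : ∀ s ∈ uIcc 0 t, |modEnergy m (f s) - yn (m + 1) (f s) ^ 2| ≤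
      yn (m + 1) (f s) ^ 2 / 2 := by
    intro s hs
    refine (hC.equiv _ _ (BL.of_coe (hf s).1)).trans ?_
    calc C * (an (f s) * yn (m + 1) (f s) ^ 2) ≤ C * (a * yn (m + 1) (f s) ^ 2) := by
          gcongr; exact han s hs
      _ = C * a * yn (m + 1) (f s) ^ 2 := by ring
      _ ≤ 1 / 2 * yn (m + 1) (f s) ^ 2 := by gcongr
      _ = _ := by ring
  have hD : ∀ s ∈ uIcc 0 t, ∃ D, HasDerivAt (fun τ => modEnergy m (f τ)) D s ∧
      |D| ≤ 2 * C * a ^ 2 * |modEnergy m (f s)| + δ := by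
    intro s hs
    have hA := approxAt_galerkin hN (hf s)
    obtain ⟨D, hD, hb⟩ := hC.deriv _ f _ _ s hA (hd s hs)
      (Eventually.of_forall fun τ => ⟨(hf τ).1.mono (by linarith), (hf τ).2⟩)
    refine ⟨D, hD, hb.trans ?_⟩
    rw [add_assoc]
    refine add_le_add ?_ (hr s hs)
    have h1 := abs_le.1 (heq s hs)
    have h2 := le_abs_self (modEnergy m (f s))
    have h3 := an_nonneg (f s)
    calc C * (an (f s) ^ 2 * yn (m + 1) (f s) ^ 2) ≤ C * (a ^ 2 * (2 * |modEnergy m (f s)|)) := by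
          gcongr
          · exact han s hs
          · linarith [h1.1]
      _ = _ := by ring
  have h := abs_le_of_abs_deriv_le (E := fun τ => modEnergy m (f τ))
    (E' := deriv fun τ => modEnergy m (f τ)) (κ := 2 * C * a ^ 2) (δ := δ) (t := t) (by positivity)
    hδ (fun s hs => by obtain ⟨D, h, -⟩ := hD s hs; exact h.differentiableAt.hasDerivAt)
    (fun s hs => by obtain ⟨D, h, hb⟩ := hD s hs; rwa [h.deriv])
  have h1 := (abs_le.1 (heq t right_mem_uIcc)).1
  have h2 := (abs_le.1 (heq 0 left_mem_uIcc)).2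
  have h2' := (abs_le.1 (heq 0 left_mem_uIcc)).1
  have h3 : |modEnergy m (f 0)| ≤ 3 / 2 * yn (m + 1) (f 0) ^ 2 := by
    rw [abs_le]; constructor <;> linarith [sq_nonneg (yn (m + 1) (f 0))]
  calc yn (m + 1) (f t) ^ 2 ≤ 2 * |modEnergy m (f t)| := by
        linarith [le_abs_self (modEnergy m (f t))]
    _ ≤ 2 * ((3 / 2 * yn (m + 1) (f 0) ^ 2 + δ / (2 * C * a ^ 2)) *
        Real.exp (2 * C * a ^ 2 * |t|)) := by
        gcongr
        exact h.trans (by gcongr)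
    _ = _ := by
        field_simp

/-- The constant in the bound of `an` and `l1` for functions of size `ε`. -/
noncomputable def anConst : ℝ := 16 * sobConst + 1

theorem anConst_pos : 0 < anConst := by
  have := sobConst_nonneg
  unfold anConst; positivity

theorem BL.an_and_l1_le {R : ℝ} {F : ℝ → ℂ} (h : BL R F) {ε : ℝ} (hε : 0 ≤ ε)
    (hX : yn 0 F ^ 2 + yn 2 F ^ 2 ≤ 16 * ε ^ 2) : an F ≤ anConst * ε ∧ l1 F ≤ anConst * ε := by
  have h0 := yn_nonneg 0 F
  have h2 := yn_nonneg 2 F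
  have hs := sobConst_nonneg
  have h3 : yn 0 F + yn 2 F ≤ 8 * ε := by
    refine abs_le_of_sq_le_sq' ?_ (by positivity) |>.2
    nlinarith [sq_nonneg (yn 0 F - yn 2 F)]
  have h4 : 2 * sobConst * (yn 0 F + yn 2 F) ≤ anConst * ε := by
    unfold anConst
    nlinarith
  exact ⟨h.an_le'.trans h4, h.l1_le'.trans h4⟩

/-- A family of approximate solutions, of size `ε`, on a time interval of length `ε⁻²`. -/
theorem exists_approx_solution : ∃ ε₀ : ℝ, 0 < ε₀ ∧ ∃ α : ℝ, 0 < α ∧ ∃ Cs : ℕ → ℝ,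
    (∀ m, 0 ≤ Cs m) ∧ ∀ ε : ℝ, 0 < ε → ε ≤ ε₀ → ∀ (M : ℝ) (f₀ : L2C), f₀ ∈ bandSpace M →
    yn 0 f₀ ^ 2 + yn 2 f₀ ^ 2 ≤ ε ^ 2 → ∀ (m : ℕ) (δ : ℝ), 0 < δ →
    ∃ (R : ℝ) (f f' r : ℝ → L2C), f 0 = f₀ ∧
      (∀ t, Band (R / 2) (f t) ∧ Herm (f t)) ∧
      ∀ t ∈ Icc (-(α / ε ^ 2)) (α / ε ^ 2), ApproxAt R (f t) (f' t) (r t) ∧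
        HasDerivAt f (f' t) t ∧ ‖f t‖ = ‖f₀‖ ∧ yn 0 (f t) ^ 2 + yn 2 (f t) ^ 2 ≤ 16 * ε ^ 2 ∧
        yn (m + 1) (f t) ^ 2 ≤ Cs m * yn (m + 1) f₀ ^ 2 + δ ∧
        (∀ n ≤ m + 1, yn n (r t) ≤ δ) ∧ an (r t) ≤ δ := by
  choose C hC using exists_energyConst
  have hC1 : ∀ m, 1 ≤ C m := fun m => (hC m).one_le
  have hC0 : ∀ m, 0 < C m := fun m => one_pos.trans_le (hC1 m)
  set β := anConst
  have hβ : 0 < β := anConst_pos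
  have hc1 := hC0 1
  set α : ℝ := Real.log 2 / (2 * C 1 * β ^ 2) with hα
  have hα0 : 0 < α := div_pos (Real.log_pos one_lt_two) (by positivity)
  refine ⟨1 / (2 * C 1 * β), by positivity, α, hα0,
    fun m => 3 * Real.exp (2 * C m * β ^ 2 * α) + Real.exp (6 * C m ^ 2 * β ^ 2 * α),
    fun m => by positivity, fun ε hε hε0 M f₀ hf₀ hX₀ m δ hδ => ?_⟩
  set a : ℝ := β * ε
  have ha : 0 < a := by positivity
  set T : ℝ := α / ε ^ 2 with hT
  have hT0 : 0 < T := by positivity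
  have haT : a ^ 2 * T = β ^ 2 * α := by simp only [a, hT]; field_simp
  set B : ℕ → ℝ := fun j => yn j f₀ * Real.exp (3 * C (j - 1) * a * T)
  have hB : ∀ j, 0 ≤ B j := fun j => mul_nonneg (yn_nonneg _ _) (Real.exp_pos _).le
  set D : ℕ → ℝ := fun n => Real.pi * 2 ^ (n + 3) * (a * B (n + 2))
  have hD : ∀ n, 0 ≤ D n := fun n => by
    have := hB (n + 2); have := Real.pi_pos; positivity
  have hsob := sobConst_nonneg
  set A : ℝ := sobConst * (D 1 + D 2)
  have hA : 0 ≤ A := mul_nonneg hsob (add_nonneg (hD 1) (hD 2))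
  set ρ : ℕ → ℝ := fun j => 2 * (B (j + 1) * D (j + 1)) +
    C j * (a * B (j + 1) * D (j + 1) + B (j + 1) ^ 2 * A)
  -- bounds under the bootstrap assumption
  have boot : ∀ (N : ℝ), 0 < N → ∀ f : ℝ → L2C, f 0 = f₀ → (∀ t, f t ∈ bandSpace N) →
      ∀ t ∈ Icc (-T) T, (∀ s ∈ uIcc 0 t, HasDerivAt f (galerkinField N (f s)) s) →
      (∀ s ∈ uIcc 0 t, yn 0 (f s) ^ 2 + yn 2 (f s) ^ 2 ≤ 16 * ε ^ 2) →
      (∀ j, yn (j + 1) (f t) ^ 2 ≤ yn (j + 1) f₀ ^ 2 * Real.exp (3 * C j * a * T)) ∧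
      (∀ n, yn n (galerkinError N (f t)) ≤ D n / N) ∧ an (galerkinError N (f t)) ≤ A / N ∧
      (∀ j, C j * a ≤ 1 / 2 → ∀ δ, ρ j / N ≤ δ → yn (j + 1) (f t) ^ 2 ≤
        (3 * yn (j + 1) f₀ ^ 2 + δ / (C j * a ^ 2)) * Real.exp (2 * C j * β ^ 2 * α)) := by
    intro N hN f hf0 hf t ht hd hX
    have hTle : ∀ s ∈ uIcc 0 t, |s| ≤ T := fun s hs => by
      have := abs_sub_left_of_mem_uIcc hs
      rw [sub_zero, sub_zero] at this
      exact this.trans (abs_le.2 ht)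
    have hsub : ∀ s ∈ uIcc 0 t, uIcc 0 s ⊆ uIcc 0 t := fun s hs =>
      uIcc_subset_uIcc left_mem_uIcc hs
    have han : ∀ s ∈ uIcc 0 t, an (f s) ≤ a ∧ l1 (f s) ≤ a := fun s hs =>
      (BL.of_coe (hf s).1).an_and_l1_le hε.le (hX s hs)
    have crude : ∀ s ∈ uIcc 0 t, ∀ j, yn (j + 1) (f s) ^ 2 ≤
        yn (j + 1) f₀ ^ 2 * Real.exp (3 * C j * a * T) := by
      intro s hs j
      have := yn_sq_le_crude (hC j) hN.le hf ha (fun u hu => hd u (hsub s hs hu))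
        (fun u hu => (han u (hsub s hs hu)).1)
      rw [hf0] at this
      refine this.trans ?_
      have := hC0 j
      gcongr
      exact hTle s hs
    have hyB : ∀ s ∈ uIcc 0 t, ∀ j, yn (j + 1) (f s) ≤ B (j + 1) := by
      intro s hs j
      refine abs_le_of_sq_le_sq' ((crude s hs j).trans ?_) (hB _) |>.2
      simp only [B, Nat.add_sub_cancel, mul_pow]
      gcongr
      have h1 : 1 ≤ Real.exp (3 * C j * a * T) := Real.one_le_exp (by have := hC0 j; positivity)
      nlinarith
    have herr : ∀ s ∈ uIcc 0 t, ∀ n, yn n (galerkinError N (f s)) ≤ D n / N := by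
      intro s hs n
      refine (yn_galerkinError_le hN (hf s) n).trans ?_
      have := Real.pi_pos
      have := l1_nonneg (f s)
      have := yn_nonneg (n + 2) (f s)
      simp only [D]
      gcongr
      · exact (han s hs).2
      · exact hyB s hs (n + 1)
    have haerr : ∀ s ∈ uIcc 0 t, an (galerkinError N (f s)) ≤ A / N := by
      intro s hs
      refine (approxAt_galerkin hN.le (hf s)).bl_r.an_le.trans ?_
      calc _ ≤ sobConst * (D 1 / N + D 2 / N) := by
            gcongr
            · exact herr s hs 1
            · exact herr s hs 2
        _ = A / N := by simp only [A]; ring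
    refine ⟨crude t right_mem_uIcc, herr t right_mem_uIcc, haerr t right_mem_uIcc,
      fun j hj δ hδ => ?_⟩
    have hcj := hC0 j
    have hBj := hB (j + 1)
    have hDj := hD (j + 1)
    have hρ0 : 0 ≤ ρ j := by positivity
    have := yn_sq_le_refined (hC j) hN.le hf (δ := δ) ha hj
      ((div_nonneg hρ0 hN.le).trans hδ) hd (fun s hs => (han s hs).1) (fun s hs => by
        refine le_trans ?_ hδ
        have g1 := yn_nonneg (j + 1) (f s)
        have g2 := yn_nonneg (j + 1) (galerkinError N (f s))
        have g3 := an_nonneg (f s)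
        have g4 := an_nonneg (galerkinError N (f s))
        calc _ ≤ 2 * (B (j + 1) * (D (j + 1) / N)) +
              C j * (a * B (j + 1) * (D (j + 1) / N) + B (j + 1) ^ 2 * (A / N)) := by
              gcongr
              · exact hyB s hs j
              · exact herr s hs _
              · exact (han s hs).1
              · exact hyB s hs j
              · exact herr s hs _
              · exact hyB s hs j
              · exact haerr s hs
          _ = ρ j / N := by simp only [ρ]; ring)
    rw [hf0] at this
    refine this.trans ?_
    have h1 : 2 * C j * a ^ 2 * |t| ≤ 2 * C j * β ^ 2 * α := by
      calc 2 * C j * a ^ 2 * |t| ≤ 2 * C j * a ^ 2 * T := by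
            gcongr; exact hTle t right_mem_uIcc
        _ = 2 * C j * (a ^ 2 * T) := by ring
        _ = _ := by rw [haT]; ring
    have hδ0 : 0 ≤ δ := (div_nonneg hρ0 hN.le).trans hδ
    gcongr
  -- choice of the truncation
  have small : ∀ K c : ℝ, 0 < c → ∀ᶠ N : ℝ in atTop, K / N ≤ c := fun K c hc =>
    ((tendsto_const_nhds.div_atTop tendsto_id).eventually (ge_mem_nhds hc))
  set δm : ℝ := δ * (C m * a ^ 2) / Real.exp (2 * C m * β ^ 2 * α)
  have hcm := hC0 m
  have hδm : 0 < δm := by positivity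
  obtain ⟨N, hN0, hNM, hN1, hNm, hND, hNA⟩ : ∃ N : ℝ, 0 < N ∧ M ≤ N ∧
      ρ 1 / N ≤ C 1 * a ^ 2 * ε ^ 2 ∧ ρ m / N ≤ δm ∧
      (∀ n ∈ Finset.range (m + 2), D n / N ≤ δ) ∧ A / N ≤ δ :=
    ((eventually_gt_atTop 0).and ((eventually_ge_atTop M).and ((small _ _ (by positivity)).and
      ((small _ _ hδm).and (((Finset.range (m + 2)).eventually_all.2 fun n _ => small _ _ hδ).and
        (small _ _ hδ)))))).exists
  obtain ⟨f, hf0, hf, hfd⟩ := exists_galerkin hN0.le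
    (⟨hf₀.1.mono hNM, hf₀.2⟩ : f₀ ∈ bandSpace N) (by positivity : 0 < T + 1)
  have hIoo : ∀ t ∈ Icc (-T) T, t ∈ Ioo (-(T + 1)) (T + 1) := fun t ht =>
    ⟨by linarith [ht.1], by linarith [ht.2]⟩
  have h0T : (0 : ℝ) ∈ Icc (-T) T := ⟨by linarith, hT0.le⟩
  have hsubT : ∀ t ∈ Icc (-T) T, uIcc 0 t ⊆ Icc (-T) T := fun t ht =>
    ordConnected_Icc.uIcc_subset h0T ht
  have hy0 : ∀ t ∈ Icc (-T) T, yn 0 (f t) = yn 0 f₀ := fun t ht => by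
    rw [yn_zero_coe, yn_zero_coe, (hfd t (hIoo t ht)).2]
  have hXlt : ∀ t ∈ Icc (-T) T, yn 0 (f t) ^ 2 + yn 2 (f t) ^ 2 < 16 * ε ^ 2 := by
    refine lt_of_continuity_argument (fun t ht => ?_) ?_ fun t ht hb => ?_
    · have h := fun n => (hasDerivAt_yn_sq (hfd t (hIoo t ht)).1
        (Eventually.of_forall fun τ => (hf τ).1) (galerkinField_mem (hf t)).1 n).continuousAt
      exact ((h 0).add (h 2)).continuousWithinAt
    · rw [hf0]
      nlinarith [sq_pos_of_pos hε]
    · obtain ⟨-, -, -, h⟩ := boot N hN0 f hf0 hf t ht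
        (fun s hs => (hfd s (hIoo s (hsubT t ht hs))).1) hb
      have h2 := h 1 (by
        simp only [a]
        calc C 1 * (β * ε) ≤ C 1 * (β * (1 / (2 * C 1 * β))) := by gcongr
          _ = 1 / 2 := by field_simp) _ hN1
      have e1 : Real.exp (2 * C 1 * β ^ 2 * α) = 2 := by
        rw [hα, mul_div_cancel₀ _ (by positivity), Real.exp_log two_pos]
      have e2 : C 1 * a ^ 2 * ε ^ 2 / (C 1 * a ^ 2) = ε ^ 2 := by field_simp
      rw [e1, e2] at h2
      rw [hy0 t ht]
      have := sq_nonneg (yn 0 f₀)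
      norm_num at h2
      nlinarith [sq_pos_of_pos hε]
  refine ⟨2 * N, f, fun t => galerkinField N (f t), fun t => galerkinError N (f t), hf0,
    fun t => ⟨by rw [mul_div_cancel_left₀ N two_ne_zero]; exact (hf t).1, (hf t).2⟩,
    fun t ht => ?_⟩
  obtain ⟨h1, h2, h3, h4⟩ := boot N hN0 f hf0 hf t ht
    (fun s hs => (hfd s (hIoo s (hsubT t ht hs))).1) (fun s hs => (hXlt s (hsubT t ht hs)).le)
  refine ⟨approxAt_galerkin hN0.le (hf t), (hfd t (hIoo t ht)).1, (hfd t (hIoo t ht)).2,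
    (hXlt t ht).le, ?_, fun n hn => (h2 n).trans (hND n (Finset.mem_range.2 (by omega))),
    h3.trans hNA⟩
  have hyy := sq_nonneg (yn (m + 1) f₀)
  rcases le_or_gt (C m * a) (1 / 2) with hm | hm
  · refine (h4 m hm _ hNm).trans ?_
    have e1 : δm / (C m * a ^ 2) * Real.exp (2 * C m * β ^ 2 * α) = δ := by
      simp only [δm]; field_simp
    rw [add_mul, e1]
    have := mul_nonneg hyy (Real.exp_pos (6 * C m ^ 2 * β ^ 2 * α)).le
    linarith
  · refine (h1 m).trans ?_
    have e1 : 3 * C m * a * T ≤ 6 * C m ^ 2 * β ^ 2 * α := by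
      have : 3 * C m * a * T * 1 ≤ 3 * C m * a * T * (2 * (C m * a)) := by
        gcongr; linarith
      calc 3 * C m * a * T ≤ 6 * C m ^ 2 * (a ^ 2 * T) := by linarith
        _ = _ := by rw [haT]; ring
    have e2 := Real.exp_le_exp.2 e1
    have := mul_le_mul_of_nonneg_left e2 hyy
    have := mul_nonneg hyy (Real.exp_pos (2 * C m * β ^ 2 * α)).le
    linarith

theorem half_add_coe (f g : L2C) :
    ((1 / 2 : ℝ) • (f + g) : L2C) =ᵐ[volume] fun x => (1 / 2 : ℂ) * f x + (1 / 2 : ℂ) * g x := by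
  filter_upwards [Lp.coeFn_smul (1 / 2 : ℝ) (f + g), Lp.coeFn_add f g] with x h1 h2
  rw [h1, Pi.smul_apply, h2, Pi.add_apply, Complex.real_smul]
  push_cast
  ring

theorem eLpNorm_wt_sub_le (n : ℕ) (p : ℝ≥0∞) (hp : 1 ≤ p) (f g : L2C) :
    eLpNorm (wt n (f - g : L2C)) p volume ≤ eLpNorm (wt n f) p volume + eLpNorm (wt n g) p volume := by
  have e : wt n (f - g : L2C) =ᵐ[volume] wt n f - wt n g := by
    filter_upwards [Lp.coeFn_sub f g] with x hx
    simp only [wt, hx, Pi.sub_apply, mul_sub]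
  rw [eLpNorm_congr_ae e]
  exact eLpNorm_sub_le (measurable_wt n (measurable_coe f)).aestronglyMeasurable
    (measurable_wt n (measurable_coe g)).aestronglyMeasurable hp

theorem eLpNorm_wt_half_add_le (n : ℕ) (p : ℝ≥0∞) (hp : 1 ≤ p) (f g : L2C) :
    eLpNorm (wt n ((1 / 2 : ℝ) • (f + g) : L2C)) p volume ≤
      ENNReal.ofReal (1 / 2) * (eLpNorm (wt n f) p volume + eLpNorm (wt n g) p volume) := by
  have e : wt n ((1 / 2 : ℝ) • (f + g) : L2C) =ᵐ[volume] (1 / 2 : ℝ) • (wt n f + wt n g) := by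
    filter_upwards [half_add_coe f g] with x hx
    simp only [wt, hx, Pi.smul_apply, Pi.add_apply, Complex.real_smul]
    push_cast
    ring
  rw [eLpNorm_congr_ae e, eLpNorm_const_smul, ← ofReal_norm, Real.norm_of_nonneg (by norm_num)]
  gcongr
  exact eLpNorm_add_le (measurable_wt n (measurable_coe f)).aestronglyMeasurable
    (measurable_wt n (measurable_coe g)).aestronglyMeasurable hp

section
variable {R : ℝ} {f g : L2C}

theorem an_sub_le (hf : BL R f) (hg : BL R g) (h : BL R (f - g : L2C)) :
    an (f - g : L2C) ≤ an f + an g := by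
  have := eLpNorm_wt_sub_le 1 1 le_rfl f g
  change An _ ≤ An _ + An _ at this
  rw [← h.ofReal_an, ← hf.ofReal_an, ← hg.ofReal_an,
    ← ENNReal.ofReal_add (an_nonneg _) (an_nonneg _)] at this
  exact (ENNReal.ofReal_le_ofReal_iff (add_nonneg (an_nonneg _) (an_nonneg _))).1 this

theorem an_half_add_le (hf : BL R f) (hg : BL R g) (h : BL R ((1 / 2 : ℝ) • (f + g) : L2C)) :
    an ((1 / 2 : ℝ) • (f + g) : L2C) ≤ 1 / 2 * (an f + an g) := by
  have := eLpNorm_wt_half_add_le 1 1 le_rfl f g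
  change An _ ≤ _ * (An _ + An _) at this
  have h1 := an_nonneg f
  have h2 := an_nonneg g
  rw [← h.ofReal_an, ← hf.ofReal_an, ← hg.ofReal_an, ← ENNReal.ofReal_add h1 h2,
    ← ENNReal.ofReal_mul (by norm_num)] at this
  exact (ENNReal.ofReal_le_ofReal_iff (by positivity)).1 this

end

theorem ApproxAt.pair {R : ℝ} {f₁ f₁' r₁ f₂ f₂' r₂ : L2C} (h₁ : ApproxAt R f₁ f₁' r₁)
    (h₂ : ApproxAt R f₂ f₂' r₂) :
    ApproxPairAt R ((1 / 2 : ℝ) • (f₁ + f₂)) (f₁ - f₂) ((1 / 2 : ℝ) • (f₁' + f₂')) (f₁' - f₂')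
      ((1 / 2 : ℝ) • (r₁ + r₂)) (r₁ - r₂) := by
  have m₁ : f₁ ∈ bandSpace (R / 2) := ⟨h₁.band, h₁.herm⟩
  have m₂ : f₂ ∈ bandSpace (R / 2) := ⟨h₂.band, h₂.herm⟩
  have m₁' : f₁' ∈ bandSpace R := ⟨h₁.band', h₁.herm'⟩
  have m₂' : f₂' ∈ bandSpace R := ⟨h₂.band', h₂.herm'⟩
  have mr₁ : r₁ ∈ bandSpace R := ⟨h₁.band_r, h₁.herm_r⟩
  have mr₂ : r₂ ∈ bandSpace R := ⟨h₂.band_r, h₂.herm_r⟩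
  have half : ∀ {N : ℝ} {f g : L2C}, f ∈ bandSpace N → g ∈ bandSpace N →
      (1 / 2 : ℝ) • (f + g) ∈ bandSpace N := fun hf hg =>
    (bandSpace _).smul_mem _ ((bandSpace _).add_mem hf hg)
  have mS := half m₁ m₂
  have mV := (bandSpace _).sub_mem m₁ m₂
  set S : L2C := (1 / 2 : ℝ) • (f₁ + f₂) with hS
  set V : L2C := f₁ - f₂ with hV
  have e₁ : f₁ =ᵐ[volume] fun x => S x + (1 / 2 : ℂ) * V x := by
    filter_upwards [half_add_coe f₁ f₂, Lp.coeFn_sub f₁ f₂] with x h1 h2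
    rw [hS, hV, h1, h2, Pi.sub_apply]; ring
  have e₂ : f₂ =ᵐ[volume] fun x => S x + (-(1 / 2) : ℂ) * V x := by
    filter_upwards [half_add_coe f₁ f₂, Lp.coeFn_sub f₁ f₂] with x h1 h2
    rw [hS, hV, h1, h2, Pi.sub_apply]; ring
  have c₁ := conv_congr e₁ e₁
  have c₂ := conv_congr e₂ e₂
  have k := fun c ξ => conv_self_of_add (Lp.memLp S) (Lp.memLp V) c ξ
  refine ⟨mS.1, mV.1, mS.2, mV.2, (half m₁' m₂').1, (half m₁' m₂').2,
    ((bandSpace _).sub_mem m₁' m₂').1, (half mr₁ mr₂).1, ((bandSpace _).sub_mem mr₁ mr₂).1,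
    h₁.nonneg, ?_, ?_⟩
  · filter_upwards [half_add_coe f₁' f₂', half_add_coe r₁ r₂, h₁.eq, h₂.eq, e₁, e₂]
      with ξ h1 h2 h3 h4 h5 h6
    rw [h1, h2, h3, h4, c₁, c₂, k, k, h5, h6]
    ring
  · filter_upwards [Lp.coeFn_sub f₁' f₂', Lp.coeFn_sub r₁ r₂, h₁.eq, h₂.eq, e₁, e₂]
      with ξ h1 h2 h3 h4 h5 h6
    rw [h1, h2, Pi.sub_apply, Pi.sub_apply, h3, h4, c₁, c₂, k, k, h5, h6]
    ring

/-- Stability of approximate solutions in `L²`. -/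
theorem exists_diff_bound : ∃ ε₀ : ℝ, 0 < ε₀ ∧ ∀ α : ℝ, 0 < α → ∃ C : ℝ, 0 ≤ C ∧
    ∀ ε : ℝ, 0 < ε → ε ≤ ε₀ → ∀ η : ℝ, 0 < η → ∃ δ : ℝ, 0 < δ ∧
    ∀ (R : ℝ) (f₁ f₁' r₁ f₂ f₂' r₂ : ℝ → L2C),
      (∀ t, Band (R / 2) (f₁ t) ∧ Herm (f₁ t)) → (∀ t, Band (R / 2) (f₂ t) ∧ Herm (f₂ t)) →
      (∀ t ∈ Icc (-(α / ε ^ 2)) (α / ε ^ 2), ApproxAt R (f₁ t) (f₁' t) (r₁ t) ∧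
        HasDerivAt f₁ (f₁' t) t ∧ yn 0 (f₁ t) ^ 2 + yn 2 (f₁ t) ^ 2 ≤ 16 * ε ^ 2 ∧
        ‖r₁ t‖ ≤ δ ∧ an (r₁ t) ≤ δ) →
      (∀ t ∈ Icc (-(α / ε ^ 2)) (α / ε ^ 2), ApproxAt R (f₂ t) (f₂' t) (r₂ t) ∧
        HasDerivAt f₂ (f₂' t) t ∧ yn 0 (f₂ t) ^ 2 + yn 2 (f₂ t) ^ 2 ≤ 16 * ε ^ 2 ∧
        ‖r₂ t‖ ≤ δ ∧ an (r₂ t) ≤ δ) →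
      ∀ t ∈ Icc (-(α / ε ^ 2)) (α / ε ^ 2),
        ‖f₁ t - f₂ t‖ ^ 2 ≤ C * ‖f₁ 0 - f₂ 0‖ ^ 2 + η := by
  obtain ⟨C, hC, hdiff⟩ := exists_diffEnergy_estimate
  set β := anConst
  have hβ : 0 < β := anConst_pos
  have hpi := Real.pi_pos
  set κ : ℝ := 10 * (C + 1) * β ^ 2 with hκd
  have hκ : 0 < κ := by positivity
  refine ⟨1 / (4 * Real.pi * β), by positivity, fun α hα => ⟨3 * Real.exp (κ * α), by positivity,
    fun ε hε hε0 η hη => ?_⟩⟩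
  set L : ℝ := 32 * ε + C * (64 * ε ^ 2 + 16 * β * ε ^ 2) with hL
  have hL0 : 0 < L := by positivity
  refine ⟨η * (κ * ε ^ 2) / (2 * L * Real.exp (κ * α)), by positivity, ?_⟩
  set δ : ℝ := η * (κ * ε ^ 2) / (2 * L * Real.exp (κ * α)) with hδd
  have hδ : 0 < δ := by positivity
  intro R f₁ f₁' r₁ f₂ f₂' r₂ hb₁ hb₂ h₁ h₂ t ht
  set T : ℝ := α / ε ^ 2 with hTd
  have hT : 0 < T := by positivity
  have h0T : (0 : ℝ) ∈ Icc (-T) T := ⟨by linarith, hT.le⟩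
  have hsub : uIcc 0 t ⊆ Icc (-T) T := ordConnected_Icc.uIcc_subset h0T ht
  set S : ℝ → L2C := fun τ => (1 / 2 : ℝ) • (f₁ τ + f₂ τ) with hSd
  set V : ℝ → L2C := fun τ => f₁ τ - f₂ τ with hVd
  have hR : 0 ≤ R := (h₁ 0 h0T).1.nonneg
  have pair : ∀ s ∈ uIcc 0 t, ApproxPairAt R (S s) (V s) ((1 / 2 : ℝ) • (f₁' s + f₂' s))
      (f₁' s - f₂' s) ((1 / 2 : ℝ) • (r₁ s + r₂ s)) (r₁ s - r₂ s) := fun s hs =>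
    (h₁ s (hsub hs)).1.pair (h₂ s (hsub hs)).1
  have mem₁ : ∀ s, f₁ s ∈ bandSpace R := fun s => ⟨(hb₁ s).1.mono (by linarith), (hb₁ s).2⟩
  have mem₂ : ∀ s, f₂ s ∈ bandSpace R := fun s => ⟨(hb₂ s).1.mono (by linarith), (hb₂ s).2⟩
  have memS : ∀ s, S s ∈ bandSpace R := fun s =>
    (bandSpace R).smul_mem _ ((bandSpace R).add_mem (mem₁ s) (mem₂ s))
  have memV : ∀ s, V s ∈ bandSpace R := fun s => (bandSpace R).sub_mem (mem₁ s) (mem₂ s)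
  have anS : ∀ s ∈ uIcc 0 t, an (S s) ≤ β * ε := fun s hs => by
    have a1 := ((BL.of_coe (mem₁ s).1).an_and_l1_le hε.le (h₁ s (hsub hs)).2.2.1).1
    have a2 := ((BL.of_coe (mem₂ s).1).an_and_l1_le hε.le (h₂ s (hsub hs)).2.2.1).1
    have := an_half_add_le (BL.of_coe (mem₁ s).1) (BL.of_coe (mem₂ s).1) (BL.of_coe (memS s).1)
    linarith
  have anV : ∀ s ∈ uIcc 0 t, an (V s) ≤ 2 * (β * ε) := fun s hs => by
    have a1 := ((BL.of_coe (mem₁ s).1).an_and_l1_le hε.le (h₁ s (hsub hs)).2.2.1).1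
    have a2 := ((BL.of_coe (mem₂ s).1).an_and_l1_le hε.le (h₂ s (hsub hs)).2.2.1).1
    have := an_sub_le (BL.of_coe (mem₁ s).1) (BL.of_coe (mem₂ s).1) (BL.of_coe (memV s).1)
    linarith
  have anr : ∀ s ∈ uIcc 0 t, an ((1 / 2 : ℝ) • (r₁ s + r₂ s) : L2C) ≤ δ := fun s hs => by
    have a1 := (h₁ s (hsub hs)).1.bl_r
    have a2 := (h₂ s (hsub hs)).1.bl_r
    have := an_half_add_le a1 a2 (BL.of_coe (pair s hs).band_r)
    linarith [(h₁ s (hsub hs)).2.2.2.2, (h₂ s (hsub hs)).2.2.2.2]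
  have ynρ : ∀ s ∈ uIcc 0 t, yn 0 (r₁ s - r₂ s : L2C) ≤ 2 * δ := fun s hs => by
    rw [yn_zero_coe]
    refine (norm_sub_le _ _).trans ?_
    linarith [(h₁ s (hsub hs)).2.2.2.1, (h₂ s (hsub hs)).2.2.2.1]
  have four : ∀ f : L2C, yn 0 f ^ 2 + yn 2 f ^ 2 ≤ 16 * ε ^ 2 → ‖f‖ ≤ 4 * ε := fun f hf => by
    rw [← yn_zero_coe]
    refine abs_le_of_sq_le_sq' ?_ (by positivity) |>.2
    nlinarith [sq_nonneg (yn 2 f)]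
  have ynV : ∀ s ∈ uIcc 0 t, yn 0 (V s) ≤ 8 * ε := fun s hs => by
    rw [yn_zero_coe]
    refine (norm_sub_le _ _).trans ?_
    linarith [four _ (h₁ s (hsub hs)).2.2.1, four _ (h₂ s (hsub hs)).2.2.1]
  have hβε : 2 * Real.pi * (β * ε) ≤ 1 / 2 := by
    calc _ ≤ 2 * Real.pi * (β * (1 / (4 * Real.pi * β))) := by gcongr
      _ = 1 / 2 := by field_simp; norm_num
  have heq : ∀ s ∈ uIcc 0 t, |diffEnergy (S s) (V s) - yn 0 (V s) ^ 2| ≤ yn 0 (V s) ^ 2 / 2 := by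
    intro s hs
    refine (abs_diffEnergy_sub_le (pair s hs).blS (pair s hs).blV).trans ?_
    calc 2 * Real.pi * (an (S s) * yn 0 (V s) ^ 2) ≤ 2 * Real.pi * (β * ε * yn 0 (V s) ^ 2) := by
          gcongr; exact anS s hs
      _ = 2 * Real.pi * (β * ε) * yn 0 (V s) ^ 2 := by ring
      _ ≤ 1 / 2 * yn 0 (V s) ^ 2 := by gcongr
      _ = _ := by ring
  have hD : ∀ s ∈ uIcc 0 t, ∃ D, HasDerivAt (fun τ => diffEnergy (S τ) (V τ)) D s ∧
      |D| ≤ κ * ε ^ 2 * |diffEnergy (S s) (V s)| + L * δ := by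
    intro s hs
    obtain ⟨D, hD, hb⟩ := hdiff R S V _ _ _ _ s (pair s hs)
      (((h₁ s (hsub hs)).2.1.add (h₂ s (hsub hs)).2.1).const_smul (1 / 2 : ℝ))
      ((h₁ s (hsub hs)).2.1.sub (h₂ s (hsub hs)).2.1)
      (Eventually.of_forall fun τ => memS τ) (Eventually.of_forall fun τ => (memV τ).1)
    refine ⟨D, hD, hb.trans ?_⟩
    have h1 := abs_le.1 (heq s hs)
    have h2 := le_abs_self (diffEnergy (S s) (V s))
    have n1 := an_nonneg (S s)
    have n2 := an_nonneg (V s)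
    have n3 := an_nonneg ((1 / 2 : ℝ) • (r₁ s + r₂ s) : L2C)
    have n4 := yn_nonneg 0 (V s)
    have n5 := yn_nonneg 0 (r₁ s - r₂ s : L2C)
    calc _ ≤ C * (((β * ε) ^ 2 + (2 * (β * ε)) ^ 2) * (2 * |diffEnergy (S s) (V s)|)) +
          2 * (8 * ε * (2 * δ)) + C * (δ * (8 * ε) ^ 2 + β * ε * (8 * ε) * (2 * δ)) := by
          gcongr
          · exact anS s hs
          · exact anV s hs
          · linarith [h1.1]
          · exact ynV s hs
          · exact ynρ s hs
          · exact anr s hs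
          · exact ynV s hs
          · exact anS s hs
          · exact ynV s hs
          · exact ynρ s hs
      _ = 10 * C * β ^ 2 * ε ^ 2 * |diffEnergy (S s) (V s)| + L * δ := by rw [hL]; ring
      _ ≤ _ := by
          rw [hκd]
          gcongr
          linarith
  have h := abs_le_of_abs_deriv_le (E := fun τ => diffEnergy (S τ) (V τ))
    (E' := deriv fun τ => diffEnergy (S τ) (V τ)) (κ := κ * ε ^ 2) (δ := L * δ) (t := t)
    (by positivity) (by positivity)
    (fun s hs => by obtain ⟨D, h, -⟩ := hD s hs; exact h.differentiableAt.hasDerivAt)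
    (fun s hs => by obtain ⟨D, h, hb⟩ := hD s hs; rwa [h.deriv])
  have h1 := (abs_le.1 (heq t right_mem_uIcc)).1
  have h2 := (abs_le.1 (heq 0 left_mem_uIcc)).2
  have h2' := (abs_le.1 (heq 0 left_mem_uIcc)).1
  have h3 : |diffEnergy (S 0) (V 0)| ≤ 3 / 2 * yn 0 (V 0) ^ 2 := by
    rw [abs_le]; constructor <;> linarith [sq_nonneg (yn 0 (V 0))]
  have htT : κ * ε ^ 2 * |t| ≤ κ * α := by
    calc _ ≤ κ * ε ^ 2 * T := by gcongr; exact abs_le.2 ht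
      _ = κ * α := by rw [hTd]; field_simp
  change ‖V t‖ ^ 2 ≤ _ * ‖V 0‖ ^ 2 + _
  rw [← yn_zero_coe, ← yn_zero_coe]
  calc yn 0 (V t) ^ 2 ≤ 2 * |diffEnergy (S t) (V t)| := by
        linarith [le_abs_self (diffEnergy (S t) (V t))]
    _ ≤ 2 * ((3 / 2 * yn 0 (V 0) ^ 2 + L * δ / (κ * ε ^ 2)) * Real.exp (κ * α)) := by
        gcongr
        exact h.trans (by gcongr)
    _ = 3 * Real.exp (κ * α) * yn 0 (V 0) ^ 2 + η := by
        rw [hδd]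
        field_simp

theorem isMult_cut_one (L : ℝ) : IsMult (cut L fun _ => 1) := by
  refine ⟨measurable_cut L measurable_const, 1, fun x => ?_⟩
  rcases le_or_gt |x| L with h | h
  · rw [cut_of_le h, norm_one]
  · rw [cut_of_lt h, norm_zero]; exact zero_le_one

/-- The restriction to the frequency band `[-L, L]`. -/
noncomputable def bandProj (L : ℝ) : L2C →L[ℝ] L2C := mulOp _ (isMult_cut_one L)

theorem bandProj_coe (L : ℝ) (f : L2C) : bandProj L f =ᵐ[volume] cut L f := by
  filter_upwards [mulOp_coe _ (isMult_cut_one L) f] with x hx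
  rw [bandProj, hx]
  rcases le_or_gt |x| L with h | h
  · rw [cut_of_le h, cut_of_le h, one_mul]
  · rw [cut_of_lt h, cut_of_lt h, zero_mul]

theorem bandProj_mem (L : ℝ) {f : L2C} (hf : Herm f) : bandProj L f ∈ bandSpace L := by
  refine ⟨(band_cut L f).congr (bandProj_coe L f).symm, Herm.congr ?_ (bandProj_coe L f).symm⟩
  filter_upwards [hf] with x hx
  rcases le_or_gt |x| L with h | h
  · rw [cut_of_le h, cut_of_le (by rwa [abs_neg]), hx]
  · rw [cut_of_lt h, cut_of_lt (by rwa [abs_neg]), map_zero]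

theorem Yn_bandProj_le (n : ℕ) (L : ℝ) (f : L2C) : Yn n (bandProj L f) ≤ Yn n f := by
  refine eLpNorm_mono_ae ?_
  filter_upwards [bandProj_coe L f] with x hx
  rw [wt, wt, norm_mul, norm_mul, hx]
  gcongr
  rcases le_or_gt |x| L with h | h
  · rw [cut_of_le h]
  · rw [cut_of_lt h, norm_zero]; exact norm_nonneg _

theorem norm_sub_bandProj_anti (f : L2C) {M N : ℝ} (h : N ≤ M) :
    ‖f - bandProj M f‖ ≤ ‖f - bandProj N f‖ := by
  refine Lp.norm_le_norm_of_ae_le ?_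
  filter_upwards [Lp.coeFn_sub f (bandProj M f), Lp.coeFn_sub f (bandProj N f), bandProj_coe M f,
    bandProj_coe N f] with x h1 h2 h3 h4
  rw [h1, h2, Pi.sub_apply, Pi.sub_apply, h3, h4]
  rcases le_or_gt |x| M with h' | h'
  · rw [cut_of_le h', sub_self, norm_zero]; exact norm_nonneg _
  · rw [cut_of_lt h', cut_of_lt (h.trans_lt h')]

theorem tendsto_bandProj (f : L2C) :
    Tendsto (fun n : ℕ => ‖f - bandProj n f‖) atTop (𝓝 0) := by
  have h1 : Tendsto (fun n : ℕ => ∫⁻ x, (if |x| ≤ (n : ℝ) then 0 else ‖f x‖ₑ ^ 2)) atTop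
      (𝓝 (∫⁻ _ : ℝ, 0)) := by
    refine tendsto_lintegral_of_dominated_convergence (fun x => ‖f x‖ₑ ^ 2) (fun n => ?_)
      (fun n => Eventually.of_forall fun x => ?_) ?_ (Eventually.of_forall fun x => ?_)
    · exact Measurable.ite (measurableSet_le (by fun_prop) measurable_const) measurable_const
        ((measurable_coe f).enorm.pow_const 2)
    · dsimp only
      split_ifs
      · exact zero_le
      · exact le_rfl
    · rw [← eLpNorm_two_sq]
      exact ENNReal.pow_ne_top (Lp.memLp f).2.ne
    · refine tendsto_const_nhds.congr' ?_
      obtain ⟨n, hn⟩ := exists_nat_ge |x|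
      filter_upwards [eventually_ge_atTop n] with m hm
      rw [if_pos (hn.trans (by exact_mod_cast hm))]
  have h2 : ∀ n : ℕ, ∫⁻ x, (if |x| ≤ (n : ℝ) then 0 else ‖f x‖ₑ ^ 2) =
      ‖f - bandProj n f‖ₑ ^ 2 := by
    intro n
    rw [Lp.enorm_def, eLpNorm_two_sq]
    refine lintegral_congr_ae ?_
    filter_upwards [Lp.coeFn_sub f (bandProj n f), bandProj_coe n f] with x h1 h2
    rw [h1, Pi.sub_apply, h2]
    split_ifs with h
    · rw [cut_of_le h, sub_self]; simp
    · rw [cut_of_lt (not_le.1 h), sub_zero]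
  simp only [h2, lintegral_zero] at h1
  have h3 := (ENNReal.tendsto_toReal ENNReal.zero_ne_top).comp h1
  have h4 := (Real.continuous_sqrt.tendsto _).comp h3
  simp only [ENNReal.toReal_zero, Real.sqrt_zero] at h4
  refine h4.congr fun n => ?_
  simp only [Function.comp_apply, ENNReal.toReal_pow, toReal_enorm]
  exact Real.sqrt_sq (norm_nonneg _)

/-- The frequency weight `min(1, (|ξ| / N)ᴷ)`. -/
theorem isMult_highWeight (K : ℕ) {N : ℝ} (hN : 0 < N) :
    IsMult fun ξ => ((min 1 (|ξ| / N) ^ K : ℝ) : ℂ) := by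
  refine ⟨by fun_prop, 1, fun x => ?_⟩
  have h0 : 0 ≤ min 1 (|x| / N) := le_min zero_le_one (by positivity)
  rw [Complex.norm_real, Real.norm_of_nonneg (by positivity)]
  exact pow_le_one₀ h0 (min_le_left _ _)

/-- Multiplication by `min(1, (|ξ| / N)ᴷ)`. -/
noncomputable def highPass (K : ℕ) {N : ℝ} (hN : 0 < N) : L2C →L[ℝ] L2C :=
  mulOp _ (isMult_highWeight K hN)

theorem norm_highPass_coe (K : ℕ) {N : ℝ} (hN : 0 < N) (f : L2C) :
    ∀ᵐ ξ, ‖highPass K hN f ξ‖ = min 1 (|ξ| / N) ^ K * ‖f ξ‖ := by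
  filter_upwards [mulOp_coe _ (isMult_highWeight K hN) f] with x hx
  have h0 : 0 ≤ min 1 (|x| / N) := le_min zero_le_one (by positivity)
  rw [highPass, hx, norm_mul, Complex.norm_real, Real.norm_of_nonneg (by positivity)]

theorem norm_highPass_le (K : ℕ) {N : ℝ} (hN : 0 < N) (f : L2C) : ‖highPass K hN f‖ ≤ ‖f‖ := by
  refine Lp.norm_le_norm_of_ae_le ?_
  filter_upwards [norm_highPass_coe K hN f] with x hx
  have h0 : 0 ≤ min 1 (|x| / N) := le_min zero_le_one (by positivity)
  rw [hx]
  exact mul_le_of_le_one_left (norm_nonneg _) (pow_le_one₀ h0 (min_le_left _ _))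

theorem norm_highPass_le_yn {R : ℝ} (K : ℕ) {N : ℝ} (hN : 0 < N) {f : L2C} (hf : Band R f) :
    N ^ K * ‖highPass K hN f‖ ≤ yn K f := by
  rw [← norm_mulOp_abs_pow hf, ← le_div_iff₀' (by positivity), div_eq_inv_mul]
  refine Lp.norm_le_mul_norm_of_ae_le_mul ?_
  filter_upwards [norm_highPass_coe K hN f, mulOp_abs_pow hf K] with x h1 h2
  rw [h1, h2, wt, norm_mul, Complex.norm_real, Real.norm_of_nonneg (by positivity), ← mul_assoc,
    ← div_eq_inv_mul, ← div_pow]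
  gcongr
  exact min_le_right _ _

theorem norm_bandProj_sub_le_highPass (K : ℕ) {M N : ℝ} (hN : 0 < N) (h : N ≤ M) (f : L2C) :
    ‖bandProj M f - bandProj N f‖ ≤ ‖highPass K hN f‖ := by
  refine Lp.norm_le_norm_of_ae_le ?_
  filter_upwards [Lp.coeFn_sub (bandProj M f) (bandProj N f), bandProj_coe M f,
    bandProj_coe N f, norm_highPass_coe K hN f] with x h1 h2 h3 h4
  have h0 : 0 ≤ min 1 (|x| / N) := le_min zero_le_one (by positivity)
  rw [h1, Pi.sub_apply, h2, h3, h4]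
  rcases le_or_gt |x| N with h' | h'
  · rw [cut_of_le h', cut_of_le (h'.trans h), sub_self, norm_zero]; positivity
  · rw [cut_of_lt h', sub_zero, min_eq_left ((one_le_div hN).2 h'.le), one_pow, one_mul]
    rcases le_or_gt |x| M with h'' | h''
    · rw [cut_of_le h'']
    · rw [cut_of_lt h'', norm_zero]; exact norm_nonneg _

theorem yn_bandProj_le_highPass (K : ℕ) {N : ℝ} (hN : 0 < N) {f : L2C} (hf : Herm f) :
    yn K (bandProj N f) ≤ N ^ K * ‖highPass K hN f‖ := by
  have hb := (bandProj_mem N hf).1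
  rw [← norm_mulOp_abs_pow hb]
  refine Lp.norm_le_mul_norm_of_ae_le_mul ?_
  filter_upwards [norm_highPass_coe K hN f, mulOp_abs_pow hb K, bandProj_coe N f] with x h1 h2 h3
  rw [h1, h2, wt, h3, norm_mul, Complex.norm_real, Real.norm_of_nonneg (by positivity), ← mul_assoc,
    ← mul_pow]
  rcases le_or_gt |x| N with h' | h'
  · rw [cut_of_le h', min_eq_right (div_le_one_of_le₀ h' hN.le), mul_div_cancel₀ _ hN.ne']
  · have h0 : 0 ≤ min 1 (|x| / N) := le_min zero_le_one (by positivity)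
    rw [cut_of_lt h', norm_zero, mul_zero]; positivity

/-- `f` is a uniform limit of approximate solutions of size `4 ε` on `[-T, T]`. -/
def Approximable (ε T : ℝ) (f : ℝ → L2C) : Prop :=
  ∀ δ : ℝ, 0 < δ → ∃ (R : ℝ) (g g' r : ℝ → L2C), (∀ t, Band (R / 2) (g t) ∧ Herm (g t)) ∧
    ∀ t ∈ Icc (-T) T, (ApproxAt R (g t) (g' t) (r t) ∧ HasDerivAt g (g' t) t ∧
      yn 0 (g t) ^ 2 + yn 2 (g t) ^ 2 ≤ 16 * ε ^ 2 ∧ ‖r t‖ ≤ δ ∧ an (r t) ≤ δ) ∧ ‖g t - f t‖ ≤ δ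

theorem exists_diff_bound' : ∃ ε₀ : ℝ, 0 < ε₀ ∧ ∀ α : ℝ, 0 < α → ∃ C : ℝ, 0 ≤ C ∧
    ∀ ε : ℝ, 0 < ε → ε ≤ ε₀ → ∀ η : ℝ, 0 < η → ∃ δ : ℝ, 0 < δ ∧
    ∀ (R₁ R₂ : ℝ) (f₁ f₁' r₁ f₂ f₂' r₂ : ℝ → L2C),
      (∀ t, Band (R₁ / 2) (f₁ t) ∧ Herm (f₁ t)) → (∀ t, Band (R₂ / 2) (f₂ t) ∧ Herm (f₂ t)) →
      (∀ t ∈ Icc (-(α / ε ^ 2)) (α / ε ^ 2), ApproxAt R₁ (f₁ t) (f₁' t) (r₁ t) ∧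
        HasDerivAt f₁ (f₁' t) t ∧ yn 0 (f₁ t) ^ 2 + yn 2 (f₁ t) ^ 2 ≤ 16 * ε ^ 2 ∧
        ‖r₁ t‖ ≤ δ ∧ an (r₁ t) ≤ δ) →
      (∀ t ∈ Icc (-(α / ε ^ 2)) (α / ε ^ 2), ApproxAt R₂ (f₂ t) (f₂' t) (r₂ t) ∧
        HasDerivAt f₂ (f₂' t) t ∧ yn 0 (f₂ t) ^ 2 + yn 2 (f₂ t) ^ 2 ≤ 16 * ε ^ 2 ∧
        ‖r₂ t‖ ≤ δ ∧ an (r₂ t) ≤ δ) →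
      ∀ t ∈ Icc (-(α / ε ^ 2)) (α / ε ^ 2),
        ‖f₁ t - f₂ t‖ ^ 2 ≤ C * ‖f₁ 0 - f₂ 0‖ ^ 2 + η := by
  obtain ⟨ε₀, hε₀, h⟩ := exists_diff_bound
  refine ⟨ε₀, hε₀, fun α hα => ?_⟩
  obtain ⟨C, hC, h⟩ := h α hα
  refine ⟨C, hC, fun ε hε hε' η hη => ?_⟩
  obtain ⟨δ, hδ, h⟩ := h ε hε hε' η hη
  refine ⟨δ, hδ, fun R₁ R₂ f₁ f₁' r₁ f₂ f₂' r₂ b₁ b₂ h₁ h₂ => ?_⟩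
  exact h (max R₁ R₂) f₁ f₁' r₁ f₂ f₂' r₂
    (fun t => ⟨(b₁ t).1.mono (by linarith [le_max_left R₁ R₂]), (b₁ t).2⟩)
    (fun t => ⟨(b₂ t).1.mono (by linarith [le_max_right R₁ R₂]), (b₂ t).2⟩)
    (fun t ht => ⟨(h₁ t ht).1.mono (le_max_left _ _), (h₁ t ht).2⟩)
    (fun t ht => ⟨(h₂ t ht).1.mono (le_max_right _ _), (h₂ t ht).2⟩)

theorem tendsto_of_norm_sub_le {u : ℕ → L2C} {f : L2C} (h : ∀ n, ‖u n - f‖ ≤ 1 / ((n : ℝ) + 1)) :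
    Tendsto u atTop (𝓝 f) :=
  tendsto_iff_norm_sub_tendsto_zero.2
    (squeeze_zero (fun _ => norm_nonneg _) h tendsto_one_div_add_atTop_nhds_zero_nat)

/-- Stability in `L²` of limits of approximate solutions. -/
theorem exists_approximable_diff : ∃ ε₀ : ℝ, 0 < ε₀ ∧ ∀ α : ℝ, 0 < α → ∃ C : ℝ, 0 ≤ C ∧
    ∀ ε : ℝ, 0 < ε → ε ≤ ε₀ → ∀ f g : ℝ → L2C, Approximable ε (α / ε ^ 2) f →
      Approximable ε (α / ε ^ 2) g → ∀ t ∈ Icc (-(α / ε ^ 2)) (α / ε ^ 2),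
        ‖f t - g t‖ ^ 2 ≤ C * ‖f 0 - g 0‖ ^ 2 := by
  obtain ⟨ε₀, hε₀, h⟩ := exists_diff_bound'
  refine ⟨ε₀, hε₀, fun α hα => ?_⟩
  obtain ⟨C, hC, h⟩ := h α hα
  refine ⟨C, hC, fun ε hε hε' f g hf hg t ht => ?_⟩
  choose δ hδ h using fun n : ℕ => h ε hε hε' (1 / ((n : ℝ) + 1)) (by positivity)
  have hδ' : ∀ n, 0 < min (δ n) (1 / ((n : ℝ) + 1)) := fun n => lt_min (hδ n) (by positivity)
  choose R₁ f₁ f₁' r₁ hb₁ h₁ using fun n => hf _ (hδ' n)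
  choose R₂ f₂ f₂' r₂ hb₂ h₂ using fun n => hg _ (hδ' n)
  have h0 : (0 : ℝ) ∈ Icc (-(α / ε ^ 2)) (α / ε ^ 2) := by
    have : 0 < α / ε ^ 2 := by positivity
    exact ⟨by linarith, this.le⟩
  have l₁ : ∀ s ∈ Icc (-(α / ε ^ 2)) (α / ε ^ 2), Tendsto (fun n => f₁ n s) atTop (𝓝 (f s)) :=
    fun s hs => tendsto_of_norm_sub_le fun n => (h₁ n s hs).2.trans (min_le_right _ _)
  have l₂ : ∀ s ∈ Icc (-(α / ε ^ 2)) (α / ε ^ 2), Tendsto (fun n => f₂ n s) atTop (𝓝 (g s)) :=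
    fun s hs => tendsto_of_norm_sub_le fun n => (h₂ n s hs).2.trans (min_le_right _ _)
  have key : ∀ n, ‖f₁ n t - f₂ n t‖ ^ 2 ≤ C * ‖f₁ n 0 - f₂ n 0‖ ^ 2 + 1 / ((n : ℝ) + 1) :=
    fun n => h n _ _ _ _ _ _ _ _ (hb₁ n) (hb₂ n)
      (fun s hs => ⟨(h₁ n s hs).1.1, (h₁ n s hs).1.2.1, (h₁ n s hs).1.2.2.1,
        (h₁ n s hs).1.2.2.2.1.trans (min_le_left _ _), (h₁ n s hs).1.2.2.2.2.trans (min_le_left _ _)⟩)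
      (fun s hs => ⟨(h₂ n s hs).1.1, (h₂ n s hs).1.2.1, (h₂ n s hs).1.2.2.1,
        (h₂ n s hs).1.2.2.2.1.trans (min_le_left _ _), (h₂ n s hs).1.2.2.2.2.trans (min_le_left _ _)⟩)
      t ht
  have e1 := ((l₁ t ht).sub (l₂ t ht)).norm.pow 2
  have e2 := ((((l₁ 0 h0).sub (l₂ 0 h0)).norm.pow 2).const_mul C).add
    tendsto_one_div_add_atTop_nhds_zero_nat
  rw [add_zero] at e2
  exact le_of_tendsto_of_tendsto' e1 e2 key

/-- Solutions with small data, with uniform control of their high frequencies. -/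
theorem exists_solution : ∃ ε₀ : ℝ, 0 < ε₀ ∧ ∃ α : ℝ, 0 < α ∧ ∃ C : ℕ → ℝ, (∀ m, 0 ≤ C m) ∧
    ∀ ε : ℝ, 0 < ε → ε ≤ ε₀ → ∀ f₀ : L2C, Herm f₀ →
    Yn 0 f₀ ^ 2 + Yn 2 f₀ ^ 2 ≤ ENNReal.ofReal (ε ^ 2) → ∀ m : ℕ, ∃ f : ℝ → L2C, f 0 = f₀ ∧
      Approximable ε (α / ε ^ 2) f ∧ ∀ t ∈ Icc (-(α / ε ^ 2)) (α / ε ^ 2), ‖f t‖ ≤ ‖f₀‖ ∧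
        ∀ (N : ℝ) (hN : 0 < N), ‖highPass (m + 1) hN (f t)‖ ^ 2 ≤
          C m * ‖highPass (m + 1) hN f₀‖ ^ 2 := by
  obtain ⟨ε₁, hε₁, α, hα, Cs, hCs, hG⟩ := exists_approx_solution
  obtain ⟨ε₂, hε₂, hD⟩ := exists_diff_bound'
  obtain ⟨C, hC, hD⟩ := hD α hα
  refine ⟨min ε₁ ε₂, lt_min hε₁ hε₂, α, hα, fun m => 2 * (C + Cs m),
    fun m => by have := hCs m; positivity, fun ε hε hε0 f₀ hf₀ hX m => ?_⟩
  have hCm := hCs m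
  set T := α / ε ^ 2 with hT
  have hT0 : 0 < T := by positivity
  have h0T : (0 : ℝ) ∈ Icc (-T) T := ⟨by linarith, hT0.le⟩
  choose δ₀ hδ₀ hD using fun n : ℕ => hD ε hε (hε0.trans (min_le_right _ _))
    (1 / ((n : ℝ) + 1)) (by positivity)
  obtain ⟨δ, hδ, hδ1, hδ2⟩ : ∃ δ : ℕ → ℝ, (∀ n, 0 < δ n) ∧ (∀ n, δ n ≤ 1 / ((n : ℝ) + 1)) ∧
      ∀ n j, j ≤ n → δ n ≤ δ₀ j := by
    refine ⟨fun n => min (1 / ((n : ℝ) + 1)) ((Finset.range (n + 1)).inf' (by simp) δ₀),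
      fun n => lt_min (by positivity) ((Finset.lt_inf'_iff _).2 fun j _ => hδ₀ j),
      fun n => min_le_left _ _, fun n j hj => (min_le_right _ _).trans
        (Finset.inf'_le _ (Finset.mem_range.2 (by omega)))⟩
  have hP : ∀ M : ℝ, yn 0 (bandProj M f₀) ^ 2 + yn 2 (bandProj M f₀) ^ 2 ≤ ε ^ 2 := by
    intro M
    have hb := BL.of_coe (bandProj_mem M hf₀).1
    have := (add_le_add (pow_le_pow_left₀ zero_le (Yn_bandProj_le 0 M f₀) 2)
      (pow_le_pow_left₀ zero_le (Yn_bandProj_le 2 M f₀) 2)).trans hX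
    rw [← hb.ofReal_yn, ← hb.ofReal_yn, ← ENNReal.ofReal_pow (yn_nonneg _ _),
      ← ENNReal.ofReal_pow (yn_nonneg _ _), ← ENNReal.ofReal_add (sq_nonneg _) (sq_nonneg _)] at this
    exact (ENNReal.ofReal_le_ofReal_iff (sq_nonneg ε)).1 this
  choose R F F' r hF0 hFb hF using fun (M : ℝ) (n : ℕ) =>
    hG ε hε (hε0.trans (min_le_left _ _)) M (bandProj M f₀) (bandProj_mem M hf₀) (hP M) m (δ n) (hδ n)
  have hres : ∀ M n, ∀ t ∈ Icc (-T) T, ‖r M n t‖ ≤ δ n := fun M n t ht => by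
    rw [← yn_zero_coe]; exact (hF M n t ht).2.2.2.2.2.1 0 (by omega)
  have hdiff : ∀ (M M' : ℝ) (n n' j : ℕ), j ≤ n → j ≤ n' → ∀ t ∈ Icc (-T) T,
      ‖F M n t - F M' n' t‖ ^ 2 ≤ C * ‖bandProj M f₀ - bandProj M' f₀‖ ^ 2 + 1 / ((j : ℝ) + 1) := by
    intro M M' n n' j hj hj' t ht
    have := hD j _ _ _ _ _ _ _ _ (hFb M n) (hFb M' n')
      (fun s hs => ⟨(hF M n s hs).1, (hF M n s hs).2.1, (hF M n s hs).2.2.2.1,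
        (hres M n s hs).trans (hδ2 n j hj), (hF M n s hs).2.2.2.2.2.2.trans (hδ2 n j hj)⟩)
      (fun s hs => ⟨(hF M' n' s hs).1, (hF M' n' s hs).2.1, (hF M' n' s hs).2.2.2.1,
        (hres M' n' s hs).trans (hδ2 n' j hj'), (hF M' n' s hs).2.2.2.2.2.2.trans (hδ2 n' j hj')⟩)
      t ht
    rwa [hF0, hF0] at this
  set b : ℕ → ℝ := fun j => √(C * (2 * ‖f₀ - bandProj j f₀‖) ^ 2 + 1 / ((j : ℝ) + 1))
  have hb : Tendsto b atTop (𝓝 0) := by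
    have h1 := ((((tendsto_bandProj f₀).const_mul 2).pow 2).const_mul C).add
      tendsto_one_div_add_atTop_nhds_zero_nat
    have h2 := (Real.continuous_sqrt.tendsto _).comp h1
    simpa [b, Function.comp_def] using h2
  have hcau : ∀ t ∈ Icc (-T) T, ∀ n n' j : ℕ, j ≤ n → j ≤ n' →
      dist (F n n t) (F n' n' t) ≤ b j := by
    intro t ht n n' j hj hj'
    rw [dist_eq_norm]
    refine Real.le_sqrt_of_sq_le ((hdiff n n' n n' j hj hj' t ht).trans ?_)
    gcongr
    have a1 := norm_sub_bandProj_anti f₀ (show (j : ℝ) ≤ n by exact_mod_cast hj)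
    have a2 := norm_sub_bandProj_anti f₀ (show (j : ℝ) ≤ n' by exact_mod_cast hj')
    calc _ = ‖(f₀ - bandProj n' f₀) - (f₀ - bandProj n f₀)‖ := by congr 1; abel
      _ ≤ _ := (norm_sub_le _ _).trans (by linarith)
  have hlim : ∀ t, ∃ l, t ∈ Icc (-T) T → Tendsto (fun n : ℕ => F n n t) atTop (𝓝 l) := by
    intro t
    by_cases ht : t ∈ Icc (-T) T
    · obtain ⟨l, hl⟩ := cauchySeq_tendsto_of_complete (cauchySeq_of_le_tendsto_0 b (hcau t ht) hb)
      exact ⟨l, fun _ => hl⟩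
    · exact ⟨0, fun h => absurd h ht⟩
  choose f hf using hlim
  refine ⟨f, ?_, ?_, ?_⟩
  · refine tendsto_nhds_unique (hf 0 h0T) ?_
    simp only [hF0]
    have := tendsto_bandProj f₀
    refine tendsto_iff_norm_sub_tendsto_zero.2 (this.congr fun n => norm_sub_rev _ _)
  · intro δ' hδ'
    obtain ⟨n, hn1, hn2⟩ := ((hb.eventually (ge_mem_nhds hδ')).and
      (tendsto_one_div_add_atTop_nhds_zero_nat.eventually (ge_mem_nhds hδ'))).exists
    have hn3 := (hδ1 n).trans hn2
    refine ⟨R n n, F n n, F' n n, r n n, hFb n n, fun t ht => ⟨⟨(hF n n t ht).1, (hF n n t ht).2.1,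
      (hF n n t ht).2.2.2.1, (hres n n t ht).trans hn3, (hF n n t ht).2.2.2.2.2.2.trans hn3⟩, ?_⟩⟩
    refine le_trans ?_ hn1
    rw [← dist_eq_norm]
    exact le_of_tendsto (tendsto_const_nhds.dist (hf t ht))
      ((eventually_ge_atTop n).mono fun p hp => hcau t ht n p n le_rfl hp)
  · refine fun t ht => ⟨le_of_tendsto (hf t ht).norm (Eventually.of_forall fun n => ?_),
      fun N hN => ?_⟩
    · rw [(hF n n t ht).2.2.1]
      refine Lp.norm_le_norm_of_ae_le ?_
      filter_upwards [bandProj_coe n f₀] with x hx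
      rw [hx]
      rcases le_or_gt |x| n with h | h
      · rw [cut_of_le h]
      · rw [cut_of_lt h, norm_zero]; exact norm_nonneg _
    have hNK : 0 < N ^ (m + 1) := by positivity
    have key : ∀ᶠ n : ℕ in atTop, ‖highPass (m + 1) hN (F n n t)‖ ^ 2 ≤
        2 * (C * ‖highPass (m + 1) hN f₀‖ ^ 2 + 1 / ((n : ℝ) + 1)) +
        2 * (Cs m * ‖highPass (m + 1) hN f₀‖ ^ 2 +
          1 / ((n : ℝ) + 1) / (N ^ (m + 1)) ^ 2) := by
      obtain ⟨n₀, hn₀⟩ := exists_nat_ge N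
      filter_upwards [eventually_ge_atTop n₀] with n hn
      have hn : N ≤ n := hn₀.trans (by exact_mod_cast hn)
      have e1 : ‖F n n t - F N n t‖ ^ 2 ≤
          C * ‖highPass (m + 1) hN f₀‖ ^ 2 + 1 / ((n : ℝ) + 1) := by
        refine (hdiff n N n n n le_rfl le_rfl t ht).trans ?_
        gcongr
        exact norm_bandProj_sub_le_highPass (m + 1) hN hn f₀
      have e2 : ‖highPass (m + 1) hN (F N n t)‖ ^ 2 ≤
          Cs m * ‖highPass (m + 1) hN f₀‖ ^ 2 + 1 / ((n : ℝ) + 1) / (N ^ (m + 1)) ^ 2 := by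
        have a1 := norm_highPass_le_yn (m + 1) hN (hFb N n t).1
        have a2 := (hF N n t ht).2.2.2.2.1
        have a3 := yn_bandProj_le_highPass (m + 1) hN hf₀
        have a4 := hδ1 n
        have a5 := yn_nonneg (m + 1) (bandProj N f₀)
        have a6 : (N ^ (m + 1) * ‖highPass (m + 1) hN (F N n t)‖) ^ 2 ≤
            Cs m * (N ^ (m + 1) * ‖highPass (m + 1) hN f₀‖) ^ 2 + 1 / ((n : ℝ) + 1) := by
          refine (pow_le_pow_left₀ (by positivity) a1 2).trans (a2.trans ?_)
          gcongr
        rw [mul_pow, mul_pow] at a6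
        rw [← mul_le_mul_iff_right₀ (by positivity : 0 < (N ^ (m + 1)) ^ 2)]
        refine a6.trans (le_of_eq ?_)
        field_simp
      have e3 : ‖highPass (m + 1) hN (F n n t)‖ ≤
          ‖F n n t - F N n t‖ + ‖highPass (m + 1) hN (F N n t)‖ := by
        calc _ = ‖highPass (m + 1) hN (F n n t - F N n t) + highPass (m + 1) hN (F N n t)‖ := by
              rw [← map_add, sub_add_cancel]
          _ ≤ _ := (norm_add_le _ _).trans (by gcongr; exact norm_highPass_le _ _ _)
      have e4 := norm_nonneg (highPass (m + 1) hN (F n n t))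
      calc _ ≤ (‖F n n t - F N n t‖ + ‖highPass (m + 1) hN (F N n t)‖) ^ 2 := by gcongr
        _ ≤ 2 * ‖F n n t - F N n t‖ ^ 2 + 2 * ‖highPass (m + 1) hN (F N n t)‖ ^ 2 := by
          linarith [sq_nonneg (‖F n n t - F N n t‖ - ‖highPass (m + 1) hN (F N n t)‖),
            add_sq (‖F n n t - F N n t‖) ‖highPass (m + 1) hN (F N n t)‖,
            sub_sq (‖F n n t - F N n t‖) ‖highPass (m + 1) hN (F N n t)‖]
        _ ≤ _ := by gcongr
    have t1 := (((highPass (m + 1) hN).continuous.tendsto _).comp (hf t ht)).norm.pow 2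
    have z := tendsto_one_div_add_atTop_nhds_zero_nat (𝕜 := ℝ)
    have t2 := ((z.const_add (C * ‖highPass (m + 1) hN f₀‖ ^ 2)).const_mul 2).add
      (((z.div_const ((N ^ (m + 1)) ^ 2)).const_add
        (Cs m * ‖highPass (m + 1) hN f₀‖ ^ 2)).const_mul 2)
    refine (le_of_tendsto_of_tendsto t1 t2 key).trans (le_of_eq ?_)
    rw [zero_div]
    ring

theorem Approximable.herm {ε T : ℝ} {f : ℝ → L2C} (h : Approximable ε T f) {t : ℝ}
    (ht : t ∈ Icc (-T) T) : Herm (f t) := by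
  choose R g g' r hb hg using fun n : ℕ => h (1 / ((n : ℝ) + 1)) (by positivity)
  have l : Tendsto (fun n => g n t) atTop (𝓝 (f t)) :=
    tendsto_of_norm_sub_le fun n => (hg n t ht).2
  obtain ⟨ns, -, hns⟩ := exists_subseq_ae_tendsto l
  filter_upwards [hns, (Measure.measurePreserving_neg volume).quasiMeasurePreserving.ae hns,
    ae_all_iff.2 fun i => (hb (ns i) t).2] with x hx hx1 hx2
  refine tendsto_nhds_unique hx1 ?_
  simp only [hx2]
  exact (Complex.continuous_conj.tendsto _).comp hx

/-- The right-hand side of the equation, restricted to the frequency band `[-L, L]`. -/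
noncomputable def bandField (L : ℝ) (f : L2C) : L2C :=
  bandProj L (mulOp _ isMult_neg_I_sg f) + quadTerm L f f

theorem ApproxAt.bandProj_eq {R : ℝ} {f f' r : L2C} (h : ApproxAt R f f' r) (L : ℝ) :
    bandProj L f' = bandField L f + bandProj L r := by
  refine Lp.ext ?_
  filter_upwards [Lp.coeFn_add (bandField L f) (bandProj L r),
    Lp.coeFn_add (bandProj L (mulOp _ isMult_neg_I_sg f)) (quadTerm L f f),
    bandProj_coe L f', bandProj_coe L r, bandProj_coe L (mulOp _ isMult_neg_I_sg f),
    mulOp_coe _ isMult_neg_I_sg f, quadTerm_coe L f f, h.eq] with x h1 h2 h3 h4 h5 h6 h7 h8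
  rw [h1, Pi.add_apply, bandField, h2, Pi.add_apply, h3, h4, h5, h7]
  rcases le_or_gt |x| L with hL | hL
  · rw [cut_of_le hL, cut_of_le hL, cut_of_le hL, cut_of_le hL, h6, h8]; ring
  · rw [cut_of_lt hL, cut_of_lt hL, cut_of_lt hL, cut_of_lt hL]; simp

theorem Approximable.hasDerivAt {ε T : ℝ} {f : ℝ → L2C} (h : Approximable ε T f) (hε : 0 < ε)
    {t : ℝ} (ht : t ∈ Ioo (-T) T) (L : ℝ) :
    HasDerivAt (fun τ => bandProj L (f τ)) (bandField L (f t)) t := by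
  choose R g g' r hb hg using fun n : ℕ => h (1 / ((n : ℝ) + 1)) (by positivity)
  have four : ∀ f : L2C, yn 0 f ^ 2 + yn 2 f ^ 2 ≤ 16 * ε ^ 2 → ‖f‖ ≤ 4 * ε := fun f hf => by
    rw [← yn_zero_coe]
    refine abs_le_of_sq_le_sq' ?_ (by positivity) |>.2
    nlinarith [sq_nonneg (yn 2 f)]
  have z := tendsto_one_div_add_atTop_nhds_zero_nat (𝕜 := ℝ)
  set A := mulOp _ isMult_neg_I_sg
  set Q := quadTerm L
  refine hasDerivAt_of_tendstoUniformlyOn (l := atTop) (f := fun n τ => bandProj L (g n τ))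
    (f' := fun n τ => bandProj L (g' n τ)) (g' := fun τ => bandField L (f τ)) isOpen_Ioo ?_
    (Eventually.of_forall fun n s hs => (bandProj L).hasFDerivAt.comp_hasDerivAt s
      (hg n s (Ioo_subset_Icc_self hs)).1.2.1) (fun s hs => ?_) ht
  · rw [Metric.tendstoUniformlyOn_iff]
    intro c hc
    have hz : Tendsto (fun n : ℕ => (‖bandProj L‖ * ‖A‖ + ‖Q‖ * (8 * ε + 1) + ‖bandProj L‖) *
        (1 / ((n : ℝ) + 1))) atTop (𝓝 0) := by simpa using z.const_mul _
    filter_upwards [hz.eventually (gt_mem_nhds hc)] with n hn s hs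
    refine lt_of_le_of_lt ?_ hn
    have hs' := Ioo_subset_Icc_self hs
    set d : ℝ := 1 / ((n : ℝ) + 1)
    have hd0 : 0 ≤ d := by positivity
    have hd1 : d ≤ 1 := by
      rw [div_le_one (by positivity)]; linarith [Nat.cast_nonneg (α := ℝ) n]
    have g1 := four _ (hg n s hs').1.2.2.1
    have g2 := (hg n s hs').2
    have g3 := (hg n s hs').1.2.2.2.1
    have f1 : ‖f s‖ ≤ 4 * ε + 1 := by
      calc ‖f s‖ = ‖g n s - (g n s - f s)‖ := by rw [sub_sub_cancel]
        _ ≤ _ := (norm_sub_le _ _).trans (by linarith)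
    have e : bandField L (g n s) + bandProj L (r n s) - bandField L (f s) =
        bandProj L (A (g n s - f s)) + (Q (g n s) (g n s - f s) + Q (g n s - f s) (f s)) +
        bandProj L (r n s) := by
      simp only [bandField, map_sub, sub_apply]
      abel
    rw [dist_comm, dist_eq_norm, (hg n s hs').1.1.bandProj_eq, e]
    calc _ ≤ ‖bandProj L (A (g n s - f s))‖ + (‖Q (g n s) (g n s - f s)‖ +
          ‖Q (g n s - f s) (f s)‖) + ‖bandProj L (r n s)‖ := by
          refine (norm_add_le _ _).trans ?_
          gcongr
          refine (norm_add_le _ _).trans ?_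
          gcongr
          exact norm_add_le _ _
      _ ≤ ‖bandProj L‖ * (‖A‖ * d) + (‖Q‖ * (4 * ε) * d + ‖Q‖ * d * (4 * ε + 1)) +
          ‖bandProj L‖ * d := by
          gcongr
          · exact (ContinuousLinearMap.le_opNorm _ _).trans (by
              gcongr; exact (A.le_opNorm _).trans (by gcongr))
          · exact (Q.le_opNorm₂ _ _).trans (by gcongr)
          · exact (Q.le_opNorm₂ _ _).trans (by gcongr)
          · exact (ContinuousLinearMap.le_opNorm _ _).trans (by gcongr)
      _ = _ := by ring
  · exact ((bandProj L).continuous.tendsto _).comp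
      (tendsto_of_norm_sub_le fun n => (hg n s (Ioo_subset_Icc_self hs)).2)

/-! ### Integration over the frequency threshold -/

/-- The square of the weight of `highPass`. -/
noncomputable def thresholdWeight (K : ℕ) (N ξ : ℝ) : ℝ≥0∞ :=
  ENNReal.ofReal (min 1 (|ξ| / N) ^ (2 * K))

theorem measurable_thresholdWeight (K : ℕ) :
    Measurable fun p : ℝ × ℝ => thresholdWeight K p.1 p.2 := by
  unfold thresholdWeight
  fun_prop

/-- The mass of `f` beyond the frequency `N`. -/
noncomputable def highMass (K : ℕ) (f : L2C) (N : ℝ) : ℝ≥0∞ :=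
  ∫⁻ ξ, thresholdWeight K N ξ * ‖f ξ‖ₑ ^ 2

theorem measurable_highMass (K : ℕ) (f : L2C) : Measurable (highMass K f) :=
  Measurable.lintegral_prod_right' (f := fun p : ℝ × ℝ => thresholdWeight K p.1 p.2 * ‖f p.2‖ₑ ^ 2)
    ((measurable_thresholdWeight K).mul
      (((measurable_coe f).comp measurable_snd).enorm.pow_const 2))

theorem highMass_eq (K : ℕ) {N : ℝ} (hN : 0 < N) (f : L2C) :
    highMass K f N = ENNReal.ofReal (‖highPass K hN f‖ ^ 2) := by
  rw [ENNReal.ofReal_pow (norm_nonneg _), ofReal_norm, Lp.enorm_def, eLpNorm_two_sq]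
  refine lintegral_congr_ae ?_
  filter_upwards [norm_highPass_coe K hN f] with ξ hξ
  have h0 : 0 ≤ min 1 (|ξ| / N) := le_min zero_le_one (by positivity)
  rw [← ofReal_norm (highPass K hN f ξ), hξ, ENNReal.ofReal_mul (by positivity), ofReal_norm, mul_pow,
    thresholdWeight, ← ENNReal.ofReal_pow (by positivity), pow_mul']

theorem lintegral_highMass (K : ℕ) (f : L2C) {p : ℝ → ℝ≥0∞} (hp : Measurable p) (S : Set ℝ) :
    ∫⁻ N in S, p N * highMass K f N =
      ∫⁻ ξ, (∫⁻ N in S, p N * thresholdWeight K N ξ) * ‖f ξ‖ₑ ^ 2 := by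
  have hm : Measurable fun q : ℝ × ℝ => p q.1 * (thresholdWeight K q.1 q.2 * ‖f q.2‖ₑ ^ 2) :=
    (hp.comp measurable_fst).mul ((measurable_thresholdWeight K).mul
      (((measurable_coe f).comp measurable_snd).enorm.pow_const 2))
  calc _ = ∫⁻ N in S, ∫⁻ ξ, p N * (thresholdWeight K N ξ * ‖f ξ‖ₑ ^ 2) := by
        refine lintegral_congr fun N => ?_
        rw [highMass, lintegral_const_mul _ (show Measurable fun ξ =>
          thresholdWeight K N ξ * ‖f ξ‖ₑ ^ 2 from ((measurable_thresholdWeight K).comp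
            measurable_prodMk_left).mul ((measurable_coe f).enorm.pow_const 2))]
    _ = ∫⁻ ξ, ∫⁻ N in S, p N * (thresholdWeight K N ξ * ‖f ξ‖ₑ ^ 2) :=
        lintegral_lintegral_swap hm.aemeasurable
    _ = _ := by
        refine lintegral_congr fun ξ => ?_
        rw [← lintegral_mul_const _ (show Measurable fun N => p N * thresholdWeight K N ξ from
          hp.mul ((measurable_thresholdWeight K).comp measurable_prodMk_right))]
        exact lintegral_congr fun N => (mul_assoc _ _ _).symm

theorem setLIntegral_rpow_Ioc {s a b : ℝ} (hs : 0 < s) (ha : 0 ≤ a) (hab : a ≤ b) :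
    ∫⁻ N in Ioc a b, ENNReal.ofReal (N ^ (2 * s - 1)) =
      ENNReal.ofReal ((b ^ (2 * s) - a ^ (2 * s)) / (2 * s)) := by
  have hi := intervalIntegral.intervalIntegrable_rpow' (a := a) (b := b)
    (by linarith : -1 < 2 * s - 1)
  rw [← ofReal_integral_eq_lintegral_ofReal ((intervalIntegrable_iff_integrableOn_Ioc_of_le hab).1 hi)
    ((ae_restrict_iff' measurableSet_Ioc).2 (Eventually.of_forall fun N hN =>
      Real.rpow_nonneg (ha.trans hN.1.le) _)), ← intervalIntegral.integral_of_le hab,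
    integral_rpow (Or.inl (by linarith)), sub_add_cancel]

theorem setLIntegral_rpow_Ioi {s b : ℝ} (hs : s < -1) (hb : 0 < b) :
    ∫⁻ N in Ioi b, ENNReal.ofReal (N ^ s) = ENNReal.ofReal (-b ^ (s + 1) / (s + 1)) := by
  rw [← ofReal_integral_eq_lintegral_ofReal (integrableOn_Ioi_rpow_of_lt hs hb)
    ((ae_restrict_iff' measurableSet_Ioi).2 (Eventually.of_forall fun N hN =>
      Real.rpow_nonneg (hb.trans hN).le _)), integral_Ioi_rpow_of_lt hs hb]

theorem lintegral_thresholdWeight {K : ℕ} {s : ℝ} (hs : 0 < s) (hsK : s < K) {ξ : ℝ} (hξ : ξ ≠ 0) :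
    ∫⁻ N in Ioi 0, ENNReal.ofReal (N ^ (2 * s - 1)) * thresholdWeight K N ξ =
      ENNReal.ofReal (1 / (2 * s) + 1 / (2 * K - 2 * s)) * ENNReal.ofReal (|ξ| ^ (2 * s)) := by
  set x := |ξ|
  have hx : 0 < x := abs_pos.2 hξ
  have h1 : ∫⁻ N in Ioc 0 x, ENNReal.ofReal (N ^ (2 * s - 1)) * thresholdWeight K N ξ =
      ENNReal.ofReal (x ^ (2 * s) / (2 * s)) := by
    rw [setLIntegral_congr_fun measurableSet_Ioc (g := fun N => ENNReal.ofReal (N ^ (2 * s - 1)))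
      (fun N hN => ?_), setLIntegral_rpow_Ioc hs le_rfl hx.le, Real.zero_rpow (by linarith), sub_zero]
    simp only [thresholdWeight]
    rw [min_eq_left ((one_le_div hN.1).2 hN.2), one_pow, ENNReal.ofReal_one, mul_one]
  have h2 : ∫⁻ N in Ioi x, ENNReal.ofReal (N ^ (2 * s - 1)) * thresholdWeight K N ξ =
      ENNReal.ofReal (x ^ (2 * s) / (2 * K - 2 * s)) := by
    rw [setLIntegral_congr_fun measurableSet_Ioi (g := fun N => ENNReal.ofReal (x ^ (2 * K)) *
      ENNReal.ofReal (N ^ (2 * s - 1 - 2 * K))) (fun N hN => ?_),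
      lintegral_const_mul _ (by fun_prop), setLIntegral_rpow_Ioi (by linarith) hx,
      ← ENNReal.ofReal_mul (by positivity)]
    · congr 1
      rw [show 2 * s - 1 - 2 * K + 1 = 2 * s - (2 * K : ℕ) by push_cast; ring,
        Real.rpow_sub_natCast hx.ne']
      push_cast
      rw [show 2 * s - 2 * (K : ℝ) = -(2 * K - 2 * s) by ring, neg_div_neg_eq]
      field_simp
    · have hN0 : 0 < N := hx.trans hN
      simp only [thresholdWeight]
      rw [min_eq_right (div_le_one_of_le₀ (le_of_lt hN) hN0.le),
        ← ENNReal.ofReal_mul (by positivity), ← ENNReal.ofReal_mul (by positivity)]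
      congr 1
      rw [show 2 * s - 1 - 2 * (K : ℝ) = 2 * s - 1 - (2 * K : ℕ) by push_cast; ring,
        Real.rpow_sub_natCast hN0.ne', div_pow]
      ring
  rw [← Ioc_union_Ioi_eq_Ioi hx.le, lintegral_union measurableSet_Ioi (Ioc_disjoint_Ioi le_rfl),
    h1, h2, ← ENNReal.ofReal_add (by positivity) (div_nonneg (by positivity) (by linarith)),
    ← ENNReal.ofReal_mul (add_nonneg (by positivity) (div_nonneg zero_le_one (by linarith)))]
  congr 1
  ring

/-- Control of the high frequencies at all thresholds gives control of homogeneous Sobolev norms,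
uniformly in the exponent. -/
theorem lintegral_rpow_le_of_highMass_le {K : ℕ} {s : ℝ} (hs : 0 < s) (hsK : s < K) {f g : L2C}
    {C : ℝ≥0∞} (h : ∀ N, 0 < N → highMass K f N ≤ C * highMass K g N) :
    ∫⁻ ξ, ENNReal.ofReal (|ξ| ^ (2 * s)) * ‖f ξ‖ₑ ^ 2 ≤
      C * ∫⁻ ξ, ENNReal.ofReal (|ξ| ^ (2 * s)) * ‖g ξ‖ₑ ^ 2 := by
  have hp : Measurable fun N : ℝ => ENNReal.ofReal (N ^ (2 * s - 1)) := by fun_prop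
  have hc : 0 < 1 / (2 * s) + 1 / (2 * K - 2 * s) := by
    have : 0 < 2 * (K : ℝ) - 2 * s := by linarith
    positivity
  have e : ∀ f : L2C, ∫⁻ N in Ioi 0, ENNReal.ofReal (N ^ (2 * s - 1)) * highMass K f N =
      ENNReal.ofReal (1 / (2 * s) + 1 / (2 * K - 2 * s)) *
        ∫⁻ ξ, ENNReal.ofReal (|ξ| ^ (2 * s)) * ‖f ξ‖ₑ ^ 2 := by
    intro f
    rw [lintegral_highMass K f hp, ← lintegral_const_mul' _ _ ENNReal.ofReal_ne_top]
    refine lintegral_congr_ae ?_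
    filter_upwards [Measure.ae_ne volume 0] with ξ hξ
    rw [lintegral_thresholdWeight hs hsK hξ, mul_assoc]
  have main : ENNReal.ofReal (1 / (2 * s) + 1 / (2 * K - 2 * s)) *
      (∫⁻ ξ, ENNReal.ofReal (|ξ| ^ (2 * s)) * ‖f ξ‖ₑ ^ 2) ≤
      ENNReal.ofReal (1 / (2 * s) + 1 / (2 * K - 2 * s)) *
      (C * ∫⁻ ξ, ENNReal.ofReal (|ξ| ^ (2 * s)) * ‖g ξ‖ₑ ^ 2) := by
    rw [← e f, mul_left_comm, ← e g, ← lintegral_const_mul _ (show Measurable fun N =>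
      ENNReal.ofReal (N ^ (2 * s - 1)) * highMass K g N from hp.mul (measurable_highMass K g))]
    refine setLIntegral_mono' measurableSet_Ioi fun N hN => ?_
    rw [mul_left_comm]
    gcongr
    exact h N hN
  exact (ENNReal.mul_le_mul_iff_right (ENNReal.ofReal_pos.2 hc).ne' ENNReal.ofReal_ne_top).1 main

/-- Control of the high frequencies at all thresholds gives uniform control of the tails. -/
theorem exists_tail_le {K : ℕ} {s : ℝ} (hs : 0 < s) (hsK : s < K) {g : L2C}
    (hg : ∫⁻ ξ, ENNReal.ofReal (|ξ| ^ (2 * s)) * ‖g ξ‖ₑ ^ 2 < ⊤) {C : ℝ≥0∞} (hC : C ≠ ⊤)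
    {η : ℝ≥0∞} (hη : 0 < η) : ∃ L : ℝ, 0 < L ∧ ∀ f : L2C,
      (∀ N, 0 < N → highMass K f N ≤ C * highMass K g N) →
      ∫⁻ ξ in {ξ | L < |ξ|}, ENNReal.ofReal (|ξ| ^ (2 * s)) * ‖f ξ‖ₑ ^ 2 ≤ η := by
  have hp : Measurable fun N : ℝ => ENNReal.ofReal (N ^ (2 * s - 1)) := by fun_prop
  set h : ℝ → ℝ≥0∞ := fun N => ENNReal.ofReal (N ^ (2 * s - 1)) * highMass K g N
  have hh : Measurable h := hp.mul (measurable_highMass K g)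
  set c : ℝ := (1 - (1 / 2) ^ (2 * s)) / (2 * s)
  have hc : 0 < c := div_pos (sub_pos.2 (Real.rpow_lt_one (by norm_num) (by norm_num) (by linarith)))
    (by linarith)
  have hfin : (volume.withDensity h) (Ioi 0) ≠ ⊤ := by
    rw [withDensity_apply _ measurableSet_Ioi, lintegral_highMass K g hp,
      lintegral_congr_ae (g := fun ξ => ENNReal.ofReal (1 / (2 * s) + 1 / (2 * K - 2 * s)) *
        (ENNReal.ofReal (|ξ| ^ (2 * s)) * ‖g ξ‖ₑ ^ 2)) ?_,
      lintegral_const_mul' _ _ ENNReal.ofReal_ne_top]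
    · exact ENNReal.mul_ne_top ENNReal.ofReal_ne_top hg.ne
    · filter_upwards [Measure.ae_ne volume 0] with ξ hξ
      rw [lintegral_thresholdWeight hs hsK hξ, mul_assoc]
  have htend : Tendsto (fun n : ℕ => (volume.withDensity h) (Ioi (n : ℝ))) atTop (𝓝 0) := by
    have hI : ⋂ n : ℕ, Ioi (n : ℝ) = ∅ := by
      refine eq_empty_of_forall_notMem fun x hx => ?_
      obtain ⟨n, hn⟩ := exists_nat_ge x
      exact absurd (mem_iInter.1 hx n) (not_lt.2 hn)
    have := tendsto_measure_iInter_atTop (μ := volume.withDensity h)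
      (s := fun n : ℕ => Ioi (n : ℝ)) (fun n => measurableSet_Ioi.nullMeasurableSet)
      (fun m n hmn => Ioi_subset_Ioi (by exact_mod_cast hmn)) ⟨0, by simpa using hfin⟩
    rwa [hI, measure_empty] at this
  have hη' : 0 < ENNReal.ofReal c * η / (C + 1) :=
    ENNReal.div_pos (ENNReal.mul_pos (ENNReal.ofReal_pos.2 hc).ne' hη.ne').ne' (ENNReal.add_ne_top.2 ⟨hC, by simp⟩)
  obtain ⟨n, hn, hn1⟩ := ((htend.eventually (ge_mem_nhds hη')).and (eventually_gt_atTop 0)).exists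
  have hn0 : (0 : ℝ) < n := by exact_mod_cast hn1
  refine ⟨2 * n, by positivity, fun f hf => ?_⟩
  have h1 : ∫⁻ N in Ioi (n : ℝ), ENNReal.ofReal (N ^ (2 * s - 1)) * highMass K f N ≤
      ENNReal.ofReal c * η := by
    calc _ ≤ ∫⁻ N in Ioi (n : ℝ), C * h N := by
          refine setLIntegral_mono' measurableSet_Ioi fun N hN => ?_
          simp only [h]
          rw [mul_left_comm]
          gcongr
          exact hf N (hn0.trans hN)
      _ = C * ∫⁻ N in Ioi (n : ℝ), h N := lintegral_const_mul _ hh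
      _ ≤ (C + 1) * (ENNReal.ofReal c * η / (C + 1)) := by
          rw [withDensity_apply _ measurableSet_Ioi] at hn
          exact mul_le_mul le_self_add hn zero_le zero_le
      _ ≤ _ := ENNReal.mul_div_le
  have h2 : ENNReal.ofReal c * ∫⁻ ξ in {ξ | 2 * (n : ℝ) < |ξ|},
      ENNReal.ofReal (|ξ| ^ (2 * s)) * ‖f ξ‖ₑ ^ 2 ≤ ENNReal.ofReal c * η := by
    refine le_trans ?_ h1
    rw [lintegral_highMass K f hp, ← lintegral_const_mul' _ _ ENNReal.ofReal_ne_top]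
    refine (setLIntegral_mono' (measurableSet_lt measurable_const (by fun_prop)) fun ξ hξ => ?_).trans
      (setLIntegral_le_lintegral _ _)
    rw [← mul_assoc]
    gcongr
    have hξ' : 2 * (n : ℝ) < |ξ| := hξ
    have hx : 0 < |ξ| := by linarith
    calc ENNReal.ofReal c * ENNReal.ofReal (|ξ| ^ (2 * s))
        = ∫⁻ N in Ioc (1 / 2 * |ξ|) |ξ|, ENNReal.ofReal (N ^ (2 * s - 1)) := by
          rw [setLIntegral_rpow_Ioc hs (by positivity) (by linarith), ← ENNReal.ofReal_mul hc.le,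
            Real.mul_rpow (by norm_num) hx.le]
          congr 1
          simp only [c]
          ring
      _ = ∫⁻ N in Ioc (1 / 2 * |ξ|) |ξ|, ENNReal.ofReal (N ^ (2 * s - 1)) *
            thresholdWeight K N ξ := by
          refine setLIntegral_congr_fun measurableSet_Ioc fun N hN => ?_
          simp only [thresholdWeight]
          rw [min_eq_left ((one_le_div (by linarith [hN.1])).2 hN.2), one_pow, ENNReal.ofReal_one,
            mul_one]
      _ ≤ _ := lintegral_mono_set fun N hN => by
          have := hN.1
          exact mem_Ioi.2 (by linarith)
  exact (ENNReal.mul_le_mul_iff_right (ENNReal.ofReal_pos.2 hc).ne' ENNReal.ofReal_ne_top).1 h2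

/-! ### Sobolev norms on the Fourier side -/

/-- The `L²` norm of `(1 + |2πξ|²)^(s/2) F`. -/
noncomputable def hs (s : ℝ) (F : ℝ → ℂ) : ℝ≥0∞ :=
  eLpNorm (fun ξ : ℝ => (1 + (2 * Real.pi * ξ) ^ 2) ^ (s / 2) * ‖F ξ‖) 2 volume

theorem one_le_bracket (ξ : ℝ) : 1 ≤ 1 + (2 * Real.pi * ξ) ^ 2 := by
  linarith [sq_nonneg (2 * Real.pi * ξ)]

theorem bracket_pos (ξ : ℝ) : 0 < 1 + (2 * Real.pi * ξ) ^ 2 := by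
  linarith [one_le_bracket ξ]

theorem hs_sq (s : ℝ) (F : ℝ → ℂ) :
    hs s F ^ 2 = ∫⁻ ξ, ENNReal.ofReal ((1 + (2 * Real.pi * ξ) ^ 2) ^ s) * ‖F ξ‖ₑ ^ 2 := by
  rw [hs, eLpNorm_two_sq]
  refine lintegral_congr fun ξ => ?_
  have h := (bracket_pos ξ).le
  rw [enorm_mul, enorm_norm, mul_pow, Real.enorm_of_nonneg (by positivity),
    ← ENNReal.ofReal_pow (by positivity), ← Real.rpow_mul_natCast h]
  norm_num

theorem Yn_sq (n : ℕ) (F : ℝ → ℂ) :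
    Yn n F ^ 2 = ∫⁻ ξ, ENNReal.ofReal (|ξ| ^ (2 * n)) * ‖F ξ‖ₑ ^ 2 := by
  rw [Yn, eLpNorm_two_sq]
  refine lintegral_congr fun ξ => ?_
  rw [enorm_wt, mul_pow, ← ENNReal.ofReal_pow (by positivity), pow_mul']

theorem hs_congr (s : ℝ) {F G : ℝ → ℂ} (h : F =ᵐ[volume] G) : hs s F = hs s G :=
  eLpNorm_congr_ae (by filter_upwards [h] with ξ h; rw [h])

theorem hs_mono {s t : ℝ} (h : s ≤ t) (F : ℝ → ℂ) : hs s F ≤ hs t F := by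
  refine eLpNorm_mono fun ξ => ?_
  have := one_le_bracket ξ
  rw [norm_mul, norm_mul, norm_norm, Real.norm_of_nonneg (Real.rpow_nonneg (bracket_pos ξ).le _),
    Real.norm_of_nonneg (Real.rpow_nonneg (bracket_pos ξ).le _)]
  gcongr

theorem hs_mono_norm (s : ℝ) {F G : ℝ → ℂ} (h : ∀ᵐ ξ, ‖F ξ‖ ≤ ‖G ξ‖) : hs s F ≤ hs s G := by
  refine eLpNorm_mono_ae ?_
  filter_upwards [h] with ξ h
  rw [norm_mul, norm_mul, norm_norm, norm_norm]
  gcongr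

theorem hs_zero (F : ℝ → ℂ) : hs 0 F = eLpNorm F 2 volume := by
  unfold hs
  simp only [zero_div, Real.rpow_zero, one_mul]
  exact eLpNorm_norm F

theorem hs_zero_coe (f : L2C) : hs 0 f = ‖f‖ₑ := by rw [hs_zero, Lp.enorm_def]

theorem enorm_le_hs {s : ℝ} (h : 0 ≤ s) (f : L2C) : ‖f‖ₑ ≤ hs s f := by
  rw [← hs_zero_coe]; exact hs_mono h _

theorem measurable_bracket (s : ℝ) : Measurable fun ξ : ℝ => (1 + (2 * Real.pi * ξ) ^ 2) ^ s :=
  Measurable.pow_const (by fun_prop) s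

theorem hs_add_le (s : ℝ) {F G : ℝ → ℂ} (hF : Measurable F) (hG : Measurable G) :
    hs s (fun ξ => F ξ + G ξ) ≤ hs s F + hs s G := by
  have h := measurable_bracket (s / 2)
  have h1 := eLpNorm_add_le (p := 2) (μ := volume) (h.mul hF.norm).aestronglyMeasurable
    (h.mul hG.norm).aestronglyMeasurable (by norm_num)
  refine le_trans (eLpNorm_mono_real fun ξ => ?_) h1
  have h2 := Real.rpow_nonneg (bracket_pos ξ).le (s / 2)
  rw [norm_mul, norm_norm, Real.norm_of_nonneg h2]
  exact (mul_le_mul_of_nonneg_left (norm_add_le _ _) h2).trans_eq (mul_add _ _ _)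

theorem hs_const_mul (s : ℝ) (c : ℂ) (F : ℝ → ℂ) :
    hs s (fun ξ => c * F ξ) = ‖c‖ₑ * hs s F := by
  unfold hs
  rw [← enorm_norm c, ← eLpNorm_const_smul]
  congr 1
  ext ξ
  rw [norm_mul, Pi.smul_apply, smul_eq_mul]
  ring

theorem hs_sub_le (s : ℝ) {F G : ℝ → ℂ} (hF : Measurable F) (hG : Measurable G) :
    hs s (fun ξ => F ξ - G ξ) ≤ hs s F + hs s G := by
  have h := hs_add_le s hF (hG.const_mul (-1))
  rw [hs_const_mul] at h
  simpa [sub_eq_add_neg] using h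

theorem hs_coe_sub_le (s : ℝ) (f g : L2C) : hs s (f - g : L2C) ≤ hs s f + hs s g :=
  (hs_congr s (Lp.coeFn_sub f g)).trans_le (hs_sub_le s (measurable_coe f) (measurable_coe g))

theorem hs_coe_add_le (s : ℝ) (f g : L2C) : hs s (f + g : L2C) ≤ hs s f + hs s g :=
  (hs_congr s (Lp.coeFn_add f g)).trans_le (hs_add_le s (measurable_coe f) (measurable_coe g))

theorem abs_rpow_le_bracket {s : ℝ} (hs0 : 0 ≤ s) (ξ : ℝ) :
    |ξ| ^ (2 * s) ≤ (1 + (2 * Real.pi * ξ) ^ 2) ^ s := by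
  rw [Real.rpow_mul (abs_nonneg ξ), Real.rpow_two, sq_abs]
  refine Real.rpow_le_rpow (sq_nonneg ξ) ?_ hs0
  have := Real.pi_gt_three
  nlinarith [sq_nonneg ξ, mul_nonneg (sq_nonneg ξ) (by nlinarith : 0 ≤ 4 * Real.pi ^ 2 - 1)]

theorem bracket_rpow_le {s : ℝ} {k : ℕ} (hs0 : 0 ≤ s) (hsk : s ≤ k) (ξ : ℝ) :
    (1 + (2 * Real.pi * ξ) ^ 2) ^ s ≤ 50 ^ k * (1 + |ξ| ^ (2 * s)) := by
  have hpi : Real.pi ^ 2 ≤ 10 := by nlinarith [Real.pi_lt_d2, Real.pi_pos]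
  have h1 : 1 + (2 * Real.pi * ξ) ^ 2 ≤ 50 * max 1 (ξ ^ 2) := by
    have a := le_max_left 1 (ξ ^ 2)
    have b := le_max_right 1 (ξ ^ 2)
    nlinarith [mul_le_mul_of_nonneg_right hpi (sq_nonneg ξ)]
  calc (1 + (2 * Real.pi * ξ) ^ 2) ^ s ≤ (50 * max 1 (ξ ^ 2)) ^ s :=
        Real.rpow_le_rpow (bracket_pos ξ).le h1 hs0
    _ = 50 ^ s * (max 1 (ξ ^ 2)) ^ s := Real.mul_rpow (by norm_num) (by positivity)
    _ ≤ 50 ^ k * (1 + |ξ| ^ (2 * s)) := by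
        gcongr
        · rw [← Real.rpow_natCast]
          exact Real.rpow_le_rpow_of_exponent_le (by norm_num) hsk
        · rw [Real.rpow_mul (abs_nonneg ξ), Real.rpow_two, sq_abs]
          rcases max_cases 1 (ξ ^ 2) with h | h
          · rw [h.1, Real.one_rpow]
            linarith [Real.rpow_nonneg (sq_nonneg ξ) s]
          · rw [h.1]; linarith

theorem hs_sq_le {s : ℝ} {k : ℕ} (hs0 : 0 ≤ s) (hsk : s ≤ k) {F : ℝ → ℂ} (hF : Measurable F) :
    hs s F ^ 2 ≤ 50 ^ k * (eLpNorm F 2 volume ^ 2 +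
      ∫⁻ ξ, ENNReal.ofReal (|ξ| ^ (2 * s)) * ‖F ξ‖ₑ ^ 2) := by
  rw [hs_sq, eLpNorm_two_sq, ← lintegral_add_left (hF.enorm.pow_const 2),
    ← lintegral_const_mul' _ _ (by norm_num)]
  refine lintegral_mono fun ξ => ?_
  calc _ ≤ ENNReal.ofReal (50 ^ k * (1 + |ξ| ^ (2 * s))) * ‖F ξ‖ₑ ^ 2 := by
        gcongr; exact bracket_rpow_le hs0 hsk ξ
    _ = _ := by
        rw [ENNReal.ofReal_mul (by positivity), ENNReal.ofReal_pow (by norm_num),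
          ENNReal.ofReal_add zero_le_one (by positivity), ENNReal.ofReal_one,
          ENNReal.ofReal_ofNat]
        ring

theorem lintegral_rpow_le_hs_sq {s : ℝ} (hs0 : 0 ≤ s) (F : ℝ → ℂ) :
    ∫⁻ ξ, ENNReal.ofReal (|ξ| ^ (2 * s)) * ‖F ξ‖ₑ ^ 2 ≤ hs s F ^ 2 := by
  rw [hs_sq]
  gcongr with ξ
  exact abs_rpow_le_bracket hs0 ξ

theorem Yn_le_hs {n : ℕ} {s : ℝ} (h : n ≤ s) (F : ℝ → ℂ) : Yn n F ≤ hs s F := by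
  refine le_trans ?_ (hs_mono h F)
  refine (ENNReal.pow_le_pow_left_iff two_ne_zero).1 ?_
  refine le_trans (le_of_eq ?_) (lintegral_rpow_le_hs_sq n.cast_nonneg F)
  rw [Yn_sq]
  refine lintegral_congr fun ξ => ?_
  rw [← Real.rpow_natCast]
  push_cast
  rfl

theorem Yn_sq_add_le_hs (F : ℝ → ℂ) (hF : Measurable F) : Yn 0 F ^ 2 + Yn 2 F ^ 2 ≤ hs 2 F ^ 2 := by
  rw [Yn_sq, Yn_sq, hs_sq, ← lintegral_add_left (by fun_prop)]
  refine lintegral_mono fun ξ => ?_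
  rw [← add_mul, ← ENNReal.ofReal_add (by positivity) (by positivity)]
  gcongr
  rw [Real.rpow_two, show 2 * 2 = 2 * 2 from rfl, pow_mul |ξ| 2 2, sq_abs]
  have := Real.pi_gt_three
  have h : ξ ^ 2 ≤ (2 * Real.pi * ξ) ^ 2 := by
    nlinarith [sq_nonneg ξ, mul_nonneg (sq_nonneg ξ) (by nlinarith : 0 ≤ 4 * Real.pi ^ 2 - 1)]
  rw [mul_zero, pow_zero]
  nlinarith [sq_nonneg ξ, sq_nonneg ((2 * Real.pi * ξ) ^ 2 - ξ ^ 2)]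

theorem hs_natCast_le (n : ℕ) {F : ℝ → ℂ} (hF : Measurable F) :
    hs n F ≤ 50 ^ n * (Yn 0 F + Yn n F) := by
  refine (ENNReal.pow_le_pow_left_iff two_ne_zero).1 ?_
  refine (hs_sq_le n.cast_nonneg le_rfl hF).trans ?_
  have e : ∫⁻ ξ, ENNReal.ofReal (|ξ| ^ (2 * (n : ℝ))) * ‖F ξ‖ₑ ^ 2 = Yn n F ^ 2 := by
    rw [Yn_sq]
    refine lintegral_congr fun ξ => ?_
    rw [← Real.rpow_natCast |ξ| (2 * n)]
    push_cast
    rfl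
  have e0 : eLpNorm F 2 volume = Yn 0 F := by rw [Yn, wt_zero]
  rw [e, e0, mul_pow]
  refine mul_le_mul (le_self_pow₀ (one_le_pow₀ (by norm_num)) two_ne_zero) ?_ zero_le zero_le
  rw [add_sq, add_right_comm]
  exact le_self_add

theorem eLpNorm_one_le_hs {s : ℝ} (h : 1 ≤ s) {F : ℝ → ℂ} (hF : Measurable F) :
    eLpNorm F 1 volume ≤ 2 * ENNReal.ofReal sobConst * hs s F := by
  refine (eLpNorm_one_le hF).trans ?_
  have h0 : Yn 0 F ≤ hs s F := Yn_le_hs (by simp; linarith) F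
  have h1 : Yn 1 F ≤ hs s F := Yn_le_hs (by simpa using h) F
  calc _ ≤ ENNReal.ofReal sobConst * (hs s F + hs s F) := by gcongr
    _ = _ := by ring

/-- The product estimate for the quadratic term. -/
theorem exists_hs_id_mul_conv_le (n : ℕ) : ∃ C : ℝ≥0, ∀ F G : ℝ → ℂ, Measurable F → Measurable G →
    hs n (fun ξ => (ξ : ℂ) * conv F G ξ) ≤ C * (hs (n + 1) F * hs (n + 1) G) := by
  refine ⟨50 ^ n * (2 * (2 * (2 * sobConst.toNNReal)) + 2 ^ (n + 1) * (2 * (2 * sobConst.toNNReal))),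
    fun F G hF hG => ?_⟩
  have hc := measurable_conv hF hG
  have e : ∀ m, Yn m (fun ξ => (ξ : ℂ) * conv F G ξ) = Yn (m + 1) (conv F G) := by
    intro m
    rw [← Yn_wt]
    refine eLpNorm_congr_norm_ae (Eventually.of_forall fun ξ => ?_)
    simp only [wt, norm_mul, Complex.norm_real, pow_one, norm_abs_eq_norm]
  have f1 := eLpNorm_one_le_hs (s := n + 1) (by linarith [n.cast_nonneg (α := ℝ)]) hF
  have g1 := eLpNorm_one_le_hs (s := n + 1) (by linarith [n.cast_nonneg (α := ℝ)]) hG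
  have key : ∀ m ≤ n, Yn (m + 1) (conv F G) ≤ 2 ^ (m + 1) * (2 * (2 * ENNReal.ofReal sobConst)) *
      (hs (n + 1) F * hs (n + 1) G) := by
    intro m hm
    have hm' : ((m + 1 : ℕ) : ℝ) ≤ n + 1 := by push_cast; gcongr
    calc _ ≤ 2 ^ (m + 1) * (Yn (m + 1) F * eLpNorm G 1 volume +
          eLpNorm F 1 volume * Yn (m + 1) G) := Yn_conv_le hF hG _
      _ ≤ 2 ^ (m + 1) * (hs (n + 1) F * (2 * ENNReal.ofReal sobConst * hs (n + 1) G) +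
          2 * ENNReal.ofReal sobConst * hs (n + 1) F * hs (n + 1) G) := by
          gcongr
          · exact Yn_le_hs hm' F
          · exact Yn_le_hs hm' G
      _ = _ := by ring
  calc _ ≤ 50 ^ n * (Yn 0 (fun ξ => (ξ : ℂ) * conv F G ξ) + Yn n (fun ξ => (ξ : ℂ) * conv F G ξ)) :=
        hs_natCast_le n (by fun_prop)
    _ ≤ 50 ^ n * (2 ^ (0 + 1) * (2 * (2 * ENNReal.ofReal sobConst)) * (hs (n + 1) F * hs (n + 1) G) +
        2 ^ (n + 1) * (2 * (2 * ENNReal.ofReal sobConst)) * (hs (n + 1) F * hs (n + 1) G)) := by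
        rw [e, e]
        gcongr
        · exact key 0 (by omega)
        · exact key n le_rfl
    _ = _ := by
        rw [← ENNReal.ofNNReal_toNNReal]
        push_cast
        ring

/-! ### Sobolev bounds from the control of high frequencies -/

theorem hs_le_of_highMass_le {k : ℕ} {f g : L2C} {C : ℝ≥0}
    (h : ∀ N, 0 < N → highMass (k + 1) f N ≤ C * highMass (k + 1) g N) (h0 : ‖f‖ ≤ ‖g‖)
    {s : ℝ} (hs0 : 0 ≤ s) (hsk : s ≤ k) : hs s f ≤ (50 ^ k * (1 + C) : ℝ≥0) * hs s g := by
  have h0' : ‖f‖ₑ ≤ ‖g‖ₑ := by rw [← ofReal_norm, ← ofReal_norm]; gcongr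
  have hC : (1 : ℝ≥0∞) ≤ (50 ^ k * (1 + C) : ℝ≥0) := by
    rw [ENNReal.one_le_coe_iff]
    exact one_le_mul (one_le_pow₀ (by norm_num)) le_self_add
  rcases hs0.eq_or_lt with rfl | hs0'
  · rw [hs_zero_coe, hs_zero_coe]
    exact h0'.trans (le_mul_of_one_le_left zero_le hC)
  refine (ENNReal.pow_le_pow_left_iff two_ne_zero).1 ?_
  calc hs s f ^ 2 ≤ 50 ^ k * (eLpNorm f 2 volume ^ 2 +
      ∫⁻ ξ, ENNReal.ofReal (|ξ| ^ (2 * s)) * ‖f ξ‖ₑ ^ 2) := hs_sq_le hs0 hsk (measurable_coe f)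
    _ ≤ 50 ^ k * (hs s g ^ 2 + C * hs s g ^ 2) := by
        gcongr
        · rw [← Lp.enorm_def]
          exact h0'.trans (enorm_le_hs hs0 g)
        · refine (lintegral_rpow_le_of_highMass_le hs0' (K := k + 1)
            (by push_cast; linarith) h).trans ?_
          gcongr
          exact lintegral_rpow_le_hs_sq hs0 g
    _ = (50 ^ k * (1 + C) : ℝ≥0) * hs s g ^ 2 := by push_cast; ring
    _ ≤ (50 ^ k * (1 + C) : ℝ≥0) ^ 2 * hs s g ^ 2 := by
        gcongr
        exact le_self_pow₀ hC two_ne_zero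
    _ = _ := (mul_pow _ _ _).symm

theorem norm_sub_bandProj_coe (L : ℝ) (f : L2C) :
    ∀ᵐ ξ, ‖(f - bandProj L f : L2C) ξ‖ₑ = {ξ : ℝ | L < |ξ|}.indicator (fun ξ => ‖f ξ‖ₑ) ξ := by
  filter_upwards [Lp.coeFn_sub f (bandProj L f), bandProj_coe L f] with ξ h1 h2
  rw [h1, Pi.sub_apply, h2]
  rcases le_or_gt |ξ| L with h | h
  · rw [cut_of_le h, sub_self, indicator_of_notMem (by simpa using h), enorm_zero]
  · rw [cut_of_lt h, sub_zero, indicator_of_mem (by simpa using h)]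

theorem exists_hs_tail_le {k : ℕ} (hk : 0 < k) {g : L2C} (hg : hs k g < ⊤) (C : ℝ≥0) {η : ℝ≥0∞}
    (hη : 0 < η) : ∃ L : ℝ, ∀ f : L2C,
      (∀ N, 0 < N → highMass (k + 1) f N ≤ C * highMass (k + 1) g N) →
      hs k (f - bandProj L f : L2C) ≤ η := by
  have hη' : 0 < η ^ 2 / (2 * 50 ^ k) :=
    ENNReal.div_pos (pow_ne_zero 2 hη.ne') (ENNReal.mul_ne_top (by norm_num) (by norm_num))
  obtain ⟨L, hL, h⟩ := exists_tail_le (K := k + 1) (s := k) (by exact_mod_cast hk)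
    (by push_cast; linarith) ((lintegral_rpow_le_hs_sq k.cast_nonneg g).trans_lt
      (ENNReal.pow_lt_top hg)) (ENNReal.coe_ne_top (r := C)) hη'
  refine ⟨max L 1, fun f hf => ?_⟩
  refine (ENNReal.pow_le_pow_left_iff two_ne_zero).1 ?_
  have hm : MeasurableSet {ξ : ℝ | max L 1 < |ξ|} := measurableSet_lt measurable_const (by fun_prop)
  calc hs k (f - bandProj (max L 1) f : L2C) ^ 2
      = ∫⁻ ξ in {ξ : ℝ | max L 1 < |ξ|},
          ENNReal.ofReal ((1 + (2 * Real.pi * ξ) ^ 2) ^ (k : ℝ)) * ‖f ξ‖ₑ ^ 2 := by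
        rw [hs_sq, ← lintegral_indicator hm]
        refine lintegral_congr_ae ?_
        filter_upwards [norm_sub_bandProj_coe (max L 1) f] with ξ hξ
        rw [hξ]
        by_cases h' : ξ ∈ {ξ : ℝ | max L 1 < |ξ|}
        · rw [indicator_of_mem h', indicator_of_mem h']
        · rw [indicator_of_notMem h', indicator_of_notMem h']; simp
    _ ≤ ∫⁻ ξ in {ξ : ℝ | max L 1 < |ξ|},
          (2 * 50 ^ k) * (ENNReal.ofReal (|ξ| ^ (2 * (k : ℝ))) * ‖f ξ‖ₑ ^ 2) := by
        refine setLIntegral_mono' hm fun ξ hξ => ?_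
        have h1 : 1 ≤ |ξ| := ((le_max_right L 1).trans_lt hξ).le
        rw [← mul_assoc]
        gcongr
        calc ENNReal.ofReal ((1 + (2 * Real.pi * ξ) ^ 2) ^ (k : ℝ))
            ≤ ENNReal.ofReal (2 * 50 ^ k * |ξ| ^ (2 * (k : ℝ))) := by
              refine ENNReal.ofReal_le_ofReal
                ((bracket_rpow_le k.cast_nonneg le_rfl ξ).trans ?_)
              have := Real.one_le_rpow h1 (by positivity : 0 ≤ 2 * (k : ℝ))
              nlinarith [pow_pos (by norm_num : (0 : ℝ) < 50) k]
          _ = _ := by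
              rw [ENNReal.ofReal_mul (by positivity), ENNReal.ofReal_mul (by norm_num),
                ENNReal.ofReal_pow (by norm_num), ENNReal.ofReal_ofNat, ENNReal.ofReal_ofNat]
    _ = (2 * 50 ^ k) * ∫⁻ ξ in {ξ : ℝ | max L 1 < |ξ|},
          (ENNReal.ofReal (|ξ| ^ (2 * (k : ℝ))) * ‖f ξ‖ₑ ^ 2) :=
        lintegral_const_mul' _ _ (ENNReal.mul_ne_top (by norm_num) (by norm_num))
    _ ≤ (2 * 50 ^ k) * (η ^ 2 / (2 * 50 ^ k)) := by
        gcongr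
        refine (lintegral_mono_set fun ξ hξ => ?_).trans (h f hf)
        exact (le_max_left L 1).trans_lt hξ
    _ ≤ η ^ 2 := ENNReal.mul_div_le

/-! ### Time regularity -/

theorem isMult_cut_bracket (s L : ℝ) :
    IsMult (cut L fun ξ => (((1 + (2 * Real.pi * ξ) ^ 2) ^ (s / 2) : ℝ) : ℂ)) := by
  refine ⟨measurable_cut L (Complex.measurable_ofReal.comp (measurable_bracket _)), ?_⟩
  have hc : Continuous fun ξ : ℝ => (1 + (2 * Real.pi * ξ) ^ 2) ^ (s / 2) :=
    Continuous.rpow_const (by fun_prop) fun ξ => Or.inl (bracket_pos ξ).ne'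
  obtain ⟨C, hC⟩ := isCompact_Icc.exists_bound_of_continuousOn (s := Icc (-L) L) hc.continuousOn
  refine ⟨max C 0, fun ξ => ?_⟩
  rcases le_or_gt |ξ| L with h | h
  · rw [cut_of_le h, Complex.norm_real]
    exact (hC ξ (abs_le.1 h)).trans (le_max_left _ _)
  · rw [cut_of_lt h, norm_zero]; exact le_max_right _ _

/-- Multiplication by `(1 + |2πξ|²)^(s/2)`, cut off to `[-L, L]`. -/
noncomputable def bracketOp (s L : ℝ) : L2C →L[ℝ] L2C := mulOp _ (isMult_cut_bracket s L)

theorem norm_bracketOp_coe (s L : ℝ) (f : L2C) : ∀ᵐ ξ, ‖bracketOp s L f ξ‖ =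
    (1 + (2 * Real.pi * ξ) ^ 2) ^ (s / 2) * ‖bandProj L f ξ‖ := by
  filter_upwards [mulOp_coe _ (isMult_cut_bracket s L) f, bandProj_coe L f] with ξ h1 h2
  have := bracket_pos ξ
  rw [bracketOp, h1, h2]
  rcases le_or_gt |ξ| L with h | h
  · rw [cut_of_le h, cut_of_le h, norm_mul, Complex.norm_real, Real.norm_of_nonneg (by positivity)]
  · rw [cut_of_lt h, cut_of_lt h]; simp

theorem enorm_bracketOp (s L : ℝ) (f : L2C) : ‖bracketOp s L f‖ₑ = hs s (bandProj L f) := by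
  rw [Lp.enorm_def]
  refine eLpNorm_congr_norm_ae ?_
  filter_upwards [norm_bracketOp_coe s L f] with ξ hξ
  have := bracket_pos ξ
  rw [hξ, Real.norm_of_nonneg (by positivity)]

theorem bracketOp_bandProj (s L : ℝ) (f : L2C) : bracketOp s L (bandProj L f) = bracketOp s L f := by
  refine Lp.ext ?_
  filter_upwards [mulOp_coe _ (isMult_cut_bracket s L) f,
    mulOp_coe _ (isMult_cut_bracket s L) (bandProj L f), bandProj_coe L f] with ξ h1 h2 h3
  rw [bracketOp, h1, h2, h3]
  rcases le_or_gt |ξ| L with h | h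
  · rw [cut_of_le h f]
  · rw [cut_of_lt h, cut_of_lt h]; simp

theorem hs_bandProj_le (s L : ℝ) (f : L2C) : hs s (bandProj L f) ≤ hs s f := by
  refine hs_mono_norm s ?_
  filter_upwards [bandProj_coe L f] with ξ hξ
  rw [hξ]
  rcases le_or_gt |ξ| L with h | h
  · rw [cut_of_le h]
  · rw [cut_of_lt h, norm_zero]; exact norm_nonneg _

theorem hs_le_of_bandProj_le {s : ℝ} {f : L2C} {B : ℝ≥0∞}
    (h : ∀ n : ℕ, hs s (bandProj n f) ≤ B) : hs s f ≤ B := by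
  refine (ENNReal.pow_le_pow_left_iff two_ne_zero).1 ?_
  have e : ∀ n : ℕ, hs s (bandProj n f) ^ 2 = ∫⁻ ξ,
      ENNReal.ofReal ((1 + (2 * Real.pi * ξ) ^ 2) ^ s) * ‖cut n f ξ‖ₑ ^ 2 := fun n => by
    rw [hs_sq]
    refine lintegral_congr_ae ?_
    filter_upwards [bandProj_coe n f] with ξ hξ
    rw [hξ]
  have l : ∀ ξ, liminf (fun n : ℕ =>
      ENNReal.ofReal ((1 + (2 * Real.pi * ξ) ^ 2) ^ s) * ‖cut n f ξ‖ₑ ^ 2) atTop =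
      ENNReal.ofReal ((1 + (2 * Real.pi * ξ) ^ 2) ^ s) * ‖f ξ‖ₑ ^ 2 := by
    intro ξ
    refine Tendsto.liminf_eq (tendsto_const_nhds.congr' ?_)
    obtain ⟨n, hn⟩ := exists_nat_ge |ξ|
    filter_upwards [eventually_ge_atTop n] with m hm
    rw [cut_of_le (hn.trans (by exact_mod_cast hm))]
  rw [hs_sq]
  simp_rw [← l]
  refine (lintegral_liminf_le fun n => ?_).trans ?_
  · exact ((measurable_bracket s).ennreal_ofReal).mul
      ((measurable_cut n (measurable_coe f)).enorm.pow_const 2)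
  · simp_rw [← e]
    refine liminf_le_of_frequently_le' (Frequently.of_forall fun n => ?_)
    gcongr
    exact h n

theorem tendsto_hs_sub {k : ℝ} {J : Set ℝ} {f : ℝ → L2C}
    (hT : ∀ η : ℝ≥0∞, 0 < η → ∃ L : ℝ, ∀ t ∈ J, hs k (f t - bandProj L (f t) : L2C) ≤ η)
    (hc : ∀ L, ContinuousOn (fun t => bandProj L (f t)) J) {t₀ : ℝ} (ht₀ : t₀ ∈ J) :
    Tendsto (fun t => hs k (f t - f t₀ : L2C)) (𝓝[J] t₀) (𝓝 0) := by
  rw [ENNReal.tendsto_nhds_zero]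
  intro η hη
  have hη3 : 0 < η / 3 := ENNReal.div_pos hη.ne' (by norm_num)
  obtain ⟨L, hL⟩ := hT _ hη3
  have h1 : Tendsto (fun t => ‖bracketOp k L (bandProj L (f t) - bandProj L (f t₀))‖ₑ) (𝓝[J] t₀)
      (𝓝 0) := by
    have := ((bracketOp k L).continuous.enorm.tendsto _).comp
      ((hc L t₀ ht₀).sub (continuousWithinAt_const (b := bandProj L (f t₀))))
    simpa [Function.comp_def] using this
  filter_upwards [(ENNReal.tendsto_nhds_zero.1 h1) _ hη3, self_mem_nhdsWithin] with t ht htJ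
  have e : f t - f t₀ = (bandProj L (f t - f t₀) + (f t - bandProj L (f t))) -
      (f t₀ - bandProj L (f t₀)) := by rw [map_sub]; abel
  rw [← map_sub, bracketOp_bandProj, enorm_bracketOp] at ht
  calc _ ≤ η / 3 + η / 3 + η / 3 := by
        rw [e]
        refine (hs_coe_sub_le _ _ _).trans ?_
        gcongr
        · refine (hs_coe_add_le _ _ _).trans ?_
          gcongr
          exact hL t htJ
        · exact hL t₀ ht₀
    _ = η := ENNReal.add_thirds η

theorem tendsto_hs_slope {s : ℝ} {J : Set ℝ} (hJ : Convex ℝ J) {f f' : ℝ → L2C}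
    (hd : ∀ L, ∀ t ∈ J, HasDerivAt (fun τ => bandProj L (f τ)) (bandProj L (f' t)) t)
    {t₀ : ℝ} (ht₀ : t₀ ∈ J)
    (hc : Tendsto (fun t => hs s (f' t - f' t₀ : L2C)) (𝓝[J] t₀) (𝓝 0)) :
    Tendsto (fun t => hs s ((t - t₀)⁻¹ • (f t - f t₀) - f' t₀ : L2C)) (𝓝[J \ {t₀}] t₀) (𝓝 0) := by
  rw [ENNReal.tendsto_nhds_zero]
  intro η hη
  wlog hη' : η ≠ ⊤ generalizing η
  · rw [not_not] at hη'
    exact Eventually.of_forall fun t => hη' ▸ le_top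
  obtain ⟨δ, hδ, hball⟩ := Metric.mem_nhdsWithin_iff.1 (ENNReal.tendsto_nhds_zero.1 hc η hη)
  have hmem : J ∩ Metric.ball t₀ δ ∈ 𝓝[J] t₀ :=
    inter_mem self_mem_nhdsWithin (mem_nhdsWithin_of_mem_nhds (Metric.ball_mem_nhds _ hδ))
  filter_upwards [nhdsWithin_mono t₀ sdiff_subset hmem, self_mem_nhdsWithin] with t ht htne
  refine hs_le_of_bandProj_le fun n => ?_
  have hne : t - t₀ ≠ 0 := sub_ne_zero.2 htne.2
  set Q := bracketOp s n
  have hQ : ∀ τ ∈ J ∩ Metric.ball t₀ δ, HasDerivWithinAt (fun τ => Q (f τ) - τ • Q (f' t₀))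
      (Q (f' τ - f' t₀)) (J ∩ Metric.ball t₀ δ) τ := by
    intro τ hτ
    have h1 : HasDerivAt (fun τ => Q (bandProj n (f τ))) (Q (bandProj n (f' τ))) τ :=
      Q.hasFDerivAt.comp_hasDerivAt τ (hd n τ hτ.1)
    simp only [Q, bracketOp_bandProj] at h1
    have h2 := (hasDerivAt_id τ).smul_const (Q (f' t₀))
    rw [one_smul] at h2
    rw [map_sub]
    exact (h1.sub h2).hasDerivWithinAt
  have hb : ∀ τ ∈ J ∩ Metric.ball t₀ δ, ‖Q (f' τ - f' t₀)‖ ≤ η.toReal := by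
    intro τ hτ
    rw [← toReal_enorm, enorm_bracketOp]
    exact ENNReal.toReal_mono hη' ((hs_bandProj_le _ _ _).trans (hball ⟨hτ.2, hτ.1⟩))
  have := (hJ.inter (convex_ball t₀ δ)).norm_image_sub_le_of_norm_hasDerivWithin_le hQ hb
    ⟨ht₀, Metric.mem_ball_self hδ⟩ ht
  have e : (t - t₀)⁻¹ • (Q (f t) - t • Q (f' t₀) - (Q (f t₀) - t₀ • Q (f' t₀))) =
      Q ((t - t₀)⁻¹ • (f t - f t₀) - f' t₀) := by
    rw [show Q (f t) - t • Q (f' t₀) - (Q (f t₀) - t₀ • Q (f' t₀)) =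
      (Q (f t) - Q (f t₀)) - (t - t₀) • Q (f' t₀) by rw [sub_smul]; abel, smul_sub, smul_smul,
      inv_mul_cancel₀ hne, one_smul, map_sub, map_smul, map_sub]
  rw [← enorm_bracketOp, ← ofReal_norm, ← e, norm_smul, norm_inv]
  refine ENNReal.ofReal_le_of_le_toReal ?_
  rw [inv_mul_le_iff₀ (norm_pos_iff.2 hne), mul_comm]
  exact this

/-! ### The right-hand side of the equation -/

/-- The right-hand side of the equation as a function. -/
noncomputable def rhs (f : ℝ → ℂ) (ξ : ℝ) : ℂ :=
  -Complex.I * (sg ξ : ℂ) * f ξ + -(Complex.I * Real.pi) * ((ξ : ℂ) * conv f f ξ)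

theorem measurable_rhs {f : ℝ → ℂ} (hf : Measurable f) : Measurable (rhs f) := by
  have h1 : Measurable fun ξ => (sg ξ : ℂ) := isMult_sg.1
  have h2 := measurable_conv hf hf
  unfold rhs
  fun_prop

theorem hs_sg_mul (s : ℝ) (F : ℝ → ℂ) : hs s (fun ξ => -Complex.I * (sg ξ : ℂ) * F ξ) = hs s F := by
  unfold hs
  congr 1
  ext ξ
  rw [norm_mul, norm_mul, norm_neg, Complex.norm_I, enorm_sg, one_mul, one_mul]

theorem memLp_of_hs_lt_top {s : ℝ} (hs0 : 0 ≤ s) {F : ℝ → ℂ} (hF : Measurable F) (h : hs s F < ⊤) :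
    MemLp F 2 volume :=
  ⟨hF.aestronglyMeasurable, by rw [← hs_zero]; exact (hs_mono hs0 F).trans_lt h⟩

theorem hs_rhs_lt_top (n : ℕ) {f : ℝ → ℂ} (hf : Measurable f) (h : hs (n + 1) f < ⊤) :
    hs n (rhs f) < ⊤ := by
  obtain ⟨C, hC⟩ := exists_hs_id_mul_conv_le n
  have hm : Measurable fun ξ => (sg ξ : ℂ) := isMult_sg.1
  have h2 := measurable_conv hf hf
  refine (hs_add_le n (by fun_prop) (by fun_prop)).trans_lt (ENNReal.add_lt_top.2 ⟨?_, ?_⟩)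
  · rw [hs_sg_mul]
    exact (hs_mono (by linarith) f).trans_lt h
  · rw [hs_const_mul]
    exact ENNReal.mul_lt_top enorm_lt_top ((hC f f hf hf).trans_lt
      (ENNReal.mul_lt_top ENNReal.coe_lt_top (ENNReal.mul_lt_top h h)))

theorem exists_hs_rhs_sub_le (n : ℕ) : ∃ C : ℝ≥0, ∀ f g : L2C,
    hs n (fun ξ => rhs f ξ - rhs g ξ) ≤
      hs (n + 1) (f - g : L2C) + C * (hs (n + 1) (f - g : L2C) * (hs (n + 1) f + hs (n + 1) g)) := by
  obtain ⟨C, hC⟩ := exists_hs_id_mul_conv_le n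
  refine ⟨Real.pi.toNNReal * C, fun f g => ?_⟩
  set d : L2C := f - g
  have mf := measurable_coe f
  have mg := measurable_coe g
  have md := measurable_coe d
  have hm : Measurable fun ξ => (sg ξ : ℂ) := isMult_sg.1
  have m1 := measurable_conv md mf
  have m2 := measurable_conv mg md
  have hd : d =ᵐ[volume] fun x => f x + (-1) * g x := by
    filter_upwards [Lp.coeFn_sub f g] with x hx
    rw [hx, Pi.sub_apply]; ring
  have Mg : MemLp (fun x => (-1 : ℂ) * g x) 2 volume := (Lp.memLp g).const_mul _
  have e : (fun ξ => rhs f ξ - rhs g ξ) =ᵐ[volume] fun ξ => -Complex.I * (sg ξ : ℂ) * d ξ +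
      -(Complex.I * Real.pi) * ((ξ : ℂ) * conv d f ξ + (ξ : ℂ) * conv g d ξ) := by
    filter_upwards [hd] with ξ h1
    rw [conv_congr hd (ae_eq_refl f), conv_congr (ae_eq_refl g) hd,
      conv_add_left (Lp.memLp f) Mg (Lp.memLp f), conv_add_right (Lp.memLp g) (Lp.memLp f) Mg,
      conv_const_mul_left, conv_const_mul_right, h1, rhs, rhs]
    ring
  rw [hs_congr _ e]
  refine (hs_add_le n (by fun_prop) (by fun_prop)).trans ?_
  gcongr
  · rw [hs_sg_mul]; exact hs_mono (by linarith) _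
  · rw [hs_const_mul]
    have hpi : ‖-(Complex.I * Real.pi)‖ₑ = (Real.pi.toNNReal : ℝ≥0∞) := by
      rw [enorm_neg, enorm_mul, ← ofReal_norm, ← ofReal_norm, Complex.norm_I, Complex.norm_real,
        Real.norm_of_nonneg Real.pi_pos.le, ENNReal.ofReal_one, one_mul]
      rfl
    calc _ ≤ (Real.pi.toNNReal : ℝ≥0∞) * (C * (hs (n + 1) d * hs (n + 1) f) +
          C * (hs (n + 1) g * hs (n + 1) d)) := by
          rw [hpi]
          gcongr
          refine (hs_add_le n (by fun_prop) (by fun_prop)).trans ?_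
          gcongr
          · exact hC _ _ md mf
          · exact hC _ _ mg md
      _ = _ := by push_cast; ring

/-! ### Uniqueness -/

theorem triIntegrable_of_triAbs_lt_top {q : ℝ → ℝ → ℝ → ℝ} {F G H F' G' H' : ℝ → ℂ}
    (hq : Measurable fun p : ℝ × ℝ => q p.1 p.2 (-p.1 - p.2)) (hF : Measurable F)
    (hG : Measurable G) (hH : Measurable H)
    (h : ∀ x y z : ℝ, ENNReal.ofReal |q x y z| * (‖F x‖ₑ * ‖G y‖ₑ * ‖H z‖ₑ) ≤
      ‖F' x‖ₑ * ‖G' y‖ₑ * ‖H' z‖ₑ) (hlt : triAbs F' G' H' < ⊤) : TriIntegrable q F G H := by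
  refine ⟨((Complex.measurable_ofReal.comp hq).mul (by fun_prop)).aestronglyMeasurable, ?_⟩
  refine (lintegral_mono fun p => ?_).trans_lt hlt
  refine le_trans (le_of_eq ?_) (h p.1 p.2 (-p.1 - p.2))
  rw [enorm_mul, enorm_mul, enorm_mul, ← ofReal_norm, Complex.norm_real, Real.norm_eq_abs]

theorem triIntegrable_snd {S V : ℝ → ℂ} (hS : Measurable S) (hV : Measurable V)
    (hS1 : eLpNorm S 1 volume < ⊤) (hV1 : Yn 1 V < ⊤) (hV0 : eLpNorm V 2 volume < ⊤) :
    TriIntegrable (fun _ y _ => y) S V V := by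
  refine triIntegrable_of_triAbs_lt_top (F' := S) (G' := wt 1 V) (H' := V) (by fun_prop) hS hV hV
    (fun x y z => le_of_eq ?_) ((triAbs_le hS (measurable_wt 1 hV) hV).trans_lt
      (ENNReal.mul_lt_top (ENNReal.mul_lt_top hS1 hV1) hV0))
  rw [enorm_wt, pow_one]
  ring

theorem triIntegrable_thd {S V : ℝ → ℂ} (hS : Measurable S) (hV : Measurable V)
    (hS1 : eLpNorm S 1 volume < ⊤) (hV1 : Yn 1 V < ⊤) (hV0 : eLpNorm V 2 volume < ⊤) :
    TriIntegrable (fun _ _ z => z) S V V := by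
  refine triIntegrable_of_triAbs_lt_top (F' := S) (G' := V) (H' := wt 1 V) (by fun_prop) hS hV hV
    (fun x y z => le_of_eq ?_) ((triAbs_le hS hV (measurable_wt 1 hV)).trans_lt
      (ENNReal.mul_lt_top (ENNReal.mul_lt_top hS1 hV0) hV1))
  rw [enorm_wt, pow_one]
  ring

theorem triIntegrable_fst {S V : ℝ → ℂ} (hS : Measurable S) (hV : Measurable V)
    (hS1 : eLpNorm S 1 volume < ⊤) (hV1 : Yn 1 V < ⊤) (hV0 : eLpNorm V 2 volume < ⊤) :
    TriIntegrable (fun x _ _ => -x) V S V := by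
  refine triIntegrable_of_triAbs_lt_top (F' := wt 1 V) (G' := S) (H' := V) (by fun_prop) hV hS hV
    (fun x y z => le_of_eq ?_) ?_
  · rw [enorm_wt, pow_one, abs_neg]
    ring
  · rw [triAbs_swap12]
    exact (triAbs_le hS (measurable_wt 1 hV) hV).trans_lt
      (ENNReal.mul_lt_top (ENNReal.mul_lt_top hS1 hV1) hV0)

theorem two_mul_tri_neg_fst {S V : ℝ → ℂ} (h2 : TriIntegrable (fun _ y _ => y) S V V)
    (h3 : TriIntegrable (fun _ _ z => z) S V V) :
    2 * tri (fun x _ _ => -x) V S V = tri (fun x _ _ => x) S V V := by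
  have e0 : tri (fun x _ _ => -x) V S V = -tri (fun x _ _ => x) V S V := by
    rw [tri_congr (q' := fun x _ _ => (-1) * x) (fun x y z _ => by ring), tri_const_mul]
    simp
  have e1 : tri (fun x _ _ => x) V S V = tri (fun _ y _ => y) S V V := tri_swap12 _ _ _ _
  have e2 : tri (fun _ y _ => y) S V V = tri (fun _ _ z => z) S V V := tri_swap23 _ _ _ _
  have e4 : tri (fun x _ _ => x) S V V = -tri (fun x _ _ => (-1) * x) S V V := by
    rw [tri_const_mul]; simp
  rw [two_mul, e0, e1, e4]
  nth_rewrite 2 [e2]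
  rw [← neg_add, ← tri_add h2 h3]
  congr 1
  exact tri_congr (fun x y z h => by linarith) _ _ _

theorem abs_inner_rhs_sub_le {f g F G : L2C} {M : ℝ≥0} (hf : Herm f) (hg : Herm g)
    (hfM : hs 2 f ≤ M) (hgM : hs 2 g ≤ M) (hF : F =ᵐ[volume] rhs f) (hG : G =ᵐ[volume] rhs g) :
    |inner ℝ (f - g) (F - G)| ≤ Real.pi / 2 * (4 * sobConst * M) * ‖f - g‖ ^ 2 := by
  set v : L2C := f - g with hv
  set s : L2C := f + g with hsdef
  have mv := measurable_coe v
  have ms := measurable_coe s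
  have hvM : hs 2 v < ⊤ := (hs_coe_sub_le 2 f g).trans_lt (ENNReal.add_lt_top.2
    ⟨hfM.trans_lt ENNReal.coe_lt_top, hgM.trans_lt ENNReal.coe_lt_top⟩)
  have hsM : hs 2 s ≤ 2 * M := (hs_coe_add_le 2 f g).trans (by rw [two_mul]; gcongr)
  have hsM' : hs 2 s < ⊤ := hsM.trans_lt (ENNReal.mul_lt_top (by simp) ENNReal.coe_lt_top)
  have hS1 : eLpNorm s 1 volume < ⊤ := (eLpNorm_one_le_hs (by norm_num : (1 : ℝ) ≤ 2) ms).trans_lt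
    (ENNReal.mul_lt_top (ENNReal.mul_lt_top (by simp) ENNReal.ofReal_lt_top) hsM')
  have hV1 : Yn 1 v < ⊤ := (Yn_le_hs (by norm_num) v).trans_lt hvM
  have hV0 : eLpNorm v 2 volume < ⊤ := (Lp.memLp v).2
  have ev : v =ᵐ[volume] fun x => f x + (-1) * g x := by
    filter_upwards [Lp.coeFn_sub f g] with x hx
    rw [hx, Pi.sub_apply]; ring
  have es : s =ᵐ[volume] fun x => f x + g x := Lp.coeFn_add f g
  have hvH : Herm v := by
    refine Herm.congr (F := fun x => f x + (-1) * g x) ?_ ev.symm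
    filter_upwards [hf, hg] with x h1 h2
    rw [h1, h2, map_add, map_mul, map_neg, map_one]
  set A := mulOp _ isMult_neg_I_sg v
  set B := F - G - A with hB
  have eB : B =ᵐ[volume] fun ξ => -(Complex.I * Real.pi) * ((ξ : ℂ) * conv s v ξ) := by
    have Mg : MemLp (fun x => (-1 : ℂ) * g x) 2 volume := (Lp.memLp g).const_mul _
    filter_upwards [Lp.coeFn_sub (F - G) A, Lp.coeFn_sub F G, mulOp_coe _ isMult_neg_I_sg v, hF, hG,
      ev] with ξ h1 h2 h3 h4 h5 h6
    rw [hB, h1, Pi.sub_apply, h2, Pi.sub_apply, h3, h4, h5, h6, rhs, rhs, conv_congr es ev,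
      conv_add_left (Lp.memLp f) (Lp.memLp g) (show MemLp (fun x => f x + -1 * g x) 2 volume from
        (Lp.memLp f).add Mg),
      conv_add_right (Lp.memLp f) (Lp.memLp f) Mg, conv_add_right (Lp.memLp g) (Lp.memLp f) Mg,
      conv_const_mul_right, conv_const_mul_right, conv_comm g f]
    ring
  have hA0 : (inner ℂ v A).re = 0 := by
    rw [← ip_zero_eq_inner, ip_congr 0 v (G' := fun ξ => -Complex.I * ((sg ξ : ℂ) * v ξ)),
      ip_const_mul_right]
    · have := im_ip_sg 0 v
      simp [this]
    · filter_upwards [mulOp_coe _ isMult_neg_I_sg v] with ξ h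
      rw [h, mul_assoc]
  have hB0 : inner ℂ v B = -(Complex.I * Real.pi) * tri (fun x _ _ => -x) v s v := by
    rw [← ip_zero_eq_inner, ip_congr 0 v eB, ip_const_mul_right,
      ← integral_conj_mul_conv (p := fun x => x) hvH (triIntegrable_fst ms mv hS1 hV1 hV0), ip]
    congr 1
    refine integral_congr_ae (Eventually.of_forall fun ξ => ?_)
    simp only [mul_zero, pow_zero, Complex.ofReal_one, one_mul]
    ring
  have htri : ‖tri (fun x _ _ => x) s v v‖ ≤ 4 * sobConst * M * ‖v‖ ^ 2 := by
    have := sobConst_nonneg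
    refine toReal_le_of_enorm_le (enorm_tri_le_lintegral _ _ _ _) ?_ (by positivity)
    calc _ = triAbs (wt 1 s) v v := by
          refine lintegral_congr fun p => ?_
          rw [enorm_wt, pow_one]
          ring
      _ ≤ An s * eLpNorm v 2 volume * eLpNorm v 2 volume := triAbs_le (measurable_wt _ ms) mv mv
      _ ≤ ENNReal.ofReal sobConst * (2 * M + 2 * M) * ‖v‖ₑ * ‖v‖ₑ := by
          rw [← Lp.enorm_def]
          gcongr
          refine (An_le ms).trans ?_
          gcongr
          · exact (Yn_le_hs (by norm_num) s).trans hsM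
          · exact (Yn_le_hs (by norm_num) s).trans hsM
      _ = _ := by
          rw [ENNReal.ofReal_mul (by positivity), ENNReal.ofReal_mul (by positivity),
            ENNReal.ofReal_mul (by positivity), ENNReal.ofReal_pow (norm_nonneg _), ofReal_norm,
            ENNReal.ofReal_coe_nnreal, ENNReal.ofReal_ofNat]
          ring
  have e : F - G = A + B := by rw [hB]; abel
  rw [inner_real_eq_re, e, inner_add_right, Complex.add_re, hA0, zero_add, hB0]
  refine (Complex.abs_re_le_norm _).trans ?_
  have h2 := two_mul_tri_neg_fst (triIntegrable_snd ms mv hS1 hV1 hV0)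
    (triIntegrable_thd ms mv hS1 hV1 hV0)
  rw [← h2, norm_mul, Complex.norm_ofNat] at htri
  rw [norm_mul, norm_neg, norm_mul, Complex.norm_I, one_mul, Complex.norm_real,
    Real.norm_of_nonneg Real.pi_pos.le]
  nlinarith [Real.pi_pos]

theorem hasDerivWithinAt_of_hs {s : ℝ} (hs0 : 0 ≤ s) {J : Set ℝ} {f : ℝ → L2C} {f' : L2C} {t₀ : ℝ}
    (h : Tendsto (fun t => hs s ((t - t₀)⁻¹ • (f t - f t₀) - f' : L2C)) (𝓝[J \ {t₀}] t₀) (𝓝 0)) :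
    HasDerivWithinAt f f' J t₀ := by
  rw [hasDerivWithinAt_iff_tendsto_slope, tendsto_iff_edist_tendsto_0]
  refine tendsto_of_tendsto_of_tendsto_of_le_of_le tendsto_const_nhds h (fun _ => zero_le)
    fun t => ?_
  simp only [edist_eq_enorm_sub, slope_def_module]
  exact enorm_le_hs hs0 _

/-- Uniqueness of solutions that are bounded in `H²`. -/
theorem eq_of_hasDerivWithinAt {T : ℝ} (hT : 0 < T) {f g f' g' : ℝ → L2C} {M : ℝ≥0}
    (hf : ∀ t ∈ Icc (-T) T, Herm (f t) ∧ hs 2 (f t) ≤ M ∧ f' t =ᵐ[volume] rhs (f t) ∧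
      HasDerivWithinAt f (f' t) (Icc (-T) T) t)
    (hg : ∀ t ∈ Icc (-T) T, Herm (g t) ∧ hs 2 (g t) ≤ M ∧ g' t =ᵐ[volume] rhs (g t) ∧
      HasDerivWithinAt g (g' t) (Icc (-T) T) t)
    (h0 : f 0 = g 0) : ∀ t ∈ Icc (-T) T, f t = g t := by
  have hin : ∀ t ∈ Ioo (-T) T, f t = g t := by
    intro t ht
    set κ : ℝ := Real.pi * (4 * sobConst * M) + 1
    have hκ : 0 < κ := by have := sobConst_nonneg; have := Real.pi_pos; positivity
    have hsub : uIcc 0 t ⊆ Ioo (-T) T :=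
      (ordConnected_Ioo).uIcc_subset ⟨by linarith, hT⟩ ht
    have key := abs_le_of_abs_deriv_le (E := fun t => ‖f t - g t‖ ^ 2)
      (E' := fun t => 2 * inner ℝ (f t - g t) (f' t - g' t)) (t := t) hκ le_rfl
      (fun s hs => by
        have hs' := hsub hs
        have hn : Icc (-T) T ∈ 𝓝 s := Icc_mem_nhds hs'.1 hs'.2
        exact (((hf s (Ioo_subset_Icc_self hs')).2.2.2.hasDerivAt hn).sub
          ((hg s (Ioo_subset_Icc_self hs')).2.2.2.hasDerivAt hn)).norm_sq)
      (fun s hs => by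
        have hs' := Ioo_subset_Icc_self (hsub hs)
        have := abs_inner_rhs_sub_le (hf s hs').1 (hg s hs').1 (hf s hs').2.1 (hg s hs').2.1
          (hf s hs').2.2.1 (hg s hs').2.2.1
        rw [abs_mul, abs_two, abs_of_nonneg (sq_nonneg ‖f s - g s‖)]
        simp only [κ]
        nlinarith [sq_nonneg ‖f s - g s‖])
    simp only [h0, sub_self, norm_zero, zero_div] at key
    norm_num at key
    exact sub_eq_zero.1 key
  have hcf : ContinuousOn f (Icc (-T) T) := fun t ht => (hf t ht).2.2.2.continuousWithinAt
  have hcg : ContinuousOn g (Icc (-T) T) := fun t ht => (hg t ht).2.2.2.continuousWithinAt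
  have : EqOn f g (Icc (-T) T) := EqOn.of_subset_closure (s := Ioo (-T) T) hin hcf hcg
    Ioo_subset_Icc_self (by rw [closure_Ioo (by linarith : -T ≠ T)])
  exact this

theorem exists_hs_le {s : ℝ} {J : Set ℝ} (hJ : IsCompact J) {f : ℝ → L2C}
    (hf : ∀ t ∈ J, hs s (f t) < ⊤)
    (hc : ∀ t₀ ∈ J, Tendsto (fun t => hs s (f t - f t₀ : L2C)) (𝓝[J] t₀) (𝓝 0)) :
    ∃ M : ℝ≥0, ∀ t ∈ J, hs s (f t) ≤ M := by
  refine hJ.induction_on (p := fun S => ∃ M : ℝ≥0, ∀ t ∈ S, hs s (f t) ≤ M) ⟨0, by simp⟩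
    (fun S S' hS ⟨M, hM⟩ => ⟨M, fun t ht => hM t (hS ht)⟩)
    (fun S S' ⟨M, hM⟩ ⟨M', hM'⟩ => ⟨max M M', fun t ht => ?_⟩) (fun t₀ ht₀ => ?_)
  · rcases ht with ht | ht
    · exact (hM t ht).trans (by exact_mod_cast le_max_left _ _)
    · exact (hM' t ht).trans (by exact_mod_cast le_max_right _ _)
  · refine ⟨_, ENNReal.tendsto_nhds_zero.1 (hc t₀ ht₀) 1 one_pos, (hs s (f t₀)).toNNReal + 1,
      fun t ht => ?_⟩
    have ht' : hs s (f t - f t₀ : L2C) ≤ 1 := ht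
    have e : f t = f t₀ + (f t - f t₀) := by abel
    rw [e, ENNReal.coe_add, ENNReal.coe_toNNReal (hf t₀ ht₀).ne]
    exact (hs_coe_add_le _ _ _).trans (by gcongr; exact ht')

/-! ### Existence of regular solutions -/

theorem Approximable.mono {ε T T' : ℝ} (h : T' ≤ T) {f : ℝ → L2C} (hf : Approximable ε T f) :
    Approximable ε T' f := by
  intro δ hδ
  obtain ⟨R, g, g', r, hb, hg⟩ := hf δ hδ
  exact ⟨R, g, g', r, hb, fun t ht => hg t ⟨by linarith [ht.1], by linarith [ht.2]⟩⟩

theorem bandProj_eq_bandField {f F : L2C} (hF : F =ᵐ[volume] rhs f) (L : ℝ) :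
    bandProj L F = bandField L f := by
  refine Lp.ext ?_
  filter_upwards [Lp.coeFn_add (bandProj L (mulOp _ isMult_neg_I_sg f)) (quadTerm L f f),
    bandProj_coe L F, bandProj_coe L (mulOp _ isMult_neg_I_sg f), mulOp_coe _ isMult_neg_I_sg f,
    quadTerm_coe L f f, hF] with x h2 h3 h5 h6 h7 h8
  rw [bandField, h2, Pi.add_apply, h3, h5, h7]
  rcases le_or_gt |x| L with hL | hL
  · rw [cut_of_le hL, cut_of_le hL, cut_of_le hL, h6, h8, rhs]
  · rw [cut_of_lt hL, cut_of_lt hL, cut_of_lt hL]; simp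

/-- Existence of solutions in `H^(n+1)` on the Fourier side. -/
theorem exists_regular_solution : ∃ ε₀ : ℝ, 0 < ε₀ ∧ ∃ α : ℝ, 0 < α ∧ ∀ n : ℕ, ∃ C : ℝ≥0,
    ∀ ε : ℝ, 0 < ε → ε ≤ ε₀ → ∀ f₀ : L2C, Herm f₀ → hs 2 f₀ ≤ ENNReal.ofReal ε →
    hs (n + 1) f₀ < ⊤ → ∃ f f' : ℝ → L2C, f 0 = f₀ ∧ Approximable ε (α / ε ^ 2) f ∧
      ∀ t ∈ Icc (-(α / ε ^ 2)) (α / ε ^ 2), Herm (f t) ∧ f' t =ᵐ[volume] rhs (f t) ∧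
        (∀ s : ℝ, 0 ≤ s → s ≤ n + 1 → hs s (f t) ≤ C * hs s f₀) ∧
        Tendsto (fun τ => hs (n + 1) (f τ - f t : L2C)) (𝓝[Icc (-(α / ε ^ 2)) (α / ε ^ 2)] t) (𝓝 0) ∧
        Tendsto (fun τ => hs n (f' τ - f' t : L2C)) (𝓝[Icc (-(α / ε ^ 2)) (α / ε ^ 2)] t) (𝓝 0) ∧
        Tendsto (fun τ => hs n ((τ - t)⁻¹ • (f τ - f t) - f' t : L2C))
          (𝓝[Icc (-(α / ε ^ 2)) (α / ε ^ 2) \ {t}] t) (𝓝 0) := by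
  obtain ⟨ε₀, hε₀, α, hα, C, hC, h⟩ := exists_solution
  refine ⟨ε₀, hε₀, α / 2, by positivity, fun n => ⟨50 ^ (n + 1) * (1 + (C (n + 1)).toNNReal),
    fun ε hε hε' f₀ hf₀ hf2 hfn => ?_⟩⟩
  have hsm : Yn 0 f₀ ^ 2 + Yn 2 f₀ ^ 2 ≤ ENNReal.ofReal (ε ^ 2) := by
    refine (Yn_sq_add_le_hs f₀ (measurable_coe f₀)).trans ?_
    rw [ENNReal.ofReal_pow hε.le]
    gcongr
  obtain ⟨f, hf0, hfA, hf⟩ := h ε hε hε' f₀ hf₀ hsm (n + 1)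
  set T := α / 2 / ε ^ 2 with hT
  have hT0 : 0 < T := by positivity
  have hTT : α / ε ^ 2 = 2 * T := by rw [hT]; ring
  rw [hTT] at hfA hf
  have hJ : Icc (-T) T ⊆ Ioo (-(2 * T)) (2 * T) := fun t ht =>
    ⟨by linarith [ht.1], by linarith [ht.2]⟩
  have hJ' : Icc (-T) T ⊆ Icc (-(2 * T)) (2 * T) := hJ.trans Ioo_subset_Icc_self
  have hhigh : ∀ t ∈ Icc (-T) T, ∀ N, 0 < N → highMass (n + 1 + 1) (f t) N ≤
      ((C (n + 1)).toNNReal : ℝ≥0) * highMass (n + 1 + 1) f₀ N := by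
    intro t ht N hN
    rw [highMass_eq _ hN, highMass_eq _ hN]
    change _ ≤ ENNReal.ofReal (C (n + 1)) * _
    rw [← ENNReal.ofReal_mul (hC _)]
    exact ENNReal.ofReal_le_ofReal ((hf t (hJ' ht)).2 N hN)
  have hbound : ∀ t ∈ Icc (-T) T, ∀ s : ℝ, 0 ≤ s → s ≤ n + 1 →
      hs s (f t) ≤ (50 ^ (n + 1) * (1 + (C (n + 1)).toNNReal) : ℝ≥0) * hs s f₀ :=
    fun t ht s h0 h1 => hs_le_of_highMass_le (hhigh t ht) (hf t (hJ' ht)).1 h0 (by exact_mod_cast h1)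
  have hn0 : (0 : ℝ) ≤ n := n.cast_nonneg
  obtain ⟨M, hM⟩ : ∃ M : ℝ≥0, ∀ t ∈ Icc (-T) T, hs (n + 1) (f t) ≤ M := by
    refine ⟨(50 ^ (n + 1) * (1 + (C (n + 1)).toNNReal) : ℝ≥0) * (hs (n + 1) f₀).toNNReal,
      fun t ht => ?_⟩
    rw [ENNReal.coe_mul, ENNReal.coe_toNNReal hfn.ne]
    exact hbound t ht _ (by linarith) le_rfl
  have hex : ∀ t, ∃ F : L2C, t ∈ Icc (-T) T → F =ᵐ[volume] rhs (f t) := by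
    intro t
    by_cases ht : t ∈ Icc (-T) T
    · have hm := memLp_of_hs_lt_top hn0 (measurable_rhs (measurable_coe (f t)))
        (hs_rhs_lt_top n (measurable_coe (f t)) ((hM t ht).trans_lt ENNReal.coe_lt_top))
      exact ⟨hm.toLp _, fun _ => hm.coeFn_toLp⟩
    · exact ⟨0, fun h => absurd h ht⟩
  choose f' hf' using hex
  have hderiv : ∀ L, ∀ t ∈ Icc (-T) T,
      HasDerivAt (fun τ => bandProj L (f τ)) (bandProj L (f' t)) t := fun L t ht => by
    rw [bandProj_eq_bandField (hf' t ht)]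
    exact hfA.hasDerivAt hε (hJ ht) L
  have hcont : ∀ t ∈ Icc (-T) T,
      Tendsto (fun τ => hs (n + 1) (f τ - f t : L2C)) (𝓝[Icc (-T) T] t) (𝓝 0) := by
    intro t ht
    refine tendsto_hs_sub (fun η hη => ?_)
      (fun L τ hτ => (hderiv L τ hτ).continuousAt.continuousWithinAt) ht
    obtain ⟨L, hL⟩ := exists_hs_tail_le (k := n + 1) (by omega) (by exact_mod_cast hfn)
      (C (n + 1)).toNNReal hη
    exact ⟨L, fun τ hτ => by exact_mod_cast hL (f τ) (hhigh τ hτ)⟩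
  have hcont' : ∀ t ∈ Icc (-T) T,
      Tendsto (fun τ => hs n (f' τ - f' t : L2C)) (𝓝[Icc (-T) T] t) (𝓝 0) := by
    intro t ht
    obtain ⟨B, hB⟩ := exists_hs_rhs_sub_le n
    have hlim : Tendsto (fun τ => hs (n + 1) (f τ - f t : L2C) +
        B * (hs (n + 1) (f τ - f t : L2C) * (M + M))) (𝓝[Icc (-T) T] t) (𝓝 0) := by
      have h1 := hcont t ht
      have h2 := ENNReal.Tendsto.const_mul (a := B) (ENNReal.Tendsto.mul_const (b := (M + M : ℝ≥0∞)) h1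
        (Or.inr (by simp))) (Or.inr ENNReal.coe_ne_top)
      simpa using h1.add h2
    refine tendsto_of_tendsto_of_tendsto_of_le_of_le' tendsto_const_nhds hlim
      (Eventually.of_forall fun _ => zero_le) ?_
    filter_upwards [self_mem_nhdsWithin] with τ hτ
    have e : (f' τ - f' t : L2C) =ᵐ[volume] fun ξ => rhs (f τ) ξ - rhs (f t) ξ := by
      filter_upwards [Lp.coeFn_sub (f' τ) (f' t), hf' τ hτ, hf' t ht] with ξ h1 h2 h3
      rw [h1, Pi.sub_apply, h2, h3]
    rw [hs_congr _ e]
    refine (hB _ _).trans ?_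
    gcongr
    · exact hM τ hτ
    · exact hM t ht
  exact ⟨f, f', hf0, hfA.mono (by linarith), fun t ht => ⟨hfA.herm (hJ' ht), hf' t ht, hbound t ht,
    hcont t ht, hcont' t ht, tendsto_hs_slope (convex_Icc _ _) hderiv ht (hcont' t ht)⟩⟩

/-! ### The Fourier transform of square integrable functions -/

theorem integral_mul_fourier (g : L2C) (φ : SchwartzMap ℝ ℂ) :
    ∫ x, φ x * (𝓕 g : L2C) x = ∫ x, (𝓕 φ : SchwartzMap ℝ ℂ) x * g x := by
  have := DFunLike.congr_fun (Lp.fourier_toTemperedDistribution_eq g) φ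
  rw [TemperedDistribution.fourier_apply, Lp.toTemperedDistribution_apply,
    Lp.toTemperedDistribution_apply] at this
  exact this.symm

theorem integral_mul_fourierInv (g : L2C) (φ : SchwartzMap ℝ ℂ) :
    ∫ x, φ x * (𝓕⁻ g : L2C) x = ∫ x, (𝓕⁻ φ : SchwartzMap ℝ ℂ) x * g x := by
  have := DFunLike.congr_fun (Lp.fourierInv_toTemperedDistribution_eq g) φ
  rw [TemperedDistribution.fourierInv_apply, Lp.toTemperedDistribution_apply,
    Lp.toTemperedDistribution_apply] at this
  exact this.symm

/-- A real test function as a complex Schwartz function. -/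
noncomputable def testSchwartz {φ : ℝ → ℝ} (h : ContDiff ℝ ∞ φ) (hc : HasCompactSupport φ) :
    SchwartzMap ℝ ℂ :=
  (hc.comp_left (g := fun x : ℝ => (x : ℂ)) Complex.ofReal_zero).toSchwartzMap
    (Complex.ofRealCLM.contDiff.comp h)

theorem ae_eq_of_forall_schwartz {F G : ℝ → ℂ} (hF : LocallyIntegrable F) (hG : LocallyIntegrable G)
    (h : ∀ φ : SchwartzMap ℝ ℂ, ∫ x, φ x * F x = ∫ x, φ x * G x) : F =ᵐ[volume] G :=
  ae_eq_of_integral_contDiff_smul_eq hF hG fun _ hg hc => h (testSchwartz hg hc)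

theorem locallyIntegrable_coe (g : L2C) : LocallyIntegrable g :=
  (Lp.memLp g).locallyIntegrable (by norm_num)

/-- The function `x ↦ conj (φ (-x))`. -/
noncomputable def schwartzConjNeg (φ : SchwartzMap ℝ ℂ) : SchwartzMap ℝ ℂ :=
  SchwartzMap.compCLMOfContinuousLinearEquiv ℝ (ContinuousLinearEquiv.neg ℝ)
    (φ.postcompCLM (Complex.conjCLE : ℂ →L[ℝ] ℂ))

theorem schwartzConjNeg_apply (φ : SchwartzMap ℝ ℂ) (x : ℝ) :
    schwartzConjNeg φ x = starRingEnd ℂ (φ (-x)) := rfl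

theorem fourier_schwartzConjNeg (φ : SchwartzMap ℝ ℂ) (ξ : ℝ) :
    (𝓕 (schwartzConjNeg φ) : SchwartzMap ℝ ℂ) ξ =
      starRingEnd ℂ ((𝓕 φ : SchwartzMap ℝ ℂ) ξ) := by
  rw [SchwartzMap.fourier_coe, SchwartzMap.fourier_coe, Real.fourier_real_eq_integral_exp_smul,
    Real.fourier_real_eq_integral_exp_smul, ← integral_conj, ← integral_neg_eq_self]
  refine integral_congr_ae (Eventually.of_forall fun x => ?_)
  simp only [schwartzConjNeg_apply, neg_neg, smul_eq_mul, map_mul, ← Complex.exp_conj,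
    Complex.conj_I, Complex.conj_ofReal]
  congr 2
  push_cast
  ring

theorem fourier_conj {g h : L2C} (hh : h =ᵐ[volume] fun x => starRingEnd ℂ (g x)) :
    (𝓕 h : L2C) =ᵐ[volume] fun ξ => starRingEnd ℂ ((𝓕 g : L2C) (-ξ)) := by
  refine ae_eq_of_forall_schwartz (locallyIntegrable_coe _) ?_ fun φ => ?_
  · exact (((Lp.memLp (𝓕 g : L2C)).comp_measurePreserving
      (Measure.measurePreserving_neg volume)).star).locallyIntegrable (by norm_num)
  · calc _ = ∫ x, (𝓕 φ : SchwartzMap ℝ ℂ) x * starRingEnd ℂ (g x) := by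
          rw [integral_mul_fourier]
          refine integral_congr_ae ?_
          filter_upwards [hh] with x hx
          rw [hx]
      _ = starRingEnd ℂ (∫ x, (𝓕 (schwartzConjNeg φ) : SchwartzMap ℝ ℂ) x * g x) := by
          rw [← integral_conj]
          simp only [fourier_schwartzConjNeg, map_mul, Complex.conj_conj]
      _ = _ := by
          rw [← integral_mul_fourier, ← integral_conj, ← integral_neg_eq_self]
          simp only [schwartzConjNeg_apply, neg_neg, map_mul, Complex.conj_conj]

/-- The Fourier transform of a real-valued function. -/
noncomputable def fourierReal (u : L2) : L2C := 𝓕 (toComplex u)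

theorem sobolevNorm_eq_hs (s : ℝ) (u : L2) : sobolevNorm s u = hs s (fourierReal u) := rfl

theorem toComplex_coe (u : L2) : toComplex u =ᵐ[volume] fun x => (u x : ℂ) :=
  Complex.ofRealCLM.coeFn_compLp u

theorem toComplex_sub (u v : L2) : toComplex (u - v) = toComplex u - toComplex v :=
  (Complex.ofRealCLM.compLpL 2 volume).map_sub u v

theorem toComplex_smul (c : ℝ) (u : L2) : toComplex (c • u) = c • toComplex u :=
  (Complex.ofRealCLM.compLpL 2 volume).map_smul c u

theorem enorm_toComplex (u : L2) : ‖toComplex u‖ₑ = ‖u‖ₑ := by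
  rw [Lp.enorm_def, Lp.enorm_def]
  refine eLpNorm_congr_norm_ae ?_
  filter_upwards [toComplex_coe u] with x hx
  rw [hx, Complex.norm_real]

theorem fourier_injective {f g : L2C} (h : (𝓕 f : L2C) = 𝓕 g) : f = g :=
  (Lp.fourierTransformₗᵢ ℝ ℂ).injective h

theorem fourier_coe_add (f g : L2C) : (𝓕 (f + g) : L2C) = 𝓕 f + 𝓕 g :=
  (Lp.fourierTransformₗᵢ ℝ ℂ).map_add f g

theorem toComplex_injective {u v : L2} (h : toComplex u = toComplex v) : u = v := by
  refine Lp.ext ?_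
  filter_upwards [toComplex_coe u, toComplex_coe v] with x h1 h2
  rw [h, h2] at h1
  exact_mod_cast h1.symm

theorem fourierReal_injective {u v : L2} (h : fourierReal u = fourierReal v) : u = v :=
  toComplex_injective (fourier_injective h)

theorem fourierReal_sub (u v : L2) : fourierReal (u - v) = fourierReal u - fourierReal v := by
  unfold fourierReal
  rw [toComplex_sub]
  exact (Lp.fourierTransformₗᵢ ℝ ℂ).map_sub _ _

theorem fourierReal_smul (c : ℝ) (u : L2) : fourierReal (c • u) = c • fourierReal u := by
  unfold fourierReal
  rw [toComplex_smul]
  exact (Lp.fourierTransformₗᵢ ℝ ℂ).map_smul (c : ℂ) _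

theorem enorm_fourierReal (u : L2) : ‖fourierReal u‖ₑ = ‖u‖ₑ := by
  rw [← enorm_toComplex u, ← ofReal_norm, ← ofReal_norm, fourierReal, Lp.norm_fourier_eq]

theorem herm_fourierReal (u : L2) : Herm (fourierReal u) := by
  have h := fourier_conj (g := toComplex u) (h := toComplex u) (by
    filter_upwards [toComplex_coe u] with x hx
    rw [hx, Complex.conj_ofReal])
  filter_upwards [h] with ξ hξ
  rw [fourierReal, hξ, Complex.conj_conj]

theorem exists_fourierReal_eq {f : L2C} (hf : Herm f) : ∃ u : L2, fourierReal u = f := by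
  set g : L2C := 𝓕⁻ f
  have hg : (𝓕 g : L2C) = f := FourierTransform.fourier_fourierInv_eq f
  set h : L2C := ((Lp.memLp g).star).toLp _
  have hh : h =ᵐ[volume] fun x => starRingEnd ℂ (g x) := ((Lp.memLp g).star).coeFn_toLp
  have e : (𝓕 h : L2C) = 𝓕 g := by
    refine Lp.ext ?_
    filter_upwards [fourier_conj hh, hf] with ξ h1 h2
    rw [h1, hg, h2, Complex.conj_conj]
  have e' := fourier_injective e
  refine ⟨Complex.reCLM.compLp g, ?_⟩
  rw [fourierReal, ← hg]
  congr 1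
  refine Lp.ext ?_
  rw [e'] at hh
  filter_upwards [toComplex_coe (Complex.reCLM.compLp g), Complex.reCLM.coeFn_compLp g, hh]
    with x h1 h2 h3
  rw [h1, h2]
  exact Complex.conj_eq_iff_re.1 h3.symm

/-! ### Products and convolutions -/

theorem continuous_fourierInv {H : ℝ → ℂ} (hH : Integrable H) : Continuous (𝓕⁻ H : ℝ → ℂ) := by
  have h : Continuous (𝓕 H : ℝ → ℂ) := VectorFourier.fourierIntegral_continuous
    Real.continuous_fourierChar (innerSL ℝ).continuous₂ hH
  have e : (𝓕⁻ H : ℝ → ℂ) = fun x => 𝓕 H (-x) := funext (Real.fourierInv_eq_fourier_neg H)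
  rw [e]
  exact h.comp continuous_neg

theorem fourierInv_coe_ae_eq {H : L2C} (hH : Integrable H) :
    (𝓕⁻ H : L2C) =ᵐ[volume] (𝓕⁻ (H : ℝ → ℂ) : ℝ → ℂ) := by
  refine ae_eq_of_forall_schwartz (locallyIntegrable_coe _)
    (continuous_fourierInv hH).locallyIntegrable fun φ => ?_
  rw [integral_mul_fourierInv, ← integral_neg_eq_self, eq_comm, ← integral_neg_eq_self, eq_comm]
  have h := VectorFourier.integral_fourierIntegral_smul_eq_flip (L := innerₗ ℝ)
    (μ := volume) (ν := volume) (f := fun x => φ (-x)) (g := (H : ℝ → ℂ))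
    Real.continuous_fourierChar continuous_inner (φ.integrable.comp_neg) hH
  rw [flip_innerₗ] at h
  have e : (𝓕⁻ φ : SchwartzMap ℝ ℂ) = (𝓕 (fun x => φ (-x)) : ℝ → ℂ) := by
    rw [SchwartzMap.fourierInv_coe, Real.fourierInv_eq_fourier_comp_neg]
  rw [integral_neg_eq_self (fun x => (𝓕⁻ φ : SchwartzMap ℝ ℂ) x * H x), e]
  refine h.trans (integral_congr_ae (Eventually.of_forall fun x => ?_))
  simp only [smul_eq_mul, Real.fourierInv_eq_fourier_neg, neg_neg]
  rfl

theorem exists_mul_of_integrable {u w : L2C} (hu : eLpNorm (𝓕 u : L2C) 1 volume < ⊤)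
    (hw : eLpNorm (𝓕 w : L2C) 1 volume < ⊤) : ∃ z : L2C, z =ᵐ[volume] (fun x => u x * w x) ∧
      (𝓕 z : L2C) =ᵐ[volume] conv (𝓕 u : L2C) (𝓕 w : L2C) := by
  set F : L2C := 𝓕 u
  set G : L2C := 𝓕 w
  have mF := measurable_coe F
  have mG := measurable_coe G
  have iF : Integrable F := memLp_one_iff_integrable.1 ⟨mF.aestronglyMeasurable, hu⟩
  have iG : Integrable G := memLp_one_iff_integrable.1 ⟨mG.aestronglyMeasurable, hw⟩
  have iC : Integrable (conv F G) := iF.integrable_convolution (ContinuousLinearMap.mul ℂ ℂ) iG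
  have mC : MemLp (conv F G) 2 volume := by
    refine ⟨(measurable_conv mF mG).aestronglyMeasurable, ?_⟩
    have := Yn_conv_le mF mG 0
    simp only [Yn, wt_zero] at this
    refine this.trans_lt (ENNReal.mul_lt_top (by simp) (ENNReal.add_lt_top.2
      ⟨ENNReal.mul_lt_top (Lp.memLp F).2 hw, ENNReal.mul_lt_top hu (Lp.memLp G).2⟩))
  set H : L2C := mC.toLp _
  have eH : H =ᵐ[volume] conv F G := mC.coeFn_toLp
  refine ⟨𝓕⁻ H, ?_, ?_⟩
  · have e1 : (𝓕⁻ F : L2C) = u := FourierTransform.fourierInv_fourier_eq u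
    have e2 : (𝓕⁻ G : L2C) = w := FourierTransform.fourierInv_fourier_eq w
    have a1 := fourierInv_coe_ae_eq iF
    have a2 := fourierInv_coe_ae_eq iG
    rw [e1] at a1
    rw [e2] at a2
    filter_upwards [fourierInv_coe_ae_eq (iC.congr eH.symm), a1, a2] with x h1 h2 h3
    rw [h1, h2, h3, Real.fourierInv_congr_ae eH, Real.fourierInv_eq_fourier_neg,
      Real.fourierInv_eq_fourier_neg, Real.fourierInv_eq_fourier_neg]
    exact Real.fourier_mul_convolution_eq iF iG (-x)
  · rw [show (𝓕 (𝓕⁻ H : L2C) : L2C) = H from FourierTransform.fourier_fourierInv_eq H]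
    exact eH

theorem two_mul_conv_id_mul {F : ℝ → ℂ} (hF : MemLp F 2 volume)
    (hF' : MemLp (fun x : ℝ => (x : ℂ) * F x) 2 volume) (ξ : ℝ) :
    2 * conv F (fun x : ℝ => (x : ℂ) * F x) ξ = ξ * conv F F ξ := by
  have hr : ∀ {G : ℝ → ℂ}, MemLp G 2 volume → MemLp (fun η => G (ξ - η)) 2 volume := fun hG =>
    hG.comp_measurePreserving (Measure.measurePreserving_sub_left volume ξ)
  rw [two_mul]
  nth_rewrite 2 [conv_comm]
  unfold conv
  have i1 : Integrable fun η => F η * (((ξ - η : ℝ) : ℂ) * F (ξ - η)) :=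
    hF.integrable_mul (hr hF')
  have i2 : Integrable fun η : ℝ => ((η : ℂ) * F η) * F (ξ - η) := hF'.integrable_mul (hr hF)
  rw [← integral_add i1 i2, ← integral_const_mul]
  refine integral_congr_ae (Eventually.of_forall fun η => ?_)
  simp only
  push_cast
  ring

/-! ### Weak derivatives -/

theorem integral_mul_toComplex (u : L2) (φ : ℝ → ℝ) :
    ∫ x, (φ x : ℂ) * toComplex u x = ((∫ x, u x * φ x : ℝ) : ℂ) := by
  rw [← integral_complex_ofReal]
  refine integral_congr_ae ?_
  filter_upwards [toComplex_coe u] with x hx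
  rw [hx]
  push_cast
  ring

theorem hasWeakDeriv_of_fourierReal {u w : L2}
    (h : fourierReal w =ᵐ[volume] fun ξ => 2 * Real.pi * Complex.I * ξ * fourierReal u ξ) :
    HasWeakDeriv u w := by
  intro φ hφ hc
  set ψ := testSchwartz hφ hc
  set ψ' : SchwartzMap ℝ ℂ := SchwartzMap.derivCLM ℂ ℂ ψ
  have hψ' : ∀ x, ψ' x = ((deriv φ x : ℝ) : ℂ) := fun x => by
    rw [SchwartzMap.derivCLM_apply]
    exact ((hφ.differentiable (by simp)).differentiableAt.hasDerivAt.ofReal_comp).deriv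
  have hF : ∀ ξ, (𝓕⁻ ψ' : SchwartzMap ℝ ℂ) ξ =
      -(2 * Real.pi * Complex.I * ξ * (𝓕⁻ ψ : SchwartzMap ℝ ℂ) ξ) := by
    intro ξ
    have e : (ψ' : ℝ → ℂ) = deriv ψ := funext fun x => SchwartzMap.derivCLM_apply ℂ ψ x
    rw [SchwartzMap.fourierInv_coe, SchwartzMap.fourierInv_coe, Real.fourierInv_eq_fourier_neg,
      Real.fourierInv_eq_fourier_neg, e, Real.fourier_deriv ψ.integrable ψ.differentiable
        (e ▸ ψ'.integrable)]
    simp only [smul_eq_mul]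
    push_cast
    ring
  have inv : ∀ (χ : SchwartzMap ℝ ℂ) (v : L2), ∫ x, χ x * toComplex v x =
      ∫ ξ, (𝓕⁻ χ : SchwartzMap ℝ ℂ) ξ * fourierReal v ξ := fun χ v => by
    rw [fourierReal, integral_mul_fourier, FourierTransform.fourier_fourierInv_eq]
  have h1 : ∫ x, ψ' x * toComplex u x = -∫ x, ψ x * toComplex w x := by
    rw [inv, inv, ← integral_neg]
    refine integral_congr_ae ?_
    filter_upwards [h] with ξ hξ
    rw [hξ, hF]
    ring
  simp only [hψ'] at h1
  rw [integral_mul_toComplex] at h1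
  have h2 := integral_mul_toComplex w φ
  change ∫ x, ψ x * toComplex w x = _ at h2
  rw [h2] at h1
  exact_mod_cast h1

theorem HasWeakDeriv.unique {u v w : L2} (hv : HasWeakDeriv u v) (hw : HasWeakDeriv u w) :
    v = w := by
  refine Lp.ext (ae_eq_of_integral_contDiff_smul_eq
    ((Lp.memLp v).locallyIntegrable (by norm_num)) ((Lp.memLp w).locallyIntegrable (by norm_num))
    fun g hg hc => ?_)
  have := (hv g hg hc).symm.trans (hw g hg hc)
  simpa [mul_comm] using this

theorem memLp_id_mul {F : ℝ → ℂ} (hF : Measurable F) (h : Yn 1 F < ⊤) :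
    MemLp (fun x : ℝ => (x : ℂ) * F x) 2 volume := by
  refine ⟨by fun_prop, lt_of_le_of_lt (le_of_eq ?_) h⟩
  refine eLpNorm_congr_norm_ae (Eventually.of_forall fun x => ?_)
  rw [wt, norm_mul, norm_mul, pow_one, Complex.norm_real, Complex.norm_real, norm_abs_eq_norm]

theorem exists_hasWeakDeriv {u : L2} (h : hs 1 (fourierReal u) < ⊤) : ∃ w : L2, HasWeakDeriv u w ∧
    fourierReal w =ᵐ[volume] fun ξ => 2 * Real.pi * Complex.I * ξ * fourierReal u ξ := by
  have hm := (memLp_id_mul (measurable_coe _) ((Yn_le_hs (by simp) _).trans_lt h)).const_mul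
    (2 * Real.pi * Complex.I)
  have e : hm.toLp _ =ᵐ[volume] fun ξ => 2 * Real.pi * Complex.I * ξ * fourierReal u ξ := by
    filter_upwards [hm.coeFn_toLp] with ξ hξ
    rw [hξ, mul_assoc _ (ξ : ℂ)]
  have hH : Herm fun ξ : ℝ => 2 * Real.pi * Complex.I * ξ * fourierReal u ξ := by
    filter_upwards [herm_fourierReal u] with ξ hξ
    simp only [hξ, map_mul, Complex.conj_ofReal, Complex.conj_I, map_ofNat]
    push_cast
    ring
  obtain ⟨w, hw⟩ := exists_fourierReal_eq (hH.congr e.symm)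
  have : fourierReal w =ᵐ[volume] fun ξ => 2 * Real.pi * Complex.I * ξ * fourierReal u ξ := by
    rw [hw]; exact e
  exact ⟨w, hasWeakDeriv_of_fourierReal this, this⟩

/-! ### The equation on the Fourier side -/

theorem fourier_hilbertTransform (f : L2C) :
    (𝓕 (hilbertTransform f) : L2C) =ᵐ[volume] fun ξ => -Complex.I * (sg ξ : ℂ) * (𝓕 f : L2C) ξ := by
  have e : (𝓕 (hilbertTransform f) : L2C) = (memLp_hilbertSymbol_mul (𝓕 f : L2C)).toLp _ :=
    FourierTransform.fourier_fourierInv_eq _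
  rw [e]
  filter_upwards [(memLp_hilbertSymbol_mul (𝓕 f : L2C)).coeFn_toLp, Measure.ae_ne volume 0]
    with ξ h1 h2
  rw [h1, hilbertSymbol]
  congr 3
  rcases lt_or_gt_of_ne h2 with h | h
  · rw [Real.sign_of_neg h, sg, if_neg (not_le.2 h)]
  · rw [Real.sign_of_pos h, sg, if_pos h.le]

theorem equation_iff {u u_t : L2} (h : hs 2 (fourierReal u) < ⊤) :
    (∃ u_x : L2, HasWeakDeriv u u_x ∧
      ∀ᵐ x : ℝ, ((u_t x + u x * u_x x : ℝ) : ℂ) = hilbertTransform (toComplex u) x) ↔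
    fourierReal u_t =ᵐ[volume] rhs (fourierReal u) := by
  set F := fourierReal u with hF
  have mF := measurable_coe F
  obtain ⟨w, hw, hwF⟩ := exists_hasWeakDeriv ((hs_mono (by norm_num) F).trans_lt h)
  have hF1 : eLpNorm F 1 volume < ⊤ := (eLpNorm_one_le_hs (by norm_num : (1 : ℝ) ≤ 2) mF).trans_lt
    (ENNReal.mul_lt_top (ENNReal.mul_lt_top (by simp) ENNReal.ofReal_lt_top) h)
  have hA : An F < ⊤ := (An_le mF).trans_lt (ENNReal.mul_lt_top ENNReal.ofReal_lt_top
    (ENNReal.add_lt_top.2 ⟨(Yn_le_hs (by norm_num) F).trans_lt h,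
      (Yn_le_hs (by norm_num) F).trans_lt h⟩))
  have hw1 : eLpNorm (fourierReal w) 1 volume < ⊤ := by
    refine (eLpNorm_le_mul_eLpNorm_of_ae_le_mul (g := wt 1 F) (c := 2 * Real.pi) ?_ 1).trans_lt
      (ENNReal.mul_lt_top ENNReal.ofReal_lt_top hA)
    filter_upwards [hwF] with ξ hξ
    rw [hξ, wt, norm_mul, norm_mul, norm_mul, norm_mul, norm_mul, Complex.norm_I, pow_one,
      Complex.norm_real, Complex.norm_real, Complex.norm_real, norm_abs_eq_norm,
      Real.norm_of_nonneg Real.pi_pos.le, Complex.norm_ofNat, mul_one, mul_assoc]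
  obtain ⟨z, hz, hzF⟩ := exists_mul_of_integrable (u := toComplex u) (w := toComplex w) hF1 hw1
  have hzF' : (𝓕 z : L2C) =ᵐ[volume] fun ξ => Complex.I * Real.pi * (ξ * conv F F ξ) := by
    filter_upwards [hzF] with ξ hξ
    have e : conv (𝓕 (toComplex u) : L2C) (𝓕 (toComplex w) : L2C) ξ =
        2 * Real.pi * Complex.I * conv F (fun x : ℝ => (x : ℂ) * F x) ξ := by
      rw [← conv_const_mul_right]
      refine congrFun (conv_congr (ae_eq_refl _) ?_) ξ
      filter_upwards [hwF] with x hx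
      rw [← mul_assoc]
      exact hx
    rw [hξ, e, ← two_mul_conv_id_mul (Lp.memLp F)
      (memLp_id_mul mF ((Yn_le_hs (by norm_num) F).trans_lt h))]
    ring
  have key : (∀ᵐ x : ℝ, ((u_t x + u x * w x : ℝ) : ℂ) = hilbertTransform (toComplex u) x) ↔
      toComplex u_t + z = hilbertTransform (toComplex u) := by
    have e : (toComplex u_t + z : L2C) =ᵐ[volume] fun x => ((u_t x + u x * w x : ℝ) : ℂ) := by
      filter_upwards [Lp.coeFn_add (toComplex u_t) z, hz, toComplex_coe u_t, toComplex_coe u,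
        toComplex_coe w] with x h1 h2 h3 h4 h5
      rw [h1, Pi.add_apply, h2, h3, h4, h5]
      push_cast
      ring
    exact ⟨fun h => Lp.ext (e.trans h), fun h => h ▸ e.symm⟩
  have key2 : toComplex u_t + z = hilbertTransform (toComplex u) ↔
      fourierReal u_t =ᵐ[volume] rhs F := by
    have e1 : (𝓕 (toComplex u_t + z) : L2C) =ᵐ[volume]
        fun ξ => fourierReal u_t ξ + Complex.I * Real.pi * (ξ * conv F F ξ) := by
      rw [fourier_coe_add]
      filter_upwards [Lp.coeFn_add (𝓕 (toComplex u_t) : L2C) (𝓕 z : L2C), hzF'] with ξ h1 h2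
      rw [h1, Pi.add_apply, h2]
      rfl
    have e2 : (𝓕 (hilbertTransform (toComplex u)) : L2C) =ᵐ[volume]
        fun ξ => -Complex.I * (sg ξ : ℂ) * F ξ := fourier_hilbertTransform (toComplex u)
    constructor
    · intro h
      rw [h] at e1
      filter_upwards [e1, e2] with ξ h1 h2
      rw [rhs, ← h2, h1]
      ring
    · intro h
      refine fourier_injective (Lp.ext ?_)
      filter_upwards [e1, e2, h] with ξ h1 h2 h3
      rw [h1, h2, h3, rhs]
      ring
  rw [← key2, ← key]
  constructor
  · rintro ⟨u_x, hx, he⟩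
    rwa [hx.unique hw] at he
  · exact fun he => ⟨w, hw, he⟩

/-! ### Solutions on the Fourier side and in physical space -/

theorem Herm.rhs {f : ℝ → ℂ} (hf : Herm f) : Herm (rhs f) := by
  filter_upwards [hf.neg_I_sg_mul] with ξ h
  rw [BurgersHilbert.rhs, BurgersHilbert.rhs, hf.conv_neg hf, mul_assoc, h]
  simp only [map_add, map_mul, map_neg, Complex.conj_I, Complex.conj_ofReal]
  push_cast
  ring

theorem isSolution_of_fourier {n : ℕ} (hn : 1 ≤ n) {J : Set ℝ} {u u_t : ℝ → L2} {f f' : ℝ → L2C}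
    (hu : ∀ t ∈ J, fourierReal (u t) = f t) (hu' : ∀ t ∈ J, fourierReal (u_t t) = f' t)
    (hf : ∀ t ∈ J, hs (n + 1) (f t) < ⊤) (hf' : ∀ t ∈ J, f' t =ᵐ[volume] rhs (f t))
    (hc : ∀ t ∈ J, Tendsto (fun τ => hs (n + 1) (f τ - f t : L2C)) (𝓝[J] t) (𝓝 0))
    (hc' : ∀ t ∈ J, Tendsto (fun τ => hs n (f' τ - f' t : L2C)) (𝓝[J] t) (𝓝 0))
    (hd : ∀ t ∈ J, Tendsto (fun τ => hs n ((τ - t)⁻¹ • (f τ - f t) - f' t : L2C))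
      (𝓝[J \ {t}] t) (𝓝 0)) : IsSolution (n + 1) J u := by
  have e : (((n + 1 : ℕ) : ℝ)) = n + 1 := by push_cast; rfl
  have hf'n : ∀ t ∈ J, hs n (f' t) < ⊤ := fun t ht => by
    rw [hs_congr _ (hf' t ht)]
    exact hs_rhs_lt_top n (measurable_coe _) (hf t ht)
  have m1 : ∀ t ∈ J, MemH (n + 1) (u t) := fun t ht => by
    rw [MemH, sobolevNorm_eq_hs, hu t ht]; exact hf t ht
  have m2 : ∀ t ∈ J, MemH n (u_t t) := fun t ht => by
    rw [MemH, sobolevNorm_eq_hs, hu' t ht]; exact hf'n t ht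
  rw [IsSolution, e, add_sub_cancel_right]
  refine ⟨⟨m1, fun t ht => (hc t ht).congr' ?_⟩, u_t, ⟨fun t ht => ⟨?_, m2 t ht⟩,
    fun t ht => (hd t ht).congr' ?_⟩, ⟨m2, fun t ht => (hc' t ht).congr' ?_⟩, fun t ht => ?_⟩
  · filter_upwards [self_mem_nhdsWithin] with τ hτ
    rw [sobolevNorm_eq_hs, fourierReal_sub, hu τ hτ, hu t ht]
  · exact (hs_mono (by linarith) _).trans_lt (m1 t ht)
  · filter_upwards [self_mem_nhdsWithin] with τ hτ
    rw [sobolevNorm_eq_hs, fourierReal_sub, fourierReal_smul, fourierReal_sub, hu τ hτ.1, hu t ht,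
      hu' t ht]
  · filter_upwards [self_mem_nhdsWithin] with τ hτ
    rw [sobolevNorm_eq_hs, fourierReal_sub, hu' τ hτ, hu' t ht]
  · refine (equation_iff ?_).2 ?_
    · rw [hu t ht]
      have : (1 : ℝ) ≤ n := by exact_mod_cast hn
      exact (hs_mono (by linarith) _).trans_lt (hf t ht)
    · rw [hu t ht, hu' t ht]; exact hf' t ht

theorem IsSolution.exists_fourier {k : ℕ} (hk : 2 ≤ k) {J : Set ℝ} (hJ : IsCompact J)
    {u : ℝ → L2} (h : IsSolution k J u) : ∃ (M : ℝ≥0) (f' : ℝ → L2C), ∀ t ∈ J,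
      hs 2 (fourierReal (u t)) ≤ M ∧ f' t =ᵐ[volume] rhs (fourierReal (u t)) ∧
      HasDerivWithinAt (fun t => fourierReal (u t)) (f' t) J t := by
  have hk' : (2 : ℝ) ≤ k := by exact_mod_cast hk
  obtain ⟨hc, u_t, hd, -, heq⟩ := h
  have h2 : ∀ t ∈ J, hs 2 (fourierReal (u t)) < ⊤ := fun t ht =>
    (hs_mono hk' _).trans_lt (hc.1 t ht)
  obtain ⟨M, hM⟩ := exists_hs_le (s := 2) hJ (f := fun t => fourierReal (u t)) h2 (fun t ht =>
    tendsto_of_tendsto_of_tendsto_of_le_of_le tendsto_const_nhds (hc.2 t ht) (fun _ => zero_le)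
      fun τ => by
        rw [← fourierReal_sub]
        exact hs_mono hk' _)
  refine ⟨M, fun t => fourierReal (u_t t), fun t ht => ⟨hM t ht, (equation_iff (h2 t ht)).1
    (heq t ht), hasDerivWithinAt_of_hs (s := k - 1) (by linarith) ?_⟩⟩
  refine (hd.2 t ht).congr fun τ => ?_
  rw [sobolevNorm_eq_hs, fourierReal_sub, fourierReal_smul, fourierReal_sub]

theorem zero_mem_timeInterval {α ε : ℝ} (hα : 0 < α) (hε : 0 < ε) : 0 ∈ timeInterval α ε := by
  have : 0 < α / ε ^ 2 := by positivity
  exact ⟨by linarith, this.le⟩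

end BurgersHilbert

open BurgersHilbert in
theorem theorem1 :
    ∃ ε₀ : ℝ, 0 < ε₀ ∧ ∃ α : ℝ, 0 < α ∧ ∀ k : ℕ, 2 ≤ k → ∃ C : ℝ≥0,
      ∀ ε : ℝ, 0 < ε → ε ≤ ε₀ →
        (∀ u₀ : BurgersHilbert.L2, BurgersHilbert.MemH k u₀ →
          BurgersHilbert.sobolevNorm 2 u₀ ≤ ENNReal.ofReal ε →
          ∃ u : ℝ → BurgersHilbert.L2,
            BurgersHilbert.IsSolution k (BurgersHilbert.timeInterval α ε) u ∧ u 0 = u₀ ∧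
            ∀ s : ℝ, 0 ≤ s → s ≤ k →
              (⨆ t ∈ BurgersHilbert.timeInterval α ε, BurgersHilbert.sobolevNorm s (u t)) ≤
                C * BurgersHilbert.sobolevNorm s (u 0)) ∧
        (∀ u₁ u₂ : ℝ → BurgersHilbert.L2,
          BurgersHilbert.IsSolution k (BurgersHilbert.timeInterval α ε) u₁ →
          BurgersHilbert.IsSolution k (BurgersHilbert.timeInterval α ε) u₂ →
          BurgersHilbert.sobolevNorm 2 (u₁ 0) ≤ ENNReal.ofReal ε →
          BurgersHilbert.sobolevNorm 2 (u₂ 0) ≤ ENNReal.ofReal ε →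
          (⨆ t ∈ BurgersHilbert.timeInterval α ε, ‖u₁ t - u₂ t‖ₑ) ≤ C * ‖u₁ 0 - u₂ 0‖ₑ) := by
  obtain ⟨ε₁, hε₁, α, hα, hex⟩ := exists_regular_solution
  obtain ⟨ε₂, hε₂, hdiff⟩ := exists_approximable_diff
  obtain ⟨D, hD, hdiff⟩ := hdiff α hα
  obtain ⟨C₁, h₁⟩ := hex 1
  refine ⟨min ε₁ ε₂, lt_min hε₁ hε₂, α, hα, fun k hk => ?_⟩
  obtain ⟨n, rfl⟩ : ∃ n, k = n + 1 := ⟨k - 1, by omega⟩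
  obtain ⟨C, hC⟩ := hex n
  have cast_k : (((n + 1 : ℕ) : ℝ)) = n + 1 := by push_cast; rfl
  refine ⟨C + (1 + D.toNNReal), fun ε hε hε' => ⟨fun u₀ hu₀ hu₀2 => ?_, fun u₁ u₂ s₁ s₂ b₁ b₂ => ?_⟩⟩
  · have h0 := zero_mem_timeInterval hα hε
    rw [MemH, cast_k] at hu₀
    obtain ⟨f, f', hf0, -, hf⟩ := hC ε hε (hε'.trans (min_le_left _ _)) (fourierReal u₀)
      (herm_fourierReal u₀) hu₀2 hu₀
    have hbound : ∀ t ∈ timeInterval α ε, ∀ s : ℝ, 0 ≤ s → s ≤ n + 1 →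
        hs s (f t) ≤ C * hs s (fourierReal u₀) := fun t ht => (hf t ht).2.2.1
    have ex : ∀ t, ∃ u : L2, t ∈ timeInterval α ε → fourierReal u = f t := fun t => by
      by_cases ht : t ∈ timeInterval α ε
      · obtain ⟨u, hu⟩ := exists_fourierReal_eq (hf t ht).1
        exact ⟨u, fun _ => hu⟩
      · exact ⟨0, fun h => absurd h ht⟩
    have ex' : ∀ t, ∃ u : L2, t ∈ timeInterval α ε → fourierReal u = f' t := fun t => by
      by_cases ht : t ∈ timeInterval α ε
      · obtain ⟨u, hu⟩ := exists_fourierReal_eq ((hf t ht).1.rhs.congr (hf t ht).2.1.symm)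
        exact ⟨u, fun _ => hu⟩
      · exact ⟨0, fun h => absurd h ht⟩
    choose u hu using ex
    choose u_t hu_t using ex'
    have hu0 : u 0 = u₀ := fourierReal_injective ((hu 0 h0).trans hf0)
    refine ⟨u, isSolution_of_fourier (by omega) hu hu_t (fun t ht => ?_)
      (fun t ht => (hf t ht).2.1) (fun t ht => (hf t ht).2.2.2.1)
      (fun t ht => (hf t ht).2.2.2.2.1) (fun t ht => (hf t ht).2.2.2.2.2), hu0, fun s hs0 hsk => ?_⟩
    · exact (hbound t ht _ (by positivity) le_rfl).trans_lt
        (ENNReal.mul_lt_top ENNReal.coe_lt_top hu₀)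
    · rw [cast_k] at hsk
      refine iSup₂_le fun t ht => ?_
      rw [sobolevNorm_eq_hs, sobolevNorm_eq_hs, hu t ht, hu0]
      refine (hbound t ht s hs0 hsk).trans ?_
      gcongr
      exact le_self_add
  · have h0 := zero_mem_timeInterval hα hε
    have key : ∀ u : ℝ → L2, IsSolution (n + 1) (timeInterval α ε) u →
        sobolevNorm 2 (u 0) ≤ ENNReal.ofReal ε →
        ∃ f : ℝ → L2C, Approximable ε (α / ε ^ 2) f ∧
          ∀ t ∈ timeInterval α ε, fourierReal (u t) = f t := by
      intro u hu hb
      rw [sobolevNorm_eq_hs] at hb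
      have e2 : ((1 : ℕ) : ℝ) + 1 = 2 := by norm_num
      obtain ⟨f, f', hf0, hfA, hf⟩ := h₁ ε hε (hε'.trans (min_le_left _ _)) (fourierReal (u 0))
        (herm_fourierReal _) hb (by rw [e2]; exact hb.trans_lt ENNReal.ofReal_lt_top)
      obtain ⟨M, F', hF⟩ := hu.exists_fourier hk isCompact_Icc
      refine ⟨f, hfA, eq_of_hasDerivWithinAt (M := max M (C₁ * (ENNReal.ofReal ε).toNNReal))
        (f' := F') (g' := f') (by positivity) (fun t ht => ⟨herm_fourierReal _,
          (hF t ht).1.trans (by exact_mod_cast le_max_left _ _), (hF t ht).2⟩)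
        (fun t ht => ⟨(hf t ht).1, ?_, (hf t ht).2.1,
          hasDerivWithinAt_of_hs (Nat.cast_nonneg 1) (hf t ht).2.2.2.2.2⟩) hf0.symm⟩
      refine ((hf t ht).2.2.1 2 (by norm_num) (by norm_num)).trans ?_
      rw [ENNReal.coe_max, ENNReal.coe_mul, ENNReal.coe_toNNReal ENNReal.ofReal_ne_top]
      exact le_max_of_le_right (by gcongr)
    obtain ⟨f, hfA, hf⟩ := key u₁ s₁ b₁
    obtain ⟨g, hgA, hg⟩ := key u₂ s₂ b₂
    refine iSup₂_le fun t ht => ?_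
    have main := hdiff ε hε (hε'.trans (min_le_right _ _)) f g hfA hgA t ht
    have main' : ‖f t - g t‖ ≤ (1 + D) * ‖f 0 - g 0‖ := by
      refine abs_le_of_sq_le_sq' (main.trans ?_) (by positivity) |>.2
      rw [mul_pow]
      gcongr
      nlinarith
    rw [← enorm_fourierReal, ← enorm_fourierReal, fourierReal_sub, fourierReal_sub, hf t ht,
      hg t ht, hf 0 h0, hg 0 h0]
    calc ‖f t - g t‖ₑ ≤ ENNReal.ofReal ((1 + D) * ‖f 0 - g 0‖) := by
          rw [← ofReal_norm]; exact ENNReal.ofReal_le_ofReal main'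
      _ = ((1 + D.toNNReal : ℝ≥0) : ℝ≥0∞) * ‖f 0 - g 0‖ₑ := by
          rw [ENNReal.ofReal_mul (by positivity), ofReal_norm, ENNReal.ofReal_add zero_le_one hD,
            ENNReal.ofReal_one]
          rfl
      _ ≤ _ := mul_le_mul' (ENNReal.coe_le_coe.2 le_add_self) le_rfl
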